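/- Let $M$ be an orientable Riemannian $3$-manifold and let $\pi\colon \mathfrak X\to M$ be a smooth bundle of hyperkähler manifolds with compact total space, together with an isometric identification $I$ of the unit tangent bundle of $M$ with the bundle of hyperkähler spheres of the fibres (that is, over each $x$ the linear extension of $I$ sends some orthonormal basis of $T_xM$ to a hyperkähler triple $I_1,I_2,I_3=I_1I_2$ on the fibre $\mathfrak X_x$, and $I$ depends smoothly on $x$), a connection on $\mathfrak X$ (a smooth projection of $T\mathfrak X$ onto the vertical tangent bundle $V\mathfrak X=\ker d\pi$), and a smooth vertical vector field $\mathfrak p\in\Gamma(\mathfrak X,V\mathfrak X)$. For a smooth section $u$ let $\nabla_v u\in V_{u(x)}\mathfrak X$ be the vertical part of $du(v)$, $v\in T_xM$, and $|\nabla u|^2=\sum_i|\nabla_{v_i}u|^2$ for an orthonormal frame $(v_1,v_2,v_3)$. The section $u$ is called a perturbed Fueter section if $$\sum_{i=1}^3 I(v_i)\nabla_{v_i}u=\mathfrak p\circ u .$$ Fix $r_0>0$. Then there are constants $\varepsilon_0>0$ and $c>0$, depending only on $M$, $\mathfrak X$, $I$, the connection, $\mathfrak p$ and $r_0$, such that for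 every perturbed Fueter section $u\in\Gamma(M,\mathfrak X)$, every $x\in M$ and every $0<r\le r_0$: if $$\varepsilon:=\frac1r\int_{B_r(x)}|\nabla u|^2\,d\mathrm{vol}\le\varepsilon_0,$$ then $$\sup_{y\in B_{r/4}(x)}|\nabla u|^2(y)\le c\,\bigl(r^{-2}\varepsilon+1\bigr).$$ -/

import Mathlib

open Bundle
open scoped Manifold ContDiff

noncomputable section

namespace Fueter

/-- Smoothness at `x` of a (not necessarily continuous elsewhere) vector field on an
`m`-dimensional manifold. -/
def SmoothFieldAt {m : ℕ} {N : Type*} [TopologicalSpace N]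
    [ChartedSpace (EuclideanSpace ℝ (Fin m)) N] [IsManifold (𝓡 m) ∞ N]
    (Z : (y : N) → TangentSpace (𝓡 m) y) (x : N) : Prop :=
  ContMDiffAt (𝓡 m) (𝓡 m).tangent ∞
    (fun y => (⟨y, Z y⟩ : TangentBundle (𝓡 m) N)) x

section Volume

variable {M : Type*} [EMetricSpace M] [ChartedSpace (EuclideanSpace ℝ (Fin 3)) M]
  [IsManifold (𝓡 3) ∞ M] [RiemannianBundle (fun x : M => TangentSpace (𝓡 3) x)]

/-- The Gram matrix `g_{ij}` of the coordinate fields of the chart `chartAt x₀`, at the point with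
coordinates `y`. -/
def gramMatrix (x₀ : M) (y : EuclideanSpace ℝ (Fin 3)) : Matrix (Fin 3) (Fin 3) ℝ :=
  let φ := chartAt (EuclideanSpace ℝ (Fin 3)) x₀
  let d : EuclideanSpace ℝ (Fin 3) → TangentSpace (𝓡 3) (φ.symm y) :=
    fun v => mfderiv (𝓡 3) (𝓡 3) φ.symm y v
  Matrix.of fun i j =>
    inner ℝ (d (EuclideanSpace.single i 1)) (d (EuclideanSpace.single j 1))

/-- The Riemannian volume of the domain of `chartAt x₀`, as a measure on `M`:
`√(det g_{ij}) dy¹ dy² dy³` in the coordinates of that chart. -/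
def chartVolume [MeasurableSpace M] (x₀ : M) : MeasureTheory.Measure M :=
  let φ := chartAt (EuclideanSpace ℝ (Fin 3)) x₀
  ((MeasureTheory.volume.restrict φ.target).withDensity
    fun y => ENNReal.ofReal (Real.sqrt (gramMatrix x₀ y).det)).map φ.symm

/-- The Riemannian volume measure of a Riemannian `3`-manifold. The measures `chartVolume x₀` are
the restrictions of the volume to the (open) chart domains, which cover `M`, so that the volume is
their supremum. -/
def riemannianVolume (M : Type*) [EMetricSpace M] [ChartedSpace (EuclideanSpace ℝ (Fin 3)) M]
    [IsManifold (𝓡 3) ∞ M] [RiemannianBundle (fun x : M => TangentSpace (𝓡 3) x)]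
    [MeasurableSpace M] : MeasureTheory.Measure M :=
  ⨆ x₀ : M, chartVolume x₀

end Volume

/-- The right-hand side of Koszul's formula for a field `h` of bilinear forms and three vector
fields: `2 h(∇_Y Z, W)`. For vector fields tangent to the leaves of a foliation and `h` restricting
to a Riemannian metric on the leaves, `∇` is the Levi-Civita connection of the leaves. -/
def koszul {n : ℕ} {X : Type*} [TopologicalSpace X]
    [ChartedSpace (EuclideanSpace ℝ (Fin n)) X] [IsManifold (𝓡 n) ∞ X]
    (h : (e : X) → TangentSpace (𝓡 n) e →L[ℝ] TangentSpace (𝓡 n) e →L[ℝ] ℝ)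
    (Y Z W : (e : X) → TangentSpace (𝓡 n) e) (e : X) : ℝ :=
  let D : ((e : X) → TangentSpace (𝓡 n) e) → (X → ℝ) → ℝ :=
    fun V f => mfderiv (𝓡 n) 𝓘(ℝ, ℝ) f e (V e)
  D Y (fun e' => h e' (Z e') (W e')) + D Z (fun e' => h e' (W e') (Y e'))
    - D W (fun e' => h e' (Y e') (Z e'))
    + h e (VectorField.mlieBracket (𝓡 n) Y Z e) (W e)
    - h e (VectorField.mlieBracket (𝓡 n) Z W e) (Y e)
    + h e (VectorField.mlieBracket (𝓡 n) W Y e) (Z e)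

/-- A bundle `proj : X → M` of hyperkähler manifolds over a Riemannian `3`-manifold `M`, with an
isometric identification `I` of the unit tangent bundle of `M` with the bundle of hyperkähler
spheres of the fibres.

The bundle is given as a surjective submersion; for compact `X`, the only case considered below,
this is the same thing as a smooth fibre bundle with compact total space (Ehresmann). The vertical
tangent space at `e` is the kernel of `mfderiv proj e`. `metric e` and `I e v` matter only on
vertical vectors. `I e` is the linear extension of the identification to all of
`T_{proj e} M`. When the fibres have positive dimension, `n = 4 k + 3` and `I` orients `M`
(by `I(v₁) I(v₂) = I(v₃)`), so that orientability need not be assumed separately. -/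
structure HyperkahlerBundle (n : ℕ) (M X : Type*) [EMetricSpace M]
    [ChartedSpace (EuclideanSpace ℝ (Fin 3)) M] [IsManifold (𝓡 3) ∞ M]
    [RiemannianBundle (fun x : M => TangentSpace (𝓡 3) x)]
    [TopologicalSpace X] [ChartedSpace (EuclideanSpace ℝ (Fin n)) X] [IsManifold (𝓡 n) ∞ X] where
  /-- the bundle projection -/
  proj : X → M
  contMDiff_proj : ContMDiff (𝓡 n) (𝓡 3) ∞ proj
  surjective_proj : Function.Surjective proj
  submersion_proj : ∀ e, Function.Surjective (mfderiv (𝓡 n) (𝓡 3) proj e)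
  /-- the Riemannian metrics of the fibres -/
  metric : (e : X) → TangentSpace (𝓡 n) e →L[ℝ] TangentSpace (𝓡 n) e →L[ℝ] ℝ
  contMDiff_metric : ContMDiff (𝓡 n) ((𝓡 n).prod 𝓘(ℝ, EuclideanSpace ℝ (Fin n) →L[ℝ]
      EuclideanSpace ℝ (Fin n) →L[ℝ] ℝ)) ∞
    (fun e => Bundle.TotalSpace.mk'
      (EuclideanSpace ℝ (Fin n) →L[ℝ] EuclideanSpace ℝ (Fin n) →L[ℝ] ℝ)
      (E := fun e : X => TangentSpace (𝓡 n) e →L[ℝ] TangentSpace (𝓡 n) e →L[ℝ] ℝ) e (metric e))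
  metric_symm : ∀ e (w w' : TangentSpace (𝓡 n) e),
    mfderiv (𝓡 n) (𝓡 3) proj e w = 0 → mfderiv (𝓡 n) (𝓡 3) proj e w' = 0 →
      metric e w w' = metric e w' w
  metric_pos : ∀ e (w : TangentSpace (𝓡 n) e),
    mfderiv (𝓡 n) (𝓡 3) proj e w = 0 → w ≠ 0 → 0 < metric e w w
  /-- the identification of tangent vectors of `M` with endomorphisms of the vertical bundle -/
  I : (e : X) → TangentSpace (𝓡 3) (proj e) →L[ℝ]
    TangentSpace (𝓡 n) e →L[ℝ] TangentSpace (𝓡 n) e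
  /-- `I` is smooth. As `proj` is a submersion, this can be said after precomposition with
  its derivative. -/
  contMDiff_I : ContMDiff (𝓡 n) ((𝓡 n).prod 𝓘(ℝ, EuclideanSpace ℝ (Fin n) →L[ℝ]
      EuclideanSpace ℝ (Fin n) →L[ℝ] EuclideanSpace ℝ (Fin n))) ∞
    (fun e => Bundle.TotalSpace.mk'
      (EuclideanSpace ℝ (Fin n) →L[ℝ] EuclideanSpace ℝ (Fin n) →L[ℝ] EuclideanSpace ℝ (Fin n))
      (E := fun e : X =>
        TangentSpace (𝓡 n) e →L[ℝ] TangentSpace (𝓡 n) e →L[ℝ] TangentSpace (𝓡 n) e)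
      e ((I e).comp (mfderiv (𝓡 n) (𝓡 3) proj e)))
  I_vertical : ∀ e v (w : TangentSpace (𝓡 n) e),
    mfderiv (𝓡 n) (𝓡 3) proj e w = 0 → mfderiv (𝓡 n) (𝓡 3) proj e (I e v w) = 0
  /-- Over each `x`, a suitable orthonormal basis `v` of `T_x M` is sent by `I` to a triple
  `I₁, I₂, I₃` of orthogonal almost complex structures of the fibre with `I₁ I₂ = I₃`. -/
  quaternionic : ∀ x : M, ∃ v : OrthonormalBasis (Fin 3) ℝ (TangentSpace (𝓡 3) x),
    ∀ (e : X) (he : proj e = x) (w w' : TangentSpace (𝓡 n) e),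
      mfderiv (𝓡 n) (𝓡 3) proj e w = 0 → mfderiv (𝓡 n) (𝓡 3) proj e w' = 0 →
        (∀ i, I e (he ▸ v i) (I e (he ▸ v i) w) = -w) ∧
        I e (he ▸ v 0) (I e (he ▸ v 1) w) = I e (he ▸ v 2) w ∧
        ∀ i, metric e (I e (he ▸ v i) w) (I e (he ▸ v i) w') = metric e w w'
  /-- The complex structures are parallel for the Levi-Civita connection `∇` of the fibres:
  `⟨∇_Y (I(ξ) Z), W⟩ = -⟨∇_Y Z, I(ξ) W⟩ = ⟨I(ξ) ∇_Y Z, W⟩` for vertical fields `Y, Z, W` and a vector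
  field `ξ` on `M` (pulled back, it is constant along the fibres). -/
  parallel : ∀ (ξ : (x : M) → TangentSpace (𝓡 3) x) (Y Z W : (e : X) → TangentSpace (𝓡 n) e)
    (e : X), SmoothFieldAt ξ (proj e) →
      SmoothFieldAt Y e → SmoothFieldAt Z e → SmoothFieldAt W e →
      (∀ e', mfderiv (𝓡 n) (𝓡 3) proj e' (Y e') = 0) →
      (∀ e', mfderiv (𝓡 n) (𝓡 3) proj e' (Z e') = 0) →
      (∀ e', mfderiv (𝓡 n) (𝓡 3) proj e' (W e') = 0) →
      koszul metric Y (fun e' => I e' (ξ (proj e')) (Z e')) W e =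
        -koszul metric Y Z (fun e' => I e' (ξ (proj e')) (W e')) e

variable {n : ℕ} {M X : Type*} [EMetricSpace M]
  [ChartedSpace (EuclideanSpace ℝ (Fin 3)) M] [IsManifold (𝓡 3) ∞ M]
  [RiemannianBundle (fun x : M => TangentSpace (𝓡 3) x)]
  [TopologicalSpace X] [ChartedSpace (EuclideanSpace ℝ (Fin n)) X] [IsManifold (𝓡 n) ∞ X]

namespace HyperkahlerBundle

/-- `w` lies in the vertical tangent bundle. -/
def IsVertical (B : HyperkahlerBundle n M X) {e : X} (w : TangentSpace (𝓡 n) e) : Prop :=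
  mfderiv (𝓡 n) (𝓡 3) B.proj e w = 0

/-- A connection on the bundle: a smooth field of projections of the tangent spaces onto the
vertical tangent spaces (the kernels of the projections are the horizontal spaces). No
compatibility with the fibrewise hyperkähler structures is required. -/
structure Connection (B : HyperkahlerBundle n M X) where
  /-- the projection onto the vertical tangent space -/
  vert : (e : X) → TangentSpace (𝓡 n) e →L[ℝ] TangentSpace (𝓡 n) e
  contMDiff_vert : ContMDiff (𝓡 n) ((𝓡 n).prod 𝓘(ℝ, EuclideanSpace ℝ (Fin n) →L[ℝ]
      EuclideanSpace ℝ (Fin n))) ∞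
    (fun e => Bundle.TotalSpace.mk' (EuclideanSpace ℝ (Fin n) →L[ℝ] EuclideanSpace ℝ (Fin n))
      (E := fun e : X => TangentSpace (𝓡 n) e →L[ℝ] TangentSpace (𝓡 n) e) e (vert e))
  isVertical_vert : ∀ e (w : TangentSpace (𝓡 n) e), B.IsVertical (vert e w)
  vert_of_isVertical : ∀ e (w : TangentSpace (𝓡 n) e), B.IsVertical w → vert e w = w

/-- A smooth vertical vector field on the total space. -/
structure VerticalField (B : HyperkahlerBundle n M X) where
  /-- the values of the vector field -/
  toFun : (e : X) → TangentSpace (𝓡 n) e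
  smooth : ∀ e, SmoothFieldAt toFun e
  isVertical : ∀ e, B.IsVertical (toFun e)

/-- A smooth section. -/
structure SmoothSection (B : HyperkahlerBundle n M X) where
  /-- the underlying map -/
  toFun : M → X
  smooth : ContMDiff (𝓡 3) (𝓡 n) ∞ toFun
  proj_toFun : ∀ x, B.proj (toFun x) = x

variable {B : HyperkahlerBundle n M X}

/-- The covariant derivative `∇_v u` of a section: the vertical part of `du(v)`. -/
def Connection.covDeriv (A : B.Connection) (u : B.SmoothSection) (x : M)
    (v : TangentSpace (𝓡 3) x) : TangentSpace (𝓡 n) (u.toFun x) :=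
  A.vert (u.toFun x) (mfderiv (𝓡 3) (𝓡 n) u.toFun x v)

/-- `|∇u|²` at `x`: the sum of `|∇_{v_i} u|²` over an orthonormal basis `v_i` of `T_x M` (the value
does not depend on the basis). -/
def Connection.energyDensity (A : B.Connection) (u : B.SmoothSection) (x : M) : ℝ :=
  haveI : FiniteDimensional ℝ (TangentSpace (𝓡 3) x) :=
    inferInstanceAs (FiniteDimensional ℝ (EuclideanSpace ℝ (Fin 3)))
  ∑ i, B.metric (u.toFun x)
    (A.covDeriv u x (stdOrthonormalBasis ℝ (TangentSpace (𝓡 3) x) i))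
    (A.covDeriv u x (stdOrthonormalBasis ℝ (TangentSpace (𝓡 3) x) i))

/-- The Fueter operator `∑ I(v_i) ∇_{v_i} u` at `x`, computed in an orthonormal basis `v` of
`T_x M`. The tangent vector `v_i` at `x = proj (u x)` is turned into a term of the type
`T_{proj (u x)} M`. -/
def Connection.fueter (A : B.Connection) (u : B.SmoothSection) (x : M)
    (v : OrthonormalBasis (Fin 3) ℝ (TangentSpace (𝓡 3) x)) : TangentSpace (𝓡 n) (u.toFun x) :=
  ∑ i, B.I (u.toFun x) ((u.proj_toFun x) ▸ v i) (A.covDeriv u x (v i))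

/-- `u` solves the perturbed Fueter equation `𝔉 u = p ∘ u`. -/
def Connection.IsPerturbedFueter (A : B.Connection) (p : B.VerticalField)
    (u : B.SmoothSection) : Prop :=
  ∀ x, ∃ v : OrthonormalBasis (Fin 3) ℝ (TangentSpace (𝓡 3) x),
    A.fueter u x v = p.toFun (u.toFun x)

end HyperkahlerBundle

/-- The renormalised energy `(1/r) ∫_{B_r(x)} |∇u|²`, for the Riemannian distance and volume. -/
def renormalisedEnergy [MeasurableSpace M] {B : HyperkahlerBundle n M X} (A : B.Connection)
    (u : B.SmoothSection) (x : M) (r : ℝ) : ℝ :=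
  (1 / r) * ∫ y in Metric.eball x (ENNReal.ofReal r), A.energyDensity u y ∂(riemannianVolume M)

end Fueter

end

/-!
# `ε`-regularity for perturbed Fueter sections

**The equation.** Since `∑ I(vᵢ)² = -3`, the perturbation `p` is absorbed by the connection: with
`Nᵥ u = ∇ᵥ u + ⅓ I(v) p`, a perturbed Fueter section solves `∑ I(vᵢ) N_{vᵢ} u = 0` exactly
(`Connection.perturbedVert`, `sum_I_perturbedVert`). The lengths of `N u` and `∇ u` differ by a bounded
amount, so that the density `f = 1 + |N u|²` is comparable with `1 + |∇ u|²`
(`density_sectionEnergy_le`). In charts of the base and of the total space, `u` becomes a solution of a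
first order system in a `LocalModel` with uniform bounds, of which finitely many suffice by
compactness (`exists_localModel`, `exists_modelCover`).

**Monotonicity.** The commutator forms `⟨·, [I(a), I(b)] ·⟩` are closed on the fibres, because the
complex structures are parallel (`commutator_cyclic`, `closed_commCoord`). For a solution of the
equation, the pull-backs by `u` of the forms of the frame vectors `a + 1, a + 2`, evaluated at
`k + 1, k + 2`, are the components of the stress tensor `δₐₖ |N u|² - 2 ⟨Nₐ u, Nₖ u⟩`
(`CliffordTriple.stress_approx`), up to an error due to the variation of the metric of the base.
Closedness bounds the divergence of that tensor by `f` itself (`abs_divergence_le`): each term that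
survives has an argument that is horizontal, hence bounded. The divergence theorem yields that
`r⁻¹ ∫_{B_r} f` is almost monotone in `r` (`monotonicity_of_stress`, `exists_monotonicity`).

**Mean value inequality.** Let `f ≤ 4 f(z)` on a ball around `z` that is small in comparison with
`f(z)^{-1/2}`. There `u` stays in a single local model, and the system with coefficients frozen at
`u(z)` squares to the Laplacian. Integration by parts bounds `N u(z)` by the mean of `√f`, up to an
error that is absorbed (`exists_gradient_estimate`, `exists_cov_le`, `exists_mean_value`). No second
derivatives of `u` are estimated.

**Conclusion.** By the Heinz trick (`heinz_trick`), applied at a maximum of `(R - |z - y|)² f(z)`, the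
two inequalities bound `f(y)` by the mean of `f` if the renormalised integral is small
(`IsDiracSection.exists_epsilon_regularity`). The comparison of Riemannian balls, distances and volumes
with Euclidean ones (`edist_chartAt_symm_le`, `setIntegral_chartAt_symm_le`) transfers the estimate to
the manifold, and a finite cover of the compact base makes the constants uniform
(`exists_epsilonRegularOn`, `epsilonRegularOn_univ`).

The explicit numerical constants in the estimates have no significance.
-/

open Bundle
open scoped Manifold ContDiff

noncomputable section

namespace Fueter

open MeasureTheory Metric Set

/-! ### Polynomial cut-off functions and integration by parts on balls -/

/-- Euclidean `3`-space, the model of the base. -/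
abbrev E3 : Type := EuclideanSpace ℝ (Fin 3)

/-- The standard basis of `E3`. -/
abbrev stdE (k : Fin 3) : E3 := EuclideanSpace.single k (1 : ℝ)

/-- The cut-off function `(1 - |x|²)₊ ^ m`. It is of class `C^{m-1}` and supported in the closed
unit ball. -/
def cutoff (m : ℕ) (x : E3) : ℝ := (max (1 - ‖x‖ ^ 2) 0) ^ m

lemma hasDerivAt_max_zero_pow (m : ℕ) (t : ℝ) :
    HasDerivAt (fun t : ℝ => (max t 0) ^ (m + 2)) ((m + 2) * (max t 0) ^ (m + 1)) t := by
  rcases lt_trichotomy t 0 with h | h | h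
  · have : (fun t : ℝ => (max t 0) ^ (m + 2)) =ᶠ[nhds t] fun _ => 0 := by
      filter_upwards [Iio_mem_nhds h] with s hs
      simp [max_eq_right (mem_Iio.1 hs).le]
    refine (this.hasDerivAt_iff).2 ?_
    simpa [max_eq_right h.le] using hasDerivAt_const t (0 : ℝ)
  · subst h
    rw [hasDerivAt_iff_isLittleO]
    simp only [max_self, ne_eq, Nat.add_eq_zero_iff, one_ne_zero, and_false, not_false_eq_true,
      zero_pow, mul_zero, sub_zero, smul_zero, OfNat.ofNat_ne_zero]
    refine Asymptotics.IsBigO.trans_isLittleO (g := fun x : ℝ => x ^ 2) ?_ ?_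
    · refine Asymptotics.IsBigO.of_bound 1 ?_
      filter_upwards [Metric.ball_mem_nhds (0 : ℝ) one_pos] with s hs
      have hs' : |s| < 1 := by simpa using hs
      have h1 : max s 0 ≤ |s| := max_le (le_abs_self s) (abs_nonneg s)
      have h0 : 0 ≤ max s 0 := le_max_right _ _
      rw [Real.norm_of_nonneg (by positivity), Real.norm_of_nonneg (by positivity), one_mul,
        ← sq_abs s]
      calc (max s 0) ^ (m + 2) ≤ |s| ^ (m + 2) := by gcongr
        _ ≤ |s| ^ 2 := pow_le_pow_of_le_one (abs_nonneg s) hs'.le (by omega)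
    · simpa using Asymptotics.isLittleO_pow_id (𝕜 := ℝ) one_lt_two
  · have : (fun t : ℝ => (max t 0) ^ (m + 2)) =ᶠ[nhds t] fun t => t ^ (m + 2) := by
      filter_upwards [Ioi_mem_nhds h] with s hs
      simp [max_eq_left (mem_Ioi.1 hs).le]
    refine (this.hasDerivAt_iff).2 ?_
    have := hasDerivAt_pow (m + 2) t
    simpa [max_eq_left h.le] using this

lemma cutoff_nonneg (m : ℕ) (x : E3) : 0 ≤ cutoff m x := by unfold cutoff; positivity

lemma cutoff_le_one (m : ℕ) (x : E3) : cutoff m x ≤ 1 := by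
  unfold cutoff
  exact pow_le_one₀ (by positivity) (max_le (by nlinarith [sq_nonneg ‖x‖]) zero_le_one)

lemma cutoff_eq_zero {m : ℕ} (hm : m ≠ 0) {x : E3} (hx : 1 ≤ ‖x‖) : cutoff m x = 0 := by
  unfold cutoff
  rw [max_eq_right (by nlinarith), zero_pow hm]

@[fun_prop]
lemma continuous_cutoff (m : ℕ) : Continuous (cutoff m) := by unfold cutoff; fun_prop

lemma hasFDerivAt_cutoff (m : ℕ) (x : E3) :
    HasFDerivAt (cutoff (m + 2)) ((-(2 * (m + 2) * cutoff (m + 1) x)) • innerSL ℝ x) x := by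
  have h1 : HasFDerivAt (fun x : E3 => 1 - ‖x‖ ^ 2) (-((2 : ℝ) • innerSL ℝ x)) x := by
    have := (hasStrictFDerivAt_norm_sq x).hasFDerivAt
    refine (this.const_sub 1).congr_fderiv ?_
    ext v
    simp [two_smul]
  have h2 := (hasDerivAt_max_zero_pow m (1 - ‖x‖ ^ 2)).comp_hasFDerivAt x h1
  refine h2.congr_fderiv ?_
  ext v
  simp [cutoff]
  ring

lemma contDiff_cutoff (m : ℕ) : ContDiff ℝ 1 (cutoff (m + 2)) := by
  rw [contDiff_one_iff_fderiv]
  refine ⟨fun x => (hasFDerivAt_cutoff m x).differentiableAt, ?_⟩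
  have : fderiv ℝ (cutoff (m + 2)) = fun x => (-(2 * (m + 2) * cutoff (m + 1) x)) • innerSL ℝ x :=
    funext fun x => (hasFDerivAt_cutoff m x).fderiv
  rw [this]
  fun_prop

section Parts

variable {F : Type*} [NormedAddCommGroup F]

lemma tsupport_subset_closedBall {G : Type*} [Zero G] {η : E3 → G} {r : ℝ}
    (h : ∀ x, r ≤ ‖x‖ → η x = 0) : tsupport η ⊆ closedBall 0 r := by
  refine closure_minimal (fun x hx => ?_) isClosed_closedBall
  rw [mem_closedBall_zero_iff]
  by_contra hlt
  exact hx (h x (not_le.1 hlt).le)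

/-- A function that vanishes outside a ball of radius `r` and is continuous on a larger ball is
integrable. -/
lemma integrable_of_zero_outside {g : E3 → F} {r R : ℝ} (hr : r < R)
    (h : ∀ x, r ≤ ‖x‖ → g x = 0) (hg : ContinuousOn g (ball 0 R)) : Integrable g := by
  have hs := tsupport_subset_closedBall h
  refine Continuous.integrable_of_hasCompactSupport ?_ ?_
  · refine continuous_of_tsupport fun x hx => hg.continuousAt (isOpen_ball.mem_nhds ?_)
    exact closedBall_subset_ball hr (hs hx)
  · exact HasCompactSupport.of_support_subset_isCompact (isCompact_closedBall 0 r)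
      ((subset_tsupport _).trans hs)

variable [NormedSpace ℝ F]

/-- Integration by parts against a cut-off function supported in a ball of radius `r`, for a
function that is differentiable on a larger ball only. -/
lemma integral_cutoff_smul_fderiv {η : E3 → ℝ} {g : E3 → F} {r R : ℝ} (hr : r < R)
    (hη : ContDiff ℝ 1 η) (h : ∀ x, r ≤ ‖x‖ → η x = 0)
    (hg : ContDiffOn ℝ 1 g (ball 0 R)) (v : E3) :
    ∫ x, η x • fderiv ℝ g x v = -∫ x, fderiv ℝ η x v • g x := by
  have hs := tsupport_subset_closedBall h
  have hη' : ∀ x, (r + R) / 2 ≤ ‖x‖ → fderiv ℝ η x v = 0 := by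
    intro x hx
    have : η =ᶠ[nhds x] fun _ => 0 := by
      filter_upwards [(isOpen_lt continuous_const continuous_norm).mem_nhds
        (show r < ‖x‖ by linarith)] with y hy
      exact h y (le_of_lt hy)
    simp [this.fderiv_eq]
  have hgc : ContinuousOn (fun x => fderiv ℝ g x v) (ball 0 R) :=
    (hg.continuousOn_fderiv_of_isOpen isOpen_ball le_rfl).clm_apply continuousOn_const
  refine integral_smul_fderiv_eq_neg_fderiv_smul_of_integrable ?_ ?_ ?_ ?_ ?_
  · refine integrable_of_zero_outside (show (r + R) / 2 < R by linarith)
      (fun x hx => by rw [hη' x hx, zero_smul]) ?_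
    exact ((hη.continuous_fderiv one_ne_zero).clm_apply continuous_const).continuousOn.smul
      hg.continuousOn
  · exact integrable_of_zero_outside hr (fun x hx => by rw [h x hx, zero_smul])
      (hη.continuous.continuousOn.smul hgc)
  · exact integrable_of_zero_outside hr (fun x hx => by rw [h x hx, zero_smul])
      (hη.continuous.continuousOn.smul hg.continuousOn)
  · exact fun x _ => (hη.differentiable one_ne_zero) x
  · intro x hx
    exact (hg.contDiffAt (isOpen_ball.mem_nhds (closedBall_subset_ball hr (hs hx)))).differentiableAt
      one_ne_zero

end Parts

/-! ### Monotonicity of the renormalised energy -/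

lemma cutoff_inv_smul_eq_zero {m : ℕ} (hm : m ≠ 0) {r : ℝ} (hr : 0 < r) {x : E3} (hx : r ≤ ‖x‖) :
    cutoff m (r⁻¹ • x) = 0 := by
  refine cutoff_eq_zero hm ?_
  rw [norm_smul, norm_inv, Real.norm_of_nonneg hr.le]
  rwa [inv_mul_eq_div, le_div_iff₀ hr, one_mul]

lemma hasDerivAt_cutoff_radius (m : ℕ) {t : ℝ} (ht : t ≠ 0) (x : E3) :
    HasDerivAt (fun t : ℝ => cutoff (m + 2) (t⁻¹ • x))
      (2 * (m + 2) * cutoff (m + 1) (t⁻¹ • x) * ‖x‖ ^ 2 / t ^ 3) t := by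
  have h1 : HasDerivAt (fun t : ℝ => t⁻¹ • x) ((-(t ^ 2)⁻¹) • x) t :=
    (hasDerivAt_inv ht).smul_const x
  have h2 := (hasFDerivAt_cutoff m (t⁻¹ • x)).comp_hasDerivAt t h1
  refine h2.congr_deriv ?_
  simp only [smul_apply, innerSL_apply_apply, inner_smul_left, inner_smul_right,
    smul_eq_mul, real_inner_self_eq_norm_sq]
  simp
  field_simp

/-- The differential inequality behind the monotonicity formula: the divergence theorem for the
vector field `∑ₐ Sₐₖ xₐ` times a cut-off function of radius `t`. -/
lemma stress_inequality {R K : ℝ} (hK : 0 ≤ K) {f : E3 → ℝ} {S : Fin 3 → Fin 3 → E3 → ℝ}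
    (hf : ContinuousOn f (ball 0 R)) (hf0 : ∀ x ∈ ball (0 : E3) R, 0 ≤ f x)
    (hS : ∀ a k, ContDiffOn ℝ 1 (S a k) (ball 0 R))
    (hdiv : ∀ a, ∀ x ∈ ball (0 : E3) R, |∑ k, fderiv ℝ (S a k) x (stdE k)| ≤ K * f x)
    (htr : ∀ x ∈ ball (0 : E3) R, f x - K * ‖x‖ * f x ≤ ∑ a, S a a x)
    (hrad : ∀ x ∈ ball (0 : E3) R,
      ∑ a, ∑ k, S a k x * x a * x k ≤ ‖x‖ ^ 2 * f x + K * ‖x‖ ^ 3 * f x)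
    {t : ℝ} (ht : 0 < t) (htR : t < R) :
    (1 - 4 * K * t) * ∫ x, f x * cutoff 2 (t⁻¹ • x) ≤
      (1 + K * t) * t * ∫ x, f x * (4 * cutoff 1 (t⁻¹ • x) * ‖x‖ ^ 2 / t ^ 3) := by
  have hcd : ContDiff ℝ 1 fun x : E3 => cutoff 2 (t⁻¹ • x) :=
    (contDiff_cutoff 0).comp (contDiff_const_smul _)
  have hηs : ∀ a : Fin 3, ContDiff ℝ 1 fun x : E3 => x a * cutoff 2 (t⁻¹ • x) := fun a => by
    refine ContDiff.mul ?_ hcd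
    exact (EuclideanSpace.proj (𝕜 := ℝ) a).contDiff
  have hηd : ∀ (a k : Fin 3) (x : E3), fderiv ℝ (fun x : E3 => x a * cutoff 2 (t⁻¹ • x)) x (stdE k)
      = (if a = k then cutoff 2 (t⁻¹ • x) else 0)
        - 4 * cutoff 1 (t⁻¹ • x) * x k / t ^ 2 * x a := by
    intro a k x
    have h1 : HasFDerivAt (fun x : E3 => x a) (EuclideanSpace.proj (𝕜 := ℝ) a) x :=
      (EuclideanSpace.proj (𝕜 := ℝ) a : E3 →L[ℝ] ℝ).hasFDerivAt
    have h2 : HasFDerivAt (fun x : E3 => t⁻¹ • x) (t⁻¹ • ContinuousLinearMap.id ℝ E3) x :=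
      (hasFDerivAt_id x).fun_const_smul _
    have h3 : HasFDerivAt (fun x : E3 => cutoff 2 (t⁻¹ • x)) _ x :=
      (hasFDerivAt_cutoff 0 (t⁻¹ • x)).comp x h2
    rw [(h1.fun_mul h3).fderiv]
    simp [EuclideanSpace.inner_single_right]
    split_ifs with h
    · field_simp; ring
    · field_simp; ring
  have hparts : ∀ a k : Fin 3, ∫ x, (x a * cutoff 2 (t⁻¹ • x)) * fderiv ℝ (S a k) x (stdE k)
      = -∫ x, ((if a = k then cutoff 2 (t⁻¹ • x) else 0)
        - 4 * cutoff 1 (t⁻¹ • x) * x k / t ^ 2 * x a) * S a k x := by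
    intro a k
    have := integral_cutoff_smul_fderiv (η := fun x : E3 => x a * cutoff 2 (t⁻¹ • x))
      (g := S a k) htR (hηs a)
      (fun x hx => by rw [cutoff_inv_smul_eq_zero two_ne_zero ht hx, mul_zero]) (hS a k) (stdE k)
    simpa only [hηd, smul_eq_mul] using this
  have hSd : ∀ a k, ContinuousOn (fun x => fderiv ℝ (S a k) x (stdE k)) (ball 0 R) := fun a k =>
    ((hS a k).continuousOn_fderiv_of_isOpen isOpen_ball le_rfl).clm_apply continuousOn_const
  have hSc : ∀ a k, ContinuousOn (S a k) (ball 0 R) := fun a k => (hS a k).continuousOn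
  have hcc : ∀ m, Continuous fun x : E3 => cutoff m (t⁻¹ • x) := fun m => by fun_prop
  have hxc : ∀ a : Fin 3, Continuous fun x : E3 => x a := fun a =>
    (EuclideanSpace.proj (𝕜 := ℝ) a : E3 →L[ℝ] ℝ).continuous
  have hi1 : ∀ a k : Fin 3, Integrable fun x : E3 =>
      (x a * cutoff 2 (t⁻¹ • x)) * fderiv ℝ (S a k) x (stdE k) := fun a k =>
    integrable_of_zero_outside htR
      (fun x hx => by rw [cutoff_inv_smul_eq_zero two_ne_zero ht hx]; simp)
      (((hxc a).mul (hcc 2)).continuousOn.mul (hSd a k))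
  have hi2 : ∀ a k : Fin 3, Integrable fun x : E3 =>
      ((if a = k then cutoff 2 (t⁻¹ • x) else 0)
        - 4 * cutoff 1 (t⁻¹ • x) * x k / t ^ 2 * x a) * S a k x := fun a k => by
    refine integrable_of_zero_outside htR (fun x hx => ?_) (ContinuousOn.mul ?_ (hSc a k))
    · rw [cutoff_inv_smul_eq_zero two_ne_zero ht hx, cutoff_inv_smul_eq_zero one_ne_zero ht hx]
      simp
    · refine Continuous.continuousOn (Continuous.sub ?_ ?_)
      · split_ifs
        · exact hcc 2
        · exact continuous_const
      · exact ((((continuous_const.mul (hcc 1)).mul (hxc k)).div_const _).mul (hxc a))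
  have hi3 : Integrable fun x : E3 => f x * cutoff 2 (t⁻¹ • x) :=
    integrable_of_zero_outside htR
      (fun x hx => by rw [cutoff_inv_smul_eq_zero two_ne_zero ht hx]; simp)
      (hf.mul (hcc 2).continuousOn)
  have hi4 : Integrable fun x : E3 => f x * (4 * cutoff 1 (t⁻¹ • x) * ‖x‖ ^ 2 / t ^ 3) :=
    integrable_of_zero_outside htR
      (fun x hx => by rw [cutoff_inv_smul_eq_zero one_ne_zero ht hx]; simp)
      (hf.mul (((continuous_const.mul (hcc 1)).mul (continuous_norm.pow 2)).div_const _).continuousOn)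
  have hi12 : ∀ a k : Fin 3, Integrable fun x : E3 =>
      ((x a * cutoff 2 (t⁻¹ • x)) * fderiv ℝ (S a k) x (stdE k) +
      ((if a = k then cutoff 2 (t⁻¹ • x) else 0)
        - 4 * cutoff 1 (t⁻¹ • x) * x k / t ^ 2 * x a) * S a k x) := fun a k =>
    (hi1 a k).add (hi2 a k)
  have hzero : ∫ x, ∑ a, ∑ k, ((x a * cutoff 2 (t⁻¹ • x)) * fderiv ℝ (S a k) x (stdE k) +
      ((if a = k then cutoff 2 (t⁻¹ • x) else 0)
        - 4 * cutoff 1 (t⁻¹ • x) * x k / t ^ 2 * x a) * S a k x) = 0 := by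
    rw [integral_finsetSum _ fun a _ => integrable_finsetSum _ fun k _ => hi12 a k]
    refine Finset.sum_eq_zero fun a _ => ?_
    rw [integral_finsetSum _ fun k _ => hi12 a k]
    refine Finset.sum_eq_zero fun k _ => ?_
    rw [integral_add (hi1 a k) (hi2 a k), hparts a k]
    ring
  rw [← integral_const_mul, ← integral_const_mul, ← sub_nonpos, ← integral_sub
    (hi3.const_mul _) (hi4.const_mul _), ← hzero]
  refine integral_mono ((hi3.const_mul _).sub (hi4.const_mul _)) ?_ fun x => ?_
  · exact integrable_finsetSum _ fun a _ => integrable_finsetSum _ fun k _ => hi12 a k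
  rcases le_or_gt t ‖x‖ with hx | hx
  · simp [cutoff_inv_smul_eq_zero two_ne_zero ht hx, cutoff_inv_smul_eq_zero one_ne_zero ht hx]
  have hxR : x ∈ ball (0 : E3) R := by rw [mem_ball_zero_iff]; linarith
  have hq1 : 0 ≤ cutoff 1 (t⁻¹ • x) := cutoff_nonneg _ _
  have hq2 : 0 ≤ cutoff 2 (t⁻¹ • x) := cutoff_nonneg _ _
  have h1 := htr x hxR
  have h2 := hrad x hxR
  have hfx := hf0 x hxR
  have h3 : ∀ a : Fin 3, -(K * t * f x) ≤ x a * ∑ k, fderiv ℝ (S a k) x (stdE k) := by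
    intro a
    have hxa : |x a| ≤ t := by
      have := PiLp.norm_apply_le x a
      rw [Real.norm_eq_abs] at this
      linarith
    have := abs_le.1 ((abs_mul (x a) _).le.trans
      (mul_le_mul hxa (hdiv a x hxR) (abs_nonneg _) ht.le))
    linarith [this.1]
  have e1 : ∑ a, ∑ k, ((x a * cutoff 2 (t⁻¹ • x)) * fderiv ℝ (S a k) x (stdE k) +
      ((if a = k then cutoff 2 (t⁻¹ • x) else 0)
        - 4 * cutoff 1 (t⁻¹ • x) * x k / t ^ 2 * x a) * S a k x)
      = cutoff 2 (t⁻¹ • x) * (∑ a, x a * ∑ k, fderiv ℝ (S a k) x (stdE k))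
        + cutoff 2 (t⁻¹ • x) * (∑ a, S a a x)
        - 4 * cutoff 1 (t⁻¹ • x) / t ^ 2 * ∑ a, ∑ k, S a k x * x a * x k := by
    simp only [Fin.sum_univ_three]
    simp
    ring
  show _ ≤ ∑ a, ∑ k, _
  rw [e1]
  have h4 : -(3 * (K * t * f x)) ≤ ∑ a, x a * ∑ k, fderiv ℝ (S a k) x (stdE k) := by
    rw [Fin.sum_univ_three]; linarith [h3 0, h3 1, h3 2]
  have h5 : K * ‖x‖ * f x ≤ K * t * f x := by gcongr
  have h6 : K * ‖x‖ ^ 3 * f x ≤ K * t * (‖x‖ ^ 2 * f x) := by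
    rw [pow_succ]
    have : K * (‖x‖ ^ 2 * ‖x‖) * f x = ‖x‖ * (K * (‖x‖ ^ 2 * f x)) := by ring
    rw [this, show K * t * (‖x‖ ^ 2 * f x) = t * (K * (‖x‖ ^ 2 * f x)) by ring]
    gcongr
  have h7 : cutoff 2 (t⁻¹ • x) * (f x - 4 * (K * t * f x)) ≤
      cutoff 2 (t⁻¹ • x) * (∑ a, x a * ∑ k, fderiv ℝ (S a k) x (stdE k)) +
        cutoff 2 (t⁻¹ • x) * (∑ a, S a a x) := by
    rw [← mul_add]
    exact mul_le_mul_of_nonneg_left (by linarith) hq2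
  have h8 : 4 * cutoff 1 (t⁻¹ • x) / t ^ 2 * ∑ a, ∑ k, S a k x * x a * x k ≤
      4 * cutoff 1 (t⁻¹ • x) / t ^ 2 * (‖x‖ ^ 2 * f x + K * t * (‖x‖ ^ 2 * f x)) :=
    mul_le_mul_of_nonneg_left (by linarith) (by positivity)
  have h9 : (1 + K * t) * t * (f x * (4 * cutoff 1 (t⁻¹ • x) * ‖x‖ ^ 2 / t ^ 3)) =
      4 * cutoff 1 (t⁻¹ • x) / t ^ 2 * (‖x‖ ^ 2 * f x + K * t * (‖x‖ ^ 2 * f x)) := by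
    field_simp
  rw [h9]
  linarith

/-- Almost-monotonicity of `t⁻¹ ∫_{B_t} f`, for a density `f` with a stress tensor `S` of nearly
the right trace and radial part and of small divergence. -/
theorem monotonicity_of_stress {R K : ℝ} (hK : 0 ≤ K) (hKR : 5 * K * R ≤ 1) {f : E3 → ℝ}
    {S : Fin 3 → Fin 3 → E3 → ℝ}
    (hf : ContinuousOn f (ball 0 R)) (hf0 : ∀ x ∈ ball (0 : E3) R, 0 ≤ f x)
    (hS : ∀ a k, ContDiffOn ℝ 1 (S a k) (ball 0 R))
    (hdiv : ∀ a, ∀ x ∈ ball (0 : E3) R, |∑ k, fderiv ℝ (S a k) x (stdE k)| ≤ K * f x)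
    (htr : ∀ x ∈ ball (0 : E3) R, f x - K * ‖x‖ * f x ≤ ∑ a, S a a x)
    (hrad : ∀ x ∈ ball (0 : E3) R,
      ∑ a, ∑ k, S a k x * x a * x k ≤ ‖x‖ ^ 2 * f x + K * ‖x‖ ^ 3 * f x)
    {ρ r : ℝ} (hρ : 0 < ρ) (hρr : ρ ≤ r) (hrR : r < R) :
    ρ⁻¹ * ∫ x in ball 0 (ρ / 2), f x ≤ 5 * (r⁻¹ * ∫ x in ball 0 r, f x) := by
  have hr : 0 < r := hρ.trans_le hρr
  obtain ⟨R₁, hrR₁, hR₁⟩ := exists_between hrR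
  have hint : IntegrableOn f (ball 0 R₁) :=
    ((hf.mono (closedBall_subset_ball hR₁)).integrableOn_compact
      (isCompact_closedBall 0 R₁)).mono_set ball_subset_closedBall
  -- the smoothed integral `F` over `B_t` and its derivative `D`
  set F : ℝ → ℝ := fun t => ∫ x in ball 0 R₁, f x * cutoff 2 (t⁻¹ • x) with hF
  set D : ℝ → ℝ := fun t => ∫ x in ball 0 R₁, f x * (4 * cutoff 1 (t⁻¹ • x) * ‖x‖ ^ 2 / t ^ 3)
    with hD
  have hfull : ∀ t, 0 < t → t < R₁ → F t = ∫ x, f x * cutoff 2 (t⁻¹ • x) := fun t ht ht1 => by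
    refine setIntegral_eq_integral_of_forall_compl_eq_zero fun x hx => ?_
    have : t ≤ ‖x‖ := by rw [mem_ball_zero_iff, not_lt] at hx; linarith
    rw [cutoff_inv_smul_eq_zero two_ne_zero ht this, mul_zero]
  have hfull' : ∀ t, 0 < t → t < R₁ →
      D t = ∫ x, f x * (4 * cutoff 1 (t⁻¹ • x) * ‖x‖ ^ 2 / t ^ 3) := fun t ht ht1 => by
    refine setIntegral_eq_integral_of_forall_compl_eq_zero fun x hx => ?_
    have : t ≤ ‖x‖ := by rw [mem_ball_zero_iff, not_lt] at hx; linarith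
    rw [cutoff_inv_smul_eq_zero one_ne_zero ht this]; simp
  have hfm : AEStronglyMeasurable f (volume.restrict (ball 0 R₁)) := hint.aestronglyMeasurable
  have hcm : ∀ (m : ℕ) (t : ℝ), AEStronglyMeasurable (fun x : E3 => cutoff m (t⁻¹ • x))
      (volume.restrict (ball 0 R₁)) := fun m t => by
    have : Continuous fun x : E3 => cutoff m (t⁻¹ • x) := by fun_prop
    exact this.aestronglyMeasurable
  have hderiv : ∀ t, 0 < t → HasDerivAt F (D t) t := by
    intro t ht
    refine (hasDerivAt_integral_of_dominated_loc_of_deriv_le (s := Ioi (t / 2))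
      (F := fun t x => f x * cutoff 2 (t⁻¹ • x))
      (F' := fun t x => f x * (4 * cutoff 1 (t⁻¹ • x) * ‖x‖ ^ 2 / t ^ 3))
      (bound := fun x => |f x| * (4 * R₁ ^ 2 / (t / 2) ^ 3))
      (Ioi_mem_nhds (by linarith)) ?_ ?_ ?_ ?_ ?_ ?_).2
    · exact Filter.Eventually.of_forall fun s => hfm.mul (hcm 2 s)
    · refine Integrable.mono' hint.norm (hfm.mul (hcm 2 t)) (Filter.Eventually.of_forall fun x => ?_)
      rw [norm_mul, Real.norm_of_nonneg (cutoff_nonneg _ _)]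
      exact mul_le_of_le_one_right (norm_nonneg _) (cutoff_le_one _ _)
    · refine hfm.mul ?_
      have : Continuous fun x : E3 => 4 * cutoff 1 (t⁻¹ • x) * ‖x‖ ^ 2 / t ^ 3 := by fun_prop
      exact this.aestronglyMeasurable
    · refine (ae_restrict_iff' measurableSet_ball).2 (Filter.Eventually.of_forall fun x hx s hs => ?_)
      have hs' : t / 2 < s := hs
      have hs0 : 0 < s := by linarith
      have hx' : ‖x‖ < R₁ := mem_ball_zero_iff.1 hx
      rw [norm_mul, Real.norm_eq_abs]
      refine mul_le_mul_of_nonneg_left ?_ (abs_nonneg _)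
      have hc0 := cutoff_nonneg 1 (s⁻¹ • x)
      rw [Real.norm_of_nonneg (by positivity)]
      have hc1 := cutoff_le_one 1 (s⁻¹ • x)
      have : 4 * cutoff 1 (s⁻¹ • x) * ‖x‖ ^ 2 ≤ 4 * R₁ ^ 2 := by
        calc 4 * cutoff 1 (s⁻¹ • x) * ‖x‖ ^ 2 ≤ 4 * 1 * R₁ ^ 2 := by gcongr
          _ = _ := by ring
      gcongr
    · exact hint.abs.mul_const _
    · refine Filter.Eventually.of_forall fun x s hs => ?_
      have hs' : t / 2 < s := hs
      have := (hasDerivAt_cutoff_radius 0 (show s ≠ 0 by linarith) x).const_mul (f x)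
      refine this.congr_deriv ?_
      norm_num
  have hF0 : ∀ t, 0 ≤ F t := fun t =>
    setIntegral_nonneg measurableSet_ball fun x hx =>
      mul_nonneg (hf0 x (ball_subset_ball hR₁.le hx)) (cutoff_nonneg _ _)
  -- `F' ≥ F (1 / t - 5 K)`, by the differential inequality
  have hmono : MonotoneOn (fun t => F t * (Real.exp (5 * K * t) / t)) (Ioo 0 R₁) := by
    have hd : ∀ t ∈ Ioo 0 R₁, HasDerivAt (fun t => F t * (Real.exp (5 * K * t) / t))
        (D t * (Real.exp (5 * K * t) / t) +
          F t * ((Real.exp (5 * K * t) * (5 * K) * t - Real.exp (5 * K * t) * 1) / t ^ 2)) t := by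
      intro t ht
      refine (hderiv t ht.1).mul (HasDerivAt.div ?_ (hasDerivAt_id' t) ht.1.ne')
      have := ((hasDerivAt_id' t).const_mul (5 * K)).exp
      simpa using this
    refine monotoneOn_of_deriv_nonneg (convex_Ioo _ _) ?_ ?_ ?_
    · exact fun t ht => (hd t ht).continuousAt.continuousWithinAt
    · rw [interior_Ioo]
      exact fun t ht => (hd t ht).differentiableAt.differentiableWithinAt
    · rw [interior_Ioo]
      intro t ht
      rw [(hd t ht).deriv]
      have h1 := stress_inequality hK hf hf0 hS hdiv htr hrad ht.1 (ht.2.trans hR₁)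
      rw [← hfull t ht.1 ht.2, ← hfull' t ht.1 ht.2] at h1
      have ht0 := ht.1
      have hKt : 5 * K * t ≤ 1 := by
        have : 5 * K * t ≤ 5 * K * R := by
          have := ht.2.trans hR₁
          gcongr
        linarith
      have hKt0 : 0 ≤ K * t := by positivity
      have h2 : (1 - 5 * K * t) * F t ≤ t * D t := by
        have h3 : (1 + K * t) * ((1 - 5 * K * t) * F t) ≤ (1 + K * t) * (t * D t) := by
          have : (1 + K * t) * ((1 - 5 * K * t) * F t) ≤ (1 - 4 * K * t) * F t := by
            have := mul_nonneg (sq_nonneg (K * t)) (hF0 t)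
            nlinarith
          linarith
        exact le_of_mul_le_mul_left h3 (by positivity)
      have h4 : D t * (Real.exp (5 * K * t) / t) +
          F t * ((Real.exp (5 * K * t) * (5 * K) * t - Real.exp (5 * K * t) * 1) / t ^ 2) =
          Real.exp (5 * K * t) / t ^ 2 * (t * D t - (1 - 5 * K * t) * F t) := by
        field_simp
        ring
      rw [h4]
      have := Real.exp_pos (5 * K * t)
      exact mul_nonneg (by positivity) (by linarith)
  have hm := hmono ⟨hρ, hρr.trans_lt hrR₁⟩ ⟨hr, hrR₁⟩ hρr
  have hlow : 9 / 16 * ∫ x in ball 0 (ρ / 2), f x ≤ F ρ := by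
    have hsub : ball (0 : E3) (ρ / 2) ⊆ ball 0 R₁ := ball_subset_ball (by linarith)
    have hi : IntegrableOn (fun x => f x * cutoff 2 (ρ⁻¹ • x)) (ball 0 R₁) := by
      refine Integrable.mono' hint.norm (hfm.mul (hcm 2 ρ)) (Filter.Eventually.of_forall fun x => ?_)
      rw [norm_mul, Real.norm_of_nonneg (cutoff_nonneg _ _)]
      exact mul_le_of_le_one_right (norm_nonneg _) (cutoff_le_one _ _)
    calc 9 / 16 * ∫ x in ball 0 (ρ / 2), f x = ∫ x in ball 0 (ρ / 2), f x * (9 / 16) := by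
          rw [integral_mul_const, mul_comm]
      _ ≤ ∫ x in ball 0 (ρ / 2), f x * cutoff 2 (ρ⁻¹ • x) := by
          refine setIntegral_mono_on ((hint.mono_set hsub).mul_const _) (hi.mono_set hsub)
            measurableSet_ball fun x hx => ?_
          refine mul_le_mul_of_nonneg_left ?_ (hf0 x (ball_subset_ball hR₁.le (hsub hx)))
          have hx' : ‖ρ⁻¹ • x‖ ≤ 1 / 2 := by
            rw [norm_smul, norm_inv, Real.norm_of_nonneg hρ.le, inv_mul_eq_div, div_le_iff₀ hρ]
            have := mem_ball_zero_iff.1 hx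
            linarith
          have h34 : (3 / 4 : ℝ) ≤ max (1 - ‖ρ⁻¹ • x‖ ^ 2) 0 := by
            refine le_max_of_le_left ?_
            nlinarith [norm_nonneg (ρ⁻¹ • x)]
          unfold cutoff
          calc (9 / 16 : ℝ) = (3 / 4) ^ 2 := by norm_num
            _ ≤ _ := by gcongr
      _ ≤ F ρ := by
          refine setIntegral_mono_set hi ?_ hsub.eventuallyLE
          refine (ae_restrict_iff' measurableSet_ball).2 (Filter.Eventually.of_forall fun x hx => ?_)
          exact mul_nonneg (hf0 x (ball_subset_ball hR₁.le hx)) (cutoff_nonneg _ _)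
  have hup : F r ≤ ∫ x in ball 0 r, f x := by
    have hsub : ball (0 : E3) r ⊆ ball 0 R₁ := ball_subset_ball hrR₁.le
    have : F r = ∫ x in ball 0 r, f x * cutoff 2 (r⁻¹ • x) := by
      rw [hfull r hr hrR₁]
      symm
      refine setIntegral_eq_integral_of_forall_compl_eq_zero fun x hx => ?_
      rw [mem_ball_zero_iff, not_lt] at hx
      rw [cutoff_inv_smul_eq_zero two_ne_zero hr hx, mul_zero]
    rw [this]
    refine setIntegral_mono_on ?_ (hint.mono_set hsub) measurableSet_ball fun x hx => ?_
    · refine Integrable.mono' (hint.mono_set hsub).norm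
        ((hfm.mul (hcm 2 r)).mono_measure (Measure.restrict_mono hsub le_rfl))
        (Filter.Eventually.of_forall fun x => ?_)
      rw [norm_mul, Real.norm_of_nonneg (cutoff_nonneg _ _)]
      exact mul_le_of_le_one_right (norm_nonneg _) (cutoff_le_one _ _)
    · exact mul_le_of_le_one_right (hf0 x (ball_subset_ball hR₁.le (hsub hx))) (cutoff_le_one _ _)
  have he1 : 1 ≤ Real.exp (5 * K * ρ) := Real.one_le_exp (by positivity)
  have he2 : Real.exp (5 * K * r) ≤ 2.7182818286 := by
    refine (Real.exp_le_exp.2 ?_).trans Real.exp_one_lt_d9.le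
    have : 5 * K * r ≤ 5 * K * R := by gcongr
    linarith
  have hI0 : 0 ≤ ∫ x in ball 0 r, f x := (hF0 r).trans hup
  calc ρ⁻¹ * ∫ x in ball 0 (ρ / 2), f x ≤ ρ⁻¹ * (16 / 9 * F ρ) := by
        gcongr; linarith
    _ = 16 / 9 * (F ρ * (1 / ρ)) := by ring
    _ ≤ 16 / 9 * (F ρ * (Real.exp (5 * K * ρ) / ρ)) := by
        have := hF0 ρ
        gcongr
    _ ≤ 16 / 9 * (F r * (Real.exp (5 * K * r) / r)) := by gcongr
    _ ≤ 16 / 9 * ((∫ x in ball 0 r, f x) * (2.7182818286 / r)) := by gcongr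
    _ ≤ 5 * (r⁻¹ * ∫ x in ball 0 r, f x) := by
        have : 0 ≤ r⁻¹ * ∫ x in ball 0 r, f x := by positivity
        have e : (∫ x in ball 0 r, f x) * (2.7182818286 / r)
            = 2.7182818286 * (r⁻¹ * ∫ x in ball 0 r, f x) := by
          rw [div_eq_mul_inv]; ring
        rw [e]
        linarith

/-! ### A gradient estimate for constant-coefficient Dirac systems -/

/-- The partial derivative `∂ᵢ ζ` of the bump function `ζ = (1 - |x|²)₊³`. -/
def bumpD (i : Fin 3) (x : E3) : ℝ := x i * (-(6 * cutoff 2 x))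

/-- The second partial derivative `∂ₖ ∂ᵢ ζ` of the bump function `ζ = (1 - |x|²)₊³`. -/
def bumpDD (i k : Fin 3) (x : E3) : ℝ :=
  (if i = k then -(6 * cutoff 2 x) else 0) + 24 * (x i * x k * cutoff 1 x)

lemma bumpDD_comm (i k : Fin 3) (x : E3) : bumpDD i k x = bumpDD k i x := by
  unfold bumpDD
  by_cases h : i = k
  · subst h; rfl
  · rw [if_neg h, if_neg (Ne.symm h), mul_comm (x i)]

lemma continuous_coord (a : Fin 3) : Continuous fun x : E3 => x a :=
  (EuclideanSpace.proj (𝕜 := ℝ) a : E3 →L[ℝ] ℝ).continuous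

@[fun_prop]
lemma continuous_bumpDD (i k : Fin 3) : Continuous (bumpDD i k) := by
  have := continuous_coord i
  have := continuous_coord k
  unfold bumpDD
  split_ifs <;> fun_prop

lemma contDiff_bumpD (i : Fin 3) : ContDiff ℝ 1 (bumpD i) :=
  (EuclideanSpace.proj (𝕜 := ℝ) i : E3 →L[ℝ] ℝ).contDiff.mul
    (contDiff_const.mul (contDiff_cutoff 0)).neg

lemma fderiv_bumpD (i k : Fin 3) (x : E3) : fderiv ℝ (bumpD i) x (stdE k) = bumpDD i k x := by
  have h1 : HasFDerivAt (fun x : E3 => x i) (EuclideanSpace.proj (𝕜 := ℝ) i) x :=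
    (EuclideanSpace.proj (𝕜 := ℝ) i : E3 →L[ℝ] ℝ).hasFDerivAt
  have h2 : HasFDerivAt (fun x : E3 => -(6 * cutoff 2 x)) _ x :=
    ((hasFDerivAt_cutoff 0 x).const_mul 6).fun_neg
  unfold bumpD bumpDD
  rw [(h1.fun_mul h2).fderiv]
  simp [EuclideanSpace.inner_single_right]
  split_ifs <;> ring

lemma bumpD_eq_zero (i : Fin 3) {x : E3} (hx : 1 ≤ ‖x‖) : bumpD i x = 0 := by
  unfold bumpD
  rw [cutoff_eq_zero two_ne_zero hx]; simp

lemma bumpDD_eq_zero (i k : Fin 3) {x : E3} (hx : 1 ≤ ‖x‖) : bumpDD i k x = 0 := by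
  unfold bumpDD
  rw [cutoff_eq_zero two_ne_zero hx, cutoff_eq_zero one_ne_zero hx]; simp

lemma abs_coord_le (x : E3) (a : Fin 3) : |x a| ≤ ‖x‖ := by
  have := PiLp.norm_apply_le x a
  rwa [Real.norm_eq_abs] at this

lemma abs_bumpDD_le (i k : Fin 3) (x : E3) : |bumpDD i k x| ≤ 30 := by
  rcases le_or_gt 1 ‖x‖ with hx | hx
  · rw [bumpDD_eq_zero i k hx]; norm_num
  have h1 : |x i * x k * cutoff 1 x| ≤ 1 := by
    rw [abs_mul, abs_mul, abs_of_nonneg (cutoff_nonneg 1 x)]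
    have hi := (abs_coord_le x i).trans hx.le
    have hk := (abs_coord_le x k).trans hx.le
    exact mul_le_one₀ (mul_le_one₀ hi (abs_nonneg _) hk) (cutoff_nonneg _ _) (cutoff_le_one _ _)
  have h2 : |(if i = k then -(6 * cutoff 2 x) else 0)| ≤ 6 := by
    split_ifs
    · rw [abs_neg, abs_of_nonneg (by have := cutoff_nonneg 2 x; positivity)]
      linarith [cutoff_le_one 2 x]
    · norm_num
  unfold bumpDD
  calc _ ≤ _ + |24 * (x i * x k * cutoff 1 x)| := abs_add_le _ _
    _ ≤ 6 + 24 * 1 := by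
        rw [abs_mul (24 : ℝ), abs_of_nonneg (by norm_num : (0 : ℝ) ≤ 24)]
        gcongr
    _ = 30 := by norm_num

lemma sum_coord_smul_stdE (x : E3) : ∑ j, x j • stdE j = x := by
  ext i
  fin_cases i <;> simp [Fin.sum_univ_three]

variable {F : Type*} [NormedAddCommGroup F] [NormedSpace ℝ F] [CompleteSpace F]

lemma contDiffOn_fderiv_apply {G : Type*} [NormedAddCommGroup G] [NormedSpace ℝ G] {w : E3 → G}
    {U : Set E3} (hU : IsOpen U) {m n : ℕ∞ω} (hmn : m + 1 ≤ n) (hw : ContDiffOn ℝ n w U) (v : E3) :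
    ContDiffOn ℝ m (fun x => fderiv ℝ w x v) U :=
  (hw.fderiv_of_isOpen hU hmn).clm_apply contDiffOn_const

/-- The integral of the radial derivative of `∂ₖ W` against a cut-off function is controlled by the
Dirac operator `∑ Jᵢ ∂ᵢ W`: it equals an integral of the Laplacian `-∑ Jᵢ Jⱼ ∂ᵢ ∂ⱼ W` against a bump
function, and all derivatives but those in the Dirac operator can be moved to the bump function. -/
lemma norm_integral_radial_le {R K K' : ℝ} (hR : 1 < R) (hK : 0 ≤ K)
    {J : Fin 3 → F →L[ℝ] F} (hJ : ∀ i, ‖J i‖ ≤ K) {W : E3 → F} (hW : ContDiffOn ℝ 2 W (ball 0 R))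
    (hcl : ∀ i j k, ∀ x ∈ ball (0 : E3) R, J i (J j (fderiv ℝ W x (stdE k))) +
      J j (J i (fderiv ℝ W x (stdE k))) = if i = j then (-2 : ℝ) • fderiv ℝ W x (stdE k) else 0)
    (hD : ∀ x ∈ ball (0 : E3) 1, ‖∑ i, J i (fderiv ℝ W x (stdE i))‖ ≤ K') (k : Fin 3) :
    ‖∫ y, cutoff 2 y • fderiv ℝ (fun x => fderiv ℝ W x (stdE k)) y y‖ ≤
      15 * K * K' * (volume (ball (0 : E3) 1)).toReal := by
  set d : Fin 3 → E3 → F := fun j x => fderiv ℝ W x (stdE j) with hd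
  have hd1 : ∀ j, ContDiffOn ℝ 1 (d j) (ball 0 R) := fun j =>
    contDiffOn_fderiv_apply isOpen_ball (by norm_num) hW _
  have hdc : ∀ j, ContinuousOn (d j) (ball 0 R) := fun j => (hd1 j).continuousOn
  have hddc : ∀ j l, ContinuousOn (fun x => fderiv ℝ (d j) x (stdE l)) (ball 0 R) := fun j l =>
    ((hd1 j).continuousOn_fderiv_of_isOpen isOpen_ball le_rfl).clm_apply continuousOn_const
  -- symmetry of second derivatives
  have hsymm : ∀ j l, ∀ x ∈ ball (0 : E3) R,
      fderiv ℝ (d j) x (stdE l) = fderiv ℝ (d l) x (stdE j) := by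
    intro j l x hx
    have hWx : ContDiffAt ℝ 2 W x := hW.contDiffAt (isOpen_ball.mem_nhds hx)
    have hs := hWx.isSymmSndFDerivAt (by simp)
    have hdiff : DifferentiableAt ℝ (fderiv ℝ W) x :=
      (hWx.fderiv_right (m := 1) (by norm_num)).differentiableAt one_ne_zero
    have h1 : ∀ j, fderiv ℝ (d j) x = (fderiv ℝ (fderiv ℝ W) x).flip (stdE j) := fun j => by
      ext v
      simp only [hd]
      rw [fderiv_clm_apply hdiff (differentiableAt_const _)]
      simp
    rw [h1, h1]
    exact hs _ _
  have hiM : ∀ i j, Integrable fun y => bumpDD i k y • d j y := fun i j =>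
    integrable_of_zero_outside hR (fun x hx => by rw [bumpDD_eq_zero _ _ hx, zero_smul])
      ((continuous_bumpDD i k).continuousOn.smul (hdc j))
  set M : Fin 3 → Fin 3 → F := fun i j => ∫ y, bumpDD i k y • d j y with hM
  have hMsymm : ∀ i j, M i j = M j i := by
    have key : ∀ i j, M i j = -∫ y, bumpD k y • fderiv ℝ (d j) y (stdE i) := by
      intro i j
      have := integral_cutoff_smul_fderiv hR (contDiff_bumpD k) (fun x hx => bumpD_eq_zero k hx)
        (hd1 j) (stdE i)
      rw [this, neg_neg]
      simp only [hM, fderiv_bumpD, bumpDD_comm i k]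
    intro i j
    rw [key, key]
    congr 1
    refine integral_congr_ae (Filter.Eventually.of_forall fun y => ?_)
    rcases lt_or_ge ‖y‖ R with hy | hy
    · simp only [hsymm j i y (mem_ball_zero_iff.2 hy)]
    · simp [bumpD_eq_zero k (hR.le.trans hy)]
  have hclM : ∀ i j, J i (J j (M i j)) + J j (J i (M i j)) =
      if i = j then (-2 : ℝ) • M i j else 0 := by
    intro i j
    have e : J i (J j (M i j)) + J j (J i (M i j)) =
        ((J i).comp (J j) + (J j).comp (J i)) (M i j) := by simp
    rw [e, hM]
    simp only
    rw [← ContinuousLinearMap.integral_comp_comm _ (hiM i j)]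
    have : ∀ y, ((J i).comp (J j) + (J j).comp (J i)) (bumpDD i k y • d j y) =
        if i = j then (-2 : ℝ) • (bumpDD i k y • d j y) else 0 := by
      intro y
      rcases lt_or_ge ‖y‖ R with hy | hy
      · have := hcl i j j y (mem_ball_zero_iff.2 hy)
        rw [map_smul, add_apply, ContinuousLinearMap.comp_apply,
          ContinuousLinearMap.comp_apply, this]
        split_ifs
        · rw [smul_comm]
        · rw [smul_zero]
      · simp [bumpDD_eq_zero _ _ (hR.le.trans hy)]
    simp only [this]
    split_ifs
    · rw [integral_smul]
    · simp
  have hdirac : ∑ i, J i (∫ y, bumpDD i k y • ∑ j, J j (d j y)) = -∑ i, M i i := by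
    have h1 : ∀ i, ∫ y, bumpDD i k y • ∑ j, J j (d j y) = ∑ j, J j (M i j) := by
      intro i
      simp only [Finset.smul_sum, ← map_smul]
      rw [integral_finsetSum _ fun j _ => (J j).integrable_comp (hiM i j)]
      exact Finset.sum_congr rfl fun j _ => (J j).integral_comp_comm (hiM i j)
    simp only [h1]
    simp only [Fin.sum_univ_three, map_add]
    have c := hclM
    have c00 := c 0 0; have c11 := c 1 1; have c22 := c 2 2
    have c01 := c 0 1; have c02 := c 0 2; have c12 := c 1 2
    simp only [if_true, Fin.reduceEq, if_false] at c00 c11 c22 c01 c02 c12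
    rw [hMsymm 1 0, hMsymm 2 0, hMsymm 2 1]
    have hh : ∀ a b : F, a + a = (-2 : ℝ) • b → a = -b := by
      intro a b h
      have h2 : (2 : ℝ) • a = (2 : ℝ) • (-b) := by rw [two_smul, h]; module
      exact smul_right_injective F (two_ne_zero' ℝ) h2
    have d0 := hh _ _ c00
    have d1 := hh _ _ c11
    have d2 := hh _ _ c22
    rw [d0, d1, d2]
    have s01 := eq_neg_of_add_eq_zero_left c01
    have s02 := eq_neg_of_add_eq_zero_left c02
    have s12 := eq_neg_of_add_eq_zero_left c12
    rw [s01, s02, s12]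
    abel
  have hmain : ∫ y, cutoff 2 y • fderiv ℝ (d k) y y = (1 / 6 : ℝ) • ∑ j, M j j := by
    have h1 : ∀ j, ∫ y, bumpD j y • fderiv ℝ (d k) y (stdE j) = -M j j := by
      intro j
      have := integral_cutoff_smul_fderiv hR (contDiff_bumpD j) (fun x hx => bumpD_eq_zero j hx)
        (hd1 j) (stdE k)
      simp only [fderiv_bumpD] at this
      rw [hM, ← this]
      refine integral_congr_ae (Filter.Eventually.of_forall fun y => ?_)
      rcases lt_or_ge ‖y‖ R with hy | hy
      · simp only [hsymm k j y (mem_ball_zero_iff.2 hy)]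
      · simp [bumpD_eq_zero j (hR.le.trans hy)]
    have h2 : ∀ y, cutoff 2 y • fderiv ℝ (d k) y y =
        (-(1 / 6) : ℝ) • ∑ j, bumpD j y • fderiv ℝ (d k) y (stdE j) := by
      intro y
      conv_lhs => rw [← sum_coord_smul_stdE y]
      rw [map_sum, Finset.smul_sum, Finset.smul_sum, sum_coord_smul_stdE]
      refine Finset.sum_congr rfl fun j _ => ?_
      rw [map_smul, smul_smul, smul_smul]
      unfold bumpD
      congr 1
      ring
    have hi : ∀ j, Integrable fun y => bumpD j y • fderiv ℝ (d k) y (stdE j) := fun j =>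
      integrable_of_zero_outside hR (fun x hx => by rw [bumpD_eq_zero _ hx, zero_smul])
        ((contDiff_bumpD j).continuous.continuousOn.smul (hddc k j))
    simp only [h2]
    rw [integral_smul, integral_finsetSum _ fun j _ => hi j]
    simp only [h1, Finset.sum_neg_distrib]
    module
  have hbound : ∀ i, ‖J i (∫ y, bumpDD i k y • ∑ j, J j (d j y))‖ ≤
      K * (30 * K' * (volume (ball (0 : E3) 1)).toReal) := by
    intro i
    refine ((J i).le_opNorm _).trans (mul_le_mul (hJ i) ?_ (norm_nonneg _) hK)
    have : ∫ y, bumpDD i k y • ∑ j, J j (d j y) =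
        ∫ y in ball (0 : E3) 1, bumpDD i k y • ∑ j, J j (d j y) := by
      symm
      refine setIntegral_eq_integral_of_forall_compl_eq_zero fun x hx => ?_
      rw [mem_ball_zero_iff, not_lt] at hx
      rw [bumpDD_eq_zero _ _ hx, zero_smul]
    rw [this]
    refine norm_setIntegral_le_of_norm_le_const measure_ball_lt_top fun x hx => ?_
    rw [norm_smul, Real.norm_eq_abs]
    exact mul_le_mul (abs_bumpDD_le _ _ _) (hD x hx) (norm_nonneg _) (by norm_num)
  rw [hmain, ← neg_neg (∑ j, M j j), ← hdirac, norm_smul, norm_neg]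
  refine (mul_le_mul_of_nonneg_left ((norm_sum_le _ _).trans
    (Finset.sum_le_sum fun i _ => hbound i)) (norm_nonneg _)).trans ?_
  simp only [Finset.sum_const, Finset.card_univ, Fintype.card_fin]
  norm_num
  apply le_of_eq
  ring

/-- A gradient bound at the centre of a ball, for solutions of `∑ Jᵢ ∂ᵢ w = O(|x|)` where the `Jᵢ`
are constant and satisfy the Clifford relations. -/
theorem exists_gradient_estimate {K : ℝ} (hK : 0 ≤ K) : ∃ C > 0, ∀ {R r K' : ℝ}, 0 < r → r < R →
    0 ≤ K' → ∀ {J : Fin 3 → F →L[ℝ] F}, (∀ i, ‖J i‖ ≤ K) → ∀ {w : E3 → F},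
    ContDiffOn ℝ 2 w (ball 0 R) →
    (∀ i j k, ∀ x ∈ ball (0 : E3) R, J i (J j (fderiv ℝ w x (stdE k))) +
      J j (J i (fderiv ℝ w x (stdE k))) = if i = j then (-2 : ℝ) • fderiv ℝ w x (stdE k) else 0) →
    (∀ x ∈ ball (0 : E3) R, ‖∑ i, J i (fderiv ℝ w x (stdE i))‖ ≤ K' * ‖x‖) → ∀ k,
    ‖fderiv ℝ w 0 (stdE k)‖ ≤
      C * (r⁻¹ ^ 3 * ∫ x in ball 0 r, ‖fderiv ℝ w x (stdE k)‖) + C * (K' * r) := by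
  set v : ℝ := (volume (ball (0 : E3) 1)).toReal with hv
  set c : ℝ := ∫ y : E3, cutoff 2 y with hc
  have hc0 : 0 < c := by
    refine (continuous_cutoff 2).integral_pos_of_hasCompactSupport_nonneg_nonzero ?_
      (fun x => cutoff_nonneg 2 x) (x := 0) ?_
    · refine HasCompactSupport.of_support_subset_isCompact (isCompact_closedBall (0 : E3) 1) ?_
      exact (subset_tsupport _).trans
        (tsupport_subset_closedBall fun x hx => cutoff_eq_zero two_ne_zero hx)
    · simp [cutoff]
  have hv0 : 0 ≤ v := ENNReal.toReal_nonneg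
  refine ⟨c⁻¹ * (1 + 15 * K * v), by positivity, ?_⟩
  intro R r K' hr hrR hK' J hJ w hw hcl hD k
  set g : E3 → F := fun x => fderiv ℝ w x (stdE k) with hg
  have hg1 : ContDiffOn ℝ 1 g (ball 0 R) :=
    contDiffOn_fderiv_apply isOpen_ball (by norm_num) hw _
  have hgd : ContinuousOn (fderiv ℝ g) (ball 0 R) :=
    hg1.continuousOn_fderiv_of_isOpen isOpen_ball le_rfl
  obtain ⟨R₁, hrR₁, hR₁⟩ := exists_between hrR
  obtain ⟨L, hL⟩ := (isCompact_closedBall (0 : E3) R₁).exists_bound_of_continuousOn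
    (hgd.mono (closedBall_subset_ball hR₁))
  set a : ℝ → F := fun ρ => ∫ y in ball (0 : E3) 1, cutoff 2 y • g (ρ • y) with ha
  set a' : ℝ → F := fun ρ => ∫ y in ball (0 : E3) 1, cutoff 2 y • fderiv ℝ g (ρ • y) y with ha'
  have hmem : ∀ ρ : ℝ, |ρ| < R₁ → ∀ y ∈ ball (0 : E3) 1, ρ • y ∈ ball (0 : E3) R₁ := by
    intro ρ hρ y hy
    rw [mem_ball_zero_iff] at hy ⊢
    rw [norm_smul, Real.norm_eq_abs]
    exact (mul_le_of_le_one_right (abs_nonneg _) hy.le).trans_lt hρ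
  have hmem' : ∀ ρ : ℝ, |ρ| < R₁ → MapsTo (fun y : E3 => ρ • y) (ball (0 : E3) 1) (ball 0 R) :=
    fun ρ hρ y hy => ball_subset_ball hR₁.le (hmem ρ hρ y hy)
  have hgm : ∀ ρ : ℝ, |ρ| < R₁ → ContinuousOn (fun y : E3 => cutoff 2 y • g (ρ • y)) (ball 0 1) :=
    fun ρ hρ => (continuous_cutoff 2).continuousOn.smul
      (hg1.continuousOn.comp (continuous_const_smul ρ).continuousOn (hmem' ρ hρ))
  have hderiv : ∀ ρ : ℝ, |ρ| < R₁ → HasDerivAt a (a' ρ) ρ := by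
    intro ρ hρ
    refine (hasDerivAt_integral_of_dominated_loc_of_deriv_le (s := {ρ : ℝ | |ρ| < R₁})
      (F := fun ρ y => cutoff 2 y • g (ρ • y))
      (F' := fun ρ y => cutoff 2 y • fderiv ℝ g (ρ • y) y)
      (bound := fun _ => L) ((isOpen_lt continuous_abs continuous_const).mem_nhds hρ)
      ?_ ?_ ?_ ?_ ?_ ?_).2
    · filter_upwards [(isOpen_lt continuous_abs continuous_const).mem_nhds hρ] with σ hσ
      exact (hgm σ hσ).aestronglyMeasurable measurableSet_ball
    · obtain ⟨L', hL'⟩ := (isCompact_closedBall (0 : E3) R₁).exists_bound_of_continuousOn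
        (hg1.continuousOn.mono (closedBall_subset_ball hR₁))
      refine Integrable.mono' (g := fun _ => L') (integrableOn_const measure_ball_lt_top.ne) ?_ ?_
      · exact (hgm ρ hρ).aestronglyMeasurable measurableSet_ball
      · refine (ae_restrict_iff' measurableSet_ball).2 (Filter.Eventually.of_forall fun y hy => ?_)
        rw [norm_smul, Real.norm_of_nonneg (cutoff_nonneg _ _)]
        exact (mul_le_of_le_one_left (norm_nonneg _) (cutoff_le_one _ _)).trans
          (hL' _ (ball_subset_closedBall (hmem ρ hρ y hy)))
    · refine ContinuousOn.aestronglyMeasurable ?_ measurableSet_ball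
      exact (continuous_cutoff 2).continuousOn.smul
        ((hgd.comp (continuous_const_smul ρ).continuousOn (hmem' ρ hρ)).clm_apply continuousOn_id)
    · refine (ae_restrict_iff' measurableSet_ball).2
        (Filter.Eventually.of_forall fun y hy σ hσ => ?_)
      rw [norm_smul, Real.norm_of_nonneg (cutoff_nonneg _ _)]
      refine (mul_le_of_le_one_left (norm_nonneg _) (cutoff_le_one _ _)).trans ?_
      refine (ContinuousLinearMap.le_opNorm _ _).trans ?_
      refine (mul_le_of_le_one_right (norm_nonneg _) (mem_ball_zero_iff.1 hy).le).trans ?_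
      exact hL _ (ball_subset_closedBall (hmem σ hσ y hy))
    · exact integrableOn_const measure_ball_lt_top.ne
    · refine (ae_restrict_iff' measurableSet_ball).2
        (Filter.Eventually.of_forall fun y hy σ hσ => ?_)
      have h1 : HasFDerivAt g (fderiv ℝ g (σ • y)) (σ • y) :=
        ((hg1.contDiffAt (isOpen_ball.mem_nhds (hmem' σ hσ hy))).differentiableAt
          one_ne_zero).hasFDerivAt
      have h2 : HasDerivAt (fun σ : ℝ => σ • y) y σ := by
        simpa using (hasDerivAt_id σ).smul_const y
      have h3 : HasDerivAt (fun σ : ℝ => g (σ • y)) (fderiv ℝ g (σ • y) y) σ :=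
        HasFDerivAt.comp_hasDerivAt (l := g) (f := fun σ : ℝ => σ • y) σ h1 h2
      exact h3.const_smul (cutoff 2 y)
  have hbound : ∀ ρ : ℝ, 0 < ρ → ρ < R₁ → ‖a' ρ‖ ≤ 15 * K * K' * v := by
    intro ρ hρ hρR
    -- rescale to the unit ball
    set W : E3 → F := fun y => ρ⁻¹ • w (ρ • y) with hW
    have hRρ : 1 < R / ρ := by rw [one_lt_div hρ]; linarith
    have hmaps : MapsTo (fun y : E3 => ρ • y) (ball (0 : E3) (R / ρ)) (ball 0 R) := by
      intro y hy
      rw [mem_ball_zero_iff] at hy ⊢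
      rw [norm_smul, Real.norm_of_nonneg hρ.le]
      rwa [lt_div_iff₀' hρ] at hy
    have hWs : ContDiffOn ℝ 2 W (ball 0 (R / ρ)) :=
      contDiffOn_const.smul (hw.comp (contDiff_const_smul ρ).contDiffOn hmaps)
    have hWd : ∀ y ∈ ball (0 : E3) (R / ρ), fderiv ℝ W y = fderiv ℝ w (ρ • y) := by
      intro y hy
      have h1 : HasFDerivAt w (fderiv ℝ w (ρ • y)) (ρ • y) :=
        ((hw.contDiffAt (isOpen_ball.mem_nhds (hmaps hy))).differentiableAt (by simp)).hasFDerivAt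
      have h2 : HasFDerivAt (fun y : E3 => ρ • y) (ρ • ContinuousLinearMap.id ℝ E3) y :=
        (hasFDerivAt_id y).fun_const_smul _
      have h3 : HasFDerivAt W _ y := (h1.comp y h2).const_smul ρ⁻¹
      rw [h3.fderiv]
      ext v
      simp [smul_smul, inv_mul_cancel₀ hρ.ne']
    have hkey := norm_integral_radial_le (J := J) (W := W) (K' := K' * ρ) hRρ hK hJ hWs
      (fun i j k y hy => by rw [hWd y hy]; exact hcl i j k _ (hmaps hy))
      (fun y hy => by
        have hy' : y ∈ ball (0 : E3) (R / ρ) := ball_subset_ball hRρ.le hy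
        rw [hWd y hy']
        refine (hD _ (hmaps hy')).trans ?_
        rw [norm_smul, Real.norm_of_nonneg hρ.le, ← mul_assoc]
        exact mul_le_of_le_one_right (by positivity) (mem_ball_zero_iff.1 hy).le) k
    have heq : ∫ y, cutoff 2 y • fderiv ℝ (fun x => fderiv ℝ W x (stdE k)) y y = ρ • a' ρ := by
      rw [ha', ← integral_smul, ← setIntegral_eq_integral_of_forall_compl_eq_zero
        (s := ball (0 : E3) 1)]
      · refine setIntegral_congr_fun measurableSet_ball fun y hy => ?_
        have hy' : y ∈ ball (0 : E3) (R / ρ) := ball_subset_ball hRρ.le hy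
        have he : (fun x => fderiv ℝ W x (stdE k)) =ᶠ[nhds y] fun x => g (ρ • x) := by
          filter_upwards [isOpen_ball.mem_nhds hy'] with z hz
          rw [hWd z hz]
        have h1 : HasFDerivAt g (fderiv ℝ g (ρ • y)) (ρ • y) :=
          ((hg1.contDiffAt (isOpen_ball.mem_nhds (hmaps hy'))).differentiableAt
            one_ne_zero).hasFDerivAt
        have h2 : HasFDerivAt (fun y : E3 => ρ • y) (ρ • ContinuousLinearMap.id ℝ E3) y :=
          (hasFDerivAt_id y).fun_const_smul _
        have h3 : HasFDerivAt (fun x => g (ρ • x)) _ y := h1.comp y h2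
        simp only [he.fderiv_eq, h3.fderiv]
        simp only [ContinuousLinearMap.comp_apply, smul_apply,
          ContinuousLinearMap.id_apply, map_smul]
        rw [smul_comm]
      · intro y hy
        rw [mem_ball_zero_iff, not_lt] at hy
        rw [cutoff_eq_zero two_ne_zero hy, zero_smul]
    rw [heq, norm_smul, Real.norm_of_nonneg hρ.le] at hkey
    have : ρ * ‖a' ρ‖ ≤ ρ * (15 * K * K' * v) := hkey.trans (le_of_eq (by ring))
    exact le_of_mul_le_mul_left this hρ
  have hcont : ContinuousOn a (Icc 0 r) := fun ρ hρ =>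
    (hderiv ρ (by rw [abs_of_nonneg hρ.1]; linarith [hρ.2])).continuousAt.continuousWithinAt
  have hdiff : ‖a r - a 0‖ ≤ 15 * K * K' * v * r := by
    have h1 : ∀ ε ∈ Ioc 0 r, ‖a r - a ε‖ ≤ 15 * K * K' * v * r := by
      intro ε hε
      have := norm_image_sub_le_of_norm_deriv_le_segment' (f := a) (f' := a') (a := ε) (b := r)
        (C := 15 * K * K' * v)
        (fun ρ hρ => (hderiv ρ (by
          rw [abs_of_nonneg (hε.1.le.trans hρ.1)]; linarith [hρ.2])).hasDerivWithinAt)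
        (fun ρ hρ => hbound ρ (hε.1.trans_le hρ.1) (by linarith [hρ.2])) r ⟨hε.2, le_rfl⟩
      refine this.trans ?_
      have := hε.1
      gcongr
      linarith
    have h2 : Filter.Tendsto (fun ε => ‖a r - a ε‖) (nhdsWithin 0 (Ioc 0 r)) (nhds ‖a r - a 0‖) := by
      refine (tendsto_const_nhds.sub ?_).norm
      exact (hcont 0 ⟨le_rfl, hr.le⟩).mono_left (nhdsWithin_mono _ Ioc_subset_Icc_self)
    have : (nhdsWithin (0 : ℝ) (Ioc 0 r)).NeBot := by
      rw [nhdsWithin_Ioc_eq_nhdsGT hr]; infer_instance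
    exact le_of_tendsto h2 (eventually_mem_nhdsWithin.mono h1)
  have ha0 : a 0 = c • g 0 := by
    simp only [ha, zero_smul]
    rw [integral_smul_const, hc, setIntegral_eq_integral_of_forall_compl_eq_zero]
    intro x hx
    rw [mem_ball_zero_iff, not_lt] at hx
    exact cutoff_eq_zero two_ne_zero hx
  have har : ‖a r‖ ≤ r⁻¹ ^ 3 * ∫ x in ball 0 r, ‖g x‖ := by
    have hrR₁' : |r| < R₁ := by rwa [abs_of_pos hr]
    have hsc : ∫ y in ball (0 : E3) 1, ‖g (r • y)‖ = r⁻¹ ^ 3 * ∫ x in ball 0 r, ‖g x‖ := by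
      have := Measure.setIntegral_comp_smul_of_pos (volume : Measure E3) (fun x => ‖g x‖)
        (ball (0 : E3) 1) hr
      rw [this, finrank_euclideanSpace_fin, smul_eq_mul, smul_unitBall_of_pos hr, inv_pow]
    rw [← hsc]
    refine (norm_integral_le_integral_norm _).trans ?_
    have hgi : IntegrableOn (fun y : E3 => ‖g (r • y)‖) (ball 0 1) := by
      have hcb : ContinuousOn (fun y : E3 => ‖g (r • y)‖) (closedBall 0 1) := by
        refine (hg1.continuousOn.comp (continuous_const_smul r).continuousOn ?_).norm
        intro y hy
        rw [mem_closedBall_zero_iff] at hy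
        show r • y ∈ ball (0 : E3) R
        rw [mem_ball_zero_iff, norm_smul, Real.norm_of_nonneg hr.le]
        exact (mul_le_of_le_one_right hr.le hy).trans_lt hrR
      exact (hcb.integrableOn_compact (isCompact_closedBall _ _)).mono_set ball_subset_closedBall
    refine setIntegral_mono_on ?_ hgi measurableSet_ball fun y _ => ?_
    · refine Integrable.mono' hgi ((hgm r hrR₁').aestronglyMeasurable measurableSet_ball).norm ?_
      refine Filter.Eventually.of_forall fun y => ?_
      rw [norm_norm, norm_smul, Real.norm_of_nonneg (cutoff_nonneg _ _)]
      exact mul_le_of_le_one_left (norm_nonneg _) (cutoff_le_one _ _)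
    · rw [norm_smul, Real.norm_of_nonneg (cutoff_nonneg _ _)]
      exact mul_le_of_le_one_left (norm_nonneg _) (cutoff_le_one _ _)
  have hI : 0 ≤ r⁻¹ ^ 3 * ∫ x in ball 0 r, ‖g x‖ := (norm_nonneg _).trans har
  have hfin : c * ‖g 0‖ ≤ r⁻¹ ^ 3 * (∫ x in ball 0 r, ‖g x‖) + 15 * K * v * (K' * r) := by
    have : c * ‖g 0‖ = ‖a 0‖ := by rw [ha0, norm_smul, Real.norm_of_nonneg hc0.le]
    rw [this]
    have h1 : ‖a 0‖ ≤ ‖a r‖ + ‖a r - a 0‖ := by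
      have := norm_sub_le (a r) (a r - a 0)
      simpa using this
    calc ‖a 0‖ ≤ _ := h1
      _ ≤ _ := add_le_add har (hdiff.trans (le_of_eq (by ring)))
  have hkr : 0 ≤ K' * r := by positivity
  have hKv : 0 ≤ K * v := by positivity
  calc ‖g 0‖ = c⁻¹ * (c * ‖g 0‖) := by field_simp
    _ ≤ c⁻¹ * ((1 + 15 * K * v) * (r⁻¹ ^ 3 * ∫ x in ball 0 r, ‖g x‖) +
        (1 + 15 * K * v) * (K' * r)) := by
        refine mul_le_mul_of_nonneg_left (hfin.trans (add_le_add ?_ ?_)) (by positivity)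
        · exact le_mul_of_one_le_left hI (by linarith)
        · exact mul_le_mul_of_nonneg_right (by linarith) hkr
    _ = _ := by ring

/-! ### The Heinz trick -/

/-- The Heinz trick: if the renormalised integrals of `f` over all small balls are controlled by
the one over `B_{2R}(y)`, the latter is small, and a mean value inequality holds on every ball of
radius `ρ` with `ρ² f(z) ≤ δ²` on which `f ≤ 4 f(z)`, then `f(y)` is controlled by the mean of
`f`. -/
theorem heinz_trick {f : E3 → ℝ} {y : E3} {R A B δ θ I : ℝ} (hR : 0 < R) (hB : 0 ≤ B)
    (hδ : 0 < δ) (hθ : 0 < θ) (hθ1 : θ ≤ 1) (hf : ContinuousOn f (closedBall y R))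
    (hf0 : ∀ x ∈ closedBall y R, 0 < f x)
    (hM : ∀ z ∈ ball y R, ∀ ρ, 0 < ρ → ρ ≤ θ * R → ρ⁻¹ * ∫ x in ball z ρ, f x ≤ A * I)
    (hH : ∀ z ∈ ball y R, ∀ ρ, 0 < ρ → ball z ρ ⊆ ball y R → (∀ x ∈ ball z ρ, f x ≤ 4 * f z) →
      ρ ^ 2 * f z ≤ δ ^ 2 → f z ≤ B * (ρ⁻¹ ^ 3 * ∫ x in ball z ρ, f x))
    (hI : B * (A * I) < δ ^ 2) :
    R ^ 2 * f y ≤ 4 * (B * (A * I)) / θ ^ 2 := by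
  -- at a maximum `z` of `(R - |z - y|)² f(z)`, one has `f ≤ 4 f(z)` in the ball of radius `s`, half
  -- the distance of `z` to the boundary
  obtain ⟨z, hz, hmax⟩ := (isCompact_closedBall y R).exists_isMaxOn ⟨y, mem_closedBall_self hR.le⟩
    (f := fun z => (R - dist z y) ^ 2 * f z)
    (((continuous_const.sub (continuous_id.dist continuous_const)).pow 2).continuousOn.mul hf)
  have hy : R ^ 2 * f y ≤ (R - dist z y) ^ 2 * f z := by
    have := hmax (mem_closedBall_self hR.le : y ∈ closedBall y R)
    simpa using this
  have hy0 : 0 < f y := hf0 y (mem_closedBall_self hR.le)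
  have hfz : 0 < f z := hf0 z hz
  have hzR : dist z y < R := by
    refine lt_of_le_of_ne hz fun h => ?_
    rw [h, sub_self] at hy
    have : 0 < R ^ 2 * f y := by positivity
    linarith
  set s := (R - dist z y) / 2 with hs
  have hs0 : 0 < s := by rw [hs]; linarith
  have hsR : s ≤ R := by rw [hs]; linarith [dist_nonneg (x := z) (y := y)]
  have hsub : ball z s ⊆ ball y R := by
    intro x hx
    rw [mem_ball] at hx ⊢
    linarith [dist_triangle x z y]
  have h4 : ∀ x ∈ ball z s, f x ≤ 4 * f z := by
    intro x hx
    have h1 := hmax (ball_subset_closedBall (hsub hx))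
    simp only [mem_ofPred_eq] at h1
    have h2 : s ≤ R - dist x y := by
      rw [mem_ball] at hx
      linarith [dist_triangle x z y]
    have h3 : s ^ 2 * f x ≤ s ^ 2 * (4 * f z) := by
      calc s ^ 2 * f x ≤ (R - dist x y) ^ 2 * f x := by
            have := (hf0 x (ball_subset_closedBall (hsub hx))).le
            gcongr
        _ ≤ (R - dist z y) ^ 2 * f z := h1
        _ = s ^ 2 * (4 * f z) := by rw [hs]; ring
    exact le_of_mul_le_mul_left h3 (by positivity)
  have key : ∀ ρ, 0 < ρ → ρ ≤ θ * s → ρ ^ 2 * f z ≤ δ ^ 2 → ρ ^ 2 * f z ≤ B * (A * I) := by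
    intro ρ hρ hρs hρf
    have hρs' : ρ ≤ s := hρs.trans (mul_le_of_le_one_left hs0.le hθ1)
    have h1 := hH z hzR ρ hρ ((ball_subset_ball hρs').trans hsub)
      (fun x hx => h4 x (ball_subset_ball hρs' hx)) hρf
    have h2 := hM z hzR ρ hρ (hρs.trans (by gcongr))
    calc ρ ^ 2 * f z ≤ ρ ^ 2 * (B * (ρ⁻¹ ^ 3 * ∫ x in ball z ρ, f x)) := by gcongr
      _ = B * (ρ⁻¹ * ∫ x in ball z ρ, f x) := by field_simp
      _ ≤ B * (A * I) := by gcongr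
  -- a radius `ρ ≤ θ s` with `ρ² f(z) = δ²` is excluded by the smallness of `I`, so that the mean
  -- value inequality applies with the radius `θ s`
  have hlt : θ * s < δ / Real.sqrt (f z) := by
    by_contra! hcon
    have h1 : (δ / Real.sqrt (f z)) ^ 2 * f z = δ ^ 2 := by
      rw [div_pow, Real.sq_sqrt hfz.le]; field_simp
    have := key _ (div_pos hδ (Real.sqrt_pos.2 hfz)) hcon h1.le
    linarith
  have hle : (θ * s) ^ 2 * f z ≤ δ ^ 2 := by
    have h1 : θ * s * Real.sqrt (f z) ≤ δ := ((lt_div_iff₀ (Real.sqrt_pos.2 hfz)).1 hlt).le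
    calc (θ * s) ^ 2 * f z = (θ * s * Real.sqrt (f z)) ^ 2 := by
          rw [mul_pow _ (Real.sqrt _), Real.sq_sqrt hfz.le]
      _ ≤ δ ^ 2 := by gcongr
  have hfin := key _ (by positivity) le_rfl hle
  rw [le_div_iff₀ (by positivity)]
  calc R ^ 2 * f y * θ ^ 2 ≤ (R - dist z y) ^ 2 * f z * θ ^ 2 := by gcongr
    _ = 4 * ((θ * s) ^ 2 * f z) := by rw [hs]; ring
    _ ≤ _ := by gcongr

/-! ### Affine changes of coordinates -/

lemma setIntegral_comp_affine {g : E3 → ℝ} (L : E3 ≃L[ℝ] E3) (z : E3) {s : Set E3}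
    (hs : MeasurableSet s) :
    ∫ x in (fun y => z + L y) '' s, g x =
      |(L : E3 →L[ℝ] E3).det| * ∫ y in s, g (z + L y) := by
  rw [integral_image_eq_integral_abs_det_fderiv_smul volume hs
    (f' := fun _ => (L : E3 →L[ℝ] E3)) ?_ ?_, ← integral_const_mul]
  · rfl
  · intro x _
    exact ((L : E3 →L[ℝ] E3).hasFDerivAt.const_add z).hasFDerivWithinAt
  · intro x _ y _ h
    exact L.injective (add_left_cancel h)

lemma abs_det_le {M : ℝ} (hM : 0 < M) (L : E3 →L[ℝ] E3) (h : ∀ y, ‖L y‖ ≤ M * ‖y‖) :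
    |L.det| ≤ M ^ 3 := by
  have h1 := Measure.addHaar_image_continuousLinearMap (volume : Measure E3) L (ball 0 1)
  have h2 : L '' ball 0 1 ⊆ ball 0 M := by
    rintro _ ⟨y, hy, rfl⟩
    rw [mem_ball_zero_iff] at hy ⊢
    exact (h y).trans_lt (by nlinarith)
  have h3 := (h1.symm.trans_le (measure_mono h2))
  rw [Measure.addHaar_ball _ _ hM.le, finrank_euclideanSpace_fin] at h3
  have h4 := (ENNReal.mul_le_mul_iff_left (measure_ball_pos volume (0 : E3) one_pos).ne'
    measure_ball_lt_top.ne).1 h3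
  exact (ENNReal.ofReal_le_ofReal_iff (by positivity)).1 h4

/-- Integrals over balls before and after an affine change of coordinates with distortion `M`. -/
lemma setIntegral_ball_comp_affine_le {g : E3 → ℝ} (L : E3 ≃L[ℝ] E3) {z : E3} {M ρ : ℝ}
    (hM : 0 < M) (h : ∀ y, ‖L y‖ ≤ M * ‖y‖) (h' : ∀ y, ‖y‖ ≤ M * ‖L y‖)
    (hg0 : ∀ x ∈ ball z (M * ρ), 0 ≤ g x) (hg : IntegrableOn g (ball z (M * ρ))) :
    ∫ y in ball 0 ρ, g (z + L y) ≤ M ^ 3 * ∫ x in ball z (M * ρ), g x := by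
  have h1 := setIntegral_comp_affine (g := g) L z (measurableSet_ball (x := (0 : E3)) (ε := ρ))
  have hsub : (fun y => z + L y) '' ball 0 ρ ⊆ ball z (M * ρ) := by
    rintro _ ⟨y, hy, rfl⟩
    rw [mem_ball_zero_iff] at hy
    rw [mem_ball, dist_eq_norm, add_sub_cancel_left]
    exact (h y).trans_lt (by gcongr)
  have hdet : |(L.symm : E3 →L[ℝ] E3).det| ≤ M ^ 3 :=
    abs_det_le hM _ fun y => by simpa using h' (L.symm y)
  have hprod : |(L.symm : E3 →L[ℝ] E3).det| * |(L : E3 →L[ℝ] E3).det| = 1 := by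
    rw [← abs_mul]
    have : (L.symm : E3 →L[ℝ] E3).det * (L : E3 →L[ℝ] E3).det = 1 := by
      rw [ContinuousLinearMap.det, ContinuousLinearMap.det, ← LinearMap.det_comp]
      have : ((L.symm : E3 →L[ℝ] E3) : E3 →ₗ[ℝ] E3) ∘ₗ ((L : E3 →L[ℝ] E3) : E3 →ₗ[ℝ] E3)
          = LinearMap.id := by
        ext y; simp
      rw [this, LinearMap.det_id]
    rw [this, abs_one]
  calc ∫ y in ball 0 ρ, g (z + L y)
      = |(L.symm : E3 →L[ℝ] E3).det| * ∫ x in (fun y => z + L y) '' ball 0 ρ, g x := by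
        rw [h1, ← mul_assoc, hprod, one_mul]
    _ ≤ M ^ 3 * ∫ x in ball z (M * ρ), g x := by
        refine mul_le_mul hdet ?_ ?_ (by positivity)
        · refine setIntegral_mono_set hg ?_ hsub.eventuallyLE
          exact (ae_restrict_iff' measurableSet_ball).2 (Filter.Eventually.of_forall hg0)
        · have hm : MeasurableSet ((fun y => z + L y) '' ball 0 ρ) := by
            have : IsOpen ((fun y => z + L y) '' ball 0 ρ) :=
              (L.toHomeomorph.trans (Homeomorph.addLeft z)).isOpenMap _ isOpen_ball
            exact this.measurableSet
          exact setIntegral_nonneg hm fun x hx => hg0 x (hsub hx)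

/-! ### The stress tensor of a Clifford triple -/

section Clifford

variable {F : Type*} [NormedAddCommGroup F] [NormedSpace ℝ F]

/-- Data at one point: a symmetric form `h` and three skew endomorphisms satisfying the Clifford
relations for the Gram matrix `G`, on a subspace `V`. -/
structure CliffordTriple (V : Submodule ℝ F) (h : F →L[ℝ] F →L[ℝ] ℝ) (c : Fin 3 → F →L[ℝ] F)
    (G : Fin 3 → Fin 3 → ℝ) : Prop where
  symm : ∀ v ∈ V, ∀ w ∈ V, h v w = h w v
  mem : ∀ i, ∀ v ∈ V, c i v ∈ V
  skew : ∀ i, ∀ v ∈ V, ∀ w ∈ V, h (c i v) w = -h v (c i w)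
  clifford : ∀ i j, ∀ v ∈ V, c i (c j v) + c j (c i v) = (-2 * G i j) • v

variable {V : Submodule ℝ F} {h : F →L[ℝ] F →L[ℝ] ℝ} {c : Fin 3 → F →L[ℝ] F}
  {G : Fin 3 → Fin 3 → ℝ}

namespace CliffordTriple

lemma inner_same (H : CliffordTriple V h c G) (i j : Fin 3) {v w : F} (hv : v ∈ V) (hw : w ∈ V) :
    h (c i v) (c j w) + h (c j v) (c i w) = 2 * G i j * h v w := by
  rw [H.skew i v hv _ (H.mem j w hw), H.skew j v hv _ (H.mem i w hw)]
  have := congrArg (h v) (H.clifford i j w hw)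
  rw [map_add, map_smul, smul_eq_mul] at this
  linarith

lemma commutator_eq (H : CliffordTriple V h c G) (i j : Fin 3) {v w : F} (hv : v ∈ V)
    (hw : w ∈ V) :
    h v (c i (c j w) - c j (c i w)) = 2 * h (c j v) (c i w) - 2 * G i j * h v w := by
  rw [H.skew j v hv _ (H.mem i w hw)]
  have := congrArg (h v) (H.clifford i j w hw)
  rw [map_add, map_smul, smul_eq_mul] at this
  rw [map_sub]
  linarith

/-- For `r = ∑ cᵢ Nᵢ`, the diagonal components of the stress tensor. -/
lemma stress_diag (H : CliffordTriple V h c G) {N : Fin 3 → F} (hN : ∀ i, N i ∈ V) {i j k : Fin 3}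
    {r : F} (hr : c i (N i) + c j (N j) + c k (N k) = r) :
    h (N j) (c j (c k (N k)) - c k (c j (N k))) =
      G j j * h (N j) (N j) + G k k * h (N k) (N k) - G i i * h (N i) (N i)
        + 2 * G j k * h (N j) (N k) - 2 * h r (c j (N j) + c k (N k)) + h r r := by
  have e1 := H.commutator_eq j k (hN j) (hN k)
  have e2 := H.inner_same j k (hN j) (hN k)
  have ei := H.inner_same i i (hN i) (hN i)
  have ej := H.inner_same j j (hN j) (hN j)
  have ek := H.inner_same k k (hN k) (hN k)
  have sjk := H.symm _ (H.mem j _ (hN j)) _ (H.mem k _ (hN k))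
  have sij := H.symm _ (H.mem i _ (hN i)) _ (H.mem j _ (hN j))
  have sik := H.symm _ (H.mem i _ (hN i)) _ (H.mem k _ (hN k))
  subst hr
  simp only [map_add, add_apply]
  linarith

/-- For `r = ∑ cᵢ Nᵢ`, the components of the stress tensor next to the diagonal. -/
lemma stress_off (H : CliffordTriple V h c G) {N : Fin 3 → F} (hN : ∀ i, N i ∈ V) {i j k : Fin 3}
    {r : F} (hr : c i (N i) + c j (N j) + c k (N k) = r) :
    h (N k) (c j (c k (N i)) - c k (c j (N i))) =
      2 * h r (c j (N i)) - 2 * G i j * h (N i) (N i) - 2 * G j j * h (N i) (N j)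
        - 2 * G j k * h (N i) (N k) := by
  have e1 := H.commutator_eq j k (hN k) (hN i)
  have e2 := H.inner_same i j (hN i) (hN i)
  have e3 := H.inner_same j j (hN j) (hN i)
  have s1 := H.symm _ (H.mem i _ (hN i)) _ (H.mem j _ (hN i))
  have s2 := H.symm _ (hN i) _ (hN j)
  have s3 := H.symm _ (hN i) _ (hN k)
  subst hr
  simp only [map_add, add_apply]
  rw [e1, s2, s3]
  linarith

/-- For `r = ∑ cᵢ Nᵢ`, the remaining components of the stress tensor. -/
lemma stress_off' (H : CliffordTriple V h c G) {N : Fin 3 → F} (hN : ∀ i, N i ∈ V)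
    {i j k : Fin 3} {r : F} (hr : c i (N i) + c j (N j) + c k (N k) = r) :
    h (N i) (c j (c k (N j)) - c k (c j (N j))) =
      2 * h (c k (N i)) r - 2 * G i k * h (N i) (N i) - 2 * G k k * h (N i) (N k)
        - 2 * G j k * h (N i) (N j) := by
  have e1 := H.commutator_eq j k (hN i) (hN j)
  have e2 := H.inner_same i k (hN i) (hN i)
  have e3 := H.inner_same k k (hN i) (hN k)
  have s1 := H.symm _ (H.mem i _ (hN i)) _ (H.mem k _ (hN i))
  subst hr
  simp only [map_add]
  rw [e1]
  linarith

lemma abs_form_le {K : ℝ} (hK : ‖h‖ ≤ K) (v w : F) : |h v w| ≤ K * (‖v‖ * ‖w‖) := by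
  have := h.le_opNorm₂ v w
  rw [Real.norm_eq_abs] at this
  calc _ ≤ _ := this
    _ = ‖h‖ * (‖v‖ * ‖w‖) := by ring
    _ ≤ _ := by gcongr

/-- The stress tensor `δₐₖ ∑ |Nᵢ|² - 2 ⟨Nₐ, Nₖ⟩` of a nearly Clifford-harmonic triple `N` is nearly
given by the commutators of the `cᵢ`. Indices are read modulo `3`. -/
lemma stress_approx (H : CliffordTriple V h c G) {N : Fin 3 → F} (hN : ∀ i, N i ∈ V) {K t s : ℝ}
    (hK : 0 ≤ K) (ht : 0 ≤ t) (ht1 : t ≤ 1) (hs : 0 ≤ s) (hh : ‖h‖ ≤ K) (hc : ∀ i, ‖c i‖ ≤ K)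
    (hG : ∀ i j, |G i j - if i = j then 1 else 0| ≤ t) (hNs : ∀ i, ‖N i‖ ≤ s)
    (hr : ‖∑ i, c i (N i)‖ ≤ t * s) (a k : Fin 3) :
    |h (N (k + 1)) (c (a + 1) (c (a + 2) (N (k + 2))) - c (a + 2) (c (a + 1) (N (k + 2)))) -
      ((if a = k then ∑ i, h (N i) (N i) else 0) - 2 * h (N a) (N k))| ≤
      (6 * K + 4 * K ^ 2) * (t * s ^ 2) := by
  set r := ∑ i, c i (N i) with hrdef
  have hr3 : c a (N a) + c (a + 1) (N (a + 1)) + c (a + 2) (N (a + 2)) = r := by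
    rw [hrdef, Fin.sum_univ_three]
    fin_cases a <;> simp <;> abel
  have hsum : ∑ i, h (N i) (N i) =
      h (N a) (N a) + h (N (a + 1)) (N (a + 1)) + h (N (a + 2)) (N (a + 2)) := by
    rw [Fin.sum_univ_three]
    fin_cases a <;> simp <;> ring
  have hNN : ∀ i j, |h (N i) (N j)| ≤ K * s ^ 2 := fun i j =>
    (abs_form_le hh _ _).trans (by rw [sq]; gcongr <;> exact hNs _)
  have hcN : ∀ i j, ‖c i (N j)‖ ≤ K * s := fun i j =>
    ((c i).le_opNorm _).trans (mul_le_mul (hc i) (hNs j) (norm_nonneg _) hK)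
  have hrc : ∀ i j, |h r (c i (N j))| ≤ K ^ 2 * (t * s ^ 2) := fun i j =>
    (abs_form_le hh _ _).trans (by
      calc K * (‖r‖ * ‖c i (N j)‖) ≤ K * ((t * s) * (K * s)) := by gcongr; exact hcN i j
        _ = _ := by ring)
  have hcr : ∀ i j, |h (c i (N j)) r| ≤ K ^ 2 * (t * s ^ 2) := fun i j =>
    (abs_form_le hh _ _).trans (by
      calc K * (‖c i (N j)‖ * ‖r‖) ≤ K * ((K * s) * (t * s)) := by gcongr; exact hcN i j
        _ = _ := by ring)
  have hrr : |h r r| ≤ K * (t * s ^ 2) := (abs_form_le hh _ _).trans (by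
    calc K * (‖r‖ * ‖r‖) ≤ K * ((t * s) * (t * s)) := by gcongr
      _ = K * (t * s ^ 2) * t := by ring
      _ ≤ K * (t * s ^ 2) * 1 := by gcongr
      _ = _ := mul_one _)
  have hGN : ∀ i j p q, |(G i j - if i = j then 1 else 0) * h (N p) (N q)| ≤ K * (t * s ^ 2) :=
    fun i j p q => by
      rw [abs_mul]
      calc _ ≤ t * (K * s ^ 2) := mul_le_mul (hG i j) (hNN p q) (abs_nonneg _) ht
        _ = _ := by ring
  have hk := (by decide : ∀ a k : Fin 3, k = a ∨ k = a + 1 ∨ k = a + 2) a k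
  have a1 := (by decide : ∀ a : Fin 3, a ≠ a + 1) a
  have a2 := (by decide : ∀ a : Fin 3, a ≠ a + 2) a
  have a12 := (by decide : ∀ a : Fin 3, a + 1 ≠ a + 2) a
  have hX : 0 ≤ K * (t * s ^ 2) := by positivity
  have hY : 0 ≤ K ^ 2 * (t * s ^ 2) := by positivity
  rcases hk with rfl | rfl | rfl
  · rw [if_pos rfl, hsum, H.stress_diag hN hr3]
    have g0 := hGN k k k k
    have g1 := hGN (k + 1) (k + 1) (k + 1) (k + 1)
    have g2 := hGN (k + 2) (k + 2) (k + 2) (k + 2)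
    have g12 := hGN (k + 1) (k + 2) (k + 1) (k + 2)
    rw [if_pos rfl] at g0 g1 g2
    rw [if_neg a12] at g12
    have r1 := hrc (k + 1) (k + 1)
    have r2 := hrc (k + 2) (k + 2)
    rw [map_add]
    rw [abs_le] at *
    constructor <;> linarith [g0.1, g0.2, g1.1, g1.2, g2.1, g2.2, g12.1, g12.2, r1.1, r1.2, r2.1,
      r2.2, hrr.1, hrr.2]
  · have e1 := (by decide : ∀ a : Fin 3, a + 1 + 1 = a + 2) a
    have e2 := (by decide : ∀ a : Fin 3, a + 1 + 2 = a) a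
    rw [if_neg a1, e1, e2, H.stress_off hN hr3]
    have g0 := hGN a (a + 1) a a
    have g1 := hGN (a + 1) (a + 1) a (a + 1)
    have g12 := hGN (a + 1) (a + 2) a (a + 2)
    rw [if_pos rfl] at g1
    rw [if_neg a1] at g0
    rw [if_neg a12] at g12
    have r1 := hrc (a + 1) a
    rw [abs_le] at *
    constructor <;> linarith [g0.1, g0.2, g1.1, g1.2, g12.1, g12.2, r1.1, r1.2]
  · have e1 := (by decide : ∀ a : Fin 3, a + 2 + 1 = a) a
    have e2 := (by decide : ∀ a : Fin 3, a + 2 + 2 = a + 1) a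
    rw [if_neg a2, e1, e2, H.stress_off' hN hr3]
    have g0 := hGN a (a + 2) a a
    have g1 := hGN (a + 2) (a + 2) a (a + 2)
    have g12 := hGN (a + 1) (a + 2) a (a + 1)
    rw [if_pos rfl] at g1
    rw [if_neg a2] at g0
    rw [if_neg a12] at g12
    have r1 := hcr (a + 2) a
    rw [abs_le] at *
    constructor <;> linarith [g0.1, g0.2, g1.1, g1.2, g12.1, g12.2, r1.1, r1.2]

end CliffordTriple

end Clifford

/-! ### Sections in local coordinates -/

section Local

variable {F : Type*} [NormedAddCommGroup F] [NormedSpace ℝ F]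

/-- A shortcut, which keeps instance search for spaces of bilinear forms fast. -/
instance instNormedAddCommGroupForm : NormedAddCommGroup (F →L[ℝ] F →L[ℝ] ℝ) :=
  ContinuousLinearMap.toNormedAddCommGroup

/-- A shortcut, which keeps instance search for spaces of bilinear forms fast. -/
instance instNormedSpaceForm : NormedSpace ℝ (F →L[ℝ] F →L[ℝ] ℝ) :=
  ContinuousLinearMap.toNormedSpace

lemma one_add_one_le_infty : (1 : WithTop ℕ∞) + 1 ≤ ∞ := by
  show (((1 + 1 : ℕ∞)) : WithTop ℕ∞) ≤ ((⊤ : ℕ∞) : WithTop ℕ∞)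
  exact WithTop.coe_le_coe.2 le_top

lemma two_le_infty : (2 : WithTop ℕ∞) ≤ ∞ := by
  rw [← one_add_one_eq_two]; exact one_add_one_le_infty

/-- The commutator form `Ω(ξ, η) = ⟨P ξ, [c, c'] P η⟩`. -/
def commForm (h : F →L[ℝ] F →L[ℝ] ℝ) (P c c' : F →L[ℝ] F) : F →L[ℝ] F →L[ℝ] ℝ :=
  h.bilinearComp P ((c.comp c' - c'.comp c).comp P)

@[simp]
lemma commForm_apply (h : F →L[ℝ] F →L[ℝ] ℝ) (P c c' : F →L[ℝ] F) (ξ η : F) :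
    commForm h P c c' ξ η = h (P ξ) (c (c' (P η)) - c' (c (P η))) := rfl

/-- The bundle in local coordinates: `F` is the coordinate space of the total space, `prj` the
projection in coordinates, `P` a projection onto the vertical directions `ker d(prj)`, `h` the fibre
metric and `c i` the action of the `i`-th coordinate field of the base. The base has metric
coefficients `G` with inverse `Ginv`. All data are bounded by `K`. -/
structure LocalModel (F : Type*) [NormedAddCommGroup F] [NormedSpace ℝ F]
    (G Ginv : Fin 3 → Fin 3 → E3 → ℝ) (K : ℝ) where
  /-- the coordinate domain -/
  W : Set F
  /-- the bundle projection -/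
  prj : F → E3
  /-- the projection onto the vertical directions -/
  P : F → F →L[ℝ] F
  /-- the metric of the fibres -/
  h : F → F →L[ℝ] F →L[ℝ] ℝ
  /-- the action of the coordinate fields of the base -/
  c : Fin 3 → F → F →L[ℝ] F
  isOpen_W : IsOpen W
  contDiffOn_prj : ContDiffOn ℝ ∞ prj W
  contDiffOn_P : ContDiffOn ℝ ∞ P W
  contDiffOn_h : ContDiffOn ℝ ∞ h W
  contDiffOn_c : ∀ i, ContDiffOn ℝ ∞ (c i) W
  vert_P : ∀ e ∈ W, ∀ ξ, fderiv ℝ prj e (P e ξ) = 0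
  P_vert : ∀ e ∈ W, ∀ ξ, fderiv ℝ prj e ξ = 0 → P e ξ = ξ
  /-- the Clifford relations on the vertical vectors -/
  triple : ∀ e ∈ W, CliffordTriple (LinearMap.ker (fderiv ℝ prj e).toLinearMap) (h e)
    (fun i => c i e) (fun i j => G i j (prj e))
  /-- the fibre metric is uniformly positive -/
  sq_norm_le : ∀ e ∈ W, ∀ ξ, fderiv ℝ prj e ξ = 0 → ‖ξ‖ ^ 2 ≤ K * h e ξ ξ
  norm_horizontal_le : ∀ e ∈ W, ∀ ξ, ‖ξ - P e ξ‖ ≤ K * ‖fderiv ℝ prj e ξ‖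
  norm_h_le : ∀ e ∈ W, ‖h e‖ ≤ K
  norm_c_le : ∀ i, ∀ e ∈ W, ‖c i e‖ ≤ K
  norm_P_le : ∀ e ∈ W, ‖P e‖ ≤ K
  lipschitz : ∀ i, ∀ e ∈ W, ∀ e' ∈ W,
    ‖(c i e).comp (P e) - (c i e').comp (P e')‖ ≤ K * ‖e - e'‖
  norm_fderiv_comm_le : ∀ i j, ∀ e ∈ W,
    ‖fderiv ℝ (fun e => commForm (h e) (P e) (c i e) (c j e)) e‖ ≤ K
  /-- the commutator forms are closed on the fibres -/
  closed : ∀ i j, ∀ e ∈ W, ∀ ξ₀ ξ₁ ξ₂, fderiv ℝ prj e ξ₀ = 0 → fderiv ℝ prj e ξ₁ = 0 →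
    fderiv ℝ prj e ξ₂ = 0 →
    fderiv ℝ (fun e => commForm (h e) (P e) (c i e) (c j e)) e ξ₀ ξ₁ ξ₂ +
    fderiv ℝ (fun e => commForm (h e) (P e) (c i e) (c j e)) e ξ₁ ξ₂ ξ₀ +
    fderiv ℝ (fun e => commForm (h e) (P e) (c i e) (c j e)) e ξ₂ ξ₀ ξ₁ = 0

/-- The action of the vector `a` of the base, for the given actions of the coordinate fields. -/
def action (c : Fin 3 → F →L[ℝ] F) (a : E3) : F →L[ℝ] F := ∑ i, a i • c i

lemma norm_action_le {c : Fin 3 → F →L[ℝ] F} {K : ℝ} (hc : ∀ i, ‖c i‖ ≤ K)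
    (a : E3) : ‖action c a‖ ≤ 3 * K * ‖a‖ := by
  unfold action
  refine (norm_sum_le _ _).trans ?_
  calc ∑ i, ‖a i • c i‖ ≤ ∑ _i : Fin 3, ‖a‖ * K := by
        refine Finset.sum_le_sum fun i _ => ?_
        rw [norm_smul, Real.norm_eq_abs]
        exact mul_le_mul (abs_coord_le a i) (hc i) (norm_nonneg _) (norm_nonneg _)
    _ = 3 * K * ‖a‖ := by simp; ring

/-- Passing to another frame of the base. -/
lemma CliffordTriple.change_frame {V : Submodule ℝ F} {h : F →L[ℝ] F →L[ℝ] ℝ}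
    {c : Fin 3 → F →L[ℝ] F} {G : Fin 3 → Fin 3 → ℝ} (H : CliffordTriple V h c G)
    (A : Fin 3 → E3) :
    CliffordTriple V h (fun i => action c (A i))
      (fun i j => ∑ k, ∑ l, G k l * (A i k * A j l)) where
  symm := H.symm
  mem i v hv := by
    simp only [action, sum_apply, smul_apply]
    exact V.sum_mem fun k _ => V.smul_mem _ (H.mem k v hv)
  skew i v hv w hw := by
    have h0 := H.skew 0 v hv w hw
    have h1 := H.skew 1 v hv w hw
    have h2 := H.skew 2 v hv w hw
    simp only [action, Fin.sum_univ_three, add_apply, smul_apply, map_add, map_smul, smul_eq_mul,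
      h0, h1, h2]
    ring
  clifford i j v hv := by
    have key : ∀ k l, (A i k * A j l) • (c k (c l v) + c l (c k v)) =
        (A i k * A j l * (-2 * G k l)) • v := fun k l => by rw [H.clifford k l v hv, smul_smul]
    have e : action c (A i) (action c (A j) v) + action c (A j) (action c (A i) v) =
        ∑ k, ∑ l, (A i k * A j l) • (c k (c l v) + c l (c k v)) := by
      simp only [action, Fin.sum_univ_three, add_apply, smul_apply, map_add, map_smul]
      module
    rw [e]
    simp only [key, ← Finset.sum_smul]
    congr 1
    simp only [Fin.sum_univ_three]
    ring

variable {G Ginv : Fin 3 → Fin 3 → E3 → ℝ} {K : ℝ}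

namespace LocalModel

/-- `û` represents, over the open set `U` of the base, a section solving the Dirac-type equation
`∑ g^{kl} c_k ∇_l û = 0`. -/
structure IsSection (m : LocalModel F G Ginv K) (U : Set E3) (û : E3 → F) : Prop where
  isOpen : IsOpen U
  contDiffOn : ContDiffOn ℝ ∞ û U
  mapsTo : MapsTo û U m.W
  proj : ∀ x ∈ U, m.prj (û x) = x
  dirac : ∀ x ∈ U, ∑ k, ∑ l,
    Ginv k l x • m.c k (û x) (m.P (û x) (fderiv ℝ û x (stdE l))) = 0

/-- The covariant derivative of a section. -/
def cov (m : LocalModel F G Ginv K) (û : E3 → F) (x : E3) : E3 →L[ℝ] F :=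
  (m.P (û x)).comp (fderiv ℝ û x)

/-- The form `⟨∇_v û, ∇_w û⟩`. -/
def energyForm (m : LocalModel F G Ginv K) (û : E3 → F) (x v w : E3) : ℝ :=
  m.h (û x) (m.cov û x v) (m.cov û x w)

/-- The form `⟨∇_v û, [c(a), c(b)] ∇_w û⟩`. -/
def stressForm (m : LocalModel F G Ginv K) (û : E3 → F) (x a b v w : E3) : ℝ :=
  commForm (m.h (û x)) (m.P (û x)) (action (fun i => m.c i (û x)) a)
    (action (fun i => m.c i (û x)) b) (fderiv ℝ û x v) (fderiv ℝ û x w)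

variable {m : LocalModel F G Ginv K} {U : Set E3} {û : E3 → F} {x : E3}

lemma IsSection.contDiffAt (hs : m.IsSection U û) (hx : x ∈ U) : ContDiffAt ℝ ∞ û x :=
  hs.contDiffOn.contDiffAt (hs.isOpen.mem_nhds hx)

lemma IsSection.differentiableAt (hs : m.IsSection U û) (hx : x ∈ U) : DifferentiableAt ℝ û x :=
  (hs.contDiffAt hx).differentiableAt (by simp)

lemma IsSection.fderiv_proj (hs : m.IsSection U û) (hx : x ∈ U) (v : E3) :
    fderiv ℝ m.prj (û x) (fderiv ℝ û x v) = v := by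
  have h1 : DifferentiableAt ℝ m.prj (û x) :=
    (m.contDiffOn_prj.contDiffAt (m.isOpen_W.mem_nhds (hs.mapsTo hx))).differentiableAt (by simp)
  have h2 : (fun y => m.prj (û y)) =ᶠ[nhds x] fun y => y :=
    Filter.eventuallyEq_of_mem (hs.isOpen.mem_nhds hx) hs.proj
  have h3 := (h1.hasFDerivAt.comp x (hs.differentiableAt hx).hasFDerivAt).fderiv
  rw [show m.prj ∘ û = fun y => m.prj (û y) from rfl, h2.fderiv_eq, fderiv_fun_id] at h3
  exact (DFunLike.congr_fun h3 v).symm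

lemma cov_vert (hs : m.IsSection U û) (hx : x ∈ U) (v : E3) :
    fderiv ℝ m.prj (û x) (m.cov û x v) = 0 := m.vert_P _ (hs.mapsTo hx) _

lemma energyForm_nonneg (hK : 0 < K) (hs : m.IsSection U û) (hx : x ∈ U) (v : E3) :
    0 ≤ m.energyForm û x v v := by
  have := m.sq_norm_le _ (hs.mapsTo hx) _ (cov_vert hs hx v)
  have h2 : 0 ≤ K * m.h (û x) (m.cov û x v) (m.cov û x v) := (sq_nonneg _).trans this
  exact nonneg_of_mul_nonneg_right h2 hK

lemma coord_sum (f : E3 →L[ℝ] F) (v : E3) : f v = ∑ i, v i • f (stdE i) := by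
  conv_lhs => rw [← sum_coord_smul_stdE v]
  simp

lemma norm_le_of_basis {f : E3 →L[ℝ] F} {L : ℝ} (h : ∀ i, ‖f (stdE i)‖ ≤ L) (v : E3) :
    ‖f v‖ ≤ 3 * L * ‖v‖ := by
  rw [coord_sum f v]
  refine (norm_sum_le _ _).trans ?_
  calc ∑ i, ‖v i • f (stdE i)‖ ≤ ∑ _i : Fin 3, ‖v‖ * L := by
        refine Finset.sum_le_sum fun i _ => ?_
        rw [norm_smul, Real.norm_eq_abs]
        exact mul_le_mul (abs_coord_le v i) (h i) (norm_nonneg _) (norm_nonneg _)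
    _ = 3 * L * ‖v‖ := by simp; ring

lemma norm_cov_le (hK : 1 ≤ K) (hs : m.IsSection U û) (hx : x ∈ U) {f : ℝ}
    (hf : f = 1 + ∑ k, m.energyForm û x (stdE k) (stdE k)) (v : E3) :
    ‖m.cov û x v‖ ≤ 3 * K * Real.sqrt f * ‖v‖ := by
  have hK0 : 0 < K := by linarith
  have hnn := fun v => energyForm_nonneg hK0 hs hx v
  have hle : ∀ k, ‖m.cov û x (stdE k)‖ ≤ K * Real.sqrt f := by
    intro k
    have h1 := m.sq_norm_le _ (hs.mapsTo hx) _ (cov_vert hs hx (stdE k))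
    have h2 : m.energyForm û x (stdE k) (stdE k) ≤ f := by
      have := Finset.single_le_sum (f := fun k => m.energyForm û x (stdE k) (stdE k))
        (fun i _ => hnn (stdE i)) (Finset.mem_univ k)
      rw [hf]; linarith
    have hf0 : 0 ≤ f := (hnn _).trans h2
    refine abs_le_of_sq_le_sq' ?_ (by positivity) |>.2
    rw [mul_pow, Real.sq_sqrt hf0]
    calc ‖m.cov û x (stdE k)‖ ^ 2 ≤ K * m.energyForm û x (stdE k) (stdE k) := h1
      _ ≤ K * f := by gcongr
      _ ≤ K ^ 2 * f := by gcongr; nlinarith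
  refine (norm_le_of_basis hle v).trans (le_of_eq (by ring))

lemma one_le_density (hK : 0 < K) (hs : m.IsSection U û) (hx : x ∈ U) :
    1 ≤ 1 + ∑ k, m.energyForm û x (stdE k) (stdE k) := by
  have := Finset.sum_nonneg fun k (_ : k ∈ Finset.univ) =>
    energyForm_nonneg hK hs hx (stdE k)
  linarith

lemma norm_horizontal_le' (hs : m.IsSection U û) (hx : x ∈ U) (v : E3) :
    ‖fderiv ℝ û x v - m.cov û x v‖ ≤ K * ‖v‖ := by
  have := m.norm_horizontal_le _ (hs.mapsTo hx) (fderiv ℝ û x v)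
  rwa [hs.fderiv_proj hx] at this

lemma norm_fderiv_le (hK : 1 ≤ K) (hs : m.IsSection U û) (hx : x ∈ U) {f : ℝ}
    (hf : f = 1 + ∑ k, m.energyForm û x (stdE k) (stdE k)) (v : E3) :
    ‖fderiv ℝ û x v‖ ≤ 4 * K * Real.sqrt f * ‖v‖ := by
  have h1 := norm_cov_le hK hs hx hf v
  have h2 := norm_horizontal_le' hs hx v
  have hf1 : 1 ≤ Real.sqrt f := by
    rw [hf, Real.one_le_sqrt]
    exact one_le_density (by linarith) hs hx
  have h3 : K * ‖v‖ ≤ K * Real.sqrt f * ‖v‖ := by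
    have := mul_le_mul_of_nonneg_left hf1 (show 0 ≤ K * ‖v‖ by positivity)
    linarith
  calc ‖fderiv ℝ û x v‖ = ‖(fderiv ℝ û x v - m.cov û x v) + m.cov û x v‖ := by simp
    _ ≤ _ := norm_add_le _ _
    _ ≤ 4 * K * Real.sqrt f * ‖v‖ := by linarith

/-- The commutator form of two vectors of the base, as a field of forms. -/
lemma commForm_action (m : LocalModel F G Ginv K) (a b : E3) (e : F) :
    commForm (m.h e) (m.P e) (action (fun i => m.c i e) a) (action (fun i => m.c i e) b) =
      ∑ i, ∑ j, (a i * b j) • commForm (m.h e) (m.P e) (m.c i e) (m.c j e) := by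
  ext ξ η
  simp only [commForm_apply, action, Fin.sum_univ_three, add_apply, smul_apply, map_add, map_smul,
    smul_eq_mul, map_sub]
  ring

lemma contDiffOn_comm (m : LocalModel F G Ginv K) (i j : Fin 3) :
    ContDiffOn ℝ ∞ (fun e => commForm (m.h e) (m.P e) (m.c i e) (m.c j e)) m.W := by
  have hM : ContDiffOn ℝ ∞
      (fun e => ((m.c i e).comp (m.c j e) - (m.c j e).comp (m.c i e)).comp (m.P e)) m.W :=
    (((m.contDiffOn_c i).clm_comp (m.contDiffOn_c j)).sub
      ((m.contDiffOn_c j).clm_comp (m.contDiffOn_c i))).clm_comp m.contDiffOn_P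
  have h1 : ContDiffOn ℝ ∞ (fun e => (m.h e).comp (m.P e)) m.W :=
    m.contDiffOn_h.clm_comp m.contDiffOn_P
  have h2 : ContDiffOn ℝ ∞ (fun e => ((m.h e).comp (m.P e)).flip) m.W :=
    (ContinuousLinearMap.flipₗᵢ ℝ F F ℝ).contDiff.comp_contDiffOn h1
  have h3 := h2.clm_comp hM
  have h4 : ContDiffOn ℝ ∞ (fun e => ((((m.h e).comp (m.P e)).flip).comp
      (((m.c i e).comp (m.c j e) - (m.c j e).comp (m.c i e)).comp (m.P e))).flip) m.W :=
    (ContinuousLinearMap.flipₗᵢ ℝ F F ℝ).contDiff.comp_contDiffOn h3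
  refine h4.congr fun e _ => ?_
  ext ξ η
  simp

lemma contDiffAt_energyForm (hs : m.IsSection U û) (hx : x ∈ U) (v w : E3) :
    ContDiffAt ℝ 1 (fun y => m.energyForm û y v w) x := by
  have hW := m.isOpen_W.mem_nhds (hs.mapsTo hx)
  have hu : ContDiffAt ℝ 1 û x := (hs.contDiffAt hx).of_le (by simp)
  have hdu : ContDiffAt ℝ 1 (fderiv ℝ û) x := (hs.contDiffAt hx).fderiv_right one_add_one_le_infty
  have hh := (((m.contDiffOn_h.contDiffAt hW).of_le (m := 1) (by simp)).comp x hu)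
  have hP := (((m.contDiffOn_P.contDiffAt hW).of_le (m := 1) (by simp)).comp x hu)
  have hc : ContDiffAt ℝ 1 (m.cov û) x := hP.clm_comp hdu
  exact (hh.clm_apply (hc.clm_apply contDiffAt_const)).clm_apply (hc.clm_apply contDiffAt_const)

lemma contDiffAt_comm_action (m : LocalModel F G Ginv K) (a b : E3) {e : F} (he : e ∈ m.W) :
    ContDiffAt ℝ 1 (fun e => commForm (m.h e) (m.P e) (action (fun i => m.c i e) a)
      (action (fun i => m.c i e) b)) e := by
  simp only [commForm_action]
  refine ContDiffAt.sum fun i _ => ContDiffAt.sum fun j _ => ContDiffAt.fun_smul contDiffAt_const ?_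
  exact ((m.contDiffOn_comm i j).contDiffAt (m.isOpen_W.mem_nhds he)).of_le (by simp)

lemma contDiffAt_stressForm (hs : m.IsSection U û) (hx : x ∈ U) (a b v w : E3) :
    ContDiffAt ℝ 1 (fun y => m.stressForm û y a b v w) x := by
  have hu : ContDiffAt ℝ 1 û x := (hs.contDiffAt hx).of_le (by simp)
  have hdu : ContDiffAt ℝ 1 (fderiv ℝ û) x := (hs.contDiffAt hx).fderiv_right one_add_one_le_infty
  have hΩ := (m.contDiffAt_comm_action a b (hs.mapsTo hx)).comp x hu
  exact (hΩ.clm_apply (hdu.clm_apply contDiffAt_const)).clm_apply (hdu.clm_apply contDiffAt_const)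

/-- The exterior derivative of a pulled back `2`-form: second derivatives cancel. -/
lemma fderiv_pullback_cyclic {Ω : F → F →L[ℝ] F →L[ℝ] ℝ} (hΩ : DifferentiableAt ℝ Ω (û x))
    (hanti : ∀ ξ η, Ω (û x) ξ η = -Ω (û x) η ξ) (hu : ContDiffAt ℝ 2 û x) (v : Fin 3 → E3) :
    ∑ k, fderiv ℝ (fun y => Ω (û y) (fderiv ℝ û y (v (k + 1))) (fderiv ℝ û y (v (k + 2)))) x (v k) =
    ∑ k, fderiv ℝ Ω (û x) (fderiv ℝ û x (v k)) (fderiv ℝ û x (v (k + 1)))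
      (fderiv ℝ û x (v (k + 2))) := by
  have hdu : DifferentiableAt ℝ (fderiv ℝ û) x :=
    (hu.fderiv_right (m := 1) (by norm_num)).differentiableAt one_ne_zero
  have hud : DifferentiableAt ℝ û x := hu.differentiableAt (by simp)
  have hd : ∀ p q r : E3, fderiv ℝ (fun y => Ω (û y) (fderiv ℝ û y p) (fderiv ℝ û y q)) x r =
      fderiv ℝ Ω (û x) (fderiv ℝ û x r) (fderiv ℝ û x p) (fderiv ℝ û x q) +
      Ω (û x) (fderiv ℝ (fderiv ℝ û) x r p) (fderiv ℝ û x q) +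
      Ω (û x) (fderiv ℝ û x p) (fderiv ℝ (fderiv ℝ û) x r q) := by
    intro p q r
    have h1 : HasFDerivAt (fun y => Ω (û y)) ((fderiv ℝ Ω (û x)).comp (fderiv ℝ û x)) x :=
      hΩ.hasFDerivAt.comp x hud.hasFDerivAt
    have h2 := fun p : E3 => hdu.hasFDerivAt.clm_apply (hasFDerivAt_const p x)
    rw [((h1.clm_apply (h2 p)).clm_apply (h2 q)).fderiv]
    simp
    ring
  have hsymm : ∀ p q, fderiv ℝ (fderiv ℝ û) x p q = fderiv ℝ (fderiv ℝ û) x q p :=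
    fun p q => hu.isSymmSndFDerivAt (by simp) p q
  simp only [Fin.sum_univ_three, hd]
  simp only [Fin.isValue, Fin.reduceAdd, zero_add]
  have a1 := hanti (fderiv ℝ (fderiv ℝ û) x (v 0) (v 1)) (fderiv ℝ û x (v 2))
  have a2 := hanti (fderiv ℝ (fderiv ℝ û) x (v 0) (v 2)) (fderiv ℝ û x (v 1))
  have a3 := hanti (fderiv ℝ (fderiv ℝ û) x (v 1) (v 2)) (fderiv ℝ û x (v 0))
  rw [hsymm (v 1) (v 0), hsymm (v 2) (v 0), hsymm (v 2) (v 1)]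
  linarith

set_option synthInstance.maxHeartbeats 400000 in
set_option maxHeartbeats 1000000 in
/-- The exterior derivative of the pulled back commutator form is bounded by the density: the form
is closed on vertical vectors, so that at least one argument of each term of the expansion is
horizontal, hence bounded. -/
lemma abs_divergence_le (hK : 1 ≤ K) (hs : m.IsSection U û) (hx : x ∈ U) {f : ℝ}
    (hf : f = 1 + ∑ k, m.energyForm û x (stdE k) (stdE k)) (a b : E3) {v : Fin 3 → E3} {M : ℝ}
    (hv : ∀ k, ‖v k‖ ≤ M) :
    |∑ k, fderiv ℝ (fun y => m.stressForm û y a b (v (k + 1)) (v (k + 2))) x (v k)| ≤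
      5184 * K ^ 4 * (‖a‖ * ‖b‖) * M ^ 3 * f := by
  have hK0 : 0 < K := by linarith
  have hM : 0 ≤ M := (norm_nonneg _).trans (hv 0)
  set e := û x with he
  have heW : e ∈ m.W := hs.mapsTo hx
  set Ω : F → F →L[ℝ] F →L[ℝ] ℝ := fun e => commForm (m.h e) (m.P e)
    (action (fun i => m.c i e) a) (action (fun i => m.c i e) b) with hΩ
  have hΩd : DifferentiableAt ℝ Ω e := (m.contDiffAt_comm_action a b heW).differentiableAt
    one_ne_zero
  have hker : ∀ ξ, m.P e ξ ∈ LinearMap.ker (fderiv ℝ m.prj e).toLinearMap := fun ξ => m.vert_P e heW ξ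
  have H := (m.triple e heW).change_frame ![a, b, 0]
  have hanti : ∀ ξ η, Ω e ξ η = -Ω e η ξ := by
    intro ξ η
    have c1 := H.commutator_eq 0 1 (hker ξ) (hker η)
    have c2 := H.commutator_eq 0 1 (hker η) (hker ξ)
    have s1 := H.symm _ (hker ξ) _ (hker η)
    have s2 := H.symm _ (H.mem 1 _ (hker ξ)) _ (H.mem 0 _ (hker η))
    have s3 := H.inner_same 0 1 (hker η) (hker ξ)
    simp only [Matrix.cons_val_zero, Matrix.cons_val_one] at c1 c2 s2 s3
    simp only [hΩ, commForm_apply]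
    rw [c1, c2]
    rw [s2, s1]
    linarith
  have hpull := fderiv_pullback_cyclic hΩd hanti ((hs.contDiffAt hx).of_le two_le_infty) v
  have hst : ∀ p q : E3, (fun y => m.stressForm û y a b p q) =
      fun y => Ω (û y) (fderiv ℝ û y p) (fderiv ℝ û y q) := fun p q => rfl
  simp only [hst]
  rw [hpull]
  have hcomm : ∀ i j, DifferentiableAt ℝ
      (fun e => commForm (m.h e) (m.P e) (m.c i e) (m.c j e)) e := fun i j =>
    ((m.contDiffOn_comm i j).contDiffAt (m.isOpen_W.mem_nhds heW)).differentiableAt (by simp)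
  have hDΩ : fderiv ℝ Ω e = ∑ i, ∑ j, (a i * b j) •
      fderiv ℝ (fun e => commForm (m.h e) (m.P e) (m.c i e) (m.c j e)) e := by
    have : Ω = fun e => ∑ i, ∑ j, (a i * b j) • commForm (m.h e) (m.P e) (m.c i e) (m.c j e) :=
      funext fun e => m.commForm_action a b e
    rw [this]
    exact (HasFDerivAt.fun_sum fun i _ => HasFDerivAt.fun_sum fun j _ =>
      (hcomm i j).hasFDerivAt.fun_const_smul _).fderiv
  set T : F → F → F → ℝ := fun ξ η ζ => fderiv ℝ Ω e ξ η ζ + fderiv ℝ Ω e η ζ ξ +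
    fderiv ℝ Ω e ζ ξ η with hT
  have hTv : ∀ ξ η ζ, fderiv ℝ m.prj e ξ = 0 → fderiv ℝ m.prj e η = 0 → fderiv ℝ m.prj e ζ = 0 →
      T ξ η ζ = 0 := by
    intro ξ η ζ h1 h2 h3
    have hij := fun i j => m.closed i j e heW ξ η ζ h1 h2 h3
    simp only [hT, hDΩ, sum_apply, smul_apply, smul_eq_mul, ← Finset.sum_add_distrib]
    refine Finset.sum_eq_zero fun i _ => Finset.sum_eq_zero fun j _ => ?_
    rw [← mul_add, ← mul_add, hij i j, mul_zero]
  have hDn : ‖fderiv ℝ Ω e‖ ≤ 9 * K * (‖a‖ * ‖b‖) := by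
    rw [hDΩ]
    refine (norm_sum_le _ _).trans ?_
    have : ∀ i ∈ (Finset.univ : Finset (Fin 3)), ‖∑ j, (a i * b j) •
        fderiv ℝ (fun e => commForm (m.h e) (m.P e) (m.c i e) (m.c j e)) e‖ ≤
        ∑ _j : Fin 3, ‖a‖ * ‖b‖ * K := fun i _ => by
      refine (norm_sum_le _ _).trans (Finset.sum_le_sum fun j _ => ?_)
      rw [norm_smul, Real.norm_eq_abs, abs_mul]
      have := m.norm_fderiv_comm_le i j e heW
      gcongr
      · exact abs_coord_le a i
      · exact abs_coord_le b j
    refine (Finset.sum_le_sum this).trans (le_of_eq ?_)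
    simp; ring
  have hTb : ∀ ξ η ζ, |T ξ η ζ| ≤ 27 * K * (‖a‖ * ‖b‖) * (‖ξ‖ * ‖η‖ * ‖ζ‖) := by
    have h1 : ∀ ξ η ζ, |fderiv ℝ Ω e ξ η ζ| ≤ 9 * K * (‖a‖ * ‖b‖) * (‖ξ‖ * ‖η‖ * ‖ζ‖) := by
      intro ξ η ζ
      have h2 := (fderiv ℝ Ω e ξ).le_opNorm₂ η ζ
      rw [Real.norm_eq_abs] at h2
      calc _ ≤ _ := h2
        _ ≤ (‖fderiv ℝ Ω e‖ * ‖ξ‖) * ‖η‖ * ‖ζ‖ := by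
            gcongr
            exact (fderiv ℝ Ω e).le_opNorm ξ
        _ ≤ (9 * K * (‖a‖ * ‖b‖) * ‖ξ‖) * ‖η‖ * ‖ζ‖ := by gcongr
        _ = _ := by ring
    intro ξ η ζ
    have a1 := h1 ξ η ζ
    have a2 := h1 η ζ ξ
    have a3 := h1 ζ ξ η
    exact (abs_add_three _ _ _).trans (by linarith)
  clear hDΩ hDn hcomm H hanti hΩd hst
  clear_value Ω
  set p : Fin 3 → F := fun k => m.cov û x (v k) with hp
  set q : Fin 3 → F := fun k => fderiv ℝ û x (v k) - m.cov û x (v k) with hq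
  have hpq : ∀ k, fderiv ℝ û x (v k) = p k + q k := fun k => by simp [hp, hq]
  have hpv : ∀ k, fderiv ℝ m.prj e (p k) = 0 := fun k => cov_vert hs hx (v k)
  have hf1 : 1 ≤ f := hf ▸ one_le_density hK0 hs hx
  have hsf1 : 1 ≤ Real.sqrt f := Real.one_le_sqrt.2 hf1
  set σ := Real.sqrt f with hσ
  have hσf : σ * σ = f := Real.mul_self_sqrt (by linarith)
  have hqn : ∀ k, ‖q k‖ ≤ 4 * K * M := fun k =>
    (norm_horizontal_le' hs hx (v k)).trans (by nlinarith [hv k, mul_nonneg hK0.le hM])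
  have hpn : ∀ k, ‖p k‖ ≤ 4 * K * σ * M := fun k => by
    have h3 : 0 ≤ K * σ * ‖v k‖ := by positivity
    calc ‖p k‖ ≤ 3 * K * σ * ‖v k‖ := norm_cov_le hK hs hx hf (v k)
      _ ≤ 4 * K * σ * ‖v k‖ := by linarith
      _ ≤ 4 * K * σ * M := by gcongr; exact hv k
  have hpqn : ∀ k, ‖p k + q k‖ ≤ 4 * K * σ * M := fun k => by
    rw [← hpq]
    refine (norm_fderiv_le hK hs hx hf (v k)).trans ?_
    gcongr; exact hv k
  have hsum : ∑ k, fderiv ℝ Ω e (fderiv ℝ û x (v k)) (fderiv ℝ û x (v (k + 1)))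
      (fderiv ℝ û x (v (k + 2))) = T (q 0) (p 1 + q 1) (p 2 + q 2) + T (p 0) (q 1) (p 2 + q 2) +
        T (p 0) (p 1) (q 2) := by
    have h0 := hTv _ _ _ (hpv 0) (hpv 1) (hpv 2)
    simp only [Fin.sum_univ_three, hpq]
    simp only [Fin.isValue, Fin.reduceAdd, zero_add]
    simp only [hT, map_add, add_apply] at h0 ⊢
    linarith
  rw [hsum]
  set L := 27 * K * (‖a‖ * ‖b‖) with hL
  have hL0 : 0 ≤ L := by positivity
  have t1 : |T (q 0) (p 1 + q 1) (p 2 + q 2)| ≤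
      L * ((4 * K * M) * (4 * K * σ * M) * (4 * K * σ * M)) := by
    refine (hTb _ _ _).trans (mul_le_mul_of_nonneg_left ?_ hL0)
    gcongr
    exacts [hqn 0, hpqn 1, hpqn 2]
  have t2 : |T (p 0) (q 1) (p 2 + q 2)| ≤
      L * ((4 * K * σ * M) * (4 * K * M) * (4 * K * σ * M)) := by
    refine (hTb _ _ _).trans (mul_le_mul_of_nonneg_left ?_ hL0)
    gcongr
    exacts [hpn 0, hqn 1, hpqn 2]
  have t3 : |T (p 0) (p 1) (q 2)| ≤
      L * ((4 * K * σ * M) * (4 * K * σ * M) * (4 * K * M)) := by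
    refine (hTb _ _ _).trans (mul_le_mul_of_nonneg_left ?_ hL0)
    gcongr
    exacts [hpn 0, hpn 1, hqn 2]
  refine (abs_add_three _ _ _).trans ?_
  calc _ ≤ 3 * L * (64 * K ^ 3 * M ^ 3 * (σ * σ)) := by linarith
    _ ≤ 5184 * K ^ 4 * (‖a‖ * ‖b‖) * M ^ 3 * f := by
        rw [hσf, hL]
        apply le_of_eq; ring

end LocalModel

end Local

/-! ### Adapted coordinates and monotonicity for sections -/

/-- A metric on a domain of the base, given by its coefficients `G` and their inverse `Ginv`,
bounded and Lipschitz with constant `Λ`. The inverse is expressed through orthonormal frames. -/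
structure BaseMetric (D : Set E3) (G Ginv : Fin 3 → Fin 3 → E3 → ℝ) (Λ : ℝ) : Prop where
  abs_le : ∀ k l, ∀ x ∈ D, |G k l x| ≤ Λ
  abs_inv_le : ∀ k l, ∀ x ∈ D, |Ginv k l x| ≤ Λ
  lipschitz : ∀ k l, ∀ x ∈ D, ∀ y ∈ D, |G k l x - G k l y| ≤ Λ * ‖x - y‖
  lipschitz_inv : ∀ k l, ∀ x ∈ D, ∀ y ∈ D, |Ginv k l x - Ginv k l y| ≤ Λ * ‖x - y‖
  exists_frame : ∀ z ∈ D, ∃ A : Fin 3 → E3,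
    (∀ i j, ∑ k, ∑ l, G k l z * (A i k * A j l) = if i = j then 1 else 0) ∧
    ∀ k l, ∑ i, A i k * A i l = Ginv k l z

lemma norm_le_sum_abs_coord (x : E3) : ‖x‖ ≤ ∑ i, |x i| := by
  conv_lhs => rw [← sum_coord_smul_stdE x]
  refine (norm_sum_le _ _).trans (Finset.sum_le_sum fun i _ => ?_)
  rw [norm_smul]; simp

/-- Linear coordinates adapted to an orthonormal frame. -/
lemma BaseMetric.exists_linear_coordinates {D : Set E3} {G Ginv : Fin 3 → Fin 3 → E3 → ℝ} {Λ : ℝ}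
    (H : BaseMetric D G Ginv Λ) (hΛ : 1 ≤ Λ) {z : E3} (hz : z ∈ D) :
    ∃ (A : Fin 3 → E3) (L : E3 ≃L[ℝ] E3),
      (∀ i j, ∑ k, ∑ l, G k l z * (A i k * A j l) = if i = j then 1 else 0) ∧
      (∀ k l, ∑ i, A i k * A i l = Ginv k l z) ∧ (∀ i, ‖A i‖ ≤ 2 * Λ) ∧
      (∀ y, L y = ∑ i, y i • A i) ∧ (∀ y, ‖L y‖ ≤ 54 * Λ ^ 2 * ‖y‖) ∧
      (∀ y, ‖y‖ ≤ 54 * Λ ^ 2 * ‖L y‖) := by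
  obtain ⟨A, hA, hA'⟩ := H.exists_frame z hz
  have hAn : ∀ i, ‖A i‖ ≤ 2 * Λ := by
    intro i
    refine abs_le_of_sq_le_sq' ?_ (by positivity) |>.2
    rw [EuclideanSpace.norm_sq_eq]
    have h1 : ∀ k, ‖A i k‖ ^ 2 ≤ Λ := fun k => by
      have h2 : ‖A i k‖ ^ 2 ≤ ∑ i, A i k * A i k := by
        rw [Real.norm_eq_abs, sq_abs, sq]
        exact Finset.single_le_sum (f := fun i => A i k * A i k)
          (fun j _ => mul_self_nonneg _) (Finset.mem_univ i)
      rw [hA' k k] at h2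
      exact h2.trans ((le_abs_self _).trans (H.abs_inv_le k k z hz))
    refine (Finset.sum_le_sum fun k _ => h1 k).trans ?_
    simp
    nlinarith
  set L₀ : E3 →ₗ[ℝ] E3 := ∑ i,
    (EuclideanSpace.proj (𝕜 := ℝ) i : E3 →L[ℝ] ℝ).toLinearMap.smulRight (A i)
    with hL₀
  have hL₀a : ∀ y, L₀ y = ∑ i, y i • A i := fun y => by simp [hL₀]
  have hcoord : ∀ (y : E3) i, y i = ∑ k, ∑ l, G k l z * (L₀ y k * A i l) := by
    intro y i
    have e : ∑ k, ∑ l, G k l z * (L₀ y k * A i l) =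
        ∑ j, y j * ∑ k, ∑ l, G k l z * (A j k * A i l) := by
      simp only [hL₀a, Fin.sum_univ_three, PiLp.add_apply, PiLp.smul_apply, smul_eq_mul]
      ring
    rw [e]
    simp [hA]
  have hlow : ∀ y, ‖y‖ ≤ 54 * Λ ^ 2 * ‖L₀ y‖ := by
    intro y
    have h1 : ∀ i, |y i| ≤ 18 * Λ ^ 2 * ‖L₀ y‖ := by
      intro i
      rw [hcoord y i]
      have h2 : ∀ k l, |G k l z * (L₀ y k * A i l)| ≤ Λ * (‖L₀ y‖ * (2 * Λ)) := fun k l => by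
        rw [abs_mul, abs_mul]
        have := H.abs_le k l z hz
        have h3 := (abs_coord_le (A i) l).trans (hAn i)
        have h4 := abs_coord_le (L₀ y) k
        gcongr
      calc _ ≤ ∑ k, |∑ l, G k l z * (L₀ y k * A i l)| := Finset.abs_sum_le_sum_abs _ _
        _ ≤ ∑ k, ∑ l, |G k l z * (L₀ y k * A i l)| :=
          Finset.sum_le_sum fun k _ => Finset.abs_sum_le_sum_abs _ _
        _ ≤ ∑ _k : Fin 3, ∑ _l : Fin 3, Λ * (‖L₀ y‖ * (2 * Λ)) :=
          Finset.sum_le_sum fun k _ => Finset.sum_le_sum fun l _ => h2 k l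
        _ = _ := by simp; ring
    refine (norm_le_sum_abs_coord y).trans ((Finset.sum_le_sum fun i _ => h1 i).trans ?_)
    simp
    linarith
  have hinj : Function.Injective L₀ := by
    rw [injective_iff_map_eq_zero]
    intro y hy
    have := hlow y
    rw [hy, norm_zero, mul_zero] at this
    exact norm_le_zero_iff.1 this
  let L : E3 ≃L[ℝ] E3 := (LinearEquiv.ofInjectiveEndo L₀ hinj).toContinuousLinearEquiv
  have hL : ∀ y, L y = L₀ y := fun y => rfl
  refine ⟨A, L, hA, hA', hAn, fun y => by rw [hL, hL₀a], fun y => ?_, fun y => ?_⟩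
  · rw [hL, hL₀a]
    refine (norm_sum_le _ _).trans ?_
    calc ∑ i, ‖y i • A i‖ ≤ ∑ _i : Fin 3, ‖y‖ * (2 * Λ) := by
          refine Finset.sum_le_sum fun i _ => ?_
          rw [norm_smul, Real.norm_eq_abs]
          exact mul_le_mul (abs_coord_le y i) (hAn i) (norm_nonneg _) (norm_nonneg _)
      _ = 6 * Λ * ‖y‖ := by simp; ring
      _ ≤ 54 * Λ ^ 2 * ‖y‖ := by gcongr <;> nlinarith
  · rw [hL]; exact hlow y

section

variable {F : Type*} [NormedAddCommGroup F] [NormedSpace ℝ F]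

/-- The energy density `1 + ∑ |∇_k û|²`, in the coordinate frame, of a section with energy form
`α`. -/
def density (α : E3 → E3 → E3 → ℝ) (x : E3) : ℝ := 1 + ∑ k, α x (stdE k) (stdE k)

/-- The forms `α = ⟨∇û, ∇û⟩` and `β = ⟨∇û, [c, c] ∇û⟩` of a section that solves the Dirac-type
equation, on a domain of the base. Near each point the section is seen in a local model of the
bundle; on balls that are small in comparison with the size of the derivative (with `δ` as the
bound), a single model suffices. -/
structure IsDiracSection (F : Type*) [NormedAddCommGroup F] [NormedSpace ℝ F] (D : Set E3)
    (G Ginv : Fin 3 → Fin 3 → E3 → ℝ) (K δ : ℝ) (α : E3 → E3 → E3 → ℝ)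
    (β : E3 → E3 → E3 → E3 → E3 → ℝ) : Prop where
  exists_model : ∀ x ∈ D, ∃ (m : LocalModel F G Ginv K) (U : Set E3) (û : E3 → F),
    x ∈ U ∧ m.IsSection U û ∧ ∀ y ∈ U, α y = m.energyForm û y ∧ β y = m.stressForm û y
  exists_model_ball : ∀ z ρ, 0 < ρ → ball z ρ ⊆ D →
    (∀ x ∈ ball z ρ, density α x ≤ 4 * density α z) → ρ ^ 2 * density α z ≤ δ ^ 2 →
    ∃ (m : LocalModel F G Ginv K) (û : E3 → F), m.IsSection (ball z ρ) û ∧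
      ∀ y ∈ ball z ρ, α y = m.energyForm û y

variable {D : Set E3} {G Ginv : Fin 3 → Fin 3 → E3 → ℝ} {K Λ δ : ℝ}
  {α : E3 → E3 → E3 → ℝ} {β : E3 → E3 → E3 → E3 → E3 → ℝ}

namespace LocalModel

variable {m : LocalModel F G Ginv K} {U : Set E3} {û : E3 → F} {x : E3}

lemma sum_action (c : Fin 3 → F →L[ℝ] F) (f : E3 →L[ℝ] F) (A : Fin 3 → E3) :
    ∑ i, action c (A i) (f (A i)) = ∑ k, ∑ l, (∑ i, A i k * A i l) • c k (f (stdE l)) := by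
  have h : ∀ i, f (A i) = ∑ l, A i l • f (stdE l) := fun i => coord_sum f (A i)
  simp only [h, action, Fin.sum_univ_three, add_apply, smul_apply, map_add, map_smul]
  module

/-- Two-sided comparison of the densities in the coordinate frame and in another frame. -/
lemma frame_density_le (hK : 1 ≤ K) (hs : m.IsSection U û) (hx : x ∈ U) {f : ℝ}
    (hf : f = 1 + ∑ k, m.energyForm û x (stdE k) (stdE k)) {A : Fin 3 → E3} {B : ℝ}
    (hA : ∀ i, ‖A i‖ ≤ B) :
    1 + ∑ i, m.energyForm û x (A i) (A i) ≤ (1 + 27 * K ^ 3 * B ^ 2) * f := by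
  have hf1 : 1 ≤ f := hf ▸ one_le_density (by linarith) hs hx
  have h1 : ∀ i, m.energyForm û x (A i) (A i) ≤ 9 * K ^ 3 * B ^ 2 * f := by
    intro i
    have h2 := norm_cov_le hK hs hx hf (A i)
    have h3 : ‖m.cov û x (A i)‖ ≤ 3 * K * Real.sqrt f * B :=
      h2.trans (by gcongr; exact hA i)
    have h4 := CliffordTriple.abs_form_le (m.norm_h_le _ (hs.mapsTo hx)) (m.cov û x (A i))
      (m.cov û x (A i))
    calc m.energyForm û x (A i) (A i) ≤ _ := (le_abs_self _).trans h4
      _ ≤ K * ((3 * K * Real.sqrt f * B) * (3 * K * Real.sqrt f * B)) := by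
        exact mul_le_mul_of_nonneg_left (mul_self_le_mul_self (norm_nonneg _) h3) (by linarith)
      _ = 9 * K ^ 3 * B ^ 2 * (Real.sqrt f * Real.sqrt f) := by ring
      _ = _ := by rw [Real.mul_self_sqrt (by linarith)]
  have h5 := Finset.sum_le_sum fun i (_ : i ∈ Finset.univ) => h1 i
  simp only [Finset.sum_const, Finset.card_univ, Fintype.card_fin, nsmul_eq_mul] at h5
  push_cast at h5
  linarith

lemma density_le_frame (hK : 1 ≤ K) (hs : m.IsSection U û) (hx : x ∈ U) {A : Fin 3 → E3} {M : ℝ}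
    {L : E3 ≃L[ℝ] E3} (hL : ∀ y, L y = ∑ i, y i • A i) (hM : ∀ y, ‖y‖ ≤ M * ‖L y‖) :
    1 + ∑ k, m.energyForm û x (stdE k) (stdE k) ≤
      (1 + 27 * K ^ 3 * M ^ 2) * (1 + ∑ i, m.energyForm û x (A i) (A i)) := by
  have hK0 : 0 < K := by linarith
  set g := 1 + ∑ i, m.energyForm û x (A i) (A i) with hg
  have hnn : ∀ i, 0 ≤ m.energyForm û x (A i) (A i) := fun i => energyForm_nonneg hK0 hs hx _
  have hg1 : 1 ≤ g := by
    have := Finset.sum_nonneg fun i (_ : i ∈ Finset.univ) => hnn i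
    linarith
  have hN : ∀ i, ‖m.cov û x (A i)‖ ≤ K * Real.sqrt g := by
    intro i
    have h1 := m.sq_norm_le _ (hs.mapsTo hx) _ (cov_vert hs hx (A i))
    have h2 : m.energyForm û x (A i) (A i) ≤ g := by
      have := Finset.single_le_sum (f := fun i => m.energyForm û x (A i) (A i))
        (fun i _ => hnn i) (Finset.mem_univ i)
      linarith
    refine abs_le_of_sq_le_sq' ?_ (by positivity) |>.2
    rw [mul_pow, Real.sq_sqrt (by linarith)]
    calc ‖m.cov û x (A i)‖ ^ 2 ≤ K * m.energyForm û x (A i) (A i) := h1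
      _ ≤ K * g := by gcongr
      _ ≤ K ^ 2 * g := by gcongr; nlinarith
  have h1 : ∀ k, m.energyForm û x (stdE k) (stdE k) ≤ 9 * K ^ 3 * M ^ 2 * g := by
    intro k
    set y := L.symm (stdE k) with hy
    have hLy : L y = stdE k := by simp [hy]
    have hyn : ‖y‖ ≤ M := by have := hM y; rw [hLy] at this; simpa using this
    have h3 : ‖m.cov û x (stdE k)‖ ≤ 3 * (M * (K * Real.sqrt g)) := by
      rw [← hLy, hL, map_sum]
      refine (norm_sum_le _ _).trans ?_
      calc _ ≤ ∑ _i : Fin 3, M * (K * Real.sqrt g) := by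
            refine Finset.sum_le_sum fun i _ => ?_
            rw [map_smul, norm_smul, Real.norm_eq_abs]
            exact mul_le_mul ((abs_coord_le y i).trans hyn) (hN i) (norm_nonneg _)
              ((norm_nonneg _).trans hyn)
        _ = _ := by simp
    have h4 := CliffordTriple.abs_form_le (m.norm_h_le _ (hs.mapsTo hx))
      (m.cov û x (stdE k)) (m.cov û x (stdE k))
    calc m.energyForm û x (stdE k) (stdE k) ≤ _ := (le_abs_self _).trans h4
      _ ≤ K * ((3 * (M * (K * Real.sqrt g))) * (3 * (M * (K * Real.sqrt g)))) := by
        exact mul_le_mul_of_nonneg_left (mul_self_le_mul_self (norm_nonneg _) h3) (by linarith)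
      _ = 9 * K ^ 3 * M ^ 2 * (Real.sqrt g * Real.sqrt g) := by ring
      _ = _ := by rw [Real.mul_self_sqrt (by linarith)]
  have h5 := Finset.sum_le_sum fun i (_ : i ∈ Finset.univ) => h1 i
  simp only [Finset.sum_const, Finset.card_univ, Fintype.card_fin, nsmul_eq_mul] at h5
  push_cast at h5
  linarith

/-- In a frame that is orthonormal at `z`, the stress form of a section at a point `x` near `z`
is the stress tensor of a harmonic map, up to a relative error of the order of `‖x - z‖`. -/
lemma stressForm_approx (hK : 1 ≤ K) (hΛ : 1 ≤ Λ) (HG : BaseMetric D G Ginv Λ)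
    (hs : m.IsSection U û) (hx : x ∈ U) (hxD : x ∈ D) {z : E3} (hz : z ∈ D) {f : ℝ}
    (hf : f = 1 + ∑ k, m.energyForm û x (stdE k) (stdE k)) {A : Fin 3 → E3}
    (hA : ∀ i j, ∑ k, ∑ l, G k l z * (A i k * A j l) = if i = j then 1 else 0)
    (hA' : ∀ k l, ∑ i, A i k * A i l = Ginv k l z) (hAn : ∀ i, ‖A i‖ ≤ 2 * Λ)
    (hxz : 36 * Λ ^ 3 * K ^ 2 * ‖x - z‖ ≤ 1) (a k : Fin 3) :
    |m.stressForm û x (A (a + 1)) (A (a + 2)) (A (k + 1)) (A (k + 2)) -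
      ((if a = k then ∑ i, m.energyForm û x (A i) (A i) else 0) -
        2 * m.energyForm û x (A a) (A k))| ≤
      233280 * Λ ^ 7 * K ^ 6 * ‖x - z‖ * f := by
  have hK0 : 0 < K := by linarith
  have hΛ0 : 0 < Λ := by linarith
  have hf1 : 1 ≤ f := hf ▸ one_le_density hK0 hs hx
  have heW := hs.mapsTo hx
  have H := (m.triple _ heW).change_frame A
  have hprj := hs.proj x hx
  have hN : ∀ i, m.cov û x (A i) ∈ LinearMap.ker (fderiv ℝ m.prj (û x)).toLinearMap := fun i =>
    cov_vert hs hx (A i)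
  set d := ‖x - z‖ with hd
  have hd0 : 0 ≤ d := norm_nonneg _
  have h1K : 1 ≤ K * Λ := by nlinarith
  have hG : ∀ i j, |∑ k, ∑ l, G k l (m.prj (û x)) * (A i k * A j l) - if i = j then 1 else 0| ≤
      36 * Λ ^ 3 * K ^ 2 * d := by
    intro i j
    rw [hprj, ← hA i j, ← Finset.sum_sub_distrib]
    have h2 : ∀ k l, |(G k l x - G k l z) * (A i k * A j l)| ≤ (Λ * d) * ((2 * Λ) * (2 * Λ)) :=
      fun k l => by
        rw [abs_mul, abs_mul]
        have h3 := HG.lipschitz k l x hxD z hz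
        have h4 := (abs_coord_le (A i) k).trans (hAn i)
        have h5 := (abs_coord_le (A j) l).trans (hAn j)
        gcongr
    calc _ = |∑ k, ∑ l, (G k l x - G k l z) * (A i k * A j l)| := by
          congr 1
          refine Finset.sum_congr rfl fun k _ => ?_
          rw [← Finset.sum_sub_distrib]
          exact Finset.sum_congr rfl fun l _ => by ring
      _ ≤ ∑ k, |∑ l, (G k l x - G k l z) * (A i k * A j l)| := Finset.abs_sum_le_sum_abs _ _
      _ ≤ ∑ k, ∑ l, |(G k l x - G k l z) * (A i k * A j l)| :=
          Finset.sum_le_sum fun k _ => Finset.abs_sum_le_sum_abs _ _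
      _ ≤ ∑ _k : Fin 3, ∑ _l : Fin 3, (Λ * d) * ((2 * Λ) * (2 * Λ)) :=
          Finset.sum_le_sum fun k _ => Finset.sum_le_sum fun l _ => h2 k l
      _ = 36 * Λ ^ 3 * 1 ^ 2 * d := by simp; ring
      _ ≤ _ := by gcongr
  have hc : ∀ i, ‖action (fun i => m.c i (û x)) (A i)‖ ≤ 6 * K * Λ := fun i => by
    refine (norm_action_le (fun i => m.norm_c_le i _ heW) (A i)).trans ?_
    calc 3 * K * ‖A i‖ ≤ 3 * K * (2 * Λ) := by gcongr; exact hAn i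
      _ = _ := by ring
  have hNs : ∀ i, ‖m.cov û x (A i)‖ ≤ 6 * K * Λ * Real.sqrt f := fun i => by
    refine (norm_cov_le hK hs hx hf (A i)).trans ?_
    calc 3 * K * Real.sqrt f * ‖A i‖ ≤ 3 * K * Real.sqrt f * (2 * Λ) := by gcongr; exact hAn i
      _ = _ := by ring
  have hres : ‖∑ i, action (fun i => m.c i (û x)) (A i) (m.cov û x (A i))‖ ≤
      36 * Λ ^ 3 * K ^ 2 * d * (6 * K * Λ * Real.sqrt f) := by
    rw [sum_action]
    have h0 := hs.dirac x hx
    have h1 : ∑ k, ∑ l, (∑ i, A i k * A i l) • m.c k (û x) (m.cov û x (stdE l)) =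
        ∑ k, ∑ l, (Ginv k l z - Ginv k l x) • m.c k (û x) (m.cov û x (stdE l)) := by
      rw [← sub_zero (∑ k, ∑ l, (∑ i, A i k * A i l) • m.c k (û x) (m.cov û x (stdE l))), ← h0,
        ← Finset.sum_sub_distrib]
      refine Finset.sum_congr rfl fun k _ => ?_
      rw [← Finset.sum_sub_distrib]
      refine Finset.sum_congr rfl fun l _ => ?_
      rw [hA', sub_smul]; rfl
    rw [h1]
    have h2 : ∀ k l, ‖(Ginv k l z - Ginv k l x) • m.c k (û x) (m.cov û x (stdE l))‖ ≤
        (Λ * d) * (K * (3 * K * Real.sqrt f)) := fun k l => by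
      rw [norm_smul, Real.norm_eq_abs]
      have h3 := HG.lipschitz_inv k l z hz x hxD
      rw [norm_sub_rev] at h3
      have h4 : ‖m.cov û x (stdE l)‖ ≤ 3 * K * Real.sqrt f := by
        simpa using norm_cov_le hK hs hx hf (stdE l)
      have h5 := (m.c k (û x)).le_of_opNorm_le (m.norm_c_le k _ heW) (m.cov û x (stdE l))
      have h6 : ‖m.c k (û x) (m.cov û x (stdE l))‖ ≤ K * (3 * K * Real.sqrt f) :=
        h5.trans (by gcongr)
      gcongr
    calc _ ≤ ∑ k, ‖∑ l, (Ginv k l z - Ginv k l x) • m.c k (û x) (m.cov û x (stdE l))‖ :=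
          norm_sum_le _ _
      _ ≤ ∑ k, ∑ l, ‖(Ginv k l z - Ginv k l x) • m.c k (û x) (m.cov û x (stdE l))‖ :=
          Finset.sum_le_sum fun k _ => norm_sum_le _ _
      _ ≤ ∑ _k : Fin 3, ∑ _l : Fin 3, (Λ * d) * (K * (3 * K * Real.sqrt f)) :=
          Finset.sum_le_sum fun k _ => Finset.sum_le_sum fun l _ => h2 k l
      _ = 27 * (Λ * K ^ 2 * d * Real.sqrt f) := by simp; ring
      _ ≤ (216 * (Λ ^ 3 * (K * Λ))) * (Λ * K ^ 2 * d * Real.sqrt f) / Λ := by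
          rw [le_div_iff₀ hΛ0]
          have h7 : Λ ≤ Λ ^ 3 * (K * Λ) := by
            have : (1:ℝ) ≤ Λ ^ 2 := one_le_pow₀ hΛ
            have h8 : 1 ≤ Λ ^ 2 * (K * Λ) := one_le_mul_of_one_le_of_one_le this h1K
            nlinarith
          have h9 : 0 ≤ Λ * K ^ 2 * d * Real.sqrt f := by positivity
          nlinarith
      _ = _ := by field_simp; ring
  have key := H.stress_approx (K := 6 * K * Λ) (N := fun i => m.cov û x (A i)) hN (by positivity)
    (by positivity) hxz (by positivity) ((m.norm_h_le _ heW).trans (by nlinarith)) hc hG hNs hres a k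
  refine key.trans ?_
  rw [mul_pow (6 * K * Λ) (Real.sqrt f), Real.sq_sqrt (by linarith)]
  have e1 : 6 * (6 * K * Λ) + 4 * (6 * K * Λ) ^ 2 ≤ 180 * (K * Λ) ^ 2 := by nlinarith
  calc _ ≤ 180 * (K * Λ) ^ 2 * (36 * Λ ^ 3 * K ^ 2 * d * ((6 * K * Λ) ^ 2 * f)) := by
        gcongr
    _ = _ := by ring

end LocalModel

end

section

variable {F : Type*} [NormedAddCommGroup F] [NormedSpace ℝ F]
  {D : Set E3} {G Ginv : Fin 3 → Fin 3 → E3 → ℝ} {K Λ δ : ℝ}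
  {α : E3 → E3 → E3 → ℝ} {β : E3 → E3 → E3 → E3 → E3 → ℝ}

namespace IsDiracSection

lemma density_eq {m : LocalModel F G Ginv K} {û : E3 → F} {x : E3} (h : α x = m.energyForm û x) :
    density α x = 1 + ∑ k, m.energyForm û x (stdE k) (stdE k) := by
  simp only [density, h]

lemma one_le_density (hK : 1 ≤ K) (H : IsDiracSection F D G Ginv K δ α β) {x : E3} (hx : x ∈ D) :
    1 ≤ density α x := by
  obtain ⟨m, U, û, hxU, hs, hαβ⟩ := H.exists_model x hx
  rw [density_eq (hαβ x hxU).1]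
  exact LocalModel.one_le_density (by linarith) hs hxU

lemma continuousOn_density (H : IsDiracSection F D G Ginv K δ α β) :
    ContinuousOn (density α) D := by
  intro x hx
  obtain ⟨m, U, û, hxU, hs, hαβ⟩ := H.exists_model x hx
  refine ContinuousAt.continuousWithinAt ?_
  have : ContinuousAt (fun y => 1 + ∑ k, m.energyForm û y (stdE k) (stdE k)) x :=
    continuousAt_const.add (tendsto_finsetSum _ fun k _ =>
      (LocalModel.contDiffAt_energyForm hs hxU _ _).continuousAt)
  refine this.congr ?_
  filter_upwards [hs.isOpen.mem_nhds hxU] with y hy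
  rw [density_eq (hαβ y hy).1]

/-- Almost monotonicity of the renormalised energy in coordinates adapted to a frame at the
centre. -/
lemma monotonicity_adapted (hK : 1 ≤ K) (hΛ : 1 ≤ Λ) (HG : BaseMetric D G Ginv Λ)
    (H : IsDiracSection F D G Ginv K δ α β) {z : E3} {R : ℝ} (hR : 0 < R) (hzR : ball z R ⊆ D)
    (hR1 : 36 * Λ ^ 3 * K ^ 2 * R ≤ 1) {M : ℝ} (hM : 1 ≤ M)
    (hR2 : 5 * (2099520 * Λ ^ 7 * K ^ 6 * M * (1 + 27 * K ^ 3 * M ^ 2) +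
      165888 * K ^ 4 * Λ ^ 5 * (1 + 27 * K ^ 3 * M ^ 2)) * (R / M) ≤ 1)
    {A : Fin 3 → E3} {L : E3 ≃L[ℝ] E3}
    (hA : ∀ i j, ∑ k, ∑ l, G k l z * (A i k * A j l) = if i = j then 1 else 0)
    (hA' : ∀ k l, ∑ i, A i k * A i l = Ginv k l z) (hAn : ∀ i, ‖A i‖ ≤ 2 * Λ)
    (hL : ∀ y, L y = ∑ i, y i • A i) (hLM : ∀ y, ‖L y‖ ≤ M * ‖y‖) (hLM' : ∀ y, ‖y‖ ≤ M * ‖L y‖)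
    {ρ r : ℝ} (hρ : 0 < ρ) (hρr : ρ ≤ r) (hrR : r < R / M) :
    ContinuousOn (fun y => 1 + ∑ i, α (z + L y) (A i) (A i)) (ball 0 (R / M)) ∧
    ρ⁻¹ * ∫ y in ball 0 (ρ / 2), (1 + ∑ i, α (z + L y) (A i) (A i)) ≤
      5 * (r⁻¹ * ∫ y in ball 0 r, (1 + ∑ i, α (z + L y) (A i) (A i))) := by
  have hK0 : 0 < K := by linarith
  have hM0 : 0 < M := by linarith
  set g : E3 → ℝ := fun y => 1 + ∑ i, α (z + L y) (A i) (A i) with hg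
  -- the stress tensor `δₐₖ |∇u|² - 2 ⟨∇ₐu, ∇ₖu⟩`, up to errors, written by means of commutator forms
  set S : Fin 3 → Fin 3 → E3 → ℝ := fun a k y => (if a = k then 1 else 0) +
    β (z + L y) (A (a + 1)) (A (a + 2)) (A (k + 1)) (A (k + 2)) with hS
  set C₁ := 1 + 27 * K ^ 3 * M ^ 2 with hC₁
  have hC₁0 : 0 < C₁ := by positivity
  have hzball : ∀ y ∈ ball (0 : E3) (R / M), z + L y ∈ ball z R := by
    intro y hy
    rw [mem_ball_zero_iff] at hy
    rw [mem_ball, dist_eq_norm, add_sub_cancel_left]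
    calc ‖L y‖ ≤ M * ‖y‖ := hLM y
      _ < M * (R / M) := by gcongr
      _ = R := by field_simp
  have haff : ∀ y, HasFDerivAt (fun y => z + L y) (L : E3 →L[ℝ] E3) y := fun y =>
    (L : E3 →L[ℝ] E3).hasFDerivAt.const_add z
  have haffs : ContDiff ℝ 1 (fun y => z + L y) := contDiff_const.add L.contDiff
  have hzD : z ∈ D := hzR (mem_ball_self hR)
  have hLstd : ∀ k, L (stdE k) = A k := by
    intro k
    rw [hL]
    simp
  have hcd : ∀ y ∈ ball (0 : E3) (R / M), ContDiffAt ℝ 1 g y ∧ ∀ a k, ContDiffAt ℝ 1 (S a k) y := by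
    intro y hy
    obtain ⟨m, U, û, hxU, hs, hαβ⟩ := H.exists_model _ (hzR (hzball y hy))
    have hev : ∀ᶠ y' in nhds y, z + L y' ∈ U :=
      haffs.continuous.continuousAt.eventually (hs.isOpen.mem_nhds hxU)
    constructor
    · have : ContDiffAt ℝ 1 (fun y => 1 + ∑ i, m.energyForm û (z + L y) (A i) (A i)) y :=
        contDiffAt_const.add (ContDiffAt.sum fun i _ =>
          ContDiffAt.comp (g := fun x => m.energyForm û x (A i) (A i)) y
            (LocalModel.contDiffAt_energyForm hs hxU (A i) (A i)) haffs.contDiffAt)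
      refine this.congr_of_eventuallyEq ?_
      filter_upwards [hev] with y' hy'
      simp only [hg, (hαβ _ hy').1]
    · intro a k
      have := contDiffAt_const (c := if a = k then (1 : ℝ) else 0).add
          ((LocalModel.contDiffAt_stressForm hs hxU (A (a + 1)) (A (a + 2)) (A (k + 1))
            (A (k + 2))).comp y haffs.contDiffAt)
      refine this.congr_of_eventuallyEq ?_
      filter_upwards [hev] with y' hy'
      simp only [hS, (hαβ _ hy').2, Function.comp]
  have hgc : ContinuousOn g (ball 0 (R / M)) := fun y hy =>
    (hcd y hy).1.continuousAt.continuousWithinAt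
  set C₀ := 233280 * Λ ^ 7 * K ^ 6 with hC₀
  have hC₀0 : 0 < C₀ := by positivity
  -- the stress tensor in terms of the energy form
  have happ : ∀ y ∈ ball (0 : E3) (R / M), (∀ v, 0 ≤ α (z + L y) v v) ∧
      (∀ a k, |S a k y - ((if a = k then g y else 0) - 2 * α (z + L y) (A a) (A k))| ≤
        C₀ * M * C₁ * ‖y‖ * g y) ∧
      (∀ a, |∑ k, fderiv ℝ (S a k) y (stdE k)| ≤ 165888 * K ^ 4 * Λ ^ 5 * C₁ * g y) ∧
      ∑ a, ∑ k, α (z + L y) (A a) (A k) * y a * y k = α (z + L y) (L y) (L y) := by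
    intro y hy
    obtain ⟨m, U, û, hxU, hs, hαβ⟩ := H.exists_model _ (hzR (hzball y hy))
    have hx := hzball y hy
    set x := z + L y with hxdef
    have hα := (hαβ x hxU).1
    have hfg : density α x ≤ C₁ * g y := by
      have := LocalModel.density_le_frame hK hs hxU hL hLM'
      have hgx : g y = 1 + ∑ i, m.energyForm û x (A i) (A i) := by
        show 1 + ∑ i, α x (A i) (A i) = _
        rw [hα]
      rwa [density_eq hα, hgx]
    have hf0 : 0 ≤ density α x := zero_le_one.trans (H.one_le_density hK (hzR hx))
    have hxz : ‖x - z‖ = ‖L y‖ := by rw [hxdef, add_sub_cancel_left]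
    have hxzR : ‖x - z‖ ≤ R := by
      rw [mem_ball, dist_eq_norm] at hx; exact hx.le
    refine ⟨fun v => ?_, fun a k => ?_, fun a => ?_, ?_⟩
    · rw [hα]; exact LocalModel.energyForm_nonneg hK0 hs hxU v
    · have := LocalModel.stressForm_approx hK hΛ HG hs hxU (hzR hx) hzD (density_eq hα) hA hA' hAn
        (le_trans (by gcongr) hR1) a k
      rw [← (hαβ x hxU).2, ← hα] at this
      have e : S a k y - ((if a = k then g y else 0) - 2 * α x (A a) (A k)) =
          β x (A (a + 1)) (A (a + 2)) (A (k + 1)) (A (k + 2)) -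
            ((if a = k then ∑ i, α x (A i) (A i) else 0) - 2 * α x (A a) (A k)) := by
        simp only [hS, hg]
        split_ifs <;> ring
      rw [e]
      refine this.trans ?_
      rw [hxz]
      calc C₀ * ‖L y‖ * density α x ≤ C₀ * (M * ‖y‖) * (C₁ * g y) := by
            gcongr; exact hLM y
        _ = _ := by ring
    · have hfd : ∀ k, fderiv ℝ (S a k) y (stdE k) = fderiv ℝ
          (fun x => m.stressForm û x (A (a + 1)) (A (a + 2)) (A (k + 1)) (A (k + 2))) x (A k) := by
        intro k
        have h1 := ((LocalModel.contDiffAt_stressForm hs hxU (A (a + 1)) (A (a + 2)) (A (k + 1))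
            (A (k + 2))).differentiableAt one_ne_zero).hasFDerivAt
        have h2 := (h1.comp y (haff y)).const_add (if a = k then (1 : ℝ) else 0)
        have hev : ∀ᶠ y' in nhds y, z + L y' ∈ U :=
          haffs.continuous.continuousAt.eventually (hs.isOpen.mem_nhds hxU)
        have h3 : S a k =ᶠ[nhds y] fun y' => (if a = k then (1 : ℝ) else 0) +
            ((fun x => m.stressForm û x (A (a + 1)) (A (a + 2)) (A (k + 1)) (A (k + 2))) ∘
              fun y => z + L y) y' := by
          filter_upwards [hev] with y' hy'
          simp only [hS, (hαβ _ hy').2, Function.comp]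
        rw [h3.fderiv_eq, h2.fderiv, ContinuousLinearMap.comp_apply]
        congr 1
        exact hLstd k
      simp only [hfd]
      refine (LocalModel.abs_divergence_le hK hs hxU (density_eq hα) (A (a + 1)) (A (a + 2))
        hAn).trans ?_
      calc _ ≤ 5184 * K ^ 4 * ((2 * Λ) * (2 * Λ)) * (2 * Λ) ^ 3 * (C₁ * g y) := by
            gcongr
            · exact hAn _
            · exact hAn _
        _ = _ := by ring
    · rw [hL, hα]
      simp only [LocalModel.energyForm, Fin.sum_univ_three, map_add, map_smul, add_apply,
        smul_apply, smul_eq_mul]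
      ring
  have hg0 : ∀ y ∈ ball (0 : E3) (R / M), 0 ≤ g y := by
    intro y hy
    have := Finset.sum_nonneg fun i (_ : i ∈ Finset.univ) => (happ y hy).1 (A i)
    simp only [hg]; linarith
  refine ⟨hgc, monotonicity_of_stress (S := S) (R := R / M)
    (K := 9 * (C₀ * M * C₁) + 165888 * K ^ 4 * Λ ^ 5 * C₁)
    (by positivity) ?_ hgc hg0 ?_ ?_ ?_ ?_ hρ hρr hrR⟩
  · refine le_trans (le_of_eq ?_) hR2
    rw [hC₀]; ring
  · exact fun a k y hy => ((hcd y hy).2 a k).contDiffWithinAt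
  · intro a y hy
    refine ((happ y hy).2.2.1 a).trans ?_
    have := hg0 y hy
    gcongr
    linarith [show 0 ≤ 9 * (C₀ * M * C₁) by positivity]
  · intro y hy
    have h1 := (happ y hy).2.1
    have hgy := hg0 y hy
    have h2 : ∀ a, g y - 2 * α (z + L y) (A a) (A a) - C₀ * M * C₁ * ‖y‖ * g y ≤ S a a y := by
      intro a
      have := (abs_le.1 (h1 a a)).1
      rw [if_pos rfl] at this
      linarith
    have h3 := Finset.sum_le_sum fun a (_ : a ∈ Finset.univ) => h2 a
    refine le_trans ?_ h3
    have h4 : g y = 1 + ∑ i, α (z + L y) (A i) (A i) := rfl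
    simp only [Fin.sum_univ_three] at h4 ⊢
    have h5 : 0 ≤ C₀ * M * C₁ * ‖y‖ * g y := by positivity
    have h6 : 0 ≤ 165888 * K ^ 4 * Λ ^ 5 * C₁ * ‖y‖ * g y := by positivity
    linarith
  · intro y hy
    obtain ⟨h0, h1, -, h2⟩ := happ y hy
    have hgy := hg0 y hy
    set T := C₀ * M * C₁ * ‖y‖ * g y with hT
    have hT0 : 0 ≤ T := by positivity
    have h3 : ∀ a k, S a k y * y a * y k ≤
        (if a = k then g y * y a * y k else 0) - 2 * (α (z + L y) (A a) (A k) * y a * y k) +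
          T * (‖y‖ * ‖y‖) := by
      intro a k
      have h4 := h1 a k
      have h5 : |(S a k y - ((if a = k then g y else 0) - 2 * α (z + L y) (A a) (A k))) *
          (y a * y k)| ≤ T * (‖y‖ * ‖y‖) := by
        rw [abs_mul, abs_mul]
        have := abs_coord_le y a
        have := abs_coord_le y k
        gcongr
      have h6 := (abs_le.1 h5).2
      split_ifs at h6 ⊢ <;> linarith
    have h7 := Finset.sum_le_sum fun a (_ : a ∈ Finset.univ) =>
      Finset.sum_le_sum fun k (_ : k ∈ Finset.univ) => h3 a k
    refine h7.trans ?_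
    simp only [Finset.sum_add_distrib, Finset.sum_sub_distrib, ← Finset.mul_sum, h2]
    have h8 : ∑ a, ∑ k, (if a = k then g y * y a * y k else 0) = ‖y‖ ^ 2 * g y := by
      rw [EuclideanSpace.norm_sq_eq]
      simp [Fin.sum_univ_three]
      ring
    rw [h8]
    have h9 := h0 (L y)
    have h10 : 0 ≤ 165888 * K ^ 4 * Λ ^ 5 * C₁ * ‖y‖ ^ 3 * g y := by positivity
    simp only [Finset.sum_const, Finset.card_univ, Fintype.card_fin, nsmul_eq_mul]
    push_cast
    have h11 : T * (‖y‖ * ‖y‖) = C₀ * M * C₁ * ‖y‖ ^ 3 * g y := by rw [hT]; ring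
    linarith

end IsDiracSection

end

section

variable {F : Type*} [NormedAddCommGroup F] [NormedSpace ℝ F]
  {D : Set E3} {G Ginv : Fin 3 → Fin 3 → E3 → ℝ} {K Λ δ : ℝ}
  {α : E3 → E3 → E3 → ℝ} {β : E3 → E3 → E3 → E3 → E3 → ℝ}

namespace IsDiracSection

lemma density_comparison (hK : 1 ≤ K) (H : IsDiracSection F D G Ginv K δ α β)
    {A : Fin 3 → E3} {L : E3 ≃L[ℝ] E3} {M : ℝ} (hAn : ∀ i, ‖A i‖ ≤ M)
    (hL : ∀ y, L y = ∑ i, y i • A i) (hLM' : ∀ y, ‖y‖ ≤ M * ‖L y‖) {x : E3} (hx : x ∈ D) :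
    density α x ≤ (1 + 27 * K ^ 3 * M ^ 2) * (1 + ∑ i, α x (A i) (A i)) ∧
    1 + ∑ i, α x (A i) (A i) ≤ (1 + 27 * K ^ 3 * M ^ 2) * density α x := by
  obtain ⟨m, U, û, hxU, hs, hαβ⟩ := H.exists_model x hx
  have hα := (hαβ x hxU).1
  have h1 := LocalModel.density_le_frame hK hs hxU hL hLM'
  have h2 := LocalModel.frame_density_le hK hs hxU rfl hAn
  rw [← density_eq hα, ← hα] at h1 h2
  exact ⟨h1, h2⟩

lemma integrableOn_density (H : IsDiracSection F D G Ginv K δ α β) {z : E3} {ρ R : ℝ}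
    (hρ : ρ < R) (hR : ball z R ⊆ D) : IntegrableOn (density α) (ball z ρ) :=
  ((H.continuousOn_density.mono ((closedBall_subset_ball hρ).trans hR)).integrableOn_compact
    (isCompact_closedBall z ρ)).mono_set ball_subset_closedBall

/-- Almost monotonicity of the renormalised energy. -/
lemma exists_monotonicity (F : Type*) [NormedAddCommGroup F] [NormedSpace ℝ F]
    (hK : 1 ≤ K) (hΛ : 1 ≤ Λ) : ∃ A > 0, ∃ R₁ > 0, ∃ θ > 0, θ ≤ 1 ∧
    ∀ {D : Set E3} {G Ginv : Fin 3 → Fin 3 → E3 → ℝ} {δ : ℝ}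
      {α : E3 → E3 → E3 → ℝ} {β : E3 → E3 → E3 → E3 → E3 → ℝ},
      BaseMetric D G Ginv Λ → IsDiracSection F D G Ginv K δ α β → ∀ z R, 0 < R → R ≤ R₁ →
      ball z R ⊆ D → ∀ ρ, 0 < ρ → ρ ≤ θ * R →
      ρ⁻¹ * ∫ x in ball z ρ, density α x ≤ A * (R⁻¹ * ∫ x in ball z (R / 2), density α x) := by
  have hK0 : 0 < K := by linarith
  have hΛ0 : 0 < Λ := by linarith
  set M := 54 * Λ ^ 2 with hM
  have hM1 : 1 ≤ M := by nlinarith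
  have hM0 : 0 < M := by linarith
  set C₁ := 1 + 27 * K ^ 3 * M ^ 2 with hC₁
  have hC₁0 : 0 < C₁ := by positivity
  set K' := 2099520 * Λ ^ 7 * K ^ 6 * M * C₁ + 165888 * K ^ 4 * Λ ^ 5 * C₁ with hK'
  have hK'0 : 0 < K' := by positivity
  refine ⟨20 * M ^ 8 * C₁ ^ 2, by positivity, min (1 / (36 * Λ ^ 3 * K ^ 2)) (1 / (5 * K')),
    lt_min (by positivity) (by positivity), 1 / (4 * M ^ 2), by positivity, ?_, ?_⟩
  · rw [div_le_one (by positivity)]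
    have : 1 ≤ M ^ 2 := one_le_pow₀ hM1
    linarith
  intro D G Ginv δ α β HG H z R hR hRR₁ hzR ρ hρ hρR
  have hzD : z ∈ D := hzR (mem_ball_self hR)
  obtain ⟨A, L, hA, hA', hAn, hL, hLM, hLM'⟩ := HG.exists_linear_coordinates hΛ hzD
  rw [← hM] at hLM hLM'
  have hR1 : 36 * Λ ^ 3 * K ^ 2 * R ≤ 1 := by
    have := hRR₁.trans (min_le_left _ _)
    rwa [le_div_iff₀ (by positivity), mul_comm] at this
  have hR2 : 5 * K' * (R / M) ≤ 1 := by
    have := hRR₁.trans (min_le_right _ _)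
    rw [le_div_iff₀ (by positivity), mul_comm] at this
    have h2 : R / M ≤ R := div_le_self hR.le hM1
    calc 5 * K' * (R / M) ≤ 5 * K' * R := by gcongr
      _ ≤ 1 := this
  set f := density α with hf
  set g : E3 → ℝ := fun y => 1 + ∑ i, α (z + L y) (A i) (A i) with hg
  set r := R / (2 * M) with hr
  have hr0 : 0 < r := by positivity
  have hrR : r < R / M := by rw [hr]; gcongr; linarith
  have hMr : M * r = R / 2 := by rw [hr]; field_simp
  have hρr : 2 * M * ρ ≤ r := by
    rw [hr]
    calc 2 * M * ρ ≤ 2 * M * (1 / (4 * M ^ 2) * R) := by gcongr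
      _ = R / (2 * M) := by field_simp; norm_num
  obtain ⟨hgc, hmono⟩ := monotonicity_adapted hK hΛ HG H hR hzR hR1 hM1 hR2 hA hA' hAn hL hLM hLM'
    (ρ := 2 * M * ρ) (by positivity) hρr hrR
  have hhalf : 2 * M * ρ / 2 = M * ρ := by ring
  rw [hhalf] at hmono
  have hcomp := fun x (hx : x ∈ D) => H.density_comparison hK (M := M)
    (fun i => (hAn i).trans (by nlinarith)) hL hLM' hx
  have hmem : ∀ y ∈ ball (0 : E3) (R / M), z + L y ∈ D := by
    intro y hy
    rw [mem_ball_zero_iff] at hy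
    refine hzR ?_
    rw [mem_ball, dist_eq_norm, add_sub_cancel_left]
    calc ‖L y‖ ≤ M * ‖y‖ := hLM y
      _ < M * (R / M) := by gcongr
      _ = R := by field_simp
  have hf0 : ∀ x ∈ D, 0 ≤ f x := fun x hx => zero_le_one.trans (H.one_le_density hK hx)
  have hg0 : ∀ y ∈ ball (0 : E3) (R / M), 0 ≤ g y := fun y hy => by
    have h1 := (hcomp _ (hmem y hy)).1
    exact nonneg_of_mul_nonneg_right ((hf0 _ (hmem y hy)).trans h1) hC₁0
  have hgi : ∀ t < R / M, IntegrableOn g (ball 0 t) := fun t ht =>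
    ((hgc.mono (closedBall_subset_ball ht)).integrableOn_compact
      (isCompact_closedBall 0 t)).mono_set ball_subset_closedBall
  have hρR2 : ρ < R := by
    have h1 : M * ρ < R / M := by nlinarith [mul_pos hM0 hρ]
    have h2 : R / M ≤ R := div_le_self hR.le hM1
    nlinarith
  have hMρ : M * ρ < R / M := by nlinarith [mul_pos hM0 hρ]
  -- from the ball around `z` to adapted coordinates
  have hfg : ∫ x in ball z ρ, f x ≤ M ^ 3 * (C₁ * ∫ y in ball 0 (M * ρ), g y) := by
    have h1 := setIntegral_ball_comp_affine_le (g := fun y => C₁ * g y) L.symm (z := 0) (M := M)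
      (ρ := ρ) hM0 (fun y => by simpa using hLM' (L.symm y)) (fun y => by simpa using hLM (L.symm y))
      (fun y hy => mul_nonneg hC₁0.le (hg0 y (ball_subset_ball hMρ.le hy)))
      ((hgi _ hMρ).const_mul C₁)
    rw [integral_const_mul, integral_const_mul] at h1
    refine le_trans ?_ h1
    rw [← integral_const_mul]
    have h2 : ∫ x in ball z ρ, f x = ∫ y in ball 0 ρ, f (z + y) := by
      have hpre : (fun y => z + y) ⁻¹' ball z ρ = ball 0 ρ := by
        ext y; simp [mem_ball, dist_eq_norm]
      have := (measurePreserving_add_left volume z).setIntegral_preimage_emb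
        (measurableEmbedding_addLeft z) f (ball z ρ)
      rw [hpre] at this
      exact this.symm
    rw [h2]
    have hsub : ∀ y ∈ closedBall (0 : E3) ρ, L.symm y ∈ ball (0 : E3) (R / M) := by
      intro y hy
      rw [mem_closedBall_zero_iff] at hy
      rw [mem_ball_zero_iff]
      calc ‖L.symm y‖ ≤ M * ‖y‖ := by simpa using hLM' (L.symm y)
        _ ≤ M * ρ := by gcongr
        _ < _ := hMρ
    have hle : ∀ y ∈ closedBall (0 : E3) ρ, f (z + y) ≤ C₁ * g (L.symm y) := by
      intro y hy
      have := (hcomp _ (hmem _ (hsub y hy))).1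
      rw [L.apply_symm_apply] at this
      simpa only [hg, L.apply_symm_apply] using this
    have hc1 : ContinuousOn (fun y => f (z + y)) (closedBall 0 ρ) := by
      refine H.continuousOn_density.comp (continuous_const.add continuous_id).continuousOn ?_
      intro y hy
      have := hmem _ (hsub y hy)
      rwa [L.apply_symm_apply] at this
    have hc2 : ContinuousOn (fun y => C₁ * g (L.symm y)) (closedBall 0 ρ) :=
      continuousOn_const.mul (hgc.comp L.symm.continuous.continuousOn hsub)
    simp only [zero_add]
    exact setIntegral_mono_on
      ((hc1.integrableOn_compact (isCompact_closedBall 0 ρ)).mono_set ball_subset_closedBall)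
      ((hc2.integrableOn_compact (isCompact_closedBall 0 ρ)).mono_set ball_subset_closedBall)
      measurableSet_ball (fun y hy => hle y (ball_subset_closedBall hy))
  -- from adapted coordinates to the ball around `z`
  have hgf : ∫ y in ball 0 r, g y ≤ M ^ 3 * (C₁ * ∫ x in ball z (R / 2), f x) := by
    have hsub : ball z (M * r) ⊆ D := by
      rw [hMr]; exact (ball_subset_ball (by linarith)).trans hzR
    have hint : IntegrableOn f (ball z (M * r)) := by
      rw [hMr]; exact H.integrableOn_density (by linarith) hzR
    have h1 := setIntegral_ball_comp_affine_le (g := fun x => C₁ * f x) L (z := z) (M := M)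
      (ρ := r) hM0 hLM hLM' (fun y hy => mul_nonneg hC₁0.le (hf0 y (hsub hy)))
      (hint.const_mul C₁)
    rw [integral_const_mul, integral_const_mul, hMr] at h1
    refine le_trans ?_ h1
    rw [← integral_const_mul]
    have hc2 : ContinuousOn (fun y => C₁ * f (z + L y)) (closedBall 0 r) :=
      continuousOn_const.mul (H.continuousOn_density.comp
        (continuous_const.add L.continuous).continuousOn
        fun y hy => hmem y (closedBall_subset_ball hrR hy))
    exact setIntegral_mono_on (hgi _ hrR)
      ((hc2.integrableOn_compact (isCompact_closedBall 0 r)).mono_set ball_subset_closedBall)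
      measurableSet_ball (fun y hy => (hcomp _ (hmem y (ball_subset_ball hrR.le hy))).2)
  have hgf : (∫ y in ball (0 : E3) (M * ρ), g y) ≤
      2 * M * ρ * (5 * (r⁻¹ * ∫ y in ball 0 r, g y)) := by
    rwa [inv_mul_le_iff₀ (by positivity)] at hmono
  calc ρ⁻¹ * ∫ x in ball z ρ, f x
      ≤ ρ⁻¹ * (M ^ 3 * (C₁ * (2 * M * ρ * (5 * (r⁻¹ *
          (M ^ 3 * (C₁ * ∫ x in ball z (R / 2), f x))))))) := by
        refine mul_le_mul_of_nonneg_left (hfg.trans ?_) (by positivity)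
        gcongr
        refine hgf.trans ?_
        gcongr
    _ = _ := by
        rw [hr]
        field_simp
        ring

end IsDiracSection

end

/-! ### The mean value inequality and ε-regularity in coordinates -/

section

variable {F : Type*} [NormedAddCommGroup F] [NormedSpace ℝ F]
  {D : Set E3} {G Ginv : Fin 3 → Fin 3 → E3 → ℝ} {K Λ δ : ℝ}
  {α : E3 → E3 → E3 → ℝ} {β : E3 → E3 → E3 → E3 → E3 → ℝ}

namespace LocalModel

variable {m : LocalModel F G Ginv K} {U : Set E3} {û : E3 → F} {x : E3}

/-- Freezing the coefficients at the centre `z` in the Dirac equation of a section: the error is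
bounded by `‖x - z‖` times the density. -/
lemma frozen_dirac_le (hK : 1 ≤ K) (hΛ : 1 ≤ Λ) (HG : BaseMetric D G Ginv Λ) {z : E3} {ρ : ℝ}
    (hρ : 0 < ρ) (hzD : ball z ρ ⊆ D) (hs : m.IsSection (ball z ρ) û) {s : ℝ} (hs1 : 1 ≤ s)
    (hf : ∀ x ∈ ball z ρ, 1 + ∑ k, m.energyForm û x (stdE k) (stdE k) ≤ (2 * s) ^ 2)
    (hx : x ∈ ball z ρ) :
    ‖∑ k, ∑ l, Ginv k l z • m.c k (û z) (m.P (û z) (fderiv ℝ û x (stdE l)))‖ ≤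
      648 * Λ * K ^ 3 * s ^ 2 * ‖x - z‖ := by
  have hK0 : 0 < K := by linarith
  have hΛ0 : 0 < Λ := by linarith
  have hz : z ∈ ball z ρ := mem_ball_self hρ
  have hdu : ∀ y ∈ ball z ρ, ∀ v, ‖fderiv ℝ û y v‖ ≤ 8 * K * s * ‖v‖ := by
    intro y hy v
    refine (norm_fderiv_le hK hs hy rfl v).trans ?_
    have h1 : Real.sqrt (1 + ∑ k, m.energyForm û y (stdE k) (stdE k)) ≤ 2 * s :=
      Real.sqrt_le_iff.2 ⟨by linarith, hf y hy⟩
    calc _ ≤ 4 * K * (2 * s) * ‖v‖ := by gcongr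
      _ = _ := by ring
  set d := ‖x - z‖ with hd
  have hd0 : 0 ≤ d := norm_nonneg _
  have hosc : ‖û x - û z‖ ≤ 8 * K * s * d := by
    refine (convex_ball z ρ).norm_image_sub_le_of_norm_fderiv_le (𝕜 := ℝ)
      (fun y hy => hs.differentiableAt hy) (fun y hy => ?_) hz hx
    exact ContinuousLinearMap.opNorm_le_bound _ (by positivity) (hdu y hy)
  have h0 := hs.dirac x hx
  have h1 : ∑ k, ∑ l, Ginv k l z • m.c k (û z) (m.P (û z) (fderiv ℝ û x (stdE l))) =
      ∑ k, ∑ l, ((Ginv k l z - Ginv k l x) • m.c k (û z) (m.P (û z) (fderiv ℝ û x (stdE l))) -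
        Ginv k l x • (((m.c k (û x)).comp (m.P (û x)) - (m.c k (û z)).comp (m.P (û z)))
          (fderiv ℝ û x (stdE l)))) := by
    rw [← sub_zero (∑ k, ∑ l, Ginv k l z • _), ← h0, ← Finset.sum_sub_distrib]
    refine Finset.sum_congr rfl fun k _ => ?_
    rw [← Finset.sum_sub_distrib]
    refine Finset.sum_congr rfl fun l _ => ?_
    rw [sub_apply, ContinuousLinearMap.comp_apply, ContinuousLinearMap.comp_apply]
    module
  rw [h1]
  have hterm : ∀ k l, ‖(Ginv k l z - Ginv k l x) •
      m.c k (û z) (m.P (û z) (fderiv ℝ û x (stdE l))) -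
        Ginv k l x • (((m.c k (û x)).comp (m.P (û x)) - (m.c k (û z)).comp (m.P (û z)))
          (fderiv ℝ û x (stdE l)))‖ ≤ 72 * Λ * K ^ 3 * s ^ 2 * d := by
    intro k l
    have hv : ‖fderiv ℝ û x (stdE l)‖ ≤ 8 * K * s := by simpa using hdu x hx (stdE l)
    have h2 : ‖m.c k (û z) (m.P (û z) (fderiv ℝ û x (stdE l)))‖ ≤ K * (K * (8 * K * s)) := by
      refine ((m.c k (û z)).le_of_opNorm_le (m.norm_c_le k _ (hs.mapsTo hz)) _).trans ?_
      gcongr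
      refine ((m.P (û z)).le_of_opNorm_le (m.norm_P_le _ (hs.mapsTo hz)) _).trans ?_
      gcongr
    have h3 : ‖((m.c k (û x)).comp (m.P (û x)) - (m.c k (û z)).comp (m.P (û z)))
        (fderiv ℝ û x (stdE l))‖ ≤ (K * (8 * K * s * d)) * (8 * K * s) := by
      refine (ContinuousLinearMap.le_of_opNorm_le _
        ((m.lipschitz k _ (hs.mapsTo hx) _ (hs.mapsTo hz)).trans
          (mul_le_mul_of_nonneg_left hosc hK0.le)) _).trans ?_
      gcongr
    have h4 := HG.lipschitz_inv k l z (hzD hz) x (hzD hx)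
    rw [norm_sub_rev] at h4
    have h5 := HG.abs_inv_le k l x (hzD hx)
    refine (norm_sub_le _ _).trans ?_
    rw [norm_smul, norm_smul, Real.norm_eq_abs, Real.norm_eq_abs]
    calc _ ≤ Λ * d * (K * (K * (8 * K * s))) + Λ * ((K * (8 * K * s * d)) * (8 * K * s)) := by
          gcongr
      _ = 8 * Λ * K ^ 3 * d * s * 1 + 64 * Λ * K ^ 3 * s ^ 2 * d := by ring
      _ ≤ 8 * Λ * K ^ 3 * d * s * s + 64 * Λ * K ^ 3 * s ^ 2 * d := by gcongr
      _ = _ := by ring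
  calc _ ≤ ∑ k, ‖∑ l, ((Ginv k l z - Ginv k l x) •
      m.c k (û z) (m.P (û z) (fderiv ℝ û x (stdE l))) -
        Ginv k l x • (((m.c k (û x)).comp (m.P (û x)) - (m.c k (û z)).comp (m.P (û z)))
          (fderiv ℝ û x (stdE l))))‖ := norm_sum_le _ _
    _ ≤ ∑ _k : Fin 3, ∑ _l : Fin 3, 72 * Λ * K ^ 3 * s ^ 2 * d :=
        Finset.sum_le_sum fun k _ => (norm_sum_le _ _).trans
          (Finset.sum_le_sum fun l _ => hterm k l)
    _ = _ := by simp; ring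

end LocalModel

namespace IsDiracSection

/-- The covariant derivative at the centre of a ball is controlled by the mean of the square root
of the density. -/
lemma exists_cov_le (F : Type*) [NormedAddCommGroup F] [NormedSpace ℝ F] [CompleteSpace F]
    (hK : 1 ≤ K) (hΛ : 1 ≤ Λ) : ∃ a > 0,
    ∀ {D : Set E3} {G Ginv : Fin 3 → Fin 3 → E3 → ℝ} {m : LocalModel F G Ginv K} {û : E3 → F},
      BaseMetric D G Ginv Λ → ∀ {z ρ s}, 0 < ρ → ball z ρ ⊆ D → m.IsSection (ball z ρ) û → 1 ≤ s →
      (∀ x ∈ ball z ρ, 1 + ∑ k, m.energyForm û x (stdE k) (stdE k) ≤ (2 * s) ^ 2) →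
      ∀ {A : Fin 3 → E3} {L : E3 ≃L[ℝ] E3} {M : ℝ}, 1 ≤ M →
      (∀ i j, ∑ k, ∑ l, G k l z * (A i k * A j l) = if i = j then 1 else 0) →
      (∀ k l, ∑ i, A i k * A i l = Ginv k l z) → (∀ i, ‖A i‖ ≤ 2 * Λ) →
      (∀ y, L y = ∑ i, y i • A i) → (∀ y, ‖L y‖ ≤ M * ‖y‖) →
      ∀ k, ‖m.cov û z (A k)‖ ≤ a * ((ρ / (2 * M))⁻¹ ^ 3 * ∫ y in ball 0 (ρ / (2 * M)),
        Real.sqrt (1 + ∑ k, m.energyForm û (z + L y) (stdE k) (stdE k))) + a * (ρ * s ^ 2) := by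
  have hK0 : 0 < K := by linarith
  have hΛ0 : 0 < Λ := by linarith
  obtain ⟨C, hC, hgrad⟩ := exists_gradient_estimate (F := F) (K := 6 * K * Λ * K) (by positivity)
  refine ⟨C * (324 * K ^ 3 * Λ), by positivity, ?_⟩
  intro D G Ginv m û HG z ρ s hρ hzD hs hs1 hf A L M hM hA hA' hAn hL hLM k
  have hM0 : 0 < M := by linarith
  have hz : z ∈ ball z ρ := mem_ball_self hρ
  have hzW := hs.mapsTo hz
  set r := ρ / (2 * M) with hr
  have hr0 : 0 < r := by positivity
  have hrR : r < ρ / M := by rw [hr]; gcongr; linarith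
  have hball : ∀ y ∈ ball (0 : E3) (ρ / M), z + L y ∈ ball z ρ := by
    intro y hy
    rw [mem_ball_zero_iff] at hy
    rw [mem_ball, dist_eq_norm, add_sub_cancel_left]
    calc ‖L y‖ ≤ M * ‖y‖ := hLM y
      _ < M * (ρ / M) := by gcongr
      _ = ρ := by field_simp
  have hLstd : ∀ k, L (stdE k) = A k := by
    intro k
    rw [hL]
    simp
  set P₀ := m.P (û z) with hP₀
  set c₀ : Fin 3 → F →L[ℝ] F := fun i => m.c i (û z) with hc₀
  set J : Fin 3 → F →L[ℝ] F := fun i => (action c₀ (A i)).comp P₀ with hJ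
  set w : E3 → F := fun y => P₀ (û (z + L y)) with hw
  have hfd : ∀ y ∈ ball (0 : E3) (ρ / M), HasFDerivAt w
      (P₀.comp ((fderiv ℝ û (z + L y)).comp (L : E3 →L[ℝ] E3))) y := by
    intro y hy
    exact P₀.hasFDerivAt.comp y ((hs.differentiableAt (hball y hy)).hasFDerivAt.comp y
      ((L : E3 →L[ℝ] E3).hasFDerivAt.const_add z))
  have hfd' : ∀ y ∈ ball (0 : E3) (ρ / M), ∀ k, fderiv ℝ w y (stdE k) =
      P₀ (fderiv ℝ û (z + L y) (A k)) := by
    intro y hy k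
    rw [(hfd y hy).fderiv, ← hLstd k]; rfl
  have hker : ∀ ξ, P₀ ξ ∈ LinearMap.ker (fderiv ℝ m.prj (û z)).toLinearMap := fun ξ =>
    m.vert_P _ hzW ξ
  have hPid : ∀ v ∈ LinearMap.ker (fderiv ℝ m.prj (û z)).toLinearMap, P₀ v = v := fun v hv =>
    m.P_vert _ hzW v hv
  have H := (m.triple _ hzW).change_frame A
  have hwd : ContDiffOn ℝ 2 w (ball 0 (ρ / M)) := by
    refine P₀.contDiff.comp_contDiffOn ((hs.contDiffOn.of_le two_le_infty).comp
      (contDiff_const.add L.contDiff).contDiffOn hball)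
  have hJn : ∀ i, ‖J i‖ ≤ 6 * K * Λ * K := by
    intro i
    refine (ContinuousLinearMap.opNorm_comp_le _ _).trans ?_
    have h1 := norm_action_le (c := c₀) (fun i => m.norm_c_le i _ hzW) (A i)
    have h2 : ‖action c₀ (A i)‖ ≤ 6 * K * Λ := by
      refine h1.trans ?_
      calc 3 * K * ‖A i‖ ≤ 3 * K * (2 * Λ) := by gcongr; exact hAn i
        _ = _ := by ring
    have := m.norm_P_le _ hzW
    gcongr
  have hcliff : ∀ i j k, ∀ y ∈ ball (0 : E3) (ρ / M), J i (J j (fderiv ℝ w y (stdE k))) +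
      J j (J i (fderiv ℝ w y (stdE k))) = if i = j then (-2 : ℝ) • fderiv ℝ w y (stdE k) else 0 := by
    intro i j k y hy
    rw [hfd' y hy k]
    set v := P₀ (fderiv ℝ û (z + L y) (A k))
    have hv : v ∈ LinearMap.ker (fderiv ℝ m.prj (û z)).toLinearMap := hker _
    have e : ∀ i j, J i (J j v) = action c₀ (A i) (action c₀ (A j) v) := by
      intro i j
      simp only [hJ, ContinuousLinearMap.comp_apply, hPid v hv]
      rw [hPid _ (H.mem j v hv)]
    rw [e, e, H.clifford i j v hv, hs.proj z hz, hA]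
    split_ifs <;> simp
  have hdirac : ∀ y ∈ ball (0 : E3) (ρ / M), ‖∑ i, J i (fderiv ℝ w y (stdE i))‖ ≤
      648 * Λ * K ^ 3 * s ^ 2 * M * ‖y‖ := by
    intro y hy
    have e : ∑ i, J i (fderiv ℝ w y (stdE i)) =
        ∑ i, action c₀ (A i) ((P₀.comp (fderiv ℝ û (z + L y))) (A i)) := by
      refine Finset.sum_congr rfl fun i _ => ?_
      rw [hfd' y hy i]
      simp only [hJ, ContinuousLinearMap.comp_apply, hPid _ (hker _)]
    rw [e, LocalModel.sum_action]
    simp only [hA']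
    refine (LocalModel.frozen_dirac_le hK hΛ HG hρ hzD hs hs1 hf (hball y hy)).trans ?_
    rw [add_sub_cancel_left]
    calc _ ≤ 648 * Λ * K ^ 3 * s ^ 2 * (M * ‖y‖) := by gcongr; exact hLM y
      _ = _ := by ring
  have key := hgrad hr0 hrR (by positivity) hJn hwd hcliff hdirac k
  have h0 : (0 : E3) ∈ ball (0 : E3) (ρ / M) := mem_ball_self (by positivity)
  rw [hfd' 0 h0 k, map_zero, add_zero] at key
  have hsqc : ContinuousOn (fun y => Real.sqrt (1 + ∑ k, m.energyForm û (z + L y) (stdE k) (stdE k)))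
      (closedBall 0 r) := by
    refine ContinuousOn.sqrt (continuousOn_const.add (continuousOn_finsetSum _ fun k _ => ?_))
    intro y hy
    have hc : ContinuousAt (fun x => m.energyForm û x (stdE k) (stdE k)) (z + L y) :=
      (LocalModel.contDiffAt_energyForm hs (hball y (closedBall_subset_ball hrR hy)) _ _).continuousAt
    exact (ContinuousAt.comp (g := fun x => m.energyForm û x (stdE k) (stdE k))
      (f := fun y => z + L y) hc (continuous_const.add L.continuous).continuousAt).continuousWithinAt
  have hint : ∫ y in ball 0 r, ‖fderiv ℝ w y (stdE k)‖ ≤ 8 * K ^ 2 * Λ * ∫ y in ball 0 r,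
      Real.sqrt (1 + ∑ k, m.energyForm û (z + L y) (stdE k) (stdE k)) := by
    rw [← integral_const_mul]
    have hcw : ContinuousOn (fun y => ‖fderiv ℝ w y (stdE k)‖) (closedBall 0 r) := by
      have := (hwd.continuousOn_fderiv_of_isOpen isOpen_ball (by norm_num)).mono
        (closedBall_subset_ball hrR)
      exact (this.clm_apply continuousOn_const).norm
    refine setIntegral_mono_on
      ((hcw.integrableOn_compact (isCompact_closedBall _ _)).mono_set ball_subset_closedBall)
      (((hsqc.integrableOn_compact (isCompact_closedBall _ _)).mono_set
        ball_subset_closedBall).const_mul _) measurableSet_ball fun y hy => ?_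
    have hy' := ball_subset_ball hrR.le hy
    rw [hfd' y hy' k]
    refine (P₀.le_of_opNorm_le (m.norm_P_le _ hzW) _).trans ?_
    have h1 := LocalModel.norm_fderiv_le hK hs (hball y hy') rfl (A k)
    calc _ ≤ K * (4 * K * Real.sqrt (1 + ∑ k, m.energyForm û (z + L y) (stdE k) (stdE k)) *
          (2 * Λ)) := by
          refine mul_le_mul_of_nonneg_left (h1.trans ?_) hK0.le
          gcongr
          exact hAn k
      _ = _ := by ring
  set X := ∫ y in ball 0 r, Real.sqrt (1 + ∑ k, m.energyForm û (z + L y) (stdE k) (stdE k)) with hX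
  have hX0 : 0 ≤ X := integral_nonneg fun y => Real.sqrt_nonneg _
  refine (show ‖m.cov û z (A k)‖ ≤ _ from key).trans ?_
  refine add_le_add ?_ ?_
  · calc _ ≤ C * (r⁻¹ ^ 3 * (8 * K ^ 2 * Λ * X)) := by gcongr
      _ = C * (8 * (K ^ 2 * Λ)) * (r⁻¹ ^ 3 * X) := by ring
      _ ≤ C * (324 * (K ^ 3 * Λ)) * (r⁻¹ ^ 3 * X) := by
          gcongr
          · norm_num
          · norm_num
      _ = _ := by ring
  · apply le_of_eq
    rw [hr]; field_simp; norm_num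

end IsDiracSection

end

section

variable {K Λ : ℝ}

lemma mul_le_weighted_sq {μ s t : ℝ} (hμ : 0 < μ) (hs : 0 ≤ s) (ht : 0 ≤ t) :
    s * t ≤ μ * s ^ 2 + μ⁻¹ * t ^ 2 := by
  have h3 : 0 ≤ μ * (s - μ⁻¹ * t) ^ 2 := by positivity
  have h4 : μ * (s - μ⁻¹ * t) ^ 2 = μ * s ^ 2 - 2 * (s * t) + μ⁻¹ * t ^ 2 := by
    field_simp
    ring
  have h5 : 0 ≤ s * t := mul_nonneg hs ht
  linarith

namespace IsDiracSection

set_option maxHeartbeats 1600000 in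
/-- The mean value inequality: on a ball that is small in comparison with the size of the
derivative, the density at the centre is controlled by its mean. -/
lemma exists_mean_value (F : Type*) [NormedAddCommGroup F] [NormedSpace ℝ F] [CompleteSpace F]
    (hK : 1 ≤ K) (hΛ : 1 ≤ Λ) {δ₀ : ℝ} (hδ₀ : 0 < δ₀) : ∃ B > 0, ∃ δ > 0,
    ∀ {D : Set E3} {G Ginv : Fin 3 → Fin 3 → E3 → ℝ} {α : E3 → E3 → E3 → ℝ}
      {β : E3 → E3 → E3 → E3 → E3 → ℝ},
      BaseMetric D G Ginv Λ → IsDiracSection F D G Ginv K δ₀ α β → ∀ z ρ, 0 < ρ → ball z ρ ⊆ D →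
      (∀ x ∈ ball z ρ, density α x ≤ 4 * density α z) → ρ ^ 2 * density α z ≤ δ ^ 2 →
      density α z ≤ B * (ρ⁻¹ ^ 3 * ∫ x in ball z (ρ / 2), density α x) := by
  have hK0 : 0 < K := by linarith
  have hΛ0 : 0 < Λ := by linarith
  obtain ⟨a, ha, hcov⟩ := exists_cov_le F hK hΛ
  set M := 54 * Λ ^ 2 with hM
  have hM1 : 1 ≤ M := by nlinarith
  have hM0 : 0 < M := by linarith
  set C₁ := 1 + 27 * K ^ 3 * M ^ 2 with hC₁
  have hC₁1 : 1 ≤ C₁ := by rw [hC₁]; linarith [show 0 ≤ 27 * K ^ 3 * M ^ 2 by positivity]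
  set V := volume.real (ball (0 : E3) 1) with hV
  have hV0 : 0 < V :=
    ENNReal.toReal_pos (measure_ball_pos volume 0 one_pos).ne' measure_ball_lt_top.ne
  set C₄ := C₁ * (1 / V + 3 * K * a) with hC₄
  have hC₄0 : 0 < C₄ := by positivity
  refine ⟨64 * C₄ ^ 2 * V * M ^ 6, by positivity, min δ₀ (1 / (4 * C₄)), lt_min hδ₀ (by positivity),
    ?_⟩
  intro D G Ginv α β HG H z ρ hρ hzD hf4 hρf
  have hz : z ∈ ball z ρ := mem_ball_self hρ
  obtain ⟨A, L, hA, hA', hAn, hL, hLM, hLM'⟩ := HG.exists_linear_coordinates hΛ (hzD hz)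
  rw [← hM] at hLM hLM'
  set f₀ := density α z with hf₀
  have hf₀1 : 1 ≤ f₀ := H.one_le_density hK (hzD hz)
  set s := Real.sqrt f₀ with hs
  have hs1 : 1 ≤ s := Real.one_le_sqrt.2 hf₀1
  have hs2 : s ^ 2 = f₀ := Real.sq_sqrt (by linarith)
  have hδle : min δ₀ (1 / (4 * C₄)) ^ 2 ≤ δ₀ ^ 2 := by
    have h1 : 0 < min δ₀ (1 / (4 * C₄)) := lt_min hδ₀ (by positivity)
    exact pow_le_pow_left₀ h1.le (min_le_left _ _) 2
  have hρs : 4 * C₄ * (ρ * s) ≤ 1 := by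
    have h1 : (ρ * s) ^ 2 ≤ min δ₀ (1 / (4 * C₄)) ^ 2 := by rw [mul_pow, hs2]; exact hρf
    have h2 := abs_le_of_sq_le_sq' h1 (le_min hδ₀.le (by positivity)) |>.2
    have h3 := h2.trans (min_le_right _ _)
    rwa [le_div_iff₀ (by positivity), mul_comm] at h3
  obtain ⟨m, û, hsec, hα⟩ := H.exists_model_ball z ρ hρ hzD hf4 (hρf.trans hδle)
  have hdens : ∀ x ∈ ball z ρ, 1 + ∑ k, m.energyForm û x (stdE k) (stdE k) = density α x :=
    fun x hx => (density_eq (hα x hx)).symm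
  set r := ρ / (2 * M) with hr
  have hr0 : 0 < r := by positivity
  have hMr : M * r = ρ / 2 := by rw [hr]; field_simp
  have hball : ∀ y ∈ closedBall (0 : E3) r, z + L y ∈ ball z ρ := by
    intro y hy
    rw [mem_closedBall_zero_iff] at hy
    rw [mem_ball, dist_eq_norm, add_sub_cancel_left]
    calc ‖L y‖ ≤ M * ‖y‖ := hLM y
      _ ≤ M * r := by gcongr
      _ < ρ := by rw [hMr]; linarith
  have hNk := fun k => hcov HG hρ hzD hsec hs1 (fun x hx => by
    rw [hdens x hx]
    have := hf4 x hx
    rw [mul_pow, hs2]; linarith) hM1 hA hA' hAn hL hLM k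
  set X := r⁻¹ ^ 3 * ∫ y in ball 0 r,
    Real.sqrt (1 + ∑ k, m.energyForm û (z + L y) (stdE k) (stdE k)) with hX
  have hXeq : X = r⁻¹ ^ 3 * ∫ y in ball 0 r, Real.sqrt (density α (z + L y)) := by
    rw [hX]
    congr 1
    refine setIntegral_congr_fun measurableSet_ball fun y hy => ?_
    simp only [hdens _ (hball y (ball_subset_closedBall hy))]
  rw [hs2] at hNk
  have hfc : ContinuousOn (fun y => density α (z + L y)) (closedBall 0 r) :=
    H.continuousOn_density.comp (continuous_const.add L.continuous).continuousOn
      fun y hy => hzD (hball y hy)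
  have hfi : IntegrableOn (fun y => density α (z + L y)) (ball 0 r) :=
    (hfc.integrableOn_compact (isCompact_closedBall _ _)).mono_set ball_subset_closedBall
  have hsi : IntegrableOn (fun y => Real.sqrt (density α (z + L y))) (ball 0 r) :=
    (hfc.sqrt.integrableOn_compact (isCompact_closedBall _ _)).mono_set ball_subset_closedBall
  have hf1 : ∀ y ∈ ball (0 : E3) r, 1 ≤ density α (z + L y) := fun y hy =>
    H.one_le_density hK (hzD (hball y (ball_subset_closedBall hy)))
  have hvol : volume.real (ball (0 : E3) r) = r ^ 3 * V := by
    rw [measureReal_def, Measure.addHaar_ball_of_pos _ _ hr0, ENNReal.toReal_mul,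
      ENNReal.toReal_ofReal (by positivity), hV, measureReal_def]
    simp
  have hconst : ∀ c : ℝ, ∫ _y in ball (0 : E3) r, c = r ^ 3 * V * c := fun c => by
    rw [setIntegral_const, hvol, smul_eq_mul]
  have hci : ∀ c : ℝ, IntegrableOn (fun _ : E3 => c) (ball 0 r) := fun c =>
    integrableOn_const measure_ball_lt_top.ne
  have hVX : V ≤ X := by
    have h1 : ∫ _y in ball (0 : E3) r, (1 : ℝ) ≤
        ∫ y in ball 0 r, Real.sqrt (density α (z + L y)) :=
      setIntegral_mono_on (hci 1) hsi measurableSet_ball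
        fun y hy => Real.one_le_sqrt.2 (hf1 y hy)
    rw [hconst, mul_one] at h1
    rw [hXeq]
    calc V = r⁻¹ ^ 3 * (r ^ 3 * V) := by field_simp
      _ ≤ _ := by gcongr
  have hX0 : 0 < X := hV0.trans_le hVX
  -- the pointwise bound of the density in terms of the mean of its square root
  have hsX : s ≤ C₄ * (X + ρ * f₀) := by
    refine abs_le_of_sq_le_sq' ?_ (by positivity) |>.2
    rw [hs2]
    have h1 := (H.density_comparison hK (M := M) (fun i => (hAn i).trans (by nlinarith)) hL hLM'
      (hzD hz)).1
    have hN2 : ∀ i, α z (A i) (A i) ≤ K * (a * X + a * (ρ * f₀)) ^ 2 := by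
      intro i
      rw [hα z hz]
      refine ((le_abs_self _).trans (CliffordTriple.abs_form_le
        (m.norm_h_le _ (hsec.mapsTo hz)) _ _)).trans ?_
      rw [sq]
      exact mul_le_mul_of_nonneg_left (mul_self_le_mul_self (norm_nonneg _) (hNk i)) hK0.le
    have h2 := Finset.sum_le_sum fun i (_ : i ∈ Finset.univ) => hN2 i
    simp only [Finset.sum_const, Finset.card_univ, Fintype.card_fin, nsmul_eq_mul] at h2
    push_cast at h2
    set Z := X + ρ * f₀ with hZ
    have hZX : X ≤ Z := by
      have : 0 ≤ ρ * f₀ := by positivity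
      linarith
    have hZ0 : 0 < Z := hX0.trans_le hZX
    have h3 : 1 ≤ (Z / V) ^ 2 := by
      refine one_le_pow₀ ?_
      rw [one_le_div hV0]; exact hVX.trans hZX
    have h4 : 3 * (K * (a * X + a * (ρ * f₀)) ^ 2) ≤ (3 * K * a * Z) ^ 2 := by
      have : a * X + a * (ρ * f₀) = a * Z := by rw [hZ]; ring
      rw [this]
      have h5 : 0 ≤ (a * Z) ^ 2 := by positivity
      have h6 : 3 * K ≤ (3 * K) ^ 2 := by nlinarith
      calc _ = 3 * K * (a * Z) ^ 2 := by ring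
        _ ≤ (3 * K) ^ 2 * (a * Z) ^ 2 := by gcongr
        _ = _ := by ring
    have h7 : (Z / V) ^ 2 + (3 * K * a * Z) ^ 2 ≤ (Z / V + 3 * K * a * Z) ^ 2 := by
      have hZV : 0 ≤ Z / V := (div_pos hZ0 hV0).le
      have h8 : 0 ≤ 3 * K * a * Z := mul_nonneg (by positivity) hZ0.le
      have h9 := mul_nonneg hZV h8
      have h10 := add_sq (Z / V) (3 * K * a * Z)
      rw [mul_assoc 2 (Z / V)] at h10
      linarith
    calc f₀ ≤ C₁ * (1 + ∑ i, α z (A i) (A i)) := h1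
      _ ≤ C₁ * (Z / V + 3 * K * a * Z) ^ 2 :=
          mul_le_mul_of_nonneg_left (by linarith) (by linarith)
      _ ≤ C₁ ^ 2 * (Z / V + 3 * K * a * Z) ^ 2 :=
          mul_le_mul_of_nonneg_right (le_self_pow₀ hC₁1 two_ne_zero) (sq_nonneg _)
      _ = (C₄ * Z) ^ 2 := by rw [hC₄]; ring
  set Y := r⁻¹ ^ 3 * ∫ y in ball 0 r, density α (z + L y) with hY
  -- weighted arithmetic-geometric mean inequality, with the weight chosen for absorption
  have hsXY : s * X ≤ f₀ / (4 * C₄) + 4 * C₄ * V * Y := by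
    set μ := 1 / (4 * C₄ * V) with hμ
    have hμ0 : 0 < μ := by positivity
    have h1 : ∀ y ∈ ball (0 : E3) r, s * Real.sqrt (density α (z + L y)) ≤
        μ * f₀ + μ⁻¹ * density α (z + L y) := by
      intro y hy
      have h2 : Real.sqrt (density α (z + L y)) ^ 2 = density α (z + L y) :=
        Real.sq_sqrt (by linarith [hf1 y hy])
      have h3 := mul_le_weighted_sq hμ0 (show 0 ≤ s by linarith)
        (Real.sqrt_nonneg (density α (z + L y)))
      rwa [hs2, h2] at h3
    have h2 := setIntegral_mono_on (hsi.const_mul s) ((hci (μ * f₀)).add (hfi.const_mul μ⁻¹))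
      measurableSet_ball h1
    rw [integral_const_mul] at h2
    have h3 : ∫ y in ball (0 : E3) r,
        ((fun _ : E3 => μ * f₀) + fun y : E3 => μ⁻¹ * density α (z + L y)) y =
        r ^ 3 * V * (μ * f₀) + μ⁻¹ * ∫ y in ball 0 r, density α (z + L y) := by
      rw [integral_add' (hci (μ * f₀)) (hfi.const_mul μ⁻¹), hconst, integral_const_mul]
    rw [h3] at h2
    have h4 := mul_le_mul_of_nonneg_left h2 (show 0 ≤ r⁻¹ ^ 3 by positivity)
    rw [hXeq]
    calc _ = r⁻¹ ^ 3 * (s * ∫ y in ball 0 r, Real.sqrt (density α (z + L y))) := by ring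
      _ ≤ _ := h4
      _ = _ := by rw [hμ, hY]; field_simp
  have hfY : f₀ ≤ 8 * C₄ ^ 2 * V * Y := by
    have h1 : f₀ ≤ C₄ * (s * X) + C₄ * (ρ * s) * f₀ := by
      have := mul_le_mul_of_nonneg_left hsX (show 0 ≤ s by linarith)
      have e : s * s = f₀ := by rw [← sq]; exact hs2
      rw [e] at this
      linarith
    have h2 : C₄ * (s * X) ≤ f₀ / 4 + 4 * C₄ ^ 2 * V * Y := by
      calc _ ≤ C₄ * (f₀ / (4 * C₄) + 4 * C₄ * V * Y) := by gcongr
        _ = _ := by field_simp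
    have h3 : C₄ * (ρ * s) * f₀ ≤ 1 / 4 * f₀ := by gcongr; linarith
    linarith
  have hYle : Y ≤ 8 * M ^ 6 * (ρ⁻¹ ^ 3 * ∫ x in ball z (ρ / 2), density α x) := by
    have hsub : ball z (M * r) ⊆ D := by
      rw [hMr]; exact (ball_subset_ball (by linarith)).trans hzD
    have hint : IntegrableOn (density α) (ball z (M * r)) := by
      rw [hMr]; exact H.integrableOn_density (by linarith) hzD
    have h1 := setIntegral_ball_comp_affine_le (g := density α) L (z := z) (M := M)
      (ρ := r) hM0 hLM hLM'
      (fun x hx => zero_le_one.trans (H.one_le_density hK (hsub hx))) hint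
    rw [hMr] at h1
    calc Y ≤ r⁻¹ ^ 3 * (M ^ 3 * ∫ x in ball z (ρ / 2), density α x) := by rw [hY]; gcongr
      _ = _ := by rw [hr]; field_simp; ring
  calc f₀ ≤ 8 * C₄ ^ 2 * V * Y := hfY
    _ ≤ 8 * C₄ ^ 2 * V * (8 * M ^ 6 * (ρ⁻¹ ^ 3 * ∫ x in ball z (ρ / 2), density α x)) := by gcongr
    _ = _ := by ring

/-- `ε`-regularity in coordinates. -/
theorem exists_epsilon_regularity (F : Type*) [NormedAddCommGroup F] [NormedSpace ℝ F]
    [CompleteSpace F] (hK : 1 ≤ K) (hΛ : 1 ≤ Λ) {δ₀ : ℝ} (hδ₀ : 0 < δ₀) :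
    ∃ ε > 0, ∃ C > 0, ∃ R₁ > 0,
    ∀ {D : Set E3} {G Ginv : Fin 3 → Fin 3 → E3 → ℝ} {α : E3 → E3 → E3 → ℝ}
      {β : E3 → E3 → E3 → E3 → E3 → ℝ},
      BaseMetric D G Ginv Λ → IsDiracSection F D G Ginv K δ₀ α β → ∀ y R, 0 < R → R ≤ R₁ →
      closedBall y (2 * R) ⊆ D → R⁻¹ * ∫ x in ball y (2 * R), density α x ≤ ε →
      R ^ 2 * density α y ≤ C * (R⁻¹ * ∫ x in ball y (2 * R), density α x) := by
  obtain ⟨A, hA, R₁, hR₁, θ, hθ, hθ1, hmono⟩ := exists_monotonicity F hK hΛ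
  obtain ⟨B, hB, δ, hδ, hmean⟩ := exists_mean_value F hK hΛ hδ₀
  refine ⟨δ ^ 2 / (2 * (B * A)), by positivity, 4 * (B * A) / θ ^ 2, by positivity, R₁, hR₁, ?_⟩
  intro D G Ginv α β HG H y R hR hRR₁ hD hI
  set I := R⁻¹ * ∫ x in ball y (2 * R), density α x with hIdef
  have hint : IntegrableOn (density α) (ball y (2 * R)) :=
    ((H.continuousOn_density.mono hD).integrableOn_compact
      (isCompact_closedBall y (2 * R))).mono_set ball_subset_closedBall
  have hsub1 : ball y (2 * R) ⊆ D := ball_subset_closedBall.trans hD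
  have hf0 : ∀ x ∈ D, 0 < density α x := fun x hx =>
    zero_lt_one.trans_le (H.one_le_density hK hx)
  have hyR : closedBall y R ⊆ D := (closedBall_subset_closedBall (by linarith)).trans hD
  have hIle : B * (A * I) < δ ^ 2 := by
    have : B * (A * I) ≤ B * (A * (δ ^ 2 / (2 * (B * A)))) := by gcongr
    have e : B * (A * (δ ^ 2 / (2 * (B * A)))) = δ ^ 2 / 2 := by field_simp
    have : 0 < δ ^ 2 := by positivity
    linarith
  have := heinz_trick (f := density α) (y := y) (A := A) (I := I) hR hB.le hδ hθ hθ1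
    (H.continuousOn_density.mono hyR) (fun x hx => hf0 x (hyR hx)) ?_ ?_ hIle
  · refine this.trans (le_of_eq (by ring))
  · intro z hz ρ hρ hρR
    have hzR : ball z R ⊆ ball y (2 * R) := by
      refine ball_subset_ball' ?_
      rw [mem_ball] at hz; linarith
    refine (hmono HG H z R hR hRR₁ (hzR.trans hsub1) ρ hρ hρR).trans ?_
    rw [hIdef]
    refine mul_le_mul_of_nonneg_left (mul_le_mul_of_nonneg_left ?_ (by positivity)) hA.le
    refine setIntegral_mono_set hint ?_ ?_
    · filter_upwards [ae_restrict_mem measurableSet_ball] with x hx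
      exact (hf0 x (hsub1 hx)).le
    · exact ((ball_subset_ball (by linarith)).trans hzR).eventuallyLE
  · intro z hz ρ hρ hzy hf4 hρf
    have hzD : ball z ρ ⊆ D := hzy.trans (ball_subset_closedBall.trans hyR)
    have hint' : IntegrableOn (density α) (ball z ρ) :=
      hint.mono_set (hzy.trans (ball_subset_ball (by linarith)))
    refine (hmean HG H z ρ hρ hzD hf4 hρf).trans ?_
    refine mul_le_mul_of_nonneg_left (mul_le_mul_of_nonneg_left ?_ (by positivity)) hB.le
    refine setIntegral_mono_set hint' ?_ ?_
    · filter_upwards [ae_restrict_mem measurableSet_ball] with x hx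
      exact (hf0 x (hzD hx)).le
    · exact (ball_subset_ball (by linarith)).eventuallyLE

end IsDiracSection

end

/-! ### The Clifford relations and the removal of the perturbation -/

variable {n : ℕ} {M X : Type*} [EMetricSpace M]
  [ChartedSpace (EuclideanSpace ℝ (Fin 3)) M] [IsManifold (𝓡 3) ∞ M]
  [RiemannianBundle (fun x : M => TangentSpace (𝓡 3) x)]
  [TopologicalSpace X] [ChartedSpace (EuclideanSpace ℝ (Fin n)) X] [IsManifold (𝓡 n) ∞ X]

namespace HyperkahlerBundle

section Pointwise

variable (B : HyperkahlerBundle n M X) (e : X)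

/-- The complex structures of an orthonormal frame anticommute, square to `-1` and are
skew-symmetric. -/
lemma exists_orthonormal_clifford : ∃ v : OrthonormalBasis (Fin 3) ℝ (TangentSpace (𝓡 3) (B.proj e)),
    ∀ w : TangentSpace (𝓡 n) e, B.IsVertical w →
      (∀ i j, B.I e (v i) (B.I e (v j) w) + B.I e (v j) (B.I e (v i) w) =
        (-2 * if i = j then (1 : ℝ) else 0) • w) ∧
      ∀ w', B.IsVertical w' → ∀ i, B.metric e (B.I e (v i) w) w' =
        -B.metric e w (B.I e (v i) w') := by
  obtain ⟨v, hv⟩ := B.quaternionic (B.proj e)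
  have hv' := fun w w' => hv e rfl w w'
  have hI := fun i (w : TangentSpace (𝓡 n) e) (hw : B.IsVertical w) => B.I_vertical e (v i) w hw
  have hsq : ∀ i w, B.IsVertical w → B.I e (v i) (B.I e (v i) w) = -w := fun i w hw =>
    (hv' w w hw hw).1 i
  have h01 : ∀ w, B.IsVertical w → B.I e (v 0) (B.I e (v 1) w) = B.I e (v 2) w := fun w hw =>
    (hv' w w hw hw).2.1
  have h12 : ∀ w, B.IsVertical w → B.I e (v 1) (B.I e (v 2) w) = B.I e (v 0) w := by
    intro w hw
    have h1 := h01 _ (hI 2 w hw)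
    rw [hsq 2 w hw] at h1
    have h2 := congrArg (B.I e (v 0)) h1
    rw [hsq 0 _ (hI 1 _ (hI 2 w hw)), map_neg] at h2
    exact neg_injective h2
  have h20 : ∀ w, B.IsVertical w → B.I e (v 2) (B.I e (v 0) w) = B.I e (v 1) w := by
    intro w hw
    have h1 := h12 _ (hI 0 w hw)
    rw [hsq 0 w hw] at h1
    have h2 := congrArg (B.I e (v 1)) h1
    rw [hsq 1 _ (hI 2 _ (hI 0 w hw)), map_neg] at h2
    exact neg_injective h2
  have h10 : ∀ w, B.IsVertical w → B.I e (v 1) (B.I e (v 0) w) = -B.I e (v 2) w := by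
    intro w hw
    rw [← h20 _ (hI 0 w hw), hsq 0 w hw, map_neg]
  have h21 : ∀ w, B.IsVertical w → B.I e (v 2) (B.I e (v 1) w) = -B.I e (v 0) w := by
    intro w hw
    rw [← h01 _ (hI 1 w hw), hsq 1 w hw, map_neg]
  have h02 : ∀ w, B.IsVertical w → B.I e (v 0) (B.I e (v 2) w) = -B.I e (v 1) w := by
    intro w hw
    rw [← h12 _ (hI 2 w hw), hsq 2 w hw, map_neg]
  refine ⟨v, fun w hw => ⟨fun i j => ?_, fun w' hw' i => ?_⟩⟩
  · have a0 := hsq 0 w hw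
    have a1 := hsq 1 w hw
    have a2 := hsq 2 w hw
    have b0 := h01 w hw
    have b1 := h12 w hw
    have b2 := h20 w hw
    have c0 := h10 w hw
    have c1 := h21 w hw
    have c2 := h02 w hw
    fin_cases i <;> fin_cases j <;>
      simp only [Fin.zero_eta, Fin.mk_one, Fin.reduceFinMk, Fin.isValue, a0, a1, a2, b0, b1, b2,
        c0, c1, c2] <;> simp <;> module
  · have h1 := (hv' (B.I e (v i) w) w' (hI i w hw) hw').2.2 i
    rw [hsq i w hw] at h1
    rw [← h1, map_neg, neg_apply]

lemma I_expand (v : OrthonormalBasis (Fin 3) ℝ (TangentSpace (𝓡 3) (B.proj e)))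
    (ξ : TangentSpace (𝓡 3) (B.proj e)) (w : TangentSpace (𝓡 n) e) :
    B.I e ξ w = ∑ i, inner ℝ (v i) ξ • B.I e (v i) w := by
  conv_lhs => rw [← v.sum_repr' ξ]
  simp [map_sum]

/-- The Clifford relation for tangent vectors of the base. -/
lemma I_clifford (ξ η : TangentSpace (𝓡 3) (B.proj e)) {w : TangentSpace (𝓡 n) e}
    (hw : B.IsVertical w) :
    B.I e ξ (B.I e η w) + B.I e η (B.I e ξ w) = (-2 * inner ℝ ξ η) • w := by
  obtain ⟨v, hv⟩ := B.exists_orthonormal_clifford e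
  have key := (hv w hw).1
  have e1 : B.I e ξ (B.I e η w) + B.I e η (B.I e ξ w) = ∑ i, ∑ j, (inner ℝ (v i) ξ * inner ℝ (v j) η) •
      (B.I e (v i) (B.I e (v j) w) + B.I e (v j) (B.I e (v i) w)) := by
    rw [B.I_expand e v ξ (B.I e η w), B.I_expand e v ξ w, B.I_expand e v η w]
    rw [B.I_expand e v η]
    simp only [Fin.sum_univ_three, map_add, map_smul]
    module
  rw [e1]
  simp only [key, ← v.sum_inner_mul_inner ξ η, Fin.sum_univ_three]
  simp [real_inner_comm]
  module

lemma I_skew (ξ : TangentSpace (𝓡 3) (B.proj e)) {w w' : TangentSpace (𝓡 n) e}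
    (hw : B.IsVertical w) (hw' : B.IsVertical w') :
    B.metric e (B.I e ξ w) w' = -B.metric e w (B.I e ξ w') := by
  obtain ⟨v, hv⟩ := B.exists_orthonormal_clifford e
  have key := (hv w hw).2 w' hw'
  rw [B.I_expand e v ξ w, B.I_expand e v ξ w']
  simp only [map_sum, map_smul, sum_apply, smul_apply, key, smul_eq_mul, Finset.sum_neg_distrib,
    mul_neg]

end Pointwise

variable {B : HyperkahlerBundle n M X}

/-- The projection onto the vertical tangent space of the connection that is modified so as to
absorb the perturbation `p`: the vertical part of `w` is increased by `⅓ I(dproj w) p`. -/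
def Connection.perturbedVert (A : B.Connection) (p : B.VerticalField) (e : X) :
    TangentSpace (𝓡 n) e →L[ℝ] TangentSpace (𝓡 n) e :=
  let J : EuclideanSpace ℝ (Fin n) →L[ℝ] EuclideanSpace ℝ (Fin n) →L[ℝ] EuclideanSpace ℝ (Fin n) :=
    (B.I e).comp (mfderiv (𝓡 n) (𝓡 3) B.proj e)
  let P : EuclideanSpace ℝ (Fin n) →L[ℝ] EuclideanSpace ℝ (Fin n) := A.vert e
  P + (1 / 3 : ℝ) • J.flip (p.toFun e)

namespace Connection

variable (A : B.Connection) (p : B.VerticalField)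

lemma perturbedVert_apply (e : X) (w : TangentSpace (𝓡 n) e) : A.perturbedVert p e w =
    A.vert e w + (1 / 3 : ℝ) • B.I e (mfderiv (𝓡 n) (𝓡 3) B.proj e w) (p.toFun e) := rfl

lemma isVertical_perturbedVert (e : X) (w : TangentSpace (𝓡 n) e) :
    B.IsVertical (A.perturbedVert p e w) := by
  have h1 := A.isVertical_vert e w
  have h2 := B.I_vertical e (mfderiv (𝓡 n) (𝓡 3) B.proj e w) _ (p.isVertical e)
  unfold IsVertical at h1 ⊢
  rw [perturbedVert_apply, map_add, map_smul, h1, h2, smul_zero, add_zero]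

lemma perturbedVert_of_isVertical (e : X) (w : TangentSpace (𝓡 n) e) (hw : B.IsVertical w) :
    A.perturbedVert p e w = w := by
  rw [perturbedVert_apply, A.vert_of_isVertical e w hw,
    show mfderiv (𝓡 n) (𝓡 3) B.proj e w = 0 from hw]
  simp

end Connection

end HyperkahlerBundle

/-! ### Tangent vectors in charts -/

section Charts

variable {m : ℕ} {N : Type*} [TopologicalSpace N] [ChartedSpace (EuclideanSpace ℝ (Fin m)) N]
  [IsManifold (𝓡 m) ∞ N]

/-- The coordinates of tangent vectors at `x` in the chart at `x₀`. -/
def tangentCoord (x₀ x : N) : TangentSpace (𝓡 m) x →L[ℝ] EuclideanSpace ℝ (Fin m) :=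
  (trivializationAt (EuclideanSpace ℝ (Fin m)) (TangentSpace (𝓡 m) : N → Type _)
    x₀).continuousLinearMapAt ℝ x

/-- The tangent vector at `x` with given coordinates in the chart at `x₀`. -/
def tangentCoordSymm (x₀ x : N) : EuclideanSpace ℝ (Fin m) →L[ℝ] TangentSpace (𝓡 m) x :=
  (trivializationAt (EuclideanSpace ℝ (Fin m)) (TangentSpace (𝓡 m) : N → Type _) x₀).symmL ℝ x

variable {x₀ x : N}

lemma mem_baseSet_of_mem_source (hx : x ∈ (chartAt (EuclideanSpace ℝ (Fin m)) x₀).source) :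
    x ∈ (trivializationAt (EuclideanSpace ℝ (Fin m)) (TangentSpace (𝓡 m) : N → Type _)
      x₀).baseSet := hx

@[simp]
lemma tangentCoord_symm (hx : x ∈ (chartAt (EuclideanSpace ℝ (Fin m)) x₀).source)
    (v : EuclideanSpace ℝ (Fin m)) : tangentCoord x₀ x (tangentCoordSymm x₀ x v) = v :=
  Trivialization.continuousLinearMapAt_symmL _ (mem_baseSet_of_mem_source hx) v

@[simp]
lemma tangentCoordSymm_coord (hx : x ∈ (chartAt (EuclideanSpace ℝ (Fin m)) x₀).source)
    (v : TangentSpace (𝓡 m) x) : tangentCoordSymm x₀ x (tangentCoord x₀ x v) = v :=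
  Trivialization.symmL_continuousLinearMapAt _ (mem_baseSet_of_mem_source hx) v

lemma hasMFDerivAt_chartAt (hx : x ∈ (chartAt (EuclideanSpace ℝ (Fin m)) x₀).source) :
    HasMFDerivAt (𝓡 m) (𝓡 m) (chartAt (EuclideanSpace ℝ (Fin m)) x₀) x (tangentCoord x₀ x) := by
  have h : MDifferentiableAt (𝓡 m) (𝓡 m) (extChartAt (𝓡 m) x₀) x :=
    mdifferentiableAt_extChartAt hx
  have h2 := h.hasMFDerivAt
  rw [← TangentBundle.continuousLinearMapAt_trivializationAt hx] at h2
  exact h2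

lemma hasMFDerivAt_chartAt_symm (hx : x ∈ (chartAt (EuclideanSpace ℝ (Fin m)) x₀).source) :
    HasMFDerivAt (𝓡 m) (𝓡 m) (chartAt (EuclideanSpace ℝ (Fin m)) x₀).symm
      (chartAt (EuclideanSpace ℝ (Fin m)) x₀ x) (tangentCoordSymm x₀ x) := by
  have h := mdifferentiableWithinAt_extChartAt_symm (I := 𝓡 m) (x := x₀)
    (z := extChartAt (𝓡 m) x₀ x) ((extChartAt (𝓡 m) x₀).map_source (by simpa using hx))
  have h2 := h.hasMFDerivWithinAt
  rw [← TangentBundle.symmL_trivializationAt hx] at h2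
  simp only [modelWithCornersSelf_coe, range_id] at h2
  exact hasMFDerivWithinAt_univ.1 h2

lemma hasMFDerivAt_chartAt_symm_of_target {y : EuclideanSpace ℝ (Fin m)}
    (hy : y ∈ (chartAt (EuclideanSpace ℝ (Fin m)) x₀).target) :
    HasMFDerivAt (𝓡 m) (𝓡 m) (chartAt (EuclideanSpace ℝ (Fin m)) x₀).symm y
      (tangentCoordSymm x₀ ((chartAt (EuclideanSpace ℝ (Fin m)) x₀).symm y)) := by
  have h := hasMFDerivAt_chartAt_symm ((chartAt (EuclideanSpace ℝ (Fin m)) x₀).map_target hy)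
  rwa [(chartAt (EuclideanSpace ℝ (Fin m)) x₀).right_inv hy] at h

lemma trivializationAt_apply (hx : x ∈ (chartAt (EuclideanSpace ℝ (Fin m)) x₀).source)
    (v : TangentSpace (𝓡 m) x) :
    ((trivializationAt (EuclideanSpace ℝ (Fin m)) (TangentSpace (𝓡 m) : N → Type _) x₀)
      ⟨x, v⟩).2 = tangentCoord x₀ x v :=
  (Trivialization.continuousLinearMapAt_apply_of_mem (R := ℝ)
    (trivializationAt (EuclideanSpace ℝ (Fin m)) (TangentSpace (𝓡 m) : N → Type _) x₀)
    (mem_baseSet_of_mem_source hx) v).symm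

variable {E' H' N' : Type*} [NormedAddCommGroup E'] [NormedSpace ℝ E'] [TopologicalSpace H']
  {J : ModelWithCorners ℝ E' H'} [TopologicalSpace N'] [ChartedSpace H' N']

/-- The field of tangent vectors with constant coordinates is smooth. -/
lemma contMDiffAt_tangentCoordSymm (hx : x ∈ (chartAt (EuclideanSpace ℝ (Fin m)) x₀).source)
    (v : EuclideanSpace ℝ (Fin m)) :
    ContMDiffAt (𝓡 m) (𝓡 m).tangent ∞
      (fun y => (⟨y, tangentCoordSymm x₀ y v⟩ : TangentBundle (𝓡 m) N)) x := by
  have := (trivializationAt (EuclideanSpace ℝ (Fin m)) (TangentSpace (𝓡 m) : N → Type _)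
    x₀).contMDiffAt_section_iff (IB := 𝓡 m) (n := ∞) (s := fun y => tangentCoordSymm x₀ y v)
    (mem_baseSet_of_mem_source hx)
  refine this.2 ?_
  refine (contMDiffAt_const (c := v)).congr_of_eventuallyEq ?_
  filter_upwards [(chartAt (EuclideanSpace ℝ (Fin m)) x₀).open_source.mem_nhds hx] with y hy
  exact (trivializationAt_apply hy _).trans (tangentCoord_symm hy v)

lemma contMDiffAt_tangentCoord {b : N' → N} {V : (z : N') → TangentSpace (𝓡 m) (b z)} {z₀ : N'}
    (hV : ContMDiffAt J (𝓡 m).tangent ∞ (fun z => (⟨b z, V z⟩ : TangentBundle (𝓡 m) N)) z₀)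
    (hz : b z₀ ∈ (chartAt (EuclideanSpace ℝ (Fin m)) x₀).source) :
    ContMDiffAt J 𝓘(ℝ, EuclideanSpace ℝ (Fin m)) ∞ (fun z => tangentCoord x₀ (b z) (V z)) z₀ := by
  have h1 := ((trivializationAt (EuclideanSpace ℝ (Fin m)) (TangentSpace (𝓡 m) : N → Type _)
    x₀).contMDiffAt_iff (by simpa [Trivialization.mem_source] using hz)).1 hV
  refine h1.2.congr_of_eventuallyEq ?_
  filter_upwards [h1.1.continuousAt.preimage_mem_nhds
    ((chartAt (EuclideanSpace ℝ (Fin m)) x₀).open_source.mem_nhds hz)] with z hz'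
  exact (trivializationAt_apply hz' _).symm

variable (x₀) in
/-- An endomorphism of a tangent space in coordinates. -/
def endCoord (x : N) (T : TangentSpace (𝓡 m) x →L[ℝ] TangentSpace (𝓡 m) x) :
    EuclideanSpace ℝ (Fin m) →L[ℝ] EuclideanSpace ℝ (Fin m) :=
  (tangentCoord x₀ x).comp (T.comp (tangentCoordSymm x₀ x))

lemma endCoord_apply (T : TangentSpace (𝓡 m) x →L[ℝ] TangentSpace (𝓡 m) x)
    (v : EuclideanSpace ℝ (Fin m)) :
    endCoord x₀ x T v = tangentCoord x₀ x (T (tangentCoordSymm x₀ x v)) := rfl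

variable (x₀) in
/-- A bilinear form on a tangent space in coordinates. -/
def formCoord (x : N) (h : TangentSpace (𝓡 m) x →L[ℝ] TangentSpace (𝓡 m) x →L[ℝ] ℝ) :
    EuclideanSpace ℝ (Fin m) →L[ℝ] EuclideanSpace ℝ (Fin m) →L[ℝ] ℝ :=
  let h' : EuclideanSpace ℝ (Fin m) →L[ℝ] EuclideanSpace ℝ (Fin m) →L[ℝ] ℝ := h
  let s : EuclideanSpace ℝ (Fin m) →L[ℝ] EuclideanSpace ℝ (Fin m) := tangentCoordSymm x₀ x
  h'.bilinearComp s s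

lemma formCoord_apply (h : TangentSpace (𝓡 m) x →L[ℝ] TangentSpace (𝓡 m) x →L[ℝ] ℝ)
    (v w : EuclideanSpace ℝ (Fin m)) :
    formCoord x₀ x h v w = h (tangentCoordSymm x₀ x v) (tangentCoordSymm x₀ x w) := rfl

variable (x₀) in
/-- A bilinear map on a tangent space in coordinates. -/
def bilinCoord (x : N)
    (T : TangentSpace (𝓡 m) x →L[ℝ] TangentSpace (𝓡 m) x →L[ℝ] TangentSpace (𝓡 m) x) :
    EuclideanSpace ℝ (Fin m) →L[ℝ] EuclideanSpace ℝ (Fin m) →L[ℝ] EuclideanSpace ℝ (Fin m) :=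
  let T' : EuclideanSpace ℝ (Fin m) →L[ℝ] EuclideanSpace ℝ (Fin m) →L[ℝ]
    EuclideanSpace ℝ (Fin m) := T
  let s : EuclideanSpace ℝ (Fin m) →L[ℝ] EuclideanSpace ℝ (Fin m) := tangentCoordSymm x₀ x
  let c : EuclideanSpace ℝ (Fin m) →L[ℝ] EuclideanSpace ℝ (Fin m) := tangentCoord x₀ x
  (ContinuousLinearMap.compL ℝ _ _ _ c).comp (T'.bilinearComp s s)

lemma bilinCoord_apply
    (T : TangentSpace (𝓡 m) x →L[ℝ] TangentSpace (𝓡 m) x →L[ℝ] TangentSpace (𝓡 m) x)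
    (v w : EuclideanSpace ℝ (Fin m)) : bilinCoord x₀ x T v w =
      tangentCoord x₀ x (T (tangentCoordSymm x₀ x v) (tangentCoordSymm x₀ x w)) := rfl

lemma contMDiffOn_chartAt_symm (x₀ : N) : ContMDiffOn (𝓡 m) (𝓡 m) ∞
    (chartAt (EuclideanSpace ℝ (Fin m)) x₀).symm (chartAt (EuclideanSpace ℝ (Fin m)) x₀).target :=
  contMDiffOn_chart_symm

lemma contMDiffAt_tangentCoordSymm_chart {y : EuclideanSpace ℝ (Fin m)}
    (hy : y ∈ (chartAt (EuclideanSpace ℝ (Fin m)) x₀).target) (v : EuclideanSpace ℝ (Fin m)) :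
    ContMDiffAt (𝓡 m) (𝓡 m).tangent ∞ (fun y =>
      (⟨(chartAt (EuclideanSpace ℝ (Fin m)) x₀).symm y, tangentCoordSymm x₀ _ v⟩ :
        TangentBundle (𝓡 m) N)) y :=
  (contMDiffAt_tangentCoordSymm ((chartAt (EuclideanSpace ℝ (Fin m)) x₀).map_target hy) v).comp y
    ((contMDiffOn_chartAt_symm x₀).contMDiffAt
      ((chartAt (EuclideanSpace ℝ (Fin m)) x₀).open_target.mem_nhds hy))

lemma contDiffOn_endCoord {T : (x : N) → TangentSpace (𝓡 m) x →L[ℝ] TangentSpace (𝓡 m) x}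
    (hT : ContMDiff (𝓡 m) ((𝓡 m).prod 𝓘(ℝ, EuclideanSpace ℝ (Fin m) →L[ℝ]
      EuclideanSpace ℝ (Fin m))) ∞
    (fun e => Bundle.TotalSpace.mk' (EuclideanSpace ℝ (Fin m) →L[ℝ] EuclideanSpace ℝ (Fin m))
      (E := fun e : N => TangentSpace (𝓡 m) e →L[ℝ] TangentSpace (𝓡 m) e) e (T e))) (x₀ : N) :
    ContDiffOn ℝ ∞ (fun y => endCoord x₀ ((chartAt (EuclideanSpace ℝ (Fin m)) x₀).symm y) (T _))
      (chartAt (EuclideanSpace ℝ (Fin m)) x₀).target := by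
  rw [contDiffOn_clm_apply]
  intro v y hy
  have h1 := ((hT.contMDiffAt).comp y ((contMDiffOn_chartAt_symm x₀).contMDiffAt
      ((chartAt (EuclideanSpace ℝ (Fin m)) x₀).open_target.mem_nhds hy)))
  have h2 := ContMDiffAt.clm_bundle_apply (E₁ := (TangentSpace (𝓡 m) : N → Type _))
    (E₂ := (TangentSpace (𝓡 m) : N → Type _)) h1 (contMDiffAt_tangentCoordSymm_chart hy v)
  exact (contMDiffAt_tangentCoord h2
    ((chartAt (EuclideanSpace ℝ (Fin m)) x₀).map_target hy)).contDiffAt.contDiffWithinAt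

lemma contDiffOn_bilinCoord
    {T : (x : N) → TangentSpace (𝓡 m) x →L[ℝ] TangentSpace (𝓡 m) x →L[ℝ] TangentSpace (𝓡 m) x}
    (hT : ContMDiff (𝓡 m) ((𝓡 m).prod 𝓘(ℝ, EuclideanSpace ℝ (Fin m) →L[ℝ]
      EuclideanSpace ℝ (Fin m) →L[ℝ] EuclideanSpace ℝ (Fin m))) ∞
    (fun e => Bundle.TotalSpace.mk' (EuclideanSpace ℝ (Fin m) →L[ℝ] EuclideanSpace ℝ (Fin m) →L[ℝ]
        EuclideanSpace ℝ (Fin m))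
      (E := fun e : N => TangentSpace (𝓡 m) e →L[ℝ] TangentSpace (𝓡 m) e →L[ℝ]
        TangentSpace (𝓡 m) e) e (T e))) (x₀ : N) :
    ContDiffOn ℝ ∞ (fun y => bilinCoord x₀ ((chartAt (EuclideanSpace ℝ (Fin m)) x₀).symm y) (T _))
      (chartAt (EuclideanSpace ℝ (Fin m)) x₀).target := by
  rw [contDiffOn_clm_apply]
  intro v
  rw [contDiffOn_clm_apply]
  intro w y hy
  have h1 := ((hT.contMDiffAt).comp y ((contMDiffOn_chartAt_symm x₀).contMDiffAt
      ((chartAt (EuclideanSpace ℝ (Fin m)) x₀).open_target.mem_nhds hy)))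
  have h2 := ContMDiffAt.clm_bundle_apply₂ (E₁ := (TangentSpace (𝓡 m) : N → Type _))
    (E₂ := (TangentSpace (𝓡 m) : N → Type _)) (E₃ := (TangentSpace (𝓡 m) : N → Type _)) h1
    (contMDiffAt_tangentCoordSymm_chart hy v) (contMDiffAt_tangentCoordSymm_chart hy w)
  exact (contMDiffAt_tangentCoord h2
    ((chartAt (EuclideanSpace ℝ (Fin m)) x₀).map_target hy)).contDiffAt.contDiffWithinAt

lemma contMDiffAt_form_apply
    {h : (x : N) → TangentSpace (𝓡 m) x →L[ℝ] TangentSpace (𝓡 m) x →L[ℝ] ℝ}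
    (hh : ContMDiff (𝓡 m) ((𝓡 m).prod 𝓘(ℝ, EuclideanSpace ℝ (Fin m) →L[ℝ]
      EuclideanSpace ℝ (Fin m) →L[ℝ] ℝ)) ∞
    (fun e => Bundle.TotalSpace.mk' (EuclideanSpace ℝ (Fin m) →L[ℝ] EuclideanSpace ℝ (Fin m) →L[ℝ] ℝ)
      (E := fun e : N => TangentSpace (𝓡 m) e →L[ℝ] TangentSpace (𝓡 m) e →L[ℝ] ℝ) e (h e)))
    {b : N' → N} {V W : (z : N') → TangentSpace (𝓡 m) (b z)} {z₀ : N'}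
    (hb : ContMDiffAt J (𝓡 m) ∞ b z₀)
    (hV : ContMDiffAt J (𝓡 m).tangent ∞ (fun z => (⟨b z, V z⟩ : TangentBundle (𝓡 m) N)) z₀)
    (hW : ContMDiffAt J (𝓡 m).tangent ∞ (fun z => (⟨b z, W z⟩ : TangentBundle (𝓡 m) N)) z₀) :
    ContMDiffAt J 𝓘(ℝ, ℝ) ∞ (fun z => h (b z) (V z) (W z)) z₀ := by
  have : ContMDiffAt J ((𝓡 m).prod 𝓘(ℝ)) ∞
      (fun z ↦ TotalSpace.mk' ℝ (E := Bundle.Trivial N ℝ) (b z) (h (b z) (V z) (W z))) z₀ :=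
    ContMDiffAt.clm_bundle_apply₂ (E₁ := (TangentSpace (𝓡 m) : N → Type _))
      (E₂ := (TangentSpace (𝓡 m) : N → Type _)) (E₃ := Bundle.Trivial N ℝ)
      (hh.contMDiffAt.comp z₀ hb) hV hW
  simp only [contMDiffAt_totalSpace] at this
  exact this.2

lemma contDiffOn_formCoord
    {h : (x : N) → TangentSpace (𝓡 m) x →L[ℝ] TangentSpace (𝓡 m) x →L[ℝ] ℝ}
    (hh : ContMDiff (𝓡 m) ((𝓡 m).prod 𝓘(ℝ, EuclideanSpace ℝ (Fin m) →L[ℝ]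
      EuclideanSpace ℝ (Fin m) →L[ℝ] ℝ)) ∞
    (fun e => Bundle.TotalSpace.mk' (EuclideanSpace ℝ (Fin m) →L[ℝ] EuclideanSpace ℝ (Fin m) →L[ℝ] ℝ)
      (E := fun e : N => TangentSpace (𝓡 m) e →L[ℝ] TangentSpace (𝓡 m) e →L[ℝ] ℝ) e (h e)))
    (x₀ : N) :
    ContDiffOn ℝ ∞ (fun y => formCoord x₀ ((chartAt (EuclideanSpace ℝ (Fin m)) x₀).symm y) (h _))
      (chartAt (EuclideanSpace ℝ (Fin m)) x₀).target := by
  rw [contDiffOn_clm_apply]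
  intro v
  rw [contDiffOn_clm_apply]
  intro w y hy
  exact (contMDiffAt_form_apply hh ((contMDiffOn_chartAt_symm x₀).contMDiffAt
      ((chartAt (EuclideanSpace ℝ (Fin m)) x₀).open_target.mem_nhds hy))
    (contMDiffAt_tangentCoordSymm_chart hy v)
    (contMDiffAt_tangentCoordSymm_chart hy w)).contDiffAt.contDiffWithinAt

end Charts

section Base

variable {M : Type*} [TopologicalSpace M] [ChartedSpace (EuclideanSpace ℝ (Fin 3)) M]

instance instFiniteDimensionalTangentSpace (x : M) :
    FiniteDimensional ℝ (TangentSpace (𝓡 3) x) :=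
  inferInstanceAs (FiniteDimensional ℝ (EuclideanSpace ℝ (Fin 3)))

lemma finrank_tangentSpace (x : M) : Module.finrank ℝ (TangentSpace (𝓡 3) x) = 3 :=
  (finrank_euclideanSpace_fin : Module.finrank ℝ (EuclideanSpace ℝ (Fin 3)) = 3)

/-- Transport along an equality of base points does not change a tangent vector, all tangent spaces
being copies of the model space. -/
lemma eqRec_tangentSpace (f : M → M) {a b : M} (h : a = b) (w : EuclideanSpace ℝ (Fin 3)) :
    (Eq.rec (motive := fun y _ => TangentSpace (𝓡 3) (f y)) w h : TangentSpace (𝓡 3) (f b)) = w := by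
  subst h
  rfl

variable [IsManifold (𝓡 3) ∞ M] {x₀ x : M}

/-- The `i`-th coordinate field of a chart of a `3`-manifold. -/
def baseField (x₀ : M) (i : Fin 3) (x : M) : TangentSpace (𝓡 3) x :=
  tangentCoordSymm x₀ x (stdE i)

lemma tangentCoordSymm_eq_sum (a : E3) :
    tangentCoordSymm x₀ x a = ∑ k, a k • baseField x₀ k x := by
  have h := sum_coord_smul_stdE a
  conv_lhs => rw [← h]
  exact (map_sum _ _ _).trans (Finset.sum_congr rfl fun k _ => map_smul _ _ _)

end Base

/-! ### The commutator forms are closed on the fibres -/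

section Bracket

variable {F : Type*} [NormedAddCommGroup F] [NormedSpace ℝ F]

/-- For a smooth field `P` of projections onto the kernels of the derivative of `prj`, the vector
fields `P ξ` and `P η` that extend two vertical vectors `ξ` and `η` commute at the given point:
their bracket is vertical, and it is annihilated by `P` since `P ∘ P = P`. -/
lemma fderiv_projection_symm {P : F → F →L[ℝ] F} {prj : F → E3} {y : F}
    (hprj : ContDiffAt ℝ 2 prj y) (hP : DifferentiableAt ℝ P y)
    (h1 : ∀ᶠ y' in nhds y, ∀ ξ, fderiv ℝ prj y' (P y' ξ) = 0)
    (h2 : ∀ᶠ y' in nhds y, ∀ ξ, fderiv ℝ prj y' ξ = 0 → P y' ξ = ξ) {ξ η : F}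
    (hξ : fderiv ℝ prj y ξ = 0) (hη : fderiv ℝ prj y η = 0) :
    fderiv ℝ P y ξ η = fderiv ℝ P y η ξ := by
  set D := fderiv ℝ P y with hD
  have hdp : DifferentiableAt ℝ (fderiv ℝ prj) y :=
    (hprj.fderiv_right (m := 1) (by norm_num)).differentiableAt one_ne_zero
  have e1 : ∀ v w, fderiv ℝ prj y w = 0 → P y (D v w) = 0 := by
    intro v w hw
    have ha := ((hP.hasFDerivAt.clm_apply (hP.hasFDerivAt.clm_apply
      (hasFDerivAt_const w y))).fderiv)
    have hb : (fun y' => P y' (P y' w)) =ᶠ[nhds y] fun y' => P y' w := by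
      filter_upwards [h1, h2] with y' ha hb using hb _ (ha w)
    rw [hb.fderiv_eq, (hP.hasFDerivAt.clm_apply (hasFDerivAt_const w y)).fderiv] at ha
    have hc := DFunLike.congr_fun ha v
    have hw' : P y w = w := h2.self_of_nhds w hw
    simp [hw', ← hD] at hc
    exact hc
  have e2 : ∀ v w, fderiv ℝ prj y w = 0 →
      fderiv ℝ prj y (D v w) = -fderiv ℝ (fderiv ℝ prj) y v w := by
    intro v w hw
    have ha := (hdp.hasFDerivAt.clm_apply (hP.hasFDerivAt.clm_apply
      (hasFDerivAt_const w y))).fderiv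
    have hb : (fun y' => fderiv ℝ prj y' (P y' w)) =ᶠ[nhds y] fun _ => 0 := by
      filter_upwards [h1] with y' ha using ha w
    rw [hb.fderiv_eq] at ha
    have hc := DFunLike.congr_fun ha v
    have hw' : P y w = w := h2.self_of_nhds w hw
    simp [hw', ← hD] at hc
    exact eq_neg_of_add_eq_zero_left hc.symm
  have hs : fderiv ℝ (fderiv ℝ prj) y ξ η = fderiv ℝ (fderiv ℝ prj) y η ξ :=
    hprj.isSymmSndFDerivAt (by simp) ξ η
  have e3 : fderiv ℝ prj y (D ξ η - D η ξ) = 0 := by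
    rw [map_sub, e2 ξ η hη, e2 η ξ hξ, hs, sub_self]
  have e4 := h2.self_of_nhds _ e3
  rw [map_sub, e1 ξ η hη, e1 η ξ hξ, sub_self] at e4
  exact sub_eq_zero.1 e4.symm

end Bracket

section Koszul

variable {n : ℕ} {X : Type*} [TopologicalSpace X]
  [ChartedSpace (EuclideanSpace ℝ (Fin n)) X] [IsManifold (𝓡 n) ∞ X]
  {h : (e : X) → TangentSpace (𝓡 n) e →L[ℝ] TangentSpace (𝓡 n) e →L[ℝ] ℝ}
  {Y Z W : (e : X) → TangentSpace (𝓡 n) e} {e : X}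

/-- The derivative of a function in the direction of a tangent vector. -/
def dirDeriv (f : X → ℝ) (e : X) (v : TangentSpace (𝓡 n) e) : ℝ := mfderiv (𝓡 n) 𝓘(ℝ, ℝ) f e v

lemma koszul_eq : koszul h Y Z W e =
    dirDeriv (n := n) (fun e' => h e' (Z e') (W e')) e (Y e)
    + dirDeriv (n := n) (fun e' => h e' (W e') (Y e')) e (Z e)
    - dirDeriv (n := n) (fun e' => h e' (Y e') (Z e')) e (W e)
    + h e (VectorField.mlieBracket (𝓡 n) Y Z e) (W e)
    - h e (VectorField.mlieBracket (𝓡 n) Z W e) (Y e)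
    + h e (VectorField.mlieBracket (𝓡 n) W Y e) (Z e) := rfl

/-- The Levi-Civita connection given by Koszul's formula is metric. -/
lemma koszul_metric (hZW : ∀ e, h e (Z e) (W e) = h e (W e) (Z e))
    (hYZ : ∀ e, h e (Y e) (Z e) = h e (Z e) (Y e)) (hYW : ∀ e, h e (Y e) (W e) = h e (W e) (Y e)) :
    koszul h Y Z W e + koszul h Y W Z e =
      2 * dirDeriv (n := n) (fun e => h e (Z e) (W e)) e (Y e) := by
  simp only [koszul_eq]
  have f1 : (fun e => h e (Z e) (W e)) = fun e => h e (W e) (Z e) := funext hZW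
  have f2 : (fun e => h e (Y e) (Z e)) = fun e => h e (Z e) (Y e) := funext hYZ
  have f3 : (fun e => h e (Y e) (W e)) = fun e => h e (W e) (Y e) := funext hYW
  rw [VectorField.mlieBracket_swap_apply (V := Z) (W := W),
    VectorField.mlieBracket_swap_apply (V := Y) (W := W),
    VectorField.mlieBracket_swap_apply (V := Y) (W := Z), f1, f2, f3]
  simp only [map_neg, neg_apply]
  ring

/-- The Levi-Civita connection given by Koszul's formula is torsion free. -/
lemma koszul_torsion_free (hZW : ∀ e, h e (Z e) (W e) = h e (W e) (Z e))
    (hYZ : ∀ e, h e (Y e) (Z e) = h e (Z e) (Y e)) (hYW : ∀ e, h e (Y e) (W e) = h e (W e) (Y e))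
    (hb : VectorField.mlieBracket (𝓡 n) Y Z e = 0) :
    koszul h Y Z W e = koszul h Z Y W e := by
  simp only [koszul_eq]
  have f1 : (fun e => h e (Z e) (W e)) = fun e => h e (W e) (Z e) := funext hZW
  have f2 : (fun e => h e (Y e) (Z e)) = fun e => h e (Z e) (Y e) := funext hYZ
  have f3 : (fun e => h e (Y e) (W e)) = fun e => h e (W e) (Y e) := funext hYW
  rw [VectorField.mlieBracket_swap_apply (V := Z) (W := W),
    VectorField.mlieBracket_swap_apply (V := Y) (W := W),
    VectorField.mlieBracket_swap_apply (V := Z) (W := Y), hb, f1, f2, f3]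
  simp only [map_neg, neg_apply, map_zero, zero_apply, neg_zero]
  ring

end Koszul

variable {n : ℕ} {M X : Type*} [EMetricSpace M]
  [ChartedSpace (EuclideanSpace ℝ (Fin 3)) M] [IsManifold (𝓡 3) ∞ M]
  [RiemannianBundle (fun x : M => TangentSpace (𝓡 3) x)]
  [TopologicalSpace X] [ChartedSpace (EuclideanSpace ℝ (Fin n)) X] [IsManifold (𝓡 n) ∞ X]

namespace HyperkahlerBundle

variable {B : HyperkahlerBundle n M X}

/-- Smooth vertical vector fields, the case of interest being smoothness at one point `e`. -/
structure SmoothVerticalAt (B : HyperkahlerBundle n M X) (Y : (e : X) → TangentSpace (𝓡 n) e)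
    (e : X) : Prop where
  smooth : SmoothFieldAt Y e
  vertical : ∀ e', B.IsVertical (Y e')

/-- The action of a vector field of the base on vector fields of the total space. -/
def act (B : HyperkahlerBundle n M X) (ξ : (x : M) → TangentSpace (𝓡 3) x)
    (Y : (e : X) → TangentSpace (𝓡 n) e) (e : X) : TangentSpace (𝓡 n) e :=
  B.I e (ξ (B.proj e)) (Y e)

/-- The commutator forms `⟨Z, [I(ξ), I(η)] W⟩` of the complex structures are closed on the fibres:
the complex structures are parallel. -/
lemma commutator_cyclic {ξ η : (x : M) → TangentSpace (𝓡 3) x}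
    {Y : Fin 3 → (e : X) → TangentSpace (𝓡 n) e}
    {e : X} (hξ : SmoothFieldAt ξ (B.proj e)) (hη : SmoothFieldAt η (B.proj e))
    (hY : ∀ i, B.SmoothVerticalAt (Y i) e)
    (hξY : ∀ i, SmoothFieldAt (B.act ξ (Y i)) e) (hηY : ∀ i, SmoothFieldAt (B.act η (Y i)) e)
    (hb : ∀ i j, VectorField.mlieBracket (𝓡 n) (Y i) (Y j) e = 0)
    {Om : Fin 3 → Fin 3 → X → ℝ}
    (hOm : ∀ i j e, Om i j e = B.metric e (Y i e)
      (B.act ξ (B.act η (Y j)) e) - B.metric e (Y i e) (B.act η (B.act ξ (Y j)) e))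
    (hd : ∀ i j, MDifferentiableAt (𝓡 n) 𝓘(ℝ, ℝ)
      (fun e => B.metric e (Y i e) (B.act ξ (B.act η (Y j)) e)) e)
    (hd' : ∀ i j, MDifferentiableAt (𝓡 n) 𝓘(ℝ, ℝ)
      (fun e => B.metric e (Y i e) (B.act η (B.act ξ (Y j)) e)) e) :
    dirDeriv (n := n) (Om 1 2) e (Y 0 e) + dirDeriv (n := n) (Om 2 0) e (Y 1 e) +
      dirDeriv (n := n) (Om 0 1) e (Y 2 e) = 0 := by
  have hactv : ∀ (ξ : (x : M) → TangentSpace (𝓡 3) x) (Z : (e : X) → TangentSpace (𝓡 n) e),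
      (∀ e', B.IsVertical (Z e')) → ∀ e', B.IsVertical (B.act ξ Z e') := fun ξ Z hZ e' =>
    B.I_vertical e' _ _ (hZ e')
  have hsym : ∀ (Z W : (e : X) → TangentSpace (𝓡 n) e), (∀ e', B.IsVertical (Z e')) →
      (∀ e', B.IsVertical (W e')) → ∀ e, B.metric e (Z e) (W e) = B.metric e (W e) (Z e) :=
    fun Z W hZ hW e => B.metric_symm e _ _ (hZ e) (hW e)
  -- parallelity, applied twice, moves a product of two complex structures to the other argument
  have hpar : ∀ i j k, koszul B.metric (Y i) (Y j) (B.act ξ (B.act η (Y k))) e =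
      koszul B.metric (Y i) (B.act η (B.act ξ (Y j))) (Y k) e := by
    intro i j k
    have h1 := B.parallel ξ (Y i) (Y j) (B.act η (Y k)) e hξ (hY i).smooth (hY j).smooth (hηY k)
      (hY i).vertical (hY j).vertical (hactv η _ (hY k).vertical)
    have h2 := B.parallel η (Y i) (B.act ξ (Y j)) (Y k) e hη (hY i).smooth (hξY j) (hY k).smooth
      (hY i).vertical (hactv ξ _ (hY j).vertical) (hY k).vertical
    have h3 := h2.trans (neg_eq_iff_eq_neg.2 h1)
    exact h3.symm
  have hpar' : ∀ i j k, koszul B.metric (Y i) (Y j) (B.act η (B.act ξ (Y k))) e =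
      koszul B.metric (Y i) (B.act ξ (B.act η (Y j))) (Y k) e := by
    intro i j k
    have h1 := B.parallel η (Y i) (Y j) (B.act ξ (Y k)) e hη (hY i).smooth (hY j).smooth (hξY k)
      (hY i).vertical (hY j).vertical (hactv ξ _ (hY k).vertical)
    have h2 := B.parallel ξ (Y i) (B.act η (Y j)) (Y k) e hξ (hY i).smooth (hηY j) (hY k).smooth
      (hY i).vertical (hactv η _ (hY j).vertical) (hY k).vertical
    have h3 := h2.trans (neg_eq_iff_eq_neg.2 h1)
    exact h3.symm
  set κ : Fin 3 → Fin 3 → Fin 3 → ℝ := fun i j k =>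
    koszul B.metric (Y i) (Y j) (B.act ξ (B.act η (Y k))) e -
      koszul B.metric (Y i) (Y j) (B.act η (B.act ξ (Y k))) e with hκ
  have hκsymm : ∀ i j k, κ i j k = κ j i k := by
    intro i j k
    have v1 := hactv ξ _ (hactv η _ (hY k).vertical)
    have v2 := hactv η _ (hactv ξ _ (hY k).vertical)
    simp only [hκ]
    rw [koszul_torsion_free (hsym _ _ (hY j).vertical v1) (hsym _ _ (hY i).vertical (hY j).vertical)
        (hsym _ _ (hY i).vertical v1) (hb i j),
      koszul_torsion_free (hsym _ _ (hY j).vertical v2) (hsym _ _ (hY i).vertical (hY j).vertical)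
        (hsym _ _ (hY i).vertical v2) (hb i j)]
  have hD : ∀ i j k, 2 * dirDeriv (n := n) (Om j k) e (Y i e) = κ i j k - κ i k j := by
    intro i j k
    have v1 := hactv ξ _ (hactv η _ (hY k).vertical)
    have v2 := hactv η _ (hactv ξ _ (hY k).vertical)
    have k1 := koszul_metric (e := e) (hsym _ _ (hY j).vertical v1)
      (hsym _ _ (hY i).vertical (hY j).vertical) (hsym _ _ (hY i).vertical v1)
    have k2 := koszul_metric (e := e) (hsym _ _ (hY j).vertical v2)
      (hsym _ _ (hY i).vertical (hY j).vertical) (hsym _ _ (hY i).vertical v2)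
    have hOmd : dirDeriv (n := n) (Om j k) e (Y i e) =
        dirDeriv (n := n) (fun e => B.metric e (Y j e) (B.act ξ (B.act η (Y k)) e)) e (Y i e) -
        dirDeriv (n := n) (fun e => B.metric e (Y j e) (B.act η (B.act ξ (Y k)) e)) e
          (Y i e) := by
      have : Om j k = (fun e => B.metric e (Y j e) (B.act ξ (B.act η (Y k)) e)) -
          fun e => B.metric e (Y j e) (B.act η (B.act ξ (Y k)) e) := funext fun e => hOm j k e
      rw [this]
      unfold dirDeriv
      have h4 := ((hd j k).hasMFDerivAt.sub (hd' j k).hasMFDerivAt).mfderiv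
      rw [h4]
      rfl
    rw [hOmd, mul_sub, ← k1, ← k2]
    have p1 := hpar i k j
    have p2 := hpar' i k j
    simp only [hκ, p1, p2]
    ring
  have d0 := hD 0 1 2
  have d1 := hD 1 2 0
  have d2 := hD 2 0 1
  have s1 := hκsymm 0 1 2
  have s2 := hκsymm 0 2 1
  have s3 := hκsymm 1 2 0
  linarith

end HyperkahlerBundle

/-! ### The bundle in coordinates -/

section FieldCoordinates

variable {n : ℕ} {X : Type*} [TopologicalSpace X]
  [ChartedSpace (EuclideanSpace ℝ (Fin n)) X] [IsManifold (𝓡 n) ∞ X] {e₀ e : X}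

lemma smoothFieldAt_of_coord {Y : (e : X) → TangentSpace (𝓡 n) e}
    {y : EuclideanSpace ℝ (Fin n) → EuclideanSpace ℝ (Fin n)}
    (he : e ∈ (chartAt (EuclideanSpace ℝ (Fin n)) e₀).source)
    (hY : ∀ᶠ e' in nhds e, tangentCoord e₀ e' (Y e') = y (chartAt (EuclideanSpace ℝ (Fin n)) e₀ e'))
    (hy : ContDiffAt ℝ ∞ y (chartAt (EuclideanSpace ℝ (Fin n)) e₀ e)) : SmoothFieldAt Y e := by
  have := (trivializationAt (EuclideanSpace ℝ (Fin n)) (TangentSpace (𝓡 n) : X → Type _)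
    e₀).contMDiffAt_section_iff (IB := 𝓡 n) (n := ∞) (s := Y) (mem_baseSet_of_mem_source he)
  refine this.2 ?_
  have h1 : ContMDiffAt (𝓡 n) (𝓡 n) ∞ (chartAt (EuclideanSpace ℝ (Fin n)) e₀) e :=
    contMDiffAt_of_mem_maximalAtlas (IsManifold.chart_mem_maximalAtlas e₀) he
  refine (hy.contMDiffAt.comp e h1).congr_of_eventuallyEq ?_
  filter_upwards [hY, (chartAt (EuclideanSpace ℝ (Fin n)) e₀).open_source.mem_nhds he] with e' h2 h3
  exact (trivializationAt_apply h3 _).trans h2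

lemma hasMFDerivAt_of_coord {f : X → ℝ} {g : EuclideanSpace ℝ (Fin n) → ℝ}
    (he : e ∈ (chartAt (EuclideanSpace ℝ (Fin n)) e₀).source)
    (hf : ∀ᶠ e' in nhds e, f e' = g (chartAt (EuclideanSpace ℝ (Fin n)) e₀ e'))
    (hg : DifferentiableAt ℝ g (chartAt (EuclideanSpace ℝ (Fin n)) e₀ e)) :
    HasMFDerivAt (𝓡 n) 𝓘(ℝ, ℝ) f e
      ((fderiv ℝ g (chartAt (EuclideanSpace ℝ (Fin n)) e₀ e)).comp (tangentCoord e₀ e)) :=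
  ((hg.hasFDerivAt.hasMFDerivAt).comp e (hasMFDerivAt_chartAt he)).congr_of_eventuallyEq hf

lemma dirDeriv_of_coord {f : X → ℝ} {g : EuclideanSpace ℝ (Fin n) → ℝ}
    (he : e ∈ (chartAt (EuclideanSpace ℝ (Fin n)) e₀).source)
    (hf : ∀ᶠ e' in nhds e, f e' = g (chartAt (EuclideanSpace ℝ (Fin n)) e₀ e'))
    (hg : DifferentiableAt ℝ g (chartAt (EuclideanSpace ℝ (Fin n)) e₀ e))
    (v : TangentSpace (𝓡 n) e) :
    dirDeriv f e v = fderiv ℝ g (chartAt (EuclideanSpace ℝ (Fin n)) e₀ e) (tangentCoord e₀ e v) := by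
  unfold dirDeriv
  rw [(hasMFDerivAt_of_coord he hf hg).mfderiv]
  rfl

lemma inverse_mfderiv_chartAt (he : e ∈ (chartAt (EuclideanSpace ℝ (Fin n)) e₀).source) :
    (mfderiv (𝓡 n) (𝓡 n) (chartAt (EuclideanSpace ℝ (Fin n)) e₀) e).inverse =
      tangentCoordSymm e₀ e := by
  rw [(hasMFDerivAt_chartAt he).mfderiv]
  exact ContinuousLinearMap.inverse_eq (ContinuousLinearMap.ext fun v => tangentCoord_symm he v)
    (ContinuousLinearMap.ext fun v => tangentCoordSymm_coord he v)

/-- In coordinates, vector fields are pullbacks under the chart. -/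
lemma eventuallyEq_mpullback_of_coord {Y : (e : X) → TangentSpace (𝓡 n) e}
    {y : (v : EuclideanSpace ℝ (Fin n)) → TangentSpace (𝓡 n) v}
    (he : e ∈ (chartAt (EuclideanSpace ℝ (Fin n)) e₀).source)
    (hY : ∀ᶠ e' in nhds e, tangentCoord e₀ e' (Y e') = y (chartAt (EuclideanSpace ℝ (Fin n)) e₀ e')) :
    Y =ᶠ[nhds e] VectorField.mpullback (𝓡 n) (𝓡 n) (chartAt (EuclideanSpace ℝ (Fin n)) e₀) y := by
  filter_upwards [hY, (chartAt (EuclideanSpace ℝ (Fin n)) e₀).open_source.mem_nhds he]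
    with e' h2 h3
  rw [VectorField.mpullback_apply, inverse_mfderiv_chartAt h3, ← h2]
  exact (tangentCoordSymm_coord h3 _).symm

lemma mlieBracket_eq_zero_of_coord {Y Z : (e : X) → TangentSpace (𝓡 n) e}
    {y z : EuclideanSpace ℝ (Fin n) → EuclideanSpace ℝ (Fin n)}
    (he : e ∈ (chartAt (EuclideanSpace ℝ (Fin n)) e₀).source)
    (hY : ∀ᶠ e' in nhds e, tangentCoord e₀ e' (Y e') = y (chartAt (EuclideanSpace ℝ (Fin n)) e₀ e'))
    (hZ : ∀ᶠ e' in nhds e, tangentCoord e₀ e' (Z e') = z (chartAt (EuclideanSpace ℝ (Fin n)) e₀ e'))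
    (hy : ContDiffAt ℝ ∞ y (chartAt (EuclideanSpace ℝ (Fin n)) e₀ e))
    (hz : ContDiffAt ℝ ∞ z (chartAt (EuclideanSpace ℝ (Fin n)) e₀ e))
    (h : fderiv ℝ z (chartAt (EuclideanSpace ℝ (Fin n)) e₀ e)
        (y (chartAt (EuclideanSpace ℝ (Fin n)) e₀ e)) =
      fderiv ℝ y (chartAt (EuclideanSpace ℝ (Fin n)) e₀ e)
        (z (chartAt (EuclideanSpace ℝ (Fin n)) e₀ e))) :
    VectorField.mlieBracket (𝓡 n) Y Z e = 0 := by
  have : IsManifold (𝓡 n) (minSmoothness ℝ 3) X :=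
    IsManifold.of_le (n := ∞) (by simp; exact WithTop.coe_le_coe.2 le_top)
  have hy' := (contMDiffAt_vectorSpace_iff_contDiffAt.2 hy).mdifferentiableAt (by simp)
  have hz' := (contMDiffAt_vectorSpace_iff_contDiffAt.2 hz).mdifferentiableAt (by simp)
  have hbr : VectorField.lieBracket ℝ y z (chartAt (EuclideanSpace ℝ (Fin n)) e₀ e) = 0 := by
    rw [VectorField.lieBracket, h, sub_self]
  let y₁ : (v : EuclideanSpace ℝ (Fin n)) → TangentSpace (𝓡 n) v := y
  let z₁ : (v : EuclideanSpace ℝ (Fin n)) → TangentSpace (𝓡 n) v := z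
  rw [(eventuallyEq_mpullback_of_coord (y := y₁) he hY).mlieBracket_vectorField_eq
      (eventuallyEq_mpullback_of_coord (y := z₁) he hZ), ← VectorField.mpullback_mlieBracket (n := 2)
    hy' hz'
    ((contMDiffAt_of_mem_maximalAtlas (IsManifold.chart_mem_maximalAtlas e₀) he).of_le two_le_infty)
    (by simp), VectorField.mpullback_apply]
  have : VectorField.mlieBracket (𝓡 n) y₁ z₁ (chartAt (EuclideanSpace ℝ (Fin n)) e₀ e) = 0 := by
    rw [← VectorField.mlieBracketWithin_univ]
    have := VectorField.mlieBracketWithin_eq_lieBracketWithin (𝕜 := ℝ) (V := y) (W := z) (s := univ)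
    have h2 := congrFun this (chartAt (EuclideanSpace ℝ (Fin n)) e₀ e)
    refine h2.trans ?_
    rw [VectorField.lieBracketWithin_univ]
    exact hbr
  rw [this, map_zero]

end FieldCoordinates

variable {n : ℕ} {M X : Type*} [EMetricSpace M]
  [ChartedSpace (EuclideanSpace ℝ (Fin 3)) M] [IsManifold (𝓡 3) ∞ M]
  [RiemannianBundle (fun x : M => TangentSpace (𝓡 3) x)]
  [TopologicalSpace X] [ChartedSpace (EuclideanSpace ℝ (Fin n)) X] [IsManifold (𝓡 n) ∞ X]

namespace HyperkahlerBundle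

section Coordinates

variable (B : HyperkahlerBundle n M X) (A : B.Connection) (p : B.VerticalField) (x₀ : M) (e₀ : X)

/-- The points at which the coordinates `chartAt e₀` of the total space and `chartAt x₀` of the base
can be used. -/
def coordDomain : Set (EuclideanSpace ℝ (Fin n)) :=
  (chartAt (EuclideanSpace ℝ (Fin n)) e₀).target ∩
    (chartAt (EuclideanSpace ℝ (Fin n)) e₀).symm ⁻¹'
      (B.proj ⁻¹' (chartAt (EuclideanSpace ℝ (Fin 3)) x₀).source)

/-- The bundle projection in coordinates. -/
def projCoord (y : EuclideanSpace ℝ (Fin n)) : E3 :=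
  chartAt (EuclideanSpace ℝ (Fin 3)) x₀ (B.proj ((chartAt (EuclideanSpace ℝ (Fin n)) e₀).symm y))

/-- The fibre metric in coordinates. -/
def metricCoord (y : EuclideanSpace ℝ (Fin n)) :
    EuclideanSpace ℝ (Fin n) →L[ℝ] EuclideanSpace ℝ (Fin n) →L[ℝ] ℝ :=
  formCoord e₀ ((chartAt (EuclideanSpace ℝ (Fin n)) e₀).symm y) (B.metric _)

/-- The action of the `i`-th coordinate field of the base in coordinates. -/
def actionCoord (i : Fin 3) (y : EuclideanSpace ℝ (Fin n)) :
    EuclideanSpace ℝ (Fin n) →L[ℝ] EuclideanSpace ℝ (Fin n) :=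
  endCoord e₀ ((chartAt (EuclideanSpace ℝ (Fin n)) e₀).symm y) (B.I _ (baseField x₀ i _))

variable {B}

/-- The vertical projection of the modified connection in coordinates. -/
def Connection.vertCoord (y : EuclideanSpace ℝ (Fin n)) :
    EuclideanSpace ℝ (Fin n) →L[ℝ] EuclideanSpace ℝ (Fin n) :=
  endCoord e₀ ((chartAt (EuclideanSpace ℝ (Fin n)) e₀).symm y) (A.perturbedVert p _)

variable {A p x₀ e₀}

lemma isOpen_coordDomain : IsOpen (B.coordDomain x₀ e₀) :=
  (chartAt (EuclideanSpace ℝ (Fin n)) e₀).symm.isOpen_inter_preimage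
    ((chartAt (EuclideanSpace ℝ (Fin 3)) x₀).open_source.preimage B.contMDiff_proj.continuous)

lemma chartAt_mem_coordDomain {e : X} (he : e ∈ (chartAt (EuclideanSpace ℝ (Fin n)) e₀).source)
    (hx : B.proj e ∈ (chartAt (EuclideanSpace ℝ (Fin 3)) x₀).source) :
    chartAt (EuclideanSpace ℝ (Fin n)) e₀ e ∈ B.coordDomain x₀ e₀ :=
  ⟨(chartAt (EuclideanSpace ℝ (Fin n)) e₀).map_source he, by
    simpa only [mem_preimage, (chartAt (EuclideanSpace ℝ (Fin n)) e₀).left_inv he] using hx⟩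

variable {y : EuclideanSpace ℝ (Fin n)}

lemma fderiv_projCoord_apply (hy : y ∈ B.coordDomain x₀ e₀) (ξ : EuclideanSpace ℝ (Fin n)) :
    fderiv ℝ (B.projCoord x₀ e₀) y ξ = tangentCoord x₀ _ (mfderiv (𝓡 n) (𝓡 3) B.proj
      ((chartAt (EuclideanSpace ℝ (Fin n)) e₀).symm y) (tangentCoordSymm e₀ _ ξ)) := by
  have h1 := (B.contMDiff_proj ((chartAt (EuclideanSpace ℝ (Fin n)) e₀).symm y)).mdifferentiableAt
    (by simp)
  have h2 := (hasMFDerivAt_chartAt (m := 3) hy.2).comp y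
    (h1.hasMFDerivAt.comp y (hasMFDerivAt_chartAt_symm_of_target hy.1))
  let D : EuclideanSpace ℝ (Fin n) →L[ℝ] E3 := (tangentCoord x₀ _).comp
    ((mfderiv (𝓡 n) (𝓡 3) B.proj ((chartAt (EuclideanSpace ℝ (Fin n)) e₀).symm y)).comp
      (tangentCoordSymm e₀ _))
  have h3 : HasFDerivAt (B.projCoord x₀ e₀) D y := hasMFDerivAt_iff_hasFDerivAt.1 h2
  rw [h3.fderiv]
  rfl

lemma fderiv_projCoord_eq_zero_iff (hy : y ∈ B.coordDomain x₀ e₀) (ξ : EuclideanSpace ℝ (Fin n)) :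
    fderiv ℝ (B.projCoord x₀ e₀) y ξ = 0 ↔ B.IsVertical
      (tangentCoordSymm e₀ ((chartAt (EuclideanSpace ℝ (Fin n)) e₀).symm y) ξ) := by
  rw [fderiv_projCoord_apply hy]
  constructor
  · intro h
    have := congrArg (tangentCoordSymm x₀
      (B.proj ((chartAt (EuclideanSpace ℝ (Fin n)) e₀).symm y))) h
    rw [tangentCoordSymm_coord hy.2] at this
    exact this.trans (map_zero _)
  · intro h
    unfold IsVertical at h
    rw [h, map_zero]

lemma fderiv_projCoord_tangentCoord (hy : y ∈ B.coordDomain x₀ e₀)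
    {w : TangentSpace (𝓡 n) ((chartAt (EuclideanSpace ℝ (Fin n)) e₀).symm y)} (hw : B.IsVertical w) :
    fderiv ℝ (B.projCoord x₀ e₀) y (tangentCoord e₀ _ w) = 0 := by
  rw [fderiv_projCoord_eq_zero_iff hy, tangentCoordSymm_coord
    ((chartAt (EuclideanSpace ℝ (Fin n)) e₀).map_target hy.1)]
  exact hw

lemma contDiffOn_projCoord : ContDiffOn ℝ ∞ (B.projCoord x₀ e₀) (B.coordDomain x₀ e₀) := by
  intro y hy
  have h1 : ContMDiffAt (𝓡 n) (𝓡 n) ∞ (chartAt (EuclideanSpace ℝ (Fin n)) e₀).symm y :=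
    (contMDiffOn_chartAt_symm e₀).contMDiffAt
      ((chartAt (EuclideanSpace ℝ (Fin n)) e₀).open_target.mem_nhds hy.1)
  have h2 : ContMDiffAt (𝓡 3) (𝓡 3) ∞ (chartAt (EuclideanSpace ℝ (Fin 3)) x₀)
      (B.proj ((chartAt (EuclideanSpace ℝ (Fin n)) e₀).symm y)) :=
    contMDiffAt_of_mem_maximalAtlas (IsManifold.chart_mem_maximalAtlas x₀) hy.2
  exact (h2.comp y ((B.contMDiff_proj _).comp y h1)).contDiffAt.contDiffWithinAt

lemma surjective_fderiv_projCoord (hy : y ∈ B.coordDomain x₀ e₀) :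
    Function.Surjective (fderiv ℝ (B.projCoord x₀ e₀) y) := by
  intro v
  obtain ⟨w, hw⟩ := B.submersion_proj _ (tangentCoordSymm x₀ _ v)
  refine ⟨tangentCoord e₀ _ w, ?_⟩
  rw [fderiv_projCoord_apply hy, tangentCoordSymm_coord
    ((chartAt (EuclideanSpace ℝ (Fin n)) e₀).map_target hy.1), hw, tangentCoord_symm hy.2]

/-- A submersion has, locally, a smooth right inverse of its derivative. -/
lemma exists_rightInverse_fderiv_projCoord (hy : y ∈ B.coordDomain x₀ e₀) :
    ∃ R : EuclideanSpace ℝ (Fin n) → E3 →L[ℝ] EuclideanSpace ℝ (Fin n), ContDiffAt ℝ ∞ R y ∧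
      ∀ᶠ z in nhds y, ∀ v, fderiv ℝ (B.projCoord x₀ e₀) z (R z v) = v := by
  set D := fderiv ℝ (B.projCoord x₀ e₀) with hD
  obtain ⟨R₀, hR₀⟩ := (D y).exists_rightInverse_of_surjective
    (LinearMap.range_eq_top.2 (surjective_fderiv_projCoord hy))
  have hDs : ContDiffAt ℝ ∞ D y :=
    ((contDiffOn_projCoord.contDiffAt (isOpen_coordDomain.mem_nhds hy)).fderiv_right
      (m := ∞) (by simp))
  set T : EuclideanSpace ℝ (Fin n) → E3 →L[ℝ] E3 := fun z => (D z).comp R₀ with hT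
  have hTs : ContDiffAt ℝ ∞ T y := hDs.clm_comp contDiffAt_const
  have hTy : T y = ((ContinuousLinearEquiv.refl ℝ E3 : E3 ≃L[ℝ] E3) : E3 →L[ℝ] E3) := by
    simp only [hT, hR₀]; rfl
  have hinv : ContDiffAt ℝ ∞ (fun z => (T z).inverse) y := by
    refine ContDiffAt.comp y (g := ContinuousLinearMap.inverse) (f := T) ?_ hTs
    rw [hTy]
    exact contDiffAt_map_inverse _
  refine ⟨fun z => R₀.comp (T z).inverse, contDiffAt_const.clm_comp hinv, ?_⟩
  have hopen : ∀ᶠ z in nhds y, T z ∈ range ((↑) : (E3 ≃L[ℝ] E3) → E3 →L[ℝ] E3) := by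
    refine hTs.continuousAt.eventually ?_
    rw [hTy]
    exact ContinuousLinearEquiv.nhds _
  filter_upwards [hopen] with z hz v
  obtain ⟨L, hL⟩ := hz
  have : T z ((T z).inverse v) = v := by
    rw [← hL, ContinuousLinearMap.inverse_equiv]
    simp
  exact this

lemma vertCoord_apply (ξ : EuclideanSpace ℝ (Fin n)) : A.vertCoord p e₀ y ξ = tangentCoord e₀ _
    (A.perturbedVert p _ (tangentCoordSymm e₀
      ((chartAt (EuclideanSpace ℝ (Fin n)) e₀).symm y) ξ)) := rfl

lemma fderiv_projCoord_vertCoord (hy : y ∈ B.coordDomain x₀ e₀) (ξ : EuclideanSpace ℝ (Fin n)) :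
    fderiv ℝ (B.projCoord x₀ e₀) y (A.vertCoord p e₀ y ξ) = 0 :=
  fderiv_projCoord_tangentCoord hy (A.isVertical_perturbedVert p _ _)

lemma vertCoord_of_vertical (hy : y ∈ B.coordDomain x₀ e₀) {ξ : EuclideanSpace ℝ (Fin n)}
    (hξ : fderiv ℝ (B.projCoord x₀ e₀) y ξ = 0) : A.vertCoord p e₀ y ξ = ξ := by
  rw [vertCoord_apply, A.perturbedVert_of_isVertical p _ _
    ((fderiv_projCoord_eq_zero_iff hy ξ).1 hξ), tangentCoord_symm
    ((chartAt (EuclideanSpace ℝ (Fin n)) e₀).map_target hy.1)]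

lemma contDiffOn_metricCoord : ContDiffOn ℝ ∞ (B.metricCoord e₀)
    (chartAt (EuclideanSpace ℝ (Fin n)) e₀).target :=
  contDiffOn_formCoord B.contMDiff_metric e₀

lemma contDiffOn_vertCoord : ContDiffOn ℝ ∞ (A.vertCoord p e₀)
    (chartAt (EuclideanSpace ℝ (Fin n)) e₀).target := by
  have h1 := contDiffOn_endCoord A.contMDiff_vert e₀
  have h2 := contDiffOn_bilinCoord B.contMDiff_I e₀
  rw [contDiffOn_clm_apply]
  intro v z hz
  have h3 : ContDiffAt ℝ ∞ (fun z => tangentCoord e₀ ((chartAt (EuclideanSpace ℝ (Fin n)) e₀).symm z)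
      (p.toFun ((chartAt (EuclideanSpace ℝ (Fin n)) e₀).symm z))) z :=
    (contMDiffAt_tangentCoord (b := (chartAt (EuclideanSpace ℝ (Fin n)) e₀).symm)
      ((p.smooth _).comp z ((contMDiffOn_chartAt_symm e₀).contMDiffAt
        ((chartAt (EuclideanSpace ℝ (Fin n)) e₀).open_target.mem_nhds hz)))
      ((chartAt (EuclideanSpace ℝ (Fin n)) e₀).map_target hz)).contDiffAt
  have ho := (chartAt (EuclideanSpace ℝ (Fin n)) e₀).open_target.mem_nhds hz
  have h4 := ((h1.contDiffAt ho).clm_apply (contDiffAt_const (c := v))).add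
    ((((h2.contDiffAt ho).clm_apply (contDiffAt_const (c := v))).clm_apply h3).const_smul
      (1 / 3 : ℝ))
  refine (h4.congr_of_eventuallyEq ?_).contDiffWithinAt
  filter_upwards [ho] with z' hz'
  rw [vertCoord_apply, A.perturbedVert_apply, map_add, map_smul]
  simp only [bilinCoord_apply, endCoord_apply,
    tangentCoordSymm_coord ((chartAt (EuclideanSpace ℝ (Fin n)) e₀).map_target hz')]
  rfl

lemma actionCoord_apply (i : Fin 3) (ξ : EuclideanSpace ℝ (Fin n)) :
    B.actionCoord x₀ e₀ i y ξ = tangentCoord e₀ _ (B.I _ (baseField x₀ i _)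
      (tangentCoordSymm e₀ ((chartAt (EuclideanSpace ℝ (Fin n)) e₀).symm y) ξ)) := rfl

lemma contDiffOn_actionCoord (i : Fin 3) :
    ContDiffOn ℝ ∞ (B.actionCoord x₀ e₀ i) (B.coordDomain x₀ e₀) := by
  have h2 := contDiffOn_bilinCoord B.contMDiff_I e₀
  intro z hz
  obtain ⟨R, hR, hR'⟩ := exists_rightInverse_fderiv_projCoord hz
  have ho := (chartAt (EuclideanSpace ℝ (Fin n)) e₀).open_target.mem_nhds hz.1
  have h3 := (h2.contDiffAt ho).clm_apply (hR.clm_apply (contDiffAt_const (c := stdE i)))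
  refine (h3.congr_of_eventuallyEq ?_).contDiffWithinAt
  filter_upwards [hR', isOpen_coordDomain.mem_nhds hz] with z' hz' hd
  ext1 ξ
  rw [actionCoord_apply, bilinCoord_apply]
  have h4 := hz' (stdE i)
  rw [fderiv_projCoord_apply hd] at h4
  have h5 := congrArg (tangentCoordSymm x₀
    (B.proj ((chartAt (EuclideanSpace ℝ (Fin n)) e₀).symm z'))) h4
  rw [tangentCoordSymm_coord hd.2] at h5
  have h6 : baseField x₀ i (B.proj ((chartAt (EuclideanSpace ℝ (Fin n)) e₀).symm z')) =
    mfderiv (𝓡 n) (𝓡 3) B.proj ((chartAt (EuclideanSpace ℝ (Fin n)) e₀).symm z')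
      (tangentCoordSymm e₀ ((chartAt (EuclideanSpace ℝ (Fin n)) e₀).symm z') (R z' (stdE i))) :=
    h5.symm
  rw [h6]
  rfl

end Coordinates

end HyperkahlerBundle

variable {n : ℕ} {M X : Type*} [EMetricSpace M]
  [ChartedSpace (EuclideanSpace ℝ (Fin 3)) M] [IsManifold (𝓡 3) ∞ M]
  [RiemannianBundle (fun x : M => TangentSpace (𝓡 3) x)]
  [TopologicalSpace X] [ChartedSpace (EuclideanSpace ℝ (Fin n)) X] [IsManifold (𝓡 n) ∞ X]

namespace HyperkahlerBundle

variable {B : HyperkahlerBundle n M X} {A : B.Connection} {p : B.VerticalField} {x₀ : M} {e₀ e : X}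
  {y : EuclideanSpace ℝ (Fin n)}

lemma vertCoord_chartAt (he : e ∈ (chartAt (EuclideanSpace ℝ (Fin n)) e₀).source)
    (ξ : EuclideanSpace ℝ (Fin n)) :
    A.vertCoord p e₀ (chartAt (EuclideanSpace ℝ (Fin n)) e₀ e) ξ =
      tangentCoord e₀ e (A.perturbedVert p e (tangentCoordSymm e₀ e ξ)) := by
  rw [vertCoord_apply, (chartAt (EuclideanSpace ℝ (Fin n)) e₀).left_inv he]

lemma actionCoord_chartAt (he : e ∈ (chartAt (EuclideanSpace ℝ (Fin n)) e₀).source) (i : Fin 3)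
    (w : TangentSpace (𝓡 n) e) :
    B.actionCoord x₀ e₀ i (chartAt (EuclideanSpace ℝ (Fin n)) e₀ e) (tangentCoord e₀ e w) =
      tangentCoord e₀ e (B.I e (baseField x₀ i _) w) := by
  rw [actionCoord_apply, (chartAt (EuclideanSpace ℝ (Fin n)) e₀).left_inv he,
    tangentCoordSymm_coord he]

lemma metricCoord_chartAt (he : e ∈ (chartAt (EuclideanSpace ℝ (Fin n)) e₀).source)
    (w w' : TangentSpace (𝓡 n) e) :
    B.metricCoord e₀ (chartAt (EuclideanSpace ℝ (Fin n)) e₀ e) (tangentCoord e₀ e w)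
      (tangentCoord e₀ e w') = B.metric e w w' := by
  unfold metricCoord
  rw [formCoord_apply, (chartAt (EuclideanSpace ℝ (Fin n)) e₀).left_inv he,
    tangentCoordSymm_coord he, tangentCoordSymm_coord he]

variable (A p x₀ e₀) in
/-- The commutator form of two coordinate fields of the base. -/
def Connection.commCoord (i j : Fin 3) (y : EuclideanSpace ℝ (Fin n)) :
    EuclideanSpace ℝ (Fin n) →L[ℝ] EuclideanSpace ℝ (Fin n) →L[ℝ] ℝ :=
  commForm (B.metricCoord e₀ y) (A.vertCoord p e₀ y) (B.actionCoord x₀ e₀ i y)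
    (B.actionCoord x₀ e₀ j y)

lemma contDiffOn_commCoord (i j : Fin 3) :
    ContDiffOn ℝ ∞ (A.commCoord p x₀ e₀ i j) (B.coordDomain x₀ e₀) := by
  have hh := (contDiffOn_metricCoord (B := B) (e₀ := e₀)).mono
    (inter_subset_left : B.coordDomain x₀ e₀ ⊆ _)
  have hP := (contDiffOn_vertCoord (A := A) (p := p) (e₀ := e₀)).mono
    (inter_subset_left : B.coordDomain x₀ e₀ ⊆ _)
  have hc := fun i => contDiffOn_actionCoord (B := B) (x₀ := x₀) (e₀ := e₀) i
  refine contDiffOn_clm_apply.2 fun ξ => contDiffOn_clm_apply.2 fun η => ?_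
  have hξ := hP.clm_apply (contDiffOn_const (c := ξ))
  have hη := hP.clm_apply (contDiffOn_const (c := η))
  exact (hh.clm_apply hξ).clm_apply
    (((hc i).clm_apply ((hc j).clm_apply hη)).sub ((hc j).clm_apply ((hc i).clm_apply hη)))

lemma smoothFieldAt_baseField (hx : B.proj e ∈ (chartAt (EuclideanSpace ℝ (Fin 3)) x₀).source)
    (i : Fin 3) : SmoothFieldAt (baseField x₀ i) (B.proj e) :=
  contMDiffAt_tangentCoordSymm hx (stdE i)

set_option maxHeartbeats 1000000 in
/-- The commutator forms are closed on the fibres, in coordinates. -/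
lemma closed_commCoord (hy : y ∈ B.coordDomain x₀ e₀) (i j : Fin 3)
    (ξ : Fin 3 → EuclideanSpace ℝ (Fin n)) (hξ : ∀ k, fderiv ℝ (B.projCoord x₀ e₀) y (ξ k) = 0) :
    fderiv ℝ (A.commCoord p x₀ e₀ i j) y (ξ 0) (ξ 1) (ξ 2) +
      fderiv ℝ (A.commCoord p x₀ e₀ i j) y (ξ 1) (ξ 2) (ξ 0) +
      fderiv ℝ (A.commCoord p x₀ e₀ i j) y (ξ 2) (ξ 0) (ξ 1) = 0 := by
  obtain ⟨e, he, rfl⟩ : ∃ e ∈ (chartAt (EuclideanSpace ℝ (Fin n)) e₀).source,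
      chartAt (EuclideanSpace ℝ (Fin n)) e₀ e = y :=
    ⟨_, (chartAt (EuclideanSpace ℝ (Fin n)) e₀).map_target hy.1,
      (chartAt (EuclideanSpace ℝ (Fin n)) e₀).right_inv hy.1⟩
  have hx : B.proj e ∈ (chartAt (EuclideanSpace ℝ (Fin 3)) x₀).source := by
    have := hy.2
    simpa only [mem_preimage, (chartAt (EuclideanSpace ℝ (Fin n)) e₀).left_inv he] using this
  have hs := (chartAt (EuclideanSpace ℝ (Fin n)) e₀).open_source.mem_nhds he
  have ho := (chartAt (EuclideanSpace ℝ (Fin n)) e₀).open_target.mem_nhds hy.1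
  have hh := (contDiffOn_metricCoord (B := B)).contDiffAt ho
  have hP := (contDiffOn_vertCoord (A := A) (p := p)).contDiffAt ho
  have hc := fun i => (contDiffOn_actionCoord (B := B) (x₀ := x₀) (e₀ := e₀) i).contDiffAt
    (isOpen_coordDomain.mem_nhds hy)
  -- the vertical vectors are extended by applying the vertical projection to constant fields
  set Y : Fin 3 → (e : X) → TangentSpace (𝓡 n) e := fun k e' =>
    A.perturbedVert p e' (tangentCoordSymm e₀ e' (ξ k)) with hYdef
  have hYc : ∀ k, ∀ᶠ e' in nhds e, tangentCoord e₀ e' (Y k e') =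
      A.vertCoord p e₀ (chartAt (EuclideanSpace ℝ (Fin n)) e₀ e') (ξ k) := fun k => by
    filter_upwards [hs] with e' he' using (vertCoord_chartAt he' _).symm
  have hYs : ∀ k, ContDiffAt ℝ ∞ (fun z => A.vertCoord p e₀ z (ξ k))
      (chartAt (EuclideanSpace ℝ (Fin n)) e₀ e) := fun k => hP.clm_apply contDiffAt_const
  have hact : ∀ (a : Fin 3) (Z : (e : X) → TangentSpace (𝓡 n) e)
      (z : EuclideanSpace ℝ (Fin n) → EuclideanSpace ℝ (Fin n)),
      (∀ᶠ e' in nhds e, tangentCoord e₀ e' (Z e') = z (chartAt (EuclideanSpace ℝ (Fin n)) e₀ e')) →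
      ∀ᶠ e' in nhds e, tangentCoord e₀ e' (B.act (baseField x₀ a) Z e') =
        B.actionCoord x₀ e₀ a (chartAt (EuclideanSpace ℝ (Fin n)) e₀ e')
          (z (chartAt (EuclideanSpace ℝ (Fin n)) e₀ e')) := by
    intro a Z z hZ
    filter_upwards [hZ, hs] with e' h1 h2
    rw [← h1, actionCoord_chartAt h2]
    rfl
  have hact1 : ∀ a k, SmoothFieldAt (B.act (baseField x₀ a) (Y k)) e := fun a k =>
    smoothFieldAt_of_coord (y := fun z => B.actionCoord x₀ e₀ a z (A.vertCoord p e₀ z (ξ k))) he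
      (hact a _ (fun z => A.vertCoord p e₀ z (ξ k)) (hYc k)) ((hc a).clm_apply (hYs k))
  have hYv : ∀ k, B.SmoothVerticalAt (Y k) e := fun k =>
    ⟨smoothFieldAt_of_coord he (hYc k) (hYs k), fun e' => A.isVertical_perturbedVert p e' _⟩
  have hsm : ∀ a b k l, ContDiffAt ℝ ∞ (fun z => B.metricCoord e₀ z (A.vertCoord p e₀ z (ξ k))
      (B.actionCoord x₀ e₀ a z (B.actionCoord x₀ e₀ b z (A.vertCoord p e₀ z (ξ l)))))
      (chartAt (EuclideanSpace ℝ (Fin n)) e₀ e) := fun a b k l =>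
    (hh.clm_apply (hYs k)).clm_apply ((hc a).clm_apply ((hc b).clm_apply (hYs l)))
  have hval : ∀ a b k l, ∀ᶠ e' in nhds e, B.metric e' (Y k e')
      (B.act (baseField x₀ a) (B.act (baseField x₀ b) (Y l)) e') =
      (fun z => B.metricCoord e₀ z (A.vertCoord p e₀ z (ξ k))
      (B.actionCoord x₀ e₀ a z (B.actionCoord x₀ e₀ b z (A.vertCoord p e₀ z (ξ l)))))
        (chartAt (EuclideanSpace ℝ (Fin n)) e₀ e') := fun a b k l => by
    filter_upwards [hYc k, hact a _
      (fun z => B.actionCoord x₀ e₀ b z (A.vertCoord p e₀ z (ξ l)))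
      (hact b _ (fun z => A.vertCoord p e₀ z (ξ l)) (hYc l)), hs] with e' h1 h2 h3
    rw [← h1, ← h2, metricCoord_chartAt h3]
  have hmd : ∀ a b k l, MDifferentiableAt (𝓡 n) 𝓘(ℝ, ℝ) (fun e' => B.metric e' (Y k e')
      (B.act (baseField x₀ a) (B.act (baseField x₀ b) (Y l)) e')) e := fun a b k l =>
    (hasMFDerivAt_of_coord he (hval a b k l)
      ((hsm a b k l).differentiableAt (by simp))).mdifferentiableAt
  have hbr : ∀ k l, VectorField.mlieBracket (𝓡 n) (Y k) (Y l) e = 0 := fun k l => by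
    refine mlieBracket_eq_zero_of_coord he (hYc k) (hYc l) (hYs k) (hYs l) ?_
    have hPd := hP.differentiableAt (by simp)
    have hD : ∀ k, fderiv ℝ (fun z => A.vertCoord p e₀ z (ξ k))
        (chartAt (EuclideanSpace ℝ (Fin n)) e₀ e) = (fderiv ℝ (A.vertCoord p e₀)
          (chartAt (EuclideanSpace ℝ (Fin n)) e₀ e)).flip (ξ k) := fun k => by
      rw [fderiv_clm_apply hPd (by fun_prop)]
      simp
    rw [hD, hD, vertCoord_of_vertical hy (hξ k), vertCoord_of_vertical hy (hξ l)]
    simp only [ContinuousLinearMap.flip_apply]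
    refine fderiv_projection_symm (prj := B.projCoord x₀ e₀)
      ((contDiffOn_projCoord.contDiffAt (isOpen_coordDomain.mem_nhds hy)).of_le two_le_infty) hPd
      ?_ ?_ (hξ k) (hξ l)
    · filter_upwards [isOpen_coordDomain.mem_nhds hy] with z hz η using
        fderiv_projCoord_vertCoord hz η
    · filter_upwards [isOpen_coordDomain.mem_nhds hy] with z hz η hη using
        vertCoord_of_vertical hz hη
  have key := commutator_cyclic (B := B) (ξ := baseField x₀ i) (η := baseField x₀ j) (Y := Y)
    (smoothFieldAt_baseField hx i) (smoothFieldAt_baseField hx j) hYv (hact1 i) (hact1 j) hbr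
    (Om := fun k l e' => B.metric e' (Y k e')
      (B.act (baseField x₀ i) (B.act (baseField x₀ j) (Y l)) e') - B.metric e' (Y k e')
      (B.act (baseField x₀ j) (B.act (baseField x₀ i) (Y l)) e')) (fun _ _ _ => rfl)
    (fun k l => hmd i j k l) (fun k l => hmd j i k l)
  have hO := ((contDiffOn_commCoord (A := A) (p := p) i j).contDiffAt
    (isOpen_coordDomain.mem_nhds hy)).differentiableAt (by simp)
  have hd : ∀ k l m, dirDeriv (n := n) (fun e' => B.metric e' (Y k e')
      (B.act (baseField x₀ i) (B.act (baseField x₀ j) (Y l)) e') - B.metric e' (Y k e')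
      (B.act (baseField x₀ j) (B.act (baseField x₀ i) (Y l)) e')) e (Y m e) =
      fderiv ℝ (A.commCoord p x₀ e₀ i j) (chartAt (EuclideanSpace ℝ (Fin n)) e₀ e) (ξ m) (ξ k)
        (ξ l) := by
    intro k l m
    have hev : ∀ᶠ e' in nhds e, B.metric e' (Y k e')
      (B.act (baseField x₀ i) (B.act (baseField x₀ j) (Y l)) e') - B.metric e' (Y k e')
      (B.act (baseField x₀ j) (B.act (baseField x₀ i) (Y l)) e') =
      (fun z => A.commCoord p x₀ e₀ i j z (ξ k) (ξ l))
        (chartAt (EuclideanSpace ℝ (Fin n)) e₀ e') := by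
      filter_upwards [hval i j k l, hval j i k l] with e' h1 h2
      rw [h1, h2]
      simp only [Connection.commCoord, commForm_apply, map_sub]
    have h1 := (hO.hasFDerivAt.clm_apply (hasFDerivAt_const (ξ k) _)).clm_apply
      (hasFDerivAt_const (ξ l) _)
    rw [dirDeriv_of_coord he hev h1.differentiableAt, h1.fderiv, (hYc m).self_of_nhds,
      vertCoord_of_vertical hy (hξ m)]
    simp
  simp only [hd] at key
  exact key

end HyperkahlerBundle

section Gram

variable {M : Type*} [EMetricSpace M]
  [ChartedSpace (EuclideanSpace ℝ (Fin 3)) M] [IsManifold (𝓡 3) ∞ M]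
  [RiemannianBundle (fun x : M => TangentSpace (𝓡 3) x)] {x₀ : M}

lemma gramMatrix_apply {z : E3} (hz : z ∈ (chartAt (EuclideanSpace ℝ (Fin 3)) x₀).target)
    (i j : Fin 3) : gramMatrix x₀ z i j =
      inner ℝ (baseField x₀ i ((chartAt (EuclideanSpace ℝ (Fin 3)) x₀).symm z))
        (baseField x₀ j ((chartAt (EuclideanSpace ℝ (Fin 3)) x₀).symm z)) := by
  have h := (hasMFDerivAt_chartAt_symm_of_target (m := 3) hz).mfderiv
  simp only [gramMatrix, Matrix.of_apply]
  rw [h]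
  rfl

lemma gramMatrix_chartAt {x : M} (hx : x ∈ (chartAt (EuclideanSpace ℝ (Fin 3)) x₀).source)
    (i j : Fin 3) : gramMatrix x₀ (chartAt (EuclideanSpace ℝ (Fin 3)) x₀ x) i j =
      inner ℝ (baseField x₀ i x) (baseField x₀ j x) := by
  rw [gramMatrix_apply ((chartAt (EuclideanSpace ℝ (Fin 3)) x₀).map_source hx),
    (chartAt (EuclideanSpace ℝ (Fin 3)) x₀).left_inv hx]

end Gram

lemma exists_eventually_norm_le {E F : Type*} [TopologicalSpace E] [NormedAddCommGroup F]
    {f : E → F} {y : E} (hf : ContinuousAt f y) : ∃ K, 0 ≤ K ∧ ∀ᶠ z in nhds y, ‖f z‖ ≤ K :=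
  ⟨‖f y‖ + 1, by positivity,
    (hf.norm.eventually (eventually_lt_nhds (lt_add_one ‖f y‖))).mono fun _ h => h.le⟩

variable {n : ℕ} {M X : Type*} [EMetricSpace M]
  [ChartedSpace (EuclideanSpace ℝ (Fin 3)) M] [IsManifold (𝓡 3) ∞ M]
  [RiemannianBundle (fun x : M => TangentSpace (𝓡 3) x)]
  [TopologicalSpace X] [ChartedSpace (EuclideanSpace ℝ (Fin n)) X] [IsManifold (𝓡 n) ∞ X]

namespace HyperkahlerBundle

variable {B : HyperkahlerBundle n M X} {A : B.Connection} {p : B.VerticalField} {x₀ : M} {e₀ e : X}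
  {y : EuclideanSpace ℝ (Fin n)}

lemma metricCoord_apply (ξ η : EuclideanSpace ℝ (Fin n)) : B.metricCoord e₀ y ξ η =
    B.metric ((chartAt (EuclideanSpace ℝ (Fin n)) e₀).symm y) (tangentCoordSymm e₀ _ ξ)
      (tangentCoordSymm e₀ _ η) := rfl

lemma cliffordTriple_coord (hy : y ∈ B.coordDomain x₀ e₀) :
    CliffordTriple (LinearMap.ker (fderiv ℝ (B.projCoord x₀ e₀) y).toLinearMap)
      (B.metricCoord e₀ y) (fun i => B.actionCoord x₀ e₀ i y)
      (fun i j => gramMatrix x₀ (B.projCoord x₀ e₀ y) i j) where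
  symm ξ hξ η hη := B.metric_symm _ _ _ ((fderiv_projCoord_eq_zero_iff hy ξ).1 hξ)
    ((fderiv_projCoord_eq_zero_iff hy η).1 hη)
  mem i ξ hξ := fderiv_projCoord_tangentCoord hy
    (B.I_vertical _ _ _ ((fderiv_projCoord_eq_zero_iff hy ξ).1 hξ))
  skew i ξ hξ η hη := by
    rw [metricCoord_apply, metricCoord_apply, actionCoord_apply, actionCoord_apply,
      tangentCoordSymm_coord ((chartAt (EuclideanSpace ℝ (Fin n)) e₀).map_target hy.1),
      tangentCoordSymm_coord ((chartAt (EuclideanSpace ℝ (Fin n)) e₀).map_target hy.1)]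
    exact B.I_skew _ _ ((fderiv_projCoord_eq_zero_iff hy ξ).1 hξ)
      ((fderiv_projCoord_eq_zero_iff hy η).1 hη)
  clifford i j ξ hξ := by
    have h := B.I_clifford ((chartAt (EuclideanSpace ℝ (Fin n)) e₀).symm y) (baseField x₀ i _)
      (baseField x₀ j _) ((fderiv_projCoord_eq_zero_iff hy ξ).1 hξ)
    rw [actionCoord_apply, actionCoord_apply, actionCoord_apply, actionCoord_apply,
      tangentCoordSymm_coord ((chartAt (EuclideanSpace ℝ (Fin n)) e₀).map_target hy.1),
      tangentCoordSymm_coord ((chartAt (EuclideanSpace ℝ (Fin n)) e₀).map_target hy.1), ← map_add,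
      h, map_smul, tangentCoord_symm ((chartAt (EuclideanSpace ℝ (Fin n)) e₀).map_target hy.1)]
    unfold projCoord
    rw [gramMatrix_chartAt hy.2]

lemma metricCoord_pos (hy : y ∈ B.coordDomain x₀ e₀) {ξ : EuclideanSpace ℝ (Fin n)}
    (hξ : fderiv ℝ (B.projCoord x₀ e₀) y ξ = 0) (h0 : ξ ≠ 0) : 0 < B.metricCoord e₀ y ξ ξ := by
  refine B.metric_pos _ _ ((fderiv_projCoord_eq_zero_iff hy ξ).1 hξ) fun h => h0 ?_
  have := congrArg (tangentCoord e₀ ((chartAt (EuclideanSpace ℝ (Fin n)) e₀).symm y)) h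
  exact (tangentCoord_symm ((chartAt (EuclideanSpace ℝ (Fin n)) e₀).map_target hy.1) ξ).symm.trans
    (this.trans (map_zero _))

/-- The fibre metric is locally uniformly positive on vertical vectors. -/
lemma exists_eventually_sq_norm_le (A : B.Connection) (p : B.VerticalField)
    (hy : y ∈ B.coordDomain x₀ e₀) : ∃ K, 0 ≤ K ∧ ∀ᶠ z in nhds y,
      ∀ ξ, fderiv ℝ (B.projCoord x₀ e₀) z ξ = 0 → ‖ξ‖ ^ 2 ≤ K * B.metricCoord e₀ z ξ ξ := by
  have ho := (chartAt (EuclideanSpace ℝ (Fin n)) e₀).open_target.mem_nhds hy.1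
  have hh := ((contDiffOn_metricCoord (B := B)).contDiffAt ho).continuousAt
  have hP := ((contDiffOn_vertCoord (A := A) (p := p)).contDiffAt ho).continuousAt
  -- a positive function on the unit sphere that agrees with the metric on vertical vectors
  set g : EuclideanSpace ℝ (Fin n) × EuclideanSpace ℝ (Fin n) → ℝ := fun q =>
    B.metricCoord e₀ q.1 (A.vertCoord p e₀ q.1 q.2) (A.vertCoord p e₀ q.1 q.2) +
      ‖q.2 - A.vertCoord p e₀ q.1 q.2‖ ^ 2 with hg
  have hgc : ∀ ξ, ContinuousAt g (y, ξ) := by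
    intro ξ
    have h1 : ContinuousAt (fun q : EuclideanSpace ℝ (Fin n) × EuclideanSpace ℝ (Fin n) =>
      A.vertCoord p e₀ q.1 q.2) (y, ξ) :=
      (ContinuousAt.comp (f := Prod.fst) (x := (y, ξ)) hP continuousAt_fst).clm_apply
        continuousAt_snd
    have h2 := ContinuousAt.comp (f := Prod.fst) (x := (y, ξ)) hh continuousAt_fst
    exact ((h2.clm_apply h1).clm_apply h1).add ((continuousAt_snd.sub h1).norm.pow 2)
  have hpos : ∀ ξ ∈ sphere (0 : EuclideanSpace ℝ (Fin n)) 1, 0 < g (y, ξ) := by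
    intro ξ hξ
    have h0 : ξ ≠ 0 := ne_zero_of_mem_unit_sphere ⟨ξ, hξ⟩
    by_cases hv : A.vertCoord p e₀ y ξ = ξ
    · have := metricCoord_pos hy (fderiv_projCoord_vertCoord (A := A) (p := p) hy ξ) (by rwa [hv])
      simp only [hg]
      positivity
    · have h1 : 0 ≤ B.metricCoord e₀ y (A.vertCoord p e₀ y ξ) (A.vertCoord p e₀ y ξ) := by
        by_cases hz : A.vertCoord p e₀ y ξ = 0
        · rw [hz]; simp
        · exact (metricCoord_pos hy (fderiv_projCoord_vertCoord hy ξ) hz).le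
      have h2 : 0 < ‖ξ - A.vertCoord p e₀ y ξ‖ := norm_pos_iff.2 (sub_ne_zero.2 (Ne.symm hv))
      simp only [hg]
      positivity
  obtain ⟨c, hc, hcg⟩ := (isCompact_sphere (0 : EuclideanSpace ℝ (Fin n)) 1).exists_forall_le'
    (f := fun ξ => g (y, ξ)) (fun ξ _ => ((hgc ξ).comp (f := fun ξ => (y, ξ))
      (by fun_prop)).continuousWithinAt) hpos
  have hev := (isCompact_sphere (0 : EuclideanSpace ℝ (Fin n))
    1).eventually_forall_of_forall_eventually
    (x₀ := y) (P := fun z ξ => c / 2 < g (z, ξ)) fun ξ hξ =>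
      (hgc ξ).eventually (eventually_gt_nhds (by linarith [hcg ξ hξ]))
  refine ⟨2 / c, by positivity, ?_⟩
  filter_upwards [hev, isOpen_coordDomain.mem_nhds hy] with z hz hzd ξ hξ
  by_cases h0 : ξ = 0
  · simp [h0]
  have hn : 0 < ‖ξ‖ := norm_pos_iff.2 h0
  have h1 := hz (‖ξ‖⁻¹ • ξ) (by simp [norm_smul, hn.ne'])
  have h2 : A.vertCoord p e₀ z (‖ξ‖⁻¹ • ξ) = ‖ξ‖⁻¹ • ξ := by
    rw [map_smul, vertCoord_of_vertical hzd hξ]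
  simp only [hg, h2, sub_self, norm_zero, map_smul, smul_apply, smul_eq_mul] at h1
  have h3 : c / 2 * ‖ξ‖ ^ 2 ≤ B.metricCoord e₀ z ξ ξ := by
    have h4 := mul_le_mul_of_nonneg_right h1.le (sq_nonneg ‖ξ‖)
    refine h4.trans (le_of_eq ?_)
    field_simp
    ring
  rw [div_mul_eq_mul_div, le_div_iff₀ hc]
  linarith

/-- The horizontal part of a vector is locally controlled by its projection. -/
lemma exists_eventually_norm_horizontal_le (A : B.Connection) (p : B.VerticalField)
    (hy : y ∈ B.coordDomain x₀ e₀) : ∃ K, 0 ≤ K ∧ ∀ᶠ z in nhds y,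
      ∀ ξ, ‖ξ - A.vertCoord p e₀ z ξ‖ ≤ K * ‖fderiv ℝ (B.projCoord x₀ e₀) z ξ‖ := by
  obtain ⟨R, hR, hR'⟩ := exists_rightInverse_fderiv_projCoord hy
  have ho := (chartAt (EuclideanSpace ℝ (Fin n)) e₀).open_target.mem_nhds hy.1
  have hP := ((contDiffOn_vertCoord (A := A) (p := p)).contDiffAt ho).continuousAt
  obtain ⟨K, hK, hev⟩ := exists_eventually_norm_le
    (f := fun z => R z - (A.vertCoord p e₀ z).comp (R z))
    (hR.continuousAt.sub (hP.clm_comp hR.continuousAt))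
  refine ⟨K, hK, ?_⟩
  filter_upwards [hR', hev, isOpen_coordDomain.mem_nhds hy] with z h1 h2 h3 ξ
  have h4 : ξ - A.vertCoord p e₀ z ξ = (R z - (A.vertCoord p e₀ z).comp (R z))
      (fderiv ℝ (B.projCoord x₀ e₀) z ξ) := by
    have h5 := vertCoord_of_vertical (A := A) (p := p) h3
      (ξ := ξ - R z (fderiv ℝ (B.projCoord x₀ e₀) z ξ)) (by rw [map_sub, h1, sub_self])
    rw [map_sub] at h5
    rw [sub_apply, ContinuousLinearMap.comp_apply]
    rw [sub_eq_sub_iff_add_eq_add] at h5 ⊢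
    rw [add_comm] at h5
    exact h5.symm
  rw [h4]
  exact (ContinuousLinearMap.le_opNorm _ _).trans
    (mul_le_mul_of_nonneg_right h2 (norm_nonneg _))

set_option maxHeartbeats 1000000 in
/-- Near every point, the bundle in coordinates is a local model. -/
lemma exists_localModel (A : B.Connection) (p : B.VerticalField) (hy : y ∈ B.coordDomain x₀ e₀) :
    ∃ W ∈ nhds y, ∃ K₀, ∀ K, K₀ ≤ K →
      ∀ Ginv : Fin 3 → Fin 3 → E3 → ℝ,
      ∃ m : LocalModel (EuclideanSpace ℝ (Fin n)) (fun i j z => gramMatrix x₀ z i j) Ginv K,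
        m.W = W ∧ m.prj = B.projCoord x₀ e₀ ∧ m.P = A.vertCoord p e₀ ∧ m.h = B.metricCoord e₀ ∧
        m.c = B.actionCoord x₀ e₀ := by
  have hd := isOpen_coordDomain.mem_nhds hy
  have ho := (chartAt (EuclideanSpace ℝ (Fin n)) e₀).open_target.mem_nhds hy.1
  have hh := (contDiffOn_metricCoord (B := B)).contDiffAt ho
  have hP := (contDiffOn_vertCoord (A := A) (p := p)).contDiffAt ho
  have hc := fun i => (contDiffOn_actionCoord (B := B) (x₀ := x₀) (e₀ := e₀) i).contDiffAt hd
  obtain ⟨K₁, hK₁, h₁⟩ := exists_eventually_sq_norm_le A p hy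
  obtain ⟨K₂, hK₂, h₂⟩ := exists_eventually_norm_horizontal_le A p hy
  obtain ⟨K₃, hK₃, h₃⟩ := exists_eventually_norm_le hh.continuousAt
  obtain ⟨K₄, hK₄, h₄⟩ := exists_eventually_norm_le (f := fun z i => B.actionCoord x₀ e₀ i z)
    (continuousAt_pi.2 fun i => (hc i).continuousAt)
  obtain ⟨K₅, hK₅, h₅⟩ := exists_eventually_norm_le hP.continuousAt
  have hL : ContDiffAt ℝ 1 (fun z i => (B.actionCoord x₀ e₀ i z).comp (A.vertCoord p e₀ z)) y :=
    contDiffAt_pi.2 fun i => ((hc i).clm_comp hP).of_le (by simp)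
  obtain ⟨K₆, t, ht, h₆⟩ := hL.exists_lipschitzOnWith
  obtain ⟨K₇, hK₇, h₇⟩ := exists_eventually_norm_le
    (f := fun z (i j : Fin 3) => ‖fderiv ℝ (A.commCoord p x₀ e₀ i j) z‖)
    (continuousAt_pi.2 fun i => continuousAt_pi.2 fun j =>
      (((contDiffOn_commCoord (A := A) (p := p) i j).contDiffAt hd).fderiv_right
        (m := 0) (by simp)).continuousAt.norm)
  obtain ⟨r, hr, hball⟩ := Metric.mem_nhds_iff.1 (Filter.inter_mem (Filter.inter_mem hd ht)
    ((((((h₁.and h₂).and h₃).and h₄).and h₅).and h₇)))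
  refine ⟨ball y r, ball_mem_nhds y hr,
    K₁ + K₂ + K₃ + K₄ + K₅ + K₆ + K₇, fun K hK Ginv => ?_⟩
  have hK₆ := K₆.2
  have hD : ∀ z ∈ ball y r, z ∈ B.coordDomain x₀ e₀ := fun z hz => (hball hz).1.1
  refine ⟨{
    W := ball y r
    prj := B.projCoord x₀ e₀
    P := A.vertCoord p e₀
    h := B.metricCoord e₀
    c := B.actionCoord x₀ e₀
    isOpen_W := isOpen_ball
    contDiffOn_prj := contDiffOn_projCoord.mono hD
    contDiffOn_P := contDiffOn_vertCoord.mono fun z hz => (hD z hz).1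
    contDiffOn_h := contDiffOn_metricCoord.mono fun z hz => (hD z hz).1
    contDiffOn_c := fun i => (contDiffOn_actionCoord i).mono hD
    vert_P := fun z hz ξ => fderiv_projCoord_vertCoord (hD z hz) ξ
    P_vert := fun z hz ξ hξ => vertCoord_of_vertical (hD z hz) hξ
    triple := fun z hz => cliffordTriple_coord (hD z hz)
    sq_norm_le := fun z hz ξ hξ => ?_
    norm_horizontal_le := fun z hz ξ => ?_
    norm_h_le := fun z hz => ?_
    norm_c_le := fun i z hz => ?_
    norm_P_le := fun z hz => ?_
    lipschitz := fun i z hz z' hz' => ?_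
    norm_fderiv_comm_le := fun i j z hz => ?_
    closed := fun i j z hz ξ₀ ξ₁ ξ₂ h0 h1 h2 => ?_ }, rfl, rfl, rfl, rfl, rfl⟩
  · obtain ⟨-, ⟨⟨⟨⟨⟨a₁, a₂⟩, a₃⟩, a₄⟩, a₅⟩, a₇⟩⟩ := hball hz
    refine (a₁ ξ hξ).trans (mul_le_mul_of_nonneg_right (by linarith) ?_)
    by_cases h0 : ξ = 0
    · simp [h0]
    · exact (metricCoord_pos (hD z hz) hξ h0).le
  · obtain ⟨-, ⟨⟨⟨⟨⟨a₁, a₂⟩, a₃⟩, a₄⟩, a₅⟩, a₇⟩⟩ := hball hz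
    exact (a₂ ξ).trans (mul_le_mul_of_nonneg_right (by linarith) (norm_nonneg _))
  · obtain ⟨-, ⟨⟨⟨⟨⟨a₁, a₂⟩, a₃⟩, a₄⟩, a₅⟩, a₇⟩⟩ := hball hz
    have a₃' : ‖B.metricCoord e₀ z‖ ≤ K₃ := a₃
    linarith
  · obtain ⟨-, ⟨⟨⟨⟨⟨a₁, a₂⟩, a₃⟩, a₄⟩, a₅⟩, a₇⟩⟩ := hball hz
    have a₄' : ‖B.actionCoord x₀ e₀ i z‖ ≤ K₄ :=
      (norm_le_pi_norm (fun i => B.actionCoord x₀ e₀ i z) i).trans a₄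
    linarith
  · obtain ⟨-, ⟨⟨⟨⟨⟨a₁, a₂⟩, a₃⟩, a₄⟩, a₅⟩, a₇⟩⟩ := hball hz
    have a₅' : ‖A.vertCoord p e₀ z‖ ≤ K₅ := a₅
    linarith
  · have a := h₆.dist_le_mul z (hball hz).1.2 z' (hball hz').1.2
    have b := (dist_le_pi_dist
      (fun i => (B.actionCoord x₀ e₀ i z).comp (A.vertCoord p e₀ z))
      (fun i => (B.actionCoord x₀ e₀ i z').comp (A.vertCoord p e₀ z')) i).trans a
    rw [dist_eq_norm, dist_eq_norm] at b
    exact b.trans (mul_le_mul_of_nonneg_right (by linarith) (norm_nonneg _))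
  · obtain ⟨-, ⟨⟨⟨⟨⟨a₁, a₂⟩, a₃⟩, a₄⟩, a₅⟩, a₇⟩⟩ := hball hz
    have a₇' : ‖fderiv ℝ (A.commCoord p x₀ e₀ i j) z‖ ≤ K₇ :=
      (le_abs_self _).trans <|
        (norm_le_pi_norm (fun j : Fin 3 => ‖fderiv ℝ (A.commCoord p x₀ e₀ i j) z‖) j).trans
        ((norm_le_pi_norm (fun i j : Fin 3 => ‖fderiv ℝ (A.commCoord p x₀ e₀ i j) z‖) i).trans a₇)
    change ‖fderiv ℝ (A.commCoord p x₀ e₀ i j) z‖ ≤ K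
    linarith
  · exact closed_commCoord (A := A) (p := p) (hD z hz) i j ![ξ₀, ξ₁, ξ₂] fun k => by
      fin_cases k
      exacts [h0, h1, h2]

end HyperkahlerBundle

/-! ### Sections of the bundle in coordinates -/

section Frames

variable {M : Type*} [EMetricSpace M]
  [ChartedSpace (EuclideanSpace ℝ (Fin 3)) M] [IsManifold (𝓡 3) ∞ M]
  [RiemannianBundle (fun x : M => TangentSpace (𝓡 3) x)] {x₀ x : M}

lemma inner_tangentCoordSymm (hx : x ∈ (chartAt (EuclideanSpace ℝ (Fin 3)) x₀).source) (a b : E3) :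
    inner ℝ (tangentCoordSymm x₀ x a) (tangentCoordSymm x₀ x b) =
      ∑ k, ∑ l, gramMatrix x₀ (chartAt (EuclideanSpace ℝ (Fin 3)) x₀ x) k l * (a k * b l) := by
  simp only [tangentCoordSymm_eq_sum, gramMatrix_chartAt hx, sum_inner, inner_sum, inner_smul_left,
    inner_smul_right, RCLike.conj_to_real]
  simp only [Finset.mul_sum]
  rw [Finset.sum_comm]
  refine Finset.sum_congr rfl fun k _ => Finset.sum_congr rfl fun l _ => ?_
  ring

/-- An orthonormal frame diagonalises the metric coefficients. -/
lemma gramMatrix_frame (hx : x ∈ (chartAt (EuclideanSpace ℝ (Fin 3)) x₀).source)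
    (v : OrthonormalBasis (Fin 3) ℝ (TangentSpace (𝓡 3) x)) (i j : Fin 3) :
    ∑ k, ∑ l, gramMatrix x₀ (chartAt (EuclideanSpace ℝ (Fin 3)) x₀ x) k l *
      (tangentCoord x₀ x (v i) k * tangentCoord x₀ x (v j) l) = if i = j then 1 else 0 := by
  rw [← inner_tangentCoordSymm hx, tangentCoordSymm_coord hx, tangentCoordSymm_coord hx]
  exact orthonormal_iff_ite.1 v.orthonormal i j

/-- The inverse of the metric coefficients, in terms of an orthonormal frame. -/
lemma gramMatrix_mul_frame (hx : x ∈ (chartAt (EuclideanSpace ℝ (Fin 3)) x₀).source)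
    (v : OrthonormalBasis (Fin 3) ℝ (TangentSpace (𝓡 3) x)) :
    gramMatrix x₀ (chartAt (EuclideanSpace ℝ (Fin 3)) x₀ x) *
      Matrix.of (fun k l => ∑ i, tangentCoord x₀ x (v i) k * tangentCoord x₀ x (v i) l) = 1 := by
  set V : Matrix (Fin 3) (Fin 3) ℝ := Matrix.of fun i k => tangentCoord x₀ x (v i) k with hV
  have h1 : V * (gramMatrix x₀ (chartAt (EuclideanSpace ℝ (Fin 3)) x₀ x) * V.transpose) = 1 := by
    ext i j
    rw [Matrix.one_apply, ← gramMatrix_frame hx v i j]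
    simp only [Matrix.mul_apply, hV, Matrix.of_apply, Matrix.transpose_apply, Finset.mul_sum]
    refine Finset.sum_congr rfl fun k _ => Finset.sum_congr rfl fun l _ => ?_
    ring
  have h2 := mul_eq_one_comm.1 h1
  rw [Matrix.mul_assoc] at h2
  rw [← h2]
  congr 1

lemma gramMatrix_inv_frame (hx : x ∈ (chartAt (EuclideanSpace ℝ (Fin 3)) x₀).source)
    (v : OrthonormalBasis (Fin 3) ℝ (TangentSpace (𝓡 3) x)) (k l : Fin 3) :
    (gramMatrix x₀ (chartAt (EuclideanSpace ℝ (Fin 3)) x₀ x))⁻¹ k l =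
      ∑ i, tangentCoord x₀ x (v i) k * tangentCoord x₀ x (v i) l := by
  rw [Matrix.inv_eq_right_inv (gramMatrix_mul_frame hx v)]
  rfl

end Frames

variable {n : ℕ} {M X : Type*} [EMetricSpace M]
  [ChartedSpace (EuclideanSpace ℝ (Fin 3)) M] [IsManifold (𝓡 3) ∞ M]
  [RiemannianBundle (fun x : M => TangentSpace (𝓡 3) x)]
  [TopologicalSpace X] [ChartedSpace (EuclideanSpace ℝ (Fin n)) X] [IsManifold (𝓡 n) ∞ X]

namespace HyperkahlerBundle

variable {B : HyperkahlerBundle n M X} {A : B.Connection} {p : B.VerticalField} {x₀ : M} {e₀ e : X}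
  {y : EuclideanSpace ℝ (Fin n)}

/-- Since `∑ I(v_i)² = -3`, the perturbation is absorbed by the modified connection. -/
lemma sum_I_perturbedVert {x : M} (h : B.proj e = x)
    (v : OrthonormalBasis (Fin 3) ℝ (TangentSpace (𝓡 3) x))
    (v' : Fin 3 → TangentSpace (𝓡 3) (B.proj e))
    (hv' : ∀ i, (v' i : EuclideanSpace ℝ (Fin 3)) = v i)
    (D : TangentSpace (𝓡 3) x →L[ℝ] TangentSpace (𝓡 n) e)
    (hD : ∀ w, (mfderiv (𝓡 n) (𝓡 3) B.proj e (D w) : EuclideanSpace ℝ (Fin 3)) = w)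
    (hp : ∑ i, B.I e (v' i) (A.vert e (D (v i))) = p.toFun e) :
    ∑ i, B.I e (v' i) (A.perturbedVert p e (D (v i))) = 0 := by
  subst h
  obtain rfl : v' = v := funext hv'
  have h1 : ∀ i, B.I e (v i) (A.perturbedVert p e (D (v i))) =
      B.I e (v i) (A.vert e (D (v i))) - (1 / 3 : ℝ) • p.toFun e := fun i => by
    rw [A.perturbedVert_apply, hD, map_add, map_smul]
    have h2 := B.I_clifford e (v i) (v i) (p.isVertical e)
    rw [real_inner_self_eq_norm_sq, v.norm_eq_one, ← two_smul ℝ] at h2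
    have h3 : B.I e (v i) (B.I e (v i) (p.toFun e)) = -p.toFun e := by
      have h4 := congrArg (fun w => (1 / 2 : ℝ) • w) h2
      simp only [smul_smul] at h4
      norm_num at h4
      exact h4
    rw [h3, smul_neg, sub_eq_add_neg]
  simp only [h1, Finset.sum_sub_distrib, hp]
  simp only [Finset.sum_const, Finset.card_univ, Fintype.card_fin, ← Nat.cast_smul_eq_nsmul ℝ,
    smul_smul]
  norm_num

/-- The Dirac equation in the coordinate frame of the base. -/
lemma sum_inv_gramMatrix_I {x : M} (h : B.proj e = x)
    (hx : x ∈ (chartAt (EuclideanSpace ℝ (Fin 3)) x₀).source)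
    (v : OrthonormalBasis (Fin 3) ℝ (TangentSpace (𝓡 3) x))
    (v' : Fin 3 → TangentSpace (𝓡 3) (B.proj e))
    (hv' : ∀ i, (v' i : EuclideanSpace ℝ (Fin 3)) = v i)
    (N : TangentSpace (𝓡 3) x →L[ℝ] TangentSpace (𝓡 n) e)
    (hN : ∑ i, B.I e (v' i) (N (v i)) = 0) :
    ∑ k, ∑ l, (gramMatrix x₀ (chartAt (EuclideanSpace ℝ (Fin 3)) x₀ x))⁻¹ k l •
      B.I e (baseField x₀ k (B.proj e)) (N (baseField x₀ l x)) = 0 := by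
  subst h
  obtain rfl : v' = v := funext hv'
  have h1 : ∀ i, B.I e (v i) (N (v i)) = ∑ k, ∑ l,
      (tangentCoord x₀ (B.proj e) (v i) k * tangentCoord x₀ (B.proj e) (v i) l) •
        B.I e (baseField x₀ k (B.proj e)) (N (baseField x₀ l (B.proj e))) := fun i => by
    have h2 := tangentCoordSymm_coord hx (v i)
    rw [tangentCoordSymm_eq_sum] at h2
    conv_lhs => rw [← h2]
    simp only [map_sum, map_smul, sum_apply, smul_apply, Finset.smul_sum, smul_smul]
    rw [Finset.sum_comm]
    refine Finset.sum_congr rfl fun k _ => Finset.sum_congr rfl fun l _ => ?_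
    rw [mul_comm]
  simp only [h1, Fin.sum_univ_three] at hN
  simp only [gramMatrix_inv_frame hx v, Fin.sum_univ_three]
  rw [← hN]
  module

lemma mfderiv_proj_section (u : B.SmoothSection) (x : M) (w : TangentSpace (𝓡 3) x) :
    mfderiv (𝓡 n) (𝓡 3) B.proj (u.toFun x) (mfderiv (𝓡 3) (𝓡 n) u.toFun x w) =
      (w : EuclideanSpace ℝ (Fin 3)) := by
  have h1 := ((B.contMDiff_proj (u.toFun x)).mdifferentiableAt (by simp)).hasMFDerivAt
  have h2 := ((u.smooth x).mdifferentiableAt (by simp)).hasMFDerivAt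
  have h3 := (h1.comp x h2).congr_of_eventuallyEq (f₁ := id)
    (Filter.Eventually.of_forall fun x => (u.proj_toFun x).symm)
  have h4 := hasMFDerivAt_unique h3 (hasMFDerivAt_id x)
  exact DFunLike.congr_fun h4 w

variable (A p) in
/-- The covariant derivative of a section for the modified connection. -/
def Connection.perturbedDeriv (u : B.SmoothSection) (x : M) :
    TangentSpace (𝓡 3) x →L[ℝ] TangentSpace (𝓡 n) (u.toFun x) :=
  (A.perturbedVert p (u.toFun x)).comp (mfderiv (𝓡 3) (𝓡 n) u.toFun x)

lemma sum_inv_gramMatrix_perturbedDeriv {u : B.SmoothSection} (hu : A.IsPerturbedFueter p u) {x : M}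
    (hx : x ∈ (chartAt (EuclideanSpace ℝ (Fin 3)) x₀).source) :
    ∑ k, ∑ l, (gramMatrix x₀ (chartAt (EuclideanSpace ℝ (Fin 3)) x₀ x))⁻¹ k l •
      B.I (u.toFun x) (baseField x₀ k _) (A.perturbedDeriv p u x (baseField x₀ l x)) = 0 := by
  obtain ⟨v, hv⟩ := hu x
  have hv' := fun i => eqRec_tangentSpace (fun y => B.proj (u.toFun y)) (u.proj_toFun x) (v i)
  exact sum_inv_gramMatrix_I (u.proj_toFun x) hx v _ hv' _
    (sum_I_perturbedVert (u.proj_toFun x) v _ hv' (mfderiv (𝓡 3) (𝓡 n) u.toFun x)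
      (mfderiv_proj_section u x) hv)

/-- The data of a local model come from the bundle, in the chart at `e₀`. -/
structure IsCoordModel (A : B.Connection) (p : B.VerticalField) (x₀ : M) (e₀ : X)
    {G Ginv : Fin 3 → Fin 3 → E3 → ℝ} {K : ℝ}
    (m : LocalModel (EuclideanSpace ℝ (Fin n)) G Ginv K) : Prop where
  prj : m.prj = B.projCoord x₀ e₀
  P : m.P = A.vertCoord p e₀
  h : m.h = B.metricCoord e₀
  c : m.c = B.actionCoord x₀ e₀

variable (B) in
/-- A section over the domain of `chartAt x₀`, as a map of the coordinates. -/
abbrev sectionOnChart (u : B.SmoothSection) (x₀ : M) (z : E3) : X :=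
  u.toFun ((chartAt (EuclideanSpace ℝ (Fin 3)) x₀).symm z)

variable (A p) in
/-- The form `⟨∇_v u, ∇_w u⟩` of a section, in the coordinates of `chartAt x₀`. -/
def Connection.sectionEnergy (u : B.SmoothSection) (x₀ : M) (z v w : E3) : ℝ :=
  let x := (chartAt (EuclideanSpace ℝ (Fin 3)) x₀).symm z
  B.metric (u.toFun x) (A.perturbedDeriv p u x (tangentCoordSymm x₀ x v))
    (A.perturbedDeriv p u x (tangentCoordSymm x₀ x w))

variable (A p) in
/-- The form `⟨∇_v u, [I(a), I(b)] ∇_w u⟩` of a section, in the coordinates of `chartAt x₀`. -/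
def Connection.sectionStress (u : B.SmoothSection) (x₀ : M) (z a b v w : E3) : ℝ :=
  let x := (chartAt (EuclideanSpace ℝ (Fin 3)) x₀).symm z
  let e := u.toFun x
  let N := A.perturbedDeriv p u x (tangentCoordSymm x₀ x w)
  let a' := tangentCoordSymm x₀ (B.proj e) a
  let b' := tangentCoordSymm x₀ (B.proj e) b
  B.metric e (A.perturbedDeriv p u x (tangentCoordSymm x₀ x v))
    (B.I e a' (B.I e b' N) - B.I e b' (B.I e a' N))

section

variable {G Ginv : Fin 3 → Fin 3 → E3 → ℝ} {K : ℝ}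
    {m : LocalModel (EuclideanSpace ℝ (Fin n)) G Ginv K} {u : B.SmoothSection} {z : E3}

lemma contMDiffAt_sectionOnChart (hz : z ∈ (chartAt (EuclideanSpace ℝ (Fin 3)) x₀).target) :
    ContMDiffAt (𝓡 3) (𝓡 n) ∞ (B.sectionOnChart u x₀) z :=
  (u.smooth _).comp z ((contMDiffOn_chartAt_symm x₀).contMDiffAt
    ((chartAt (EuclideanSpace ℝ (Fin 3)) x₀).open_target.mem_nhds hz))

lemma contDiffAt_chartAt_sectionOnChart
    (hz : z ∈ (chartAt (EuclideanSpace ℝ (Fin 3)) x₀).target)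
    (he : B.sectionOnChart u x₀ z ∈ (chartAt (EuclideanSpace ℝ (Fin n)) e₀).source) :
    ContDiffAt ℝ ∞ (fun z => chartAt (EuclideanSpace ℝ (Fin n)) e₀ (B.sectionOnChart u x₀ z)) z :=
  ((contMDiffAt_of_mem_maximalAtlas (IsManifold.chart_mem_maximalAtlas e₀) he).comp z
    (contMDiffAt_sectionOnChart hz)).contDiffAt

lemma fderiv_chartAt_sectionOnChart
    (hz : z ∈ (chartAt (EuclideanSpace ℝ (Fin 3)) x₀).target)
    (he : B.sectionOnChart u x₀ z ∈ (chartAt (EuclideanSpace ℝ (Fin n)) e₀).source) (v : E3) :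
    fderiv ℝ (fun z => chartAt (EuclideanSpace ℝ (Fin n)) e₀ (B.sectionOnChart u x₀ z)) z v =
      tangentCoord e₀ (B.sectionOnChart u x₀ z) (mfderiv (𝓡 3) (𝓡 n) u.toFun
        ((chartAt (EuclideanSpace ℝ (Fin 3)) x₀).symm z) (tangentCoordSymm x₀ _ v)) := by
  have h2 := (hasMFDerivAt_chartAt he).comp z
    (((u.smooth _).mdifferentiableAt (by simp)).hasMFDerivAt.comp z
      (hasMFDerivAt_chartAt_symm_of_target hz))
  let D : E3 →L[ℝ] EuclideanSpace ℝ (Fin n) := (tangentCoord e₀ (B.sectionOnChart u x₀ z)).comp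
    ((mfderiv (𝓡 3) (𝓡 n) u.toFun ((chartAt (EuclideanSpace ℝ (Fin 3)) x₀).symm z)).comp
      (tangentCoordSymm x₀ _))
  have h3 : HasFDerivAt (fun z => chartAt (EuclideanSpace ℝ (Fin n)) e₀ (B.sectionOnChart u x₀ z))
    D z := hasMFDerivAt_iff_hasFDerivAt.1 h2
  rw [h3.fderiv]
  rfl

lemma vertCoord_fderiv_sectionOnChart
    (hz : z ∈ (chartAt (EuclideanSpace ℝ (Fin 3)) x₀).target)
    (he : B.sectionOnChart u x₀ z ∈ (chartAt (EuclideanSpace ℝ (Fin n)) e₀).source) (v : E3) :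
    A.vertCoord p e₀ (chartAt (EuclideanSpace ℝ (Fin n)) e₀ (B.sectionOnChart u x₀ z))
      (fderiv ℝ (fun z => chartAt (EuclideanSpace ℝ (Fin n)) e₀ (B.sectionOnChart u x₀ z)) z v) =
      tangentCoord e₀ (B.sectionOnChart u x₀ z) (A.perturbedDeriv p u
        ((chartAt (EuclideanSpace ℝ (Fin 3)) x₀).symm z) (tangentCoordSymm x₀ _ v)) := by
  rw [fderiv_chartAt_sectionOnChart hz he, vertCoord_chartAt he, tangentCoordSymm_coord he]
  rfl

lemma IsCoordModel.energyForm_eq (hm : IsCoordModel A p x₀ e₀ m)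
    (hz : z ∈ (chartAt (EuclideanSpace ℝ (Fin 3)) x₀).target)
    (he : B.sectionOnChart u x₀ z ∈ (chartAt (EuclideanSpace ℝ (Fin n)) e₀).source) :
    A.sectionEnergy p u x₀ z = m.energyForm
      (fun z => chartAt (EuclideanSpace ℝ (Fin n)) e₀ (B.sectionOnChart u x₀ z)) z := by
  ext v w
  simp only [LocalModel.energyForm, LocalModel.cov, ContinuousLinearMap.comp_apply, hm.P, hm.h]
  rw [vertCoord_fderiv_sectionOnChart hz he, vertCoord_fderiv_sectionOnChart hz he,
    metricCoord_chartAt he]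
  rfl

lemma action_actionCoord (he : e ∈ (chartAt (EuclideanSpace ℝ (Fin n)) e₀).source) (a : E3)
    (w : TangentSpace (𝓡 n) e) :
    action (fun i => B.actionCoord x₀ e₀ i (chartAt (EuclideanSpace ℝ (Fin n)) e₀ e)) a
      (tangentCoord e₀ e w) = tangentCoord e₀ e (B.I e (tangentCoordSymm x₀ _ a) w) := by
  rw [tangentCoordSymm_eq_sum]
  simp only [action, sum_apply, smul_apply, actionCoord_chartAt he, map_sum, map_smul]

lemma IsCoordModel.stressForm_eq (hm : IsCoordModel A p x₀ e₀ m)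
    (hz : z ∈ (chartAt (EuclideanSpace ℝ (Fin 3)) x₀).target)
    (he : B.sectionOnChart u x₀ z ∈ (chartAt (EuclideanSpace ℝ (Fin n)) e₀).source) :
    A.sectionStress p u x₀ z = m.stressForm
      (fun z => chartAt (EuclideanSpace ℝ (Fin n)) e₀ (B.sectionOnChart u x₀ z)) z := by
  ext a b v w
  simp only [LocalModel.stressForm, commForm_apply, hm.P, hm.h, hm.c]
  rw [vertCoord_fderiv_sectionOnChart hz he, vertCoord_fderiv_sectionOnChart hz he,
    action_actionCoord he, action_actionCoord he, action_actionCoord he, action_actionCoord he,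
    ← map_sub, metricCoord_chartAt he]
  rfl

/-- A perturbed Fueter section solves, in coordinates, the Dirac-type equation of the local
model. -/
lemma IsCoordModel.isSection
    {m : LocalModel (EuclideanSpace ℝ (Fin n)) G (fun i j z => (gramMatrix x₀ z)⁻¹ i j) K}
    (hm : IsCoordModel A p x₀ e₀ m) (hu : A.IsPerturbedFueter p u) {U : Set E3} (hU : IsOpen U)
    (hUt : U ⊆ (chartAt (EuclideanSpace ℝ (Fin 3)) x₀).target)
    (hUs : ∀ z ∈ U, B.sectionOnChart u x₀ z ∈ (chartAt (EuclideanSpace ℝ (Fin n)) e₀).source)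
    (hUW : ∀ z ∈ U, chartAt (EuclideanSpace ℝ (Fin n)) e₀ (B.sectionOnChart u x₀ z) ∈ m.W) :
    m.IsSection U
      (fun z => chartAt (EuclideanSpace ℝ (Fin n)) e₀ (B.sectionOnChart u x₀ z)) where
  isOpen := hU
  contDiffOn z hz := (contDiffAt_chartAt_sectionOnChart (hUt hz) (hUs z hz)).contDiffWithinAt
  mapsTo := hUW
  proj z hz := by
    rw [hm.prj, projCoord, (chartAt (EuclideanSpace ℝ (Fin n)) e₀).left_inv (hUs z hz)]
    rw [u.proj_toFun, (chartAt (EuclideanSpace ℝ (Fin 3)) x₀).right_inv (hUt hz)]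
  dirac z hz := by
    have h1 := sum_inv_gramMatrix_perturbedDeriv (x₀ := x₀) hu
      ((chartAt (EuclideanSpace ℝ (Fin 3)) x₀).map_target (hUt hz))
    rw [(chartAt (EuclideanSpace ℝ (Fin 3)) x₀).right_inv (hUt hz)] at h1
    have h2 := congrArg (tangentCoord e₀ (B.sectionOnChart u x₀ z)) h1
    rw [hm.P, hm.c]
    refine Eq.trans ?_ (h2.trans (map_zero _))
    simp only [map_sum, map_smul]
    refine Finset.sum_congr rfl fun k _ => Finset.sum_congr rfl fun l _ => ?_
    rw [vertCoord_fderiv_sectionOnChart (hUt hz) (hUs z hz), actionCoord_chartAt (hUs z hz)]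
    rfl

end

end HyperkahlerBundle

/-! ### Finite covers by local models -/

variable {n : ℕ} {M X : Type*} [EMetricSpace M]
  [ChartedSpace (EuclideanSpace ℝ (Fin 3)) M] [IsManifold (𝓡 3) ∞ M]
  [RiemannianBundle (fun x : M => TangentSpace (𝓡 3) x)]
  [TopologicalSpace X] [ChartedSpace (EuclideanSpace ℝ (Fin n)) X] [IsManifold (𝓡 n) ∞ X]

namespace HyperkahlerBundle

variable {B : HyperkahlerBundle n M X}

/-- A finite family `θ j`, `j ∈ t`, of cut-off functions on the total space with support in the
domain of a local model, such that over `S` some `θ j` is equal to `1` at every point, together with local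
models in whose coordinates the derivatives of the `θ j` are bounded by `L`. -/
structure ModelCover (A : B.Connection) (p : B.VerticalField) (x₀ : M) (S : Set X) (K L : ℝ)
    (t : Finset X) (θ : X → X → ℝ) : Prop where
  smooth : ∀ j ∈ t, ContMDiff (𝓡 n) 𝓘(ℝ, ℝ) ∞ (θ j)
  exists_model_support : ∀ j ∈ t, ∃ m : LocalModel (EuclideanSpace ℝ (Fin n))
    (fun i j z => gramMatrix x₀ z i j) (fun i j z => (gramMatrix x₀ z)⁻¹ i j) K,
    IsCoordModel A p x₀ j m ∧ ∀ e, θ j e ≠ 0 →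
      e ∈ (chartAt (EuclideanSpace ℝ (Fin n)) j).source ∧
        chartAt (EuclideanSpace ℝ (Fin n)) j e ∈ m.W
  exists_eq_one : ∀ e ∈ S, ∃ j ∈ t, θ j e = 1
  exists_model : ∀ e ∈ S, ∃ (i : X) (m : LocalModel (EuclideanSpace ℝ (Fin n))
    (fun i j z => gramMatrix x₀ z i j) (fun i j z => (gramMatrix x₀ z)⁻¹ i j) K),
    IsCoordModel A p x₀ i m ∧ e ∈ (chartAt (EuclideanSpace ℝ (Fin n)) i).source ∧
      chartAt (EuclideanSpace ℝ (Fin n)) i e ∈ m.W ∧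
      ∀ j ∈ t, ‖fderiv ℝ (fun y => θ j ((chartAt (EuclideanSpace ℝ (Fin n)) i).symm y))
        (chartAt (EuclideanSpace ℝ (Fin n)) i e)‖ ≤ L

variable {A : B.Connection} {p : B.VerticalField} {x₀ : M}

set_option maxHeartbeats 800000 in
/-- By compactness, the part of the total space over a compact set in a chart of the base is covered
by finitely many local models. -/
lemma exists_modelCover [T2Space X] [CompactSpace X] (A : B.Connection) (p : B.VerticalField)
    {S : Set X} (hS : IsClosed S)
    (hSx : ∀ e ∈ S, B.proj e ∈ (chartAt (EuclideanSpace ℝ (Fin 3)) x₀).source) :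
    ∃ K L t θ, 1 ≤ K ∧ 0 ≤ L ∧ ModelCover A p x₀ S K L t θ := by
  have hSc := hS.isCompact
  have hdom : ∀ e ∈ S, chartAt (EuclideanSpace ℝ (Fin n)) e e ∈ B.coordDomain x₀ e := fun e he =>
    chartAt_mem_coordDomain (mem_chart_source _ e) (hSx e he)
  choose! W hW K₀ hm using fun e (he : e ∈ S) => exists_localModel A p (hdom e he)
  set N : X → Set X := fun e => (chartAt (EuclideanSpace ℝ (Fin n)) e).source ∩
    chartAt (EuclideanSpace ℝ (Fin n)) e ⁻¹' W e with hNdef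
  have hN : ∀ e ∈ S, N e ∈ nhds e := fun e he => Filter.inter_mem
    ((chartAt (EuclideanSpace ℝ (Fin n)) e).open_source.mem_nhds (mem_chart_source _ e))
    (((chartAt (EuclideanSpace ℝ (Fin n)) e).continuousAt (mem_chart_source _ e)) (hW e he))
  have hθ : ∀ e : X, ∃ θ : SmoothBumpFunction (𝓡 n) e, e ∈ S → tsupport θ ⊆ N e := fun e => by
    by_cases he : e ∈ S
    · obtain ⟨f, -, hf⟩ := (SmoothBumpFunction.nhds_basis_tsupport (I := 𝓡 n) e).mem_iff.1 (hN e he)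
      exact ⟨f, fun _ => hf⟩
    · obtain ⟨f, -, -⟩ :=
        (SmoothBumpFunction.nhds_basis_tsupport (I := 𝓡 n) e).mem_iff.1 Filter.univ_mem
      exact ⟨f, fun h => (he h).elim⟩
  choose θ hθN using hθ
  obtain ⟨t, htS, ht⟩ := hSc.elim_nhds_subcover (fun e => {e' | θ e e' = 1})
    fun e _ => (θ e).eventuallyEq_one
  have hsm : ∀ j, ContMDiff (𝓡 n) 𝓘(ℝ, ℝ) ∞ (θ j) := fun j => (θ j).contMDiff
  -- a bound for the derivatives of the finitely many cut-off functions near `e`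
  have hL : ∀ e : X, ∃ L, 0 ≤ L ∧ ∀ᶠ e' in nhds e, ∀ j ∈ t,
      ‖fderiv ℝ (fun y => θ j ((chartAt (EuclideanSpace ℝ (Fin n)) e).symm y))
        (chartAt (EuclideanSpace ℝ (Fin n)) e e')‖ ≤ L := by
    intro e
    have hc : ∀ j, ContinuousAt (fun z => fderiv ℝ
        (fun y => θ j ((chartAt (EuclideanSpace ℝ (Fin n)) e).symm y)) z)
        (chartAt (EuclideanSpace ℝ (Fin n)) e e) := fun j => by
      have h1 : ContMDiffAt (𝓡 n) (𝓡 n) ∞ (chartAt (EuclideanSpace ℝ (Fin n)) e).symm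
          (chartAt (EuclideanSpace ℝ (Fin n)) e e) :=
        (contMDiffOn_chartAt_symm e).contMDiffAt
          ((chartAt (EuclideanSpace ℝ (Fin n)) e).open_target.mem_nhds (mem_chart_target _ e))
      have h2 : ContDiffAt ℝ ∞ (fun y => θ j ((chartAt (EuclideanSpace ℝ (Fin n)) e).symm y))
          (chartAt (EuclideanSpace ℝ (Fin n)) e e) := ((hsm j _).comp _ h1).contDiffAt
      exact (h2.fderiv_right (m := 0) (by simp)).continuousAt
    obtain ⟨L, hL, hev⟩ := exists_eventually_norm_le (f := fun z => ∑ j ∈ t, ‖fderiv ℝ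
        (fun y => θ j ((chartAt (EuclideanSpace ℝ (Fin n)) e).symm y)) z‖)
        (y := chartAt (EuclideanSpace ℝ (Fin n)) e e)
        (tendsto_finsetSum _ fun j _ => (hc j).norm)
    refine ⟨L, hL, ?_⟩
    filter_upwards [((chartAt (EuclideanSpace ℝ (Fin n)) e).continuousAt
      (mem_chart_source _ e)).eventually hev] with e' he' j hj
    exact (Finset.single_le_sum (f := fun j => ‖fderiv ℝ
        (fun y => θ j ((chartAt (EuclideanSpace ℝ (Fin n)) e).symm y))
        (chartAt (EuclideanSpace ℝ (Fin n)) e e')‖) (fun _ _ => norm_nonneg _) hj).trans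
      ((le_abs_self _).trans he')
  choose L hL0 hLe using hL
  obtain ⟨t', ht'S, ht'⟩ := hSc.elim_nhds_subcover (fun e => N e ∩ {e' | ∀ j ∈ t,
      ‖fderiv ℝ (fun y => θ j ((chartAt (EuclideanSpace ℝ (Fin n)) e).symm y))
        (chartAt (EuclideanSpace ℝ (Fin n)) e e')‖ ≤ L e})
    fun e he => Filter.inter_mem (hN e he) (hLe e)
  have hs1 : 0 ≤ ∑ e ∈ t, |K₀ e| := Finset.sum_nonneg fun _ _ => abs_nonneg _
  have hs2 : 0 ≤ ∑ e ∈ t', |K₀ e| := Finset.sum_nonneg fun _ _ => abs_nonneg _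
  refine ⟨1 + ∑ e ∈ t, |K₀ e| + ∑ e ∈ t', |K₀ e|, ∑ e ∈ t', L e, t, fun j => θ j, by linarith,
    Finset.sum_nonneg fun _ _ => hL0 _, ⟨fun j _ => hsm j, fun j hj => ?_, fun e he => ?_,
      fun e he => ?_⟩⟩
  · have h1 := Finset.single_le_sum (f := fun e => |K₀ e|) (fun _ _ => abs_nonneg _) hj
    obtain ⟨m, hmW, h2⟩ := hm j (htS j hj) (1 + ∑ e ∈ t, |K₀ e| + ∑ e ∈ t', |K₀ e|) (show K₀ j ≤ _ by
      linarith [le_abs_self (K₀ j)]) (fun i j z => (gramMatrix x₀ z)⁻¹ i j)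
    refine ⟨m, ⟨h2.1, h2.2.1, h2.2.2.1, h2.2.2.2⟩, fun e he => ?_⟩
    have h3 := hθN j (htS j hj) (subset_tsupport _ he)
    rw [hmW]
    exact h3
  · obtain ⟨j, hj, h1⟩ := mem_iUnion₂.1 (ht he)
    exact ⟨j, hj, h1⟩
  · obtain ⟨i, hi, h1⟩ := mem_iUnion₂.1 (ht' he)
    have h2 := Finset.single_le_sum (f := fun e => |K₀ e|) (fun _ _ => abs_nonneg _) hi
    obtain ⟨m, hmW, h3⟩ := hm i (ht'S i hi) (1 + ∑ e ∈ t, |K₀ e| + ∑ e ∈ t', |K₀ e|) (show K₀ i ≤ _ by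
      linarith [le_abs_self (K₀ i)]) (fun i j z => (gramMatrix x₀ z)⁻¹ i j)
    refine ⟨i, m, ⟨h3.1, h3.2.1, h3.2.2.1, h3.2.2.2⟩, h1.1.1, ?_,
      fun j hj => (h1.2 j hj).trans (Finset.single_le_sum (f := L) (fun _ _ => hL0 _) hi)⟩
    rw [hmW]
    exact h1.1.2

variable {u : B.SmoothSection} {K L : ℝ} {t : Finset X} {θ : X → X → ℝ} {S : Set X} {D : Set E3}

lemma continuousOn_sectionOnChart (hD : D ⊆ (chartAt (EuclideanSpace ℝ (Fin 3)) x₀).target) :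
    ContinuousOn (B.sectionOnChart u x₀) D := fun _ hz =>
  (contMDiffAt_sectionOnChart (hD hz)).continuousAt.continuousWithinAt

/-- A perturbed Fueter section is represented in a local model near every point, with control of the
derivatives of the cut-off functions by the energy density. -/
lemma ModelCover.exists_section (H : ModelCover A p x₀ S K L t θ) (hu : A.IsPerturbedFueter p u)
    (hDo : IsOpen D) (hD : D ⊆ (chartAt (EuclideanSpace ℝ (Fin 3)) x₀).target)
    {z : E3} (hz : z ∈ D) (hzS : B.sectionOnChart u x₀ z ∈ S) :
    ∃ (i : X) (m : LocalModel (EuclideanSpace ℝ (Fin n))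
      (fun i j z => gramMatrix x₀ z i j) (fun i j z => (gramMatrix x₀ z)⁻¹ i j) K) (U : Set E3),
      z ∈ U ∧ U ⊆ D ∧ (∀ y ∈ U, B.sectionOnChart u x₀ y ∈
        (chartAt (EuclideanSpace ℝ (Fin n)) i).source) ∧ IsCoordModel A p x₀ i m ∧
      m.IsSection U
        (fun z => chartAt (EuclideanSpace ℝ (Fin n)) i (B.sectionOnChart u x₀ z)) ∧
      ∀ j ∈ t, ‖fderiv ℝ (fun y => θ j ((chartAt (EuclideanSpace ℝ (Fin n)) i).symm y))
        (chartAt (EuclideanSpace ℝ (Fin n)) i (B.sectionOnChart u x₀ z))‖ ≤ L := by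
  obtain ⟨i, m, hm, h1, h2, h3⟩ := H.exists_model _ hzS
  have hO : IsOpen ((chartAt (EuclideanSpace ℝ (Fin n)) i).source ∩
      chartAt (EuclideanSpace ℝ (Fin n)) i ⁻¹' m.W) :=
    (chartAt (EuclideanSpace ℝ (Fin n)) i).isOpen_inter_preimage m.isOpen_W
  refine ⟨i, m, D ∩ B.sectionOnChart u x₀ ⁻¹' ((chartAt (EuclideanSpace ℝ (Fin n)) i).source ∩
      chartAt (EuclideanSpace ℝ (Fin n)) i ⁻¹' m.W), ⟨hz, h1, h2⟩, inter_subset_left,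
      fun y hy => hy.2.1, hm, ?_, h3⟩
  exact hm.isSection hu ((continuousOn_sectionOnChart hD).isOpen_inter_preimage hDo hO)
    (inter_subset_left.trans hD) (fun y hy => hy.2.1) fun y hy => hy.2.2

lemma ModelCover.isDiracSection (H : ModelCover A p x₀ S K L t θ) (hK : 1 ≤ K) (hL : 0 ≤ L)
    (hu : A.IsPerturbedFueter p u)
    (hDo : IsOpen D) (hD : D ⊆ (chartAt (EuclideanSpace ℝ (Fin 3)) x₀).target)
    (hDS : ∀ z ∈ D, B.sectionOnChart u x₀ z ∈ S) :
    IsDiracSection (EuclideanSpace ℝ (Fin n)) D (fun i j z => gramMatrix x₀ z i j)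
      (fun i j z => (gramMatrix x₀ z)⁻¹ i j) K (1 / (8 * K * L + 1)) (A.sectionEnergy p u x₀)
      (A.sectionStress p u x₀) where
  exists_model z hz := by
    obtain ⟨i, m, U, hzU, hUD, hUs, hm, hs, -⟩ := H.exists_section hu hDo hD hz (hDS z hz)
    exact ⟨m, U, _, hzU, hs, fun y hy => ⟨hm.energyForm_eq (hD (hUD hy)) (hUs y hy),
      hm.stressForm_eq (hD (hUD hy)) (hUs y hy)⟩⟩
  exists_model_ball z ρ hρ hball hdens hsmall := by
    set d := density (A.sectionEnergy p u x₀) z with hd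
    have hzb : z ∈ ball z ρ := mem_ball_self hρ
    obtain ⟨j, hj, hj1⟩ := H.exists_eq_one _ (hDS z (hball hzb))
    obtain ⟨m, hm, hmθ⟩ := H.exists_model_support j hj
    have hδ : (0 : ℝ) < 1 / (8 * K * L + 1) := by positivity
    -- the derivative of the cut-off function along the section is at most `8 K L √d`
    have hder : ∀ x ∈ ball z ρ, DifferentiableAt ℝ (fun y => θ j (B.sectionOnChart u x₀ y)) x ∧
        ‖fderiv ℝ (fun y => θ j (B.sectionOnChart u x₀ y)) x‖ ≤ 8 * K * L * Real.sqrt d := by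
      intro x hx
      obtain ⟨i, m', U, hxU, hUD, hUs, hm', hs, hθ⟩ :=
        H.exists_section hu hDo hD (hball hx) (hDS x (hball hx))
      set û := fun z => chartAt (EuclideanSpace ℝ (Fin n)) i (B.sectionOnChart u x₀ z) with hû
      have hev : (fun y => θ j (B.sectionOnChart u x₀ y)) =ᶠ[nhds x] fun y =>
          θ j ((chartAt (EuclideanSpace ℝ (Fin n)) i).symm (û y)) := by
        filter_upwards [hs.isOpen.mem_nhds hxU] with y hy
        rw [hû, (chartAt (EuclideanSpace ℝ (Fin n)) i).left_inv (hUs y hy)]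
      have hd1 : DifferentiableAt ℝ
          (fun y => θ j ((chartAt (EuclideanSpace ℝ (Fin n)) i).symm y)) (û x) := by
        have h1 : ContMDiffAt (𝓡 n) (𝓡 n) ∞ (chartAt (EuclideanSpace ℝ (Fin n)) i).symm (û x) :=
          (contMDiffOn_chartAt_symm i).contMDiffAt
            ((chartAt (EuclideanSpace ℝ (Fin n)) i).open_target.mem_nhds
              ((chartAt (EuclideanSpace ℝ (Fin n)) i).map_source (hUs x hxU)))
        have h2 : ContDiffAt ℝ ∞ (fun y => θ j ((chartAt (EuclideanSpace ℝ (Fin n)) i).symm y))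
          (û x) := ((H.smooth j hj _).comp _ h1).contDiffAt
        exact h2.differentiableAt (by simp)
      have hc := hd1.hasFDerivAt.comp x (hs.differentiableAt hxU).hasFDerivAt
      have hc' : HasFDerivAt (fun y => θ j (B.sectionOnChart u x₀ y)) _ x :=
        hc.congr_of_eventuallyEq hev
      refine ⟨hc'.differentiableAt, ?_⟩
      rw [hc'.fderiv]
      have hdx : density (A.sectionEnergy p u x₀) x =
          1 + ∑ k, m'.energyForm û x (stdE k) (stdE k) := by
        rw [density, hm'.energyForm_eq (hD (hUD hxU)) (hUs x hxU)]
      have hsq : Real.sqrt (density (A.sectionEnergy p u x₀) x) ≤ 2 * Real.sqrt d := by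
        refine Real.sqrt_le_iff.2 ⟨by positivity, ?_⟩
        have h1 := hdens x hx
        have h0 : 0 ≤ d := by
          have := (m'.one_le_density (by linarith) hs hxU)
          rw [← hdx] at this
          linarith
        rw [mul_pow, Real.sq_sqrt h0]
        linarith
      have hû' : ‖fderiv ℝ û x‖ ≤ 4 * K * (2 * Real.sqrt d) := by
        refine ContinuousLinearMap.opNorm_le_bound _ (by positivity) fun v => ?_
        refine (LocalModel.norm_fderiv_le hK hs hxU hdx v).trans ?_
        gcongr
      refine (ContinuousLinearMap.opNorm_comp_le _ _).trans ?_
      calc _ ≤ L * (4 * K * (2 * Real.sqrt d)) :=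
            mul_le_mul (hθ j hj) hû' (norm_nonneg _) hL
        _ = _ := by ring
    -- hence the section stays in the support of the cut-off function
    have hpos : ∀ x ∈ ball z ρ, θ j (B.sectionOnChart u x₀ x) ≠ 0 := by
      intro x hx h0
      have h1 := (convex_ball z ρ).norm_image_sub_le_of_norm_fderiv_le
        (fun y hy => (hder y hy).1) (fun y hy => (hder y hy).2) hzb hx
      rw [h0, hj1] at h1
      have h2 : ρ * Real.sqrt d ≤ 1 / (8 * K * L + 1) := by
        have h3 := Real.sqrt_le_sqrt hsmall
        rwa [Real.sqrt_mul (sq_nonneg ρ), Real.sqrt_sq hρ.le, Real.sqrt_sq hδ.le] at h3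
      have h4 : 8 * K * L * Real.sqrt d * ‖x - z‖ ≤ 8 * K * L * (1 / (8 * K * L + 1)) := by
        have h5 : ‖x - z‖ ≤ ρ := by rw [← dist_eq_norm]; exact (mem_ball.1 hx).le
        calc 8 * K * L * Real.sqrt d * ‖x - z‖ ≤ 8 * K * L * Real.sqrt d * ρ := by gcongr
          _ = 8 * K * L * (ρ * Real.sqrt d) := by ring
          _ ≤ _ := by gcongr
      have h6 : 8 * K * L * (1 / (8 * K * L + 1)) < 1 := by
        rw [mul_one_div, div_lt_one (by positivity)]
        linarith
      norm_num at h1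
      linarith
    have hs := hm.isSection hu isOpen_ball (hball.trans hD) (fun y hy => (hmθ _ (hpos y hy)).1)
      fun y hy => (hmθ _ (hpos y hy)).2
    exact ⟨m, _, hs, fun y hy => hm.energyForm_eq (hD (hball hy)) (hmθ _ (hpos y hy)).1⟩

end HyperkahlerBundle

/-! ### The metric of the base in coordinates -/

section

variable {M : Type*} [EMetricSpace M]
  [ChartedSpace (EuclideanSpace ℝ (Fin 3)) M] [IsManifold (𝓡 3) ∞ M]
  [RiemannianBundle (fun x : M => TangentSpace (𝓡 3) x)] {x₀ : M}

/-- The standard orthonormal basis, indexed by `Fin 3`. -/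
def orthonormalFrame (x : M) : OrthonormalBasis (Fin 3) ℝ (TangentSpace (𝓡 3) x) :=
  (stdOrthonormalBasis ℝ (TangentSpace (𝓡 3) x)).reindex (finCongr (finrank_tangentSpace x))

lemma det_gramMatrix_ne_zero {z : E3} (hz : z ∈ (chartAt (EuclideanSpace ℝ (Fin 3)) x₀).target) :
    (gramMatrix x₀ z).det ≠ 0 := by
  have h := gramMatrix_mul_frame ((chartAt (EuclideanSpace ℝ (Fin 3)) x₀).map_target hz)
    (orthonormalFrame _)
  rw [(chartAt (EuclideanSpace ℝ (Fin 3)) x₀).right_inv hz] at h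
  have h2 := congrArg Matrix.det h
  rw [Matrix.det_mul, Matrix.det_one] at h2
  exact left_ne_zero_of_mul_eq_one h2

lemma exists_frame_gramMatrix {z : E3} (hz : z ∈ (chartAt (EuclideanSpace ℝ (Fin 3)) x₀).target) :
    ∃ V : Fin 3 → E3,
    (∀ i j, ∑ k, ∑ l, gramMatrix x₀ z k l * (V i k * V j l) = if i = j then 1 else 0) ∧
    ∀ k l, ∑ i, V i k * V i l = (gramMatrix x₀ z)⁻¹ k l := by
  have hx := (chartAt (EuclideanSpace ℝ (Fin 3)) x₀).map_target hz
  have h1 := gramMatrix_frame hx (orthonormalFrame _)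
  have h2 := gramMatrix_inv_frame hx (orthonormalFrame _)
  rw [(chartAt (EuclideanSpace ℝ (Fin 3)) x₀).right_inv hz] at h1 h2
  exact ⟨_, h1, fun k l => (h2 k l).symm⟩

lemma gramMatrix_det_pos {z : E3} (hz : z ∈ (chartAt (EuclideanSpace ℝ (Fin 3)) x₀).target) :
    0 < (gramMatrix x₀ z).det := by
  have h := gramMatrix_mul_frame ((chartAt (EuclideanSpace ℝ (Fin 3)) x₀).map_target hz)
    (orthonormalFrame _)
  rw [(chartAt (EuclideanSpace ℝ (Fin 3)) x₀).right_inv hz] at h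
  have h2 := congrArg Matrix.det h
  set V : Matrix (Fin 3) (Fin 3) ℝ := Matrix.of fun i k => tangentCoord x₀
    ((chartAt (EuclideanSpace ℝ (Fin 3)) x₀).symm z) (orthonormalFrame _ i) k with hV
  have h3 : (Matrix.of fun k l => ∑ i, tangentCoord x₀
      ((chartAt (EuclideanSpace ℝ (Fin 3)) x₀).symm z) (orthonormalFrame _ i) k * tangentCoord x₀
      ((chartAt (EuclideanSpace ℝ (Fin 3)) x₀).symm z) (orthonormalFrame _ i) l) =
      V.transpose * V := rfl
  rw [h3, Matrix.det_mul, Matrix.det_mul, Matrix.det_transpose, Matrix.det_one] at h2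
  by_contra h4
  nlinarith [mul_self_nonneg V.det, not_lt.1 h4]

variable [IsContMDiffRiemannianBundle (𝓡 3) ∞ (EuclideanSpace ℝ (Fin 3))
      (fun x : M => TangentSpace (𝓡 3) x)]

lemma contDiffOn_gramMatrix (i j : Fin 3) : ContDiffOn ℝ ∞ (fun z => gramMatrix x₀ z i j)
    (chartAt (EuclideanSpace ℝ (Fin 3)) x₀).target := by
  intro z hz
  have h : ContMDiffAt (𝓡 3) 𝓘(ℝ, ℝ) ∞ (fun z : E3 =>
      inner ℝ (baseField x₀ i ((chartAt (EuclideanSpace ℝ (Fin 3)) x₀).symm z))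
        (baseField x₀ j ((chartAt (EuclideanSpace ℝ (Fin 3)) x₀).symm z))) z :=
    ContMDiffAt.inner_bundle (F := EuclideanSpace ℝ (Fin 3))
      (contMDiffAt_tangentCoordSymm_chart hz (stdE i))
      (contMDiffAt_tangentCoordSymm_chart hz (stdE j))
  refine (h.contDiffAt.congr_of_eventuallyEq ?_).contDiffWithinAt
  filter_upwards [(chartAt (EuclideanSpace ℝ (Fin 3)) x₀).open_target.mem_nhds hz] with z' hz'
  exact gramMatrix_apply hz' i j

lemma contDiffOn_det_gramMatrix : ContDiffOn ℝ ∞ (fun z => (gramMatrix x₀ z).det)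
    (chartAt (EuclideanSpace ℝ (Fin 3)) x₀).target := by
  simp only [Matrix.det_fin_three]
  have h := fun i j => contDiffOn_gramMatrix (x₀ := x₀) i j
  refine ContDiffOn.sub (ContDiffOn.add (ContDiffOn.add (ContDiffOn.sub (ContDiffOn.sub
    ?_ ?_) ?_) ?_) ?_) ?_ <;> exact ((h _ _).mul (h _ _)).mul (h _ _)

lemma contDiffOn_inv_gramMatrix (i j : Fin 3) : ContDiffOn ℝ ∞ (fun z => (gramMatrix x₀ z)⁻¹ i j)
    (chartAt (EuclideanSpace ℝ (Fin 3)) x₀).target := by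
  have h := fun i j => contDiffOn_gramMatrix (x₀ := x₀) i j
  have hd := (contDiffOn_det_gramMatrix (x₀ := x₀)).inv fun z hz => det_gramMatrix_ne_zero hz
  simp only [Matrix.inv_def, Matrix.smul_apply, smul_eq_mul, Ring.inverse_eq_inv']
  refine hd.mul ?_
  simp only [Matrix.adjugate_fin_three]
  fin_cases i <;> fin_cases j <;> simp <;> first
    | exact ((h _ _).mul (h _ _)).sub ((h _ _).mul (h _ _))
    | exact (((h _ _).mul (h _ _)).neg).add ((h _ _).mul (h _ _))

/-- Near every point of the chart, the base metric has Lipschitz coefficients. -/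
lemma exists_baseMetric {y₀ : E3} (hy : y₀ ∈ (chartAt (EuclideanSpace ℝ (Fin 3)) x₀).target) :
    ∃ r > 0, closedBall y₀ r ⊆ (chartAt (EuclideanSpace ℝ (Fin 3)) x₀).target ∧ ∃ Λ, 1 ≤ Λ ∧
      ∀ D ⊆ closedBall y₀ r, BaseMetric D (fun i j z => gramMatrix x₀ z i j)
        (fun i j z => (gramMatrix x₀ z)⁻¹ i j) Λ := by
  have ho := (chartAt (EuclideanSpace ℝ (Fin 3)) x₀).open_target.mem_nhds hy
  have hG : ContDiffAt ℝ 1 (fun z (i j : Fin 3) => gramMatrix x₀ z i j) y₀ :=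
    contDiffAt_pi.2 fun i => contDiffAt_pi.2 fun j =>
      ((contDiffOn_gramMatrix i j).contDiffAt ho).of_le (by simp)
  have hI : ContDiffAt ℝ 1 (fun z (i j : Fin 3) => (gramMatrix x₀ z)⁻¹ i j) y₀ :=
    contDiffAt_pi.2 fun i => contDiffAt_pi.2 fun j =>
      ((contDiffOn_inv_gramMatrix i j).contDiffAt ho).of_le (by simp)
  obtain ⟨K₁, t₁, ht₁, h₁⟩ := hG.exists_lipschitzOnWith
  obtain ⟨K₂, t₂, ht₂, h₂⟩ := hI.exists_lipschitzOnWith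
  obtain ⟨K₃, hK₃, h₃⟩ := exists_eventually_norm_le hG.continuousAt
  obtain ⟨K₄, hK₄, h₄⟩ := exists_eventually_norm_le hI.continuousAt
  obtain ⟨r, hr, hb⟩ := Metric.nhds_basis_closedBall.mem_iff.1
    (Filter.inter_mem (Filter.inter_mem ho (Filter.inter_mem ht₁ ht₂)) (h₃.and h₄))
  have hK₁ := K₁.2
  have hK₂ := K₂.2
  refine ⟨r, hr, fun z hz => (hb hz).1.1, 1 + K₁ + K₂ + K₃ + K₄, by linarith, fun D hD => ?_⟩
  exact {
    abs_le := fun k l z hz => by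
      have h := (norm_le_pi_norm (fun j : Fin 3 => gramMatrix x₀ z k j) l).trans
        ((norm_le_pi_norm (fun i j : Fin 3 => gramMatrix x₀ z i j) k).trans (hb (hD hz)).2.1)
      rw [Real.norm_eq_abs] at h
      linarith
    abs_inv_le := fun k l z hz => by
      have h := (norm_le_pi_norm (fun j : Fin 3 => (gramMatrix x₀ z)⁻¹ k j) l).trans
        ((norm_le_pi_norm (fun i j : Fin 3 => (gramMatrix x₀ z)⁻¹ i j) k).trans (hb (hD hz)).2.2)
      rw [Real.norm_eq_abs] at h
      linarith
    lipschitz := fun k l z hz z' hz' => by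
      have a := h₁.dist_le_mul z (hb (hD hz)).1.2.1 z' (hb (hD hz')).1.2.1
      have b := (dist_le_pi_dist (fun j : Fin 3 => gramMatrix x₀ z k j)
        (fun j : Fin 3 => gramMatrix x₀ z' k j) l).trans ((dist_le_pi_dist
        (fun i j : Fin 3 => gramMatrix x₀ z i j) (fun i j : Fin 3 => gramMatrix x₀ z' i j) k).trans a)
      rw [Real.dist_eq, dist_eq_norm] at b
      exact b.trans (mul_le_mul_of_nonneg_right (by linarith) (norm_nonneg _))
    lipschitz_inv := fun k l z hz z' hz' => by
      have a := h₂.dist_le_mul z (hb (hD hz)).1.2.2 z' (hb (hD hz')).1.2.2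
      have b := (dist_le_pi_dist (fun j : Fin 3 => (gramMatrix x₀ z)⁻¹ k j)
        (fun j : Fin 3 => (gramMatrix x₀ z')⁻¹ k j) l).trans ((dist_le_pi_dist
        (fun i j : Fin 3 => (gramMatrix x₀ z)⁻¹ i j)
        (fun i j : Fin 3 => (gramMatrix x₀ z')⁻¹ i j) k).trans a)
      rw [Real.dist_eq, dist_eq_norm] at b
      exact b.trans (mul_le_mul_of_nonneg_right (by linarith) (norm_nonneg _))
    exists_frame := fun z hz => exists_frame_gramMatrix (hb (hD hz)).1.1 }

end

/-! ### Distances in coordinates -/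

section

variable {M : Type*} [EMetricSpace M]
  [ChartedSpace (EuclideanSpace ℝ (Fin 3)) M] [IsManifold (𝓡 3) ∞ M]
  [RiemannianBundle (fun x : M => TangentSpace (𝓡 3) x)] {x₀ x : M}

lemma abs_sum_sum_le {G : Fin 3 → Fin 3 → ℝ} {Λ : ℝ} (hG : ∀ k l, |G k l| ≤ Λ) (a b : E3) :
    |∑ k, ∑ l, G k l * (a k * b l)| ≤ 9 * Λ * (‖a‖ * ‖b‖) := by
  have h2 : ∀ k l, |G k l * (a k * b l)| ≤ Λ * (‖a‖ * ‖b‖) := fun k l => by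
    rw [abs_mul, abs_mul]
    have h1 := hG k l
    have h3 := abs_coord_le a k
    have h4 := abs_coord_le b l
    have : 0 ≤ Λ := (abs_nonneg _).trans h1
    gcongr
  calc _ ≤ ∑ k, |∑ l, G k l * (a k * b l)| := Finset.abs_sum_le_sum_abs _ _
    _ ≤ ∑ k, ∑ l, |G k l * (a k * b l)| :=
      Finset.sum_le_sum fun k _ => Finset.abs_sum_le_sum_abs _ _
    _ ≤ ∑ _k : Fin 3, ∑ _l : Fin 3, Λ * (‖a‖ * ‖b‖) :=
      Finset.sum_le_sum fun k _ => Finset.sum_le_sum fun l _ => h2 k l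
    _ = _ := by simp; ring

lemma norm_tangentCoordSymm_le (hx : x ∈ (chartAt (EuclideanSpace ℝ (Fin 3)) x₀).source) {Λ : ℝ}
    (hΛ : 1 ≤ Λ)
    (hG : ∀ k l, |gramMatrix x₀ (chartAt (EuclideanSpace ℝ (Fin 3)) x₀ x) k l| ≤ Λ) (a : E3) :
    ‖tangentCoordSymm x₀ x a‖ ≤ 3 * Λ * ‖a‖ := by
  refine abs_le_of_sq_le_sq' ?_ (by positivity) |>.2
  rw [← real_inner_self_eq_norm_sq, inner_tangentCoordSymm hx]
  refine (le_abs_self _).trans ((abs_sum_sum_le hG a a).trans ?_)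
  have h : 0 ≤ ‖a‖ * ‖a‖ := mul_self_nonneg _
  nlinarith

variable [IsRiemannianManifold (𝓡 3) M]

/-- The inverse of a chart is Lipschitz where the metric coefficients are bounded: the image of a
segment is a path of controlled length. -/
lemma edist_chartAt_symm_le {y₀ : E3} {r Λ : ℝ} (hΛ : 1 ≤ Λ)
    (hb : ball y₀ r ⊆ (chartAt (EuclideanSpace ℝ (Fin 3)) x₀).target)
    (hG : ∀ k l, ∀ z ∈ ball y₀ r, |gramMatrix x₀ z k l| ≤ Λ) {a b : E3} (ha : a ∈ ball y₀ r)
    (hb' : b ∈ ball y₀ r) :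
    edist ((chartAt (EuclideanSpace ℝ (Fin 3)) x₀).symm a)
      ((chartAt (EuclideanSpace ℝ (Fin 3)) x₀).symm b) ≤ ENNReal.ofReal (3 * Λ * ‖b - a‖) := by
  set φ := chartAt (EuclideanSpace ℝ (Fin 3)) x₀ with hφ
  set γ : ℝ → M := fun t => φ.symm (a + t • (b - a)) with hγ
  have hmem : ∀ t ∈ Icc (0 : ℝ) 1, a + t • (b - a) ∈ ball y₀ r := fun t ht =>
    (convex_ball y₀ r).add_smul_sub_mem ha hb' ht
  have hline : ∀ t : ℝ, HasFDerivAt (fun t : ℝ => a + t • (b - a))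
      ((1 : ℝ →L[ℝ] ℝ).smulRight (b - a)) t := fun t =>
    ((hasFDerivAt_id t).smul_const (b - a)).const_add a
  have hd : ∀ t ∈ Icc (0 : ℝ) 1, HasMFDerivAt 𝓘(ℝ, ℝ) (𝓡 3) γ t
      ((tangentCoordSymm x₀ (φ.symm (a + t • (b - a)))).comp
        ((1 : ℝ →L[ℝ] ℝ).smulRight (b - a))) := fun t ht =>
    (hasMFDerivAt_chartAt_symm_of_target (hb (hmem t ht))).comp t (hline t).hasMFDerivAt
  have hsm : ContMDiffOn 𝓘(ℝ, ℝ) (𝓡 3) 1 γ (Icc 0 1) := by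
    have h1 : ContMDiff 𝓘(ℝ, ℝ) 𝓘(ℝ, E3) ∞ fun t : ℝ => a + t • (b - a) := by
      rw [contMDiff_iff_contDiff]
      fun_prop
    refine ContMDiffOn.of_le (n := ∞) ?_ (by simp)
    exact (contMDiffOn_chartAt_symm x₀).comp h1.contMDiffOn fun t ht => hb (hmem t ht)
  have h1 := Manifold.riemannianEDist_le_pathELength (I := 𝓡 3) hsm rfl rfl zero_le_one
  rw [IsRiemannianManifold.out (I := 𝓡 3)]
  simp only [hγ, zero_smul, add_zero, one_smul, add_sub_cancel] at h1
  refine h1.trans ?_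
  rw [Manifold.pathELength_eq_lintegral_mfderiv_Icc]
  calc _ ≤ ∫⁻ _t in Icc (0 : ℝ) 1, ENNReal.ofReal (3 * Λ * ‖b - a‖) := by
        refine setLIntegral_mono' measurableSet_Icc fun t ht => ?_
        rw [(hd t ht).mfderiv]
        have hz := hb (hmem t ht)
        have h2 := norm_tangentCoordSymm_le (φ.map_target hz) hΛ (fun k l => by
          rw [← hφ, φ.right_inv hz]; exact hG k l _ (hmem t ht)) (b - a)
        rw [← ofReal_norm]
        refine ENNReal.ofReal_le_ofReal (le_trans (le_of_eq ?_) h2)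
        congr 1
        show tangentCoordSymm x₀ _ ((1 : ℝ) • (b - a)) = _
        rw [one_smul]
    _ = _ := by simp

end

/-! ### The Riemannian volume -/

section

variable {M : Type*} [TopologicalSpace M] [ChartedSpace (EuclideanSpace ℝ (Fin 3)) M]
  [MeasurableSpace M] [BorelSpace M] {x₀ : M}

lemma aemeasurable_chartAt_symm :
    AEMeasurable (chartAt (EuclideanSpace ℝ (Fin 3)) x₀).symm
    (volume.restrict (chartAt (EuclideanSpace ℝ (Fin 3)) x₀).target) :=
  (chartAt (EuclideanSpace ℝ (Fin 3)) x₀).symm.continuousOn.aemeasurable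
    (chartAt (EuclideanSpace ℝ (Fin 3)) x₀).open_target.measurableSet

lemma aemeasurable_chartAt_symm_withDensity (d : E3 → ENNReal) :
    AEMeasurable (chartAt (EuclideanSpace ℝ (Fin 3)) x₀).symm
    ((volume.restrict (chartAt (EuclideanSpace ℝ (Fin 3)) x₀).target).withDensity d) :=
  aemeasurable_chartAt_symm.mono_ac (withDensity_absolutelyContinuous _ _)

end

section

variable {M : Type*} [EMetricSpace M]
  [ChartedSpace (EuclideanSpace ℝ (Fin 3)) M]
  [RiemannianBundle (fun x : M => TangentSpace (𝓡 3) x)] {x₀ : M}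

variable (x₀) in
/-- The density of the Riemannian volume in the chart at `x₀`. -/
def volumeDensity (z : E3) : ENNReal := ENNReal.ofReal (Real.sqrt (gramMatrix x₀ z).det)

section

variable [MeasurableSpace M] [BorelSpace M]

lemma chartVolume_apply {A : Set M} (hA : MeasurableSet A) : chartVolume x₀ A =
    ∫⁻ z in (chartAt (EuclideanSpace ℝ (Fin 3)) x₀).symm ⁻¹' A ∩
      (chartAt (EuclideanSpace ℝ (Fin 3)) x₀).target, volumeDensity x₀ z := by
  have h : chartVolume x₀ =
      ((volume.restrict (chartAt (EuclideanSpace ℝ (Fin 3)) x₀).target).withDensity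
      (volumeDensity x₀)).map (chartAt (EuclideanSpace ℝ (Fin 3)) x₀).symm := rfl
  rw [h, Measure.map_apply_of_aemeasurable (aemeasurable_chartAt_symm_withDensity _) hA,
    withDensity_apply', Measure.restrict_restrict'
      (chartAt (EuclideanSpace ℝ (Fin 3)) x₀).open_target.measurableSet]

end

variable [IsManifold (𝓡 3) ∞ M]

lemma chartVolume_le_riemannianVolume [MeasurableSpace M] :
    chartVolume x₀ ≤ riemannianVolume M :=
  le_iSup (fun x₀ : M => chartVolume x₀) x₀

section

variable [MeasurableSpace M] [BorelSpace M]

/-- The chart volumes agree where both are defined: the densities transform by the determinant of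
the change of coordinates. -/
lemma chartVolume_le {x₁ : M} {A : Set M} (hA : MeasurableSet A)
    (hAs : A ⊆ (chartAt (EuclideanSpace ℝ (Fin 3)) x₁).source) :
    chartVolume x₀ A ≤ chartVolume x₁ A := by
  set φ := chartAt (EuclideanSpace ℝ (Fin 3)) x₀ with hφ
  set ψ := chartAt (EuclideanSpace ℝ (Fin 3)) x₁ with hψ
  set s : Set E3 := ψ.target ∩ ψ.symm ⁻¹' (A ∩ φ.source) with hs
  have hsm : MeasurableSet s := by
    have h1 : MeasurableSet (ψ.target.domRestrict ψ.symm ⁻¹' (A ∩ φ.source)) :=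
      ψ.symm.continuousOn.domRestrict.measurable (hA.inter φ.open_source.measurableSet)
    have h2 := MeasurableSet.subtype_image ψ.open_target.measurableSet h1
    convert h2 using 1
    ext z
    simp only [hs, mem_inter_iff, mem_preimage, mem_image, Subtype.exists, exists_and_right,
      exists_eq_right, domRestrict_apply, exists_prop]
    tauto
  set J : E3 → E3 →L[ℝ] E3 := fun z =>
    (tangentCoord x₀ (ψ.symm z)).comp (tangentCoordSymm x₁ (ψ.symm z)) with hJ
  have hder : ∀ z ∈ s, HasFDerivWithinAt (fun z => φ (ψ.symm z)) (J z) s z := fun z hz => by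
    have h := (hasMFDerivAt_chartAt hz.2.2).comp z (hasMFDerivAt_chartAt_symm_of_target hz.1)
    have h2 : HasFDerivAt (fun z => φ (ψ.symm z)) (J z) z := hasMFDerivAt_iff_hasFDerivAt.1 h
    exact h2.hasFDerivWithinAt
  have hinj : InjOn (fun z => φ (ψ.symm z)) s := fun z hz z' hz' h =>
    ψ.symm.injOn hz.1 hz'.1 (φ.injOn hz.2.2 hz'.2.2 h)
  have himg : φ.symm ⁻¹' A ∩ φ.target = (fun z => φ (ψ.symm z)) '' s := by
    ext y
    constructor
    · rintro ⟨hy, hyt⟩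
      refine ⟨ψ (φ.symm y), ⟨ψ.map_source (hAs hy), ?_⟩, ?_⟩
      · rw [mem_preimage, ψ.left_inv (hAs hy)]
        exact ⟨hy, φ.map_target hyt⟩
      · simp only [ψ.left_inv (hAs hy), φ.right_inv hyt]
    · rintro ⟨z, hz, rfl⟩
      exact ⟨by simpa only [mem_preimage, φ.left_inv hz.2.2] using hz.2.1, φ.map_source hz.2.2⟩
  have hdens : ∀ z ∈ s, ENNReal.ofReal |(J z).det| * volumeDensity x₀ (φ (ψ.symm z)) =
      volumeDensity x₁ z := by
    intro z hz
    set P : Matrix (Fin 3) (Fin 3) ℝ := Matrix.of fun a i => J z (stdE i) a with hP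
    have hdet : (J z).det = P.det := by
      have h1 := LinearMap.det_toMatrix (EuclideanSpace.basisFun (Fin 3) ℝ).toBasis
        (J z).toLinearMap
      rw [ContinuousLinearMap.det, ← h1]
      congr 1
    have hgram : gramMatrix x₁ z = P.transpose * gramMatrix x₀ (φ (ψ.symm z)) * P := by
      ext i k
      have h1 := gramMatrix_apply hz.1 i k
      have hcs : ∀ i, baseField x₁ i (ψ.symm z) = tangentCoordSymm x₀ (ψ.symm z) (J z (stdE i)) :=
        fun i => (tangentCoordSymm_coord hz.2.2 (baseField x₁ i (ψ.symm z))).symm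
      rw [h1, ← hψ, hcs, hcs, inner_tangentCoordSymm hz.2.2]
      simp only [Matrix.mul_apply, Matrix.transpose_apply, hP, Matrix.of_apply, Finset.sum_mul]
      rw [Finset.sum_comm]
      refine Finset.sum_congr rfl fun k _ => Finset.sum_congr rfl fun l _ => ?_
      ring
    unfold volumeDensity
    rw [← ENNReal.ofReal_mul (abs_nonneg _), hgram, Matrix.det_mul, Matrix.det_mul,
      Matrix.det_transpose, hdet, mul_comm P.det, mul_assoc, mul_comm, ← Real.sqrt_sq_eq_abs,
      ← Real.sqrt_mul (gramMatrix_det_pos (φ.map_source hz.2.2)).le, sq]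
  rw [chartVolume_apply hA, chartVolume_apply hA, ← hφ, ← hψ, himg,
    lintegral_image_eq_lintegral_abs_det_fderiv_mul volume hsm hder hinj,
    setLIntegral_congr_fun hsm hdens]
  exact lintegral_mono_set fun z hz => ⟨hz.2.1, hz.1⟩

end

variable [IsContMDiffRiemannianBundle (𝓡 3) ∞ (EuclideanSpace ℝ (Fin 3))
      (fun x : M => TangentSpace (𝓡 3) x)]

lemma aemeasurable_volumeDensity : AEMeasurable (volumeDensity x₀)
    (volume.restrict (chartAt (EuclideanSpace ℝ (Fin 3)) x₀).target) :=
  (((Real.continuous_sqrt.comp_continuousOn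
    (contDiffOn_det_gramMatrix (x₀ := x₀)).continuousOn).aemeasurable
    (chartAt (EuclideanSpace ℝ (Fin 3)) x₀).open_target.measurableSet)).ennreal_ofReal

variable [MeasurableSpace M] [BorelSpace M]

lemma lintegral_chartVolume {f : M → ENNReal} (hf : Measurable f) :
    ∫⁻ x, f x ∂(chartVolume x₀) = ∫⁻ z in (chartAt (EuclideanSpace ℝ (Fin 3)) x₀).target,
      volumeDensity x₀ z * f ((chartAt (EuclideanSpace ℝ (Fin 3)) x₀).symm z) := by
  have h : chartVolume x₀ =
      ((volume.restrict (chartAt (EuclideanSpace ℝ (Fin 3)) x₀).target).withDensity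
      (volumeDensity x₀)).map (chartAt (EuclideanSpace ℝ (Fin 3)) x₀).symm := rfl
  rw [h, lintegral_map' hf.aemeasurable (aemeasurable_chartAt_symm_withDensity _),
    lintegral_withDensity_eq_lintegral_mul₀ aemeasurable_volumeDensity
      (g := fun z => f ((chartAt (EuclideanSpace ℝ (Fin 3)) x₀).symm z))
      (hf.comp_aemeasurable aemeasurable_chartAt_symm)]
  rfl

/-- An integral over a domain of a chart, with respect to Lebesgue measure, is controlled by the
integral with respect to the Riemannian volume. -/
lemma setIntegral_chartAt_symm_le {f : M → ℝ} (hf : Continuous f) (hf0 : ∀ x, 0 ≤ f x)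
    (hint : Integrable f (riemannianVolume M)) {T : Set E3} (hT : IsOpen T)
    (hTt : T ⊆ (chartAt (EuclideanSpace ℝ (Fin 3)) x₀).target) {A : Set M} (hA : MeasurableSet A)
    (hTA : ∀ z ∈ T, (chartAt (EuclideanSpace ℝ (Fin 3)) x₀).symm z ∈ A) {c : ℝ} (hc : 0 ≤ c)
    (hdet : ∀ z ∈ T, c ≤ Real.sqrt (gramMatrix x₀ z).det) :
    c * ∫ z in T, f ((chartAt (EuclideanSpace ℝ (Fin 3)) x₀).symm z) ≤
      ∫ x in A, f x ∂(riemannianVolume M) := by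
  have hfm : Measurable fun x => ENNReal.ofReal (f x) := hf.measurable.ennreal_ofReal
  have h1 : ENNReal.ofReal c * ∫⁻ z in T, ENNReal.ofReal
      (f ((chartAt (EuclideanSpace ℝ (Fin 3)) x₀).symm z)) ≤
      ∫⁻ x in A, ENNReal.ofReal (f x) ∂(riemannianVolume M) := by
    calc _ = ∫⁻ z in T, ENNReal.ofReal c * ENNReal.ofReal
          (f ((chartAt (EuclideanSpace ℝ (Fin 3)) x₀).symm z)) :=
          (lintegral_const_mul' _ _ ENNReal.ofReal_ne_top).symm
      _ ≤ ∫⁻ z in T, volumeDensity x₀ z * A.indicator (fun x => ENNReal.ofReal (f x))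
          ((chartAt (EuclideanSpace ℝ (Fin 3)) x₀).symm z) := by
          refine setLIntegral_mono' hT.measurableSet fun z hz => ?_
          rw [indicator_of_mem (hTA z hz)]
          exact mul_le_mul_left (ENNReal.ofReal_le_ofReal (hdet z hz)) _
      _ ≤ ∫⁻ z in (chartAt (EuclideanSpace ℝ (Fin 3)) x₀).target, volumeDensity x₀ z *
          A.indicator (fun x => ENNReal.ofReal (f x))
          ((chartAt (EuclideanSpace ℝ (Fin 3)) x₀).symm z) := lintegral_mono_set hTt
      _ = ∫⁻ x, A.indicator (fun x => ENNReal.ofReal (f x)) x ∂(chartVolume x₀) :=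
          (lintegral_chartVolume (hfm.indicator hA)).symm
      _ ≤ ∫⁻ x, A.indicator (fun x => ENNReal.ofReal (f x)) x ∂(riemannianVolume M) :=
          lintegral_mono' chartVolume_le_riemannianVolume le_rfl
      _ = _ := lintegral_indicator hA _
  have hcont : ContinuousOn (fun z => f ((chartAt (EuclideanSpace ℝ (Fin 3)) x₀).symm z)) T :=
    hf.comp_continuousOn ((chartAt (EuclideanSpace ℝ (Fin 3)) x₀).symm.continuousOn.mono hTt)
  rw [integral_eq_lintegral_of_nonneg_ae (Filter.Eventually.of_forall fun z => hf0 _)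
      (hcont.aestronglyMeasurable hT.measurableSet),
    integral_eq_lintegral_of_nonneg_ae (Filter.Eventually.of_forall fun z => hf0 _)
      hf.aestronglyMeasurable]
  have h2 := ENNReal.toReal_mono ?_ h1
  · rwa [ENNReal.toReal_mul, ENNReal.toReal_ofReal hc] at h2
  exact (hint.integrableOn (s := A)).lintegral_lt_top.ne

/-- The volume is finite near every point. -/
lemma exists_chartVolume_lt_top (x₁ : M) : ∃ U : Set M, IsOpen U ∧ x₁ ∈ U ∧
    U ⊆ (chartAt (EuclideanSpace ℝ (Fin 3)) x₁).source ∧ chartVolume x₁ U < ⊤ := by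
  set ψ := chartAt (EuclideanSpace ℝ (Fin 3)) x₁ with hψ
  have ho := ψ.open_target.mem_nhds (mem_chart_target (EuclideanSpace ℝ (Fin 3)) x₁)
  obtain ⟨K, hK, hev⟩ := exists_eventually_norm_le
    ((Real.continuous_sqrt.continuousAt).comp
      ((contDiffOn_det_gramMatrix (x₀ := x₁)).contDiffAt ho).continuousAt)
  obtain ⟨r, hr, hb⟩ := Metric.mem_nhds_iff.1 (Filter.inter_mem ho hev)
  refine ⟨ψ.source ∩ ψ ⁻¹' ball (ψ x₁) r, ψ.isOpen_inter_preimage isOpen_ball,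
    ⟨mem_chart_source _ x₁, mem_ball_self hr⟩, inter_subset_left, ?_⟩
  rw [chartVolume_apply (ψ.isOpen_inter_preimage isOpen_ball).measurableSet]
  calc _ ≤ ∫⁻ z in ball (ψ x₁) r, volumeDensity x₁ z := lintegral_mono_set fun z hz => by
        have h := hz.1.2
        rwa [mem_preimage, ψ.right_inv hz.2] at h
    _ ≤ ∫⁻ _z in ball (ψ x₁) r, ENNReal.ofReal K := by
        refine setLIntegral_mono' measurableSet_ball fun z hz => ENNReal.ofReal_le_ofReal ?_
        exact (le_abs_self _).trans (hb hz).2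
    _ < ⊤ := by
        rw [setLIntegral_const]
        exact ENNReal.mul_lt_top ENNReal.ofReal_lt_top measure_ball_lt_top

/-- The Riemannian volume of a compact manifold is finite. -/
lemma isFiniteMeasure_riemannianVolume [CompactSpace M] :
    IsFiniteMeasure (riemannianVolume M) := by
  choose U hUo hUm hUs hUv using fun x : M => exists_chartVolume_lt_top x
  obtain ⟨t, -, ht⟩ := (isCompact_univ (X := M)).elim_nhds_subcover U
    fun x _ => (hUo x).mem_nhds (hUm x)
  have hle : riemannianVolume M ≤ ∑ j ∈ t, (chartVolume j).restrict (U j) := by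
    refine iSup_le fun x => Measure.le_iff.2 fun A hA => ?_
    rw [Measure.finsetSum_apply]
    calc chartVolume x A ≤ chartVolume x (⋃ j ∈ t, A ∩ U j) := measure_mono fun y hy => by
          obtain ⟨j, hj, hyj⟩ := mem_iUnion₂.1 (ht (mem_univ y))
          exact mem_iUnion₂.2 ⟨j, hj, hy, hyj⟩
      _ ≤ ∑ j ∈ t, chartVolume x (A ∩ U j) := measure_biUnion_finset_le _ _
      _ ≤ ∑ j ∈ t, (chartVolume j).restrict (U j) A := Finset.sum_le_sum fun j _ => by
          rw [Measure.restrict_apply hA]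
          exact chartVolume_le (hA.inter (hUo j).measurableSet)
            (inter_subset_right.trans (hUs j))
  refine ⟨(hle univ).trans_lt ?_⟩
  rw [Measure.finsetSum_apply]
  refine ENNReal.sum_lt_top.2 fun j _ => ?_
  rw [Measure.restrict_apply MeasurableSet.univ, univ_inter]
  exact hUv j

end

/-! ### The energy density of a section -/

variable {n : ℕ} {M X : Type*} [EMetricSpace M]
  [ChartedSpace (EuclideanSpace ℝ (Fin 3)) M] [IsManifold (𝓡 3) ∞ M]
  [RiemannianBundle (fun x : M => TangentSpace (𝓡 3) x)]
  [TopologicalSpace X] [ChartedSpace (EuclideanSpace ℝ (Fin n)) X] [IsManifold (𝓡 n) ∞ X]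

namespace HyperkahlerBundle

variable {B : HyperkahlerBundle n M X} {A : B.Connection} {p : B.VerticalField} {x₀ : M} {e : X}

lemma metric_self_nonneg {w : TangentSpace (𝓡 n) e} (hw : B.IsVertical w) :
    0 ≤ B.metric e w w := by
  by_cases h : w = 0
  · rw [h, map_zero]
  · exact (B.metric_pos e w hw h).le

lemma metric_self_add_add_le {a b c : TangentSpace (𝓡 n) e} (ha : B.IsVertical a)
    (hb : B.IsVertical b) (hc : B.IsVertical c) : B.metric e (a + b + c) (a + b + c) ≤
      3 * (B.metric e a a + B.metric e b b + B.metric e c c) := by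
  have hsub : ∀ v w : TangentSpace (𝓡 n) e, B.IsVertical v → B.IsVertical w →
      B.metric e v w + B.metric e w v ≤ B.metric e v v + B.metric e w w := fun v w hv hw => by
    have h : B.IsVertical (v - w) := by
      unfold IsVertical at hv hw ⊢
      rw [map_sub, hv, hw, sub_zero]
    have h2 := metric_self_nonneg h
    simp only [map_sub, sub_apply] at h2
    linarith
  have h1 := hsub a b ha hb
  have h2 := hsub a c ha hc
  have h3 := hsub b c hb hc
  simp only [map_add, add_apply]
  linarith

/-- The length of a vertical vector `⅓ I(ξ) p` is `⅓ |ξ| |p|`, so that the covariant derivatives for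
the given and for the modified connection are comparable. -/
lemma metric_perturbedVert_le {x : M} (h : B.proj e = x)
    (D : TangentSpace (𝓡 3) x →L[ℝ] TangentSpace (𝓡 n) e)
    (hD : ∀ w, (mfderiv (𝓡 n) (𝓡 3) B.proj e (D w) : EuclideanSpace ℝ (Fin 3)) = w)
    (v : TangentSpace (𝓡 3) x) :
    B.metric e (A.perturbedVert p e (D v)) (A.perturbedVert p e (D v)) ≤
      3 * (B.metric e (A.vert e (D v)) (A.vert e (D v)) +
        ‖v‖ ^ 2 * B.metric e (p.toFun e) (p.toFun e)) ∧
    B.metric e (A.vert e (D v)) (A.vert e (D v)) ≤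
      3 * (B.metric e (A.perturbedVert p e (D v)) (A.perturbedVert p e (D v)) +
        ‖v‖ ^ 2 * B.metric e (p.toFun e) (p.toFun e)) := by
  subst h
  have hN : A.perturbedVert p e (D v) = A.vert e (D v) + (1 / 3 : ℝ) • B.I e v (p.toFun e) := by
    rw [A.perturbedVert_apply, hD]
  have hp := p.isVertical e
  have hIp : B.IsVertical (B.I e v (p.toFun e)) := B.I_vertical e v _ hp
  have hI : B.metric e (B.I e v (p.toFun e)) (B.I e v (p.toFun e)) =
      ‖v‖ ^ 2 * B.metric e (p.toFun e) (p.toFun e) := by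
    have h2 := B.I_clifford e v v hp
    rw [real_inner_self_eq_norm_sq, ← two_smul ℝ] at h2
    have h3 : B.I e v (B.I e v (p.toFun e)) = (-‖v‖ ^ 2) • p.toFun e := by
      have h4 := congrArg (fun w => (1 / 2 : ℝ) • w) h2
      simp only [smul_smul] at h4
      rw [show (1 / 2 : ℝ) * 2 = 1 by norm_num, one_smul] at h4
      rw [h4]
      congr 1
      ring
    rw [B.I_skew e v hp hIp, h3, map_smul, smul_eq_mul]
    ring
  have hpp := metric_self_nonneg hp
  have hv2 := sq_nonneg ‖v‖
  have hmul : 0 ≤ ‖v‖ ^ 2 * B.metric e (p.toFun e) (p.toFun e) := mul_nonneg hv2 hpp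
  have hvert : ∀ c : ℝ, B.IsVertical (c • B.I e v (p.toFun e)) := fun c => by
    unfold IsVertical at hIp ⊢
    rw [map_smul, hIp, smul_zero]
  have hz : B.IsVertical (0 : TangentSpace (𝓡 n) e) := map_zero _
  have hsq : ∀ c : ℝ, c ^ 2 = 1 / 9 → B.metric e (c • B.I e v (p.toFun e))
      (c • B.I e v (p.toFun e)) = 1 / 9 * (‖v‖ ^ 2 * B.metric e (p.toFun e) (p.toFun e)) :=
    fun c hc => by
      rw [map_smul, map_smul, smul_apply, hI, smul_eq_mul, smul_eq_mul, ← mul_assoc, ← sq, hc]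
  constructor
  · have h1 := metric_self_add_add_le (A.isVertical_vert e (D v)) (hvert (1 / 3)) hz
    rw [hsq _ (by norm_num), map_zero, add_zero, add_zero, ← hN] at h1
    linarith
  · have h1 := metric_self_add_add_le (A.isVertical_perturbedVert p e (D v)) (hvert (-1 / 3)) hz
    have h2 : A.perturbedVert p e (D v) + (-1 / 3 : ℝ) • B.I e v (p.toFun e) =
        A.vert e (D v) := by
      rw [hN]
      module
    rw [hsq _ (by norm_num), map_zero, add_zero, add_zero, h2] at h1
    linarith

variable (A) in
/-- The form `⟨∇_v u, ∇_w u⟩` of a section. -/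
def Connection.gradForm (u : B.SmoothSection) (x : M) (v w : TangentSpace (𝓡 3) x) : ℝ :=
  B.metric (u.toFun x) (A.covDeriv u x v) (A.covDeriv u x w)

variable {u : B.SmoothSection} {x : M}

lemma gradForm_self_nonneg (v : TangentSpace (𝓡 3) x) : 0 ≤ A.gradForm u x v v :=
  metric_self_nonneg (A.isVertical_vert _ _)

lemma gradForm_sum_sum (a b : Fin 3 → ℝ) (v w : Fin 3 → TangentSpace (𝓡 3) x) :
    A.gradForm u x (∑ k, a k • v k) (∑ k, b k • w k) =
      ∑ k, ∑ l, a k * b l * A.gradForm u x (v k) (w l) := by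
  simp only [Connection.gradForm, Connection.covDeriv, Fin.sum_univ_three, map_add, map_smul,
    add_apply, smul_apply, smul_eq_mul]
  ring

lemma gradForm_sum_le (a : Fin 3 → ℝ) (v : Fin 3 → TangentSpace (𝓡 3) x) :
    A.gradForm u x (∑ k, a k • v k) (∑ k, a k • v k) ≤
      3 * ∑ k, a k ^ 2 * A.gradForm u x (v k) (v k) := by
  have h := metric_self_add_add_le
    (A.isVertical_vert _ (mfderiv (𝓡 3) (𝓡 n) u.toFun x (a 0 • v 0)))
    (A.isVertical_vert _ (mfderiv (𝓡 3) (𝓡 n) u.toFun x (a 1 • v 1)))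
    (A.isVertical_vert _ (mfderiv (𝓡 3) (𝓡 n) u.toFun x (a 2 • v 2)))
  simp only [Connection.gradForm, Connection.covDeriv, Fin.sum_univ_three, map_add, map_smul,
    add_apply, smul_apply, smul_eq_mul] at h ⊢
  linarith

lemma energyDensity_eq : A.energyDensity u x =
    ∑ i, A.gradForm u x (orthonormalFrame x i) (orthonormalFrame x i) := by
  unfold Connection.energyDensity
  refine Fintype.sum_equiv (finCongr (finrank_tangentSpace x)) _ _ fun i => ?_
  simp only [orthonormalFrame, OrthonormalBasis.reindex_apply, finCongr_symm, finCongr_apply,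
    Fin.cast_cast, Fin.cast_eq_self]
  rfl

lemma energyDensity_nonneg : 0 ≤ A.energyDensity u x := by
  rw [energyDensity_eq]
  exact Finset.sum_nonneg fun i _ => gradForm_self_nonneg _

lemma energyDensity_eq_sum_gramMatrix (hx : x ∈ (chartAt (EuclideanSpace ℝ (Fin 3)) x₀).source) :
    A.energyDensity u x = ∑ k, ∑ l,
      (gramMatrix x₀ (chartAt (EuclideanSpace ℝ (Fin 3)) x₀ x))⁻¹ k l *
        A.gradForm u x (baseField x₀ k x) (baseField x₀ l x) := by
  have h1 : ∀ i, orthonormalFrame x i =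
      ∑ k, tangentCoord x₀ x (orthonormalFrame x i) k • baseField x₀ k x := fun i => by
    rw [← tangentCoordSymm_eq_sum, tangentCoordSymm_coord hx]
  have h2 : ∀ i, A.gradForm u x (orthonormalFrame x i) (orthonormalFrame x i) = ∑ k, ∑ l,
      tangentCoord x₀ x (orthonormalFrame x i) k * tangentCoord x₀ x (orthonormalFrame x i) l *
        A.gradForm u x (baseField x₀ k x) (baseField x₀ l x) := fun i => by
    rw [← gradForm_sum_sum, ← h1]
  simp only [energyDensity_eq, h2, gramMatrix_inv_frame hx (orthonormalFrame x), Finset.sum_mul]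
  rw [Finset.sum_comm]
  exact Finset.sum_congr rfl fun k _ => Finset.sum_comm

lemma contMDiffAt_gradForm (hx : x ∈ (chartAt (EuclideanSpace ℝ (Fin 3)) x₀).source)
    (k l : Fin 3) : ContMDiffAt (𝓡 3) 𝓘(ℝ, ℝ) ∞
      (fun x => A.gradForm u x (baseField x₀ k x) (baseField x₀ l x)) x := by
  have h : ∀ k, ContMDiffAt (𝓡 3) (𝓡 n).tangent ∞ (fun x => (⟨u.toFun x,
      A.covDeriv u x (baseField x₀ k x)⟩ : TangentBundle (𝓡 n) X)) x := fun k => by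
    have h1 := (u.smooth.contMDiff_tangentMap (m := ∞) (by simp)).contMDiffAt.comp x
      (contMDiffAt_tangentCoordSymm hx (stdE k))
    exact ContMDiffAt.clm_bundle_apply (E₁ := (TangentSpace (𝓡 n) : X → Type _))
      (E₂ := (TangentSpace (𝓡 n) : X → Type _)) ((A.contMDiff_vert.contMDiffAt).comp x (u.smooth x))
      h1
  exact contMDiffAt_form_apply B.contMDiff_metric (u.smooth x) (h k) (h l)

lemma continuous_energyDensity [IsContMDiffRiemannianBundle (𝓡 3) ∞ (EuclideanSpace ℝ (Fin 3))
      (fun x : M => TangentSpace (𝓡 3) x)] : Continuous (A.energyDensity u) := by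
  rw [continuous_iff_continuousAt]
  intro x₀
  have hx := mem_chart_source (EuclideanSpace ℝ (Fin 3)) x₀
  have h : ContinuousAt (fun x => ∑ k, ∑ l,
      (gramMatrix x₀ (chartAt (EuclideanSpace ℝ (Fin 3)) x₀ x))⁻¹ k l *
        A.gradForm u x (baseField x₀ k x) (baseField x₀ l x)) x₀ := by
    refine tendsto_finsetSum _ fun k _ => tendsto_finsetSum _ fun l _ => ?_
    refine ContinuousAt.mul ?_ (contMDiffAt_gradForm hx k l).continuousAt
    exact ContinuousAt.comp (g := fun z => (gramMatrix x₀ z)⁻¹ k l)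
      ((contDiffOn_inv_gramMatrix k l).continuousOn.continuousAt
      ((chartAt (EuclideanSpace ℝ (Fin 3)) x₀).open_target.mem_nhds
        (mem_chart_target (EuclideanSpace ℝ (Fin 3)) x₀)))
      ((chartAt (EuclideanSpace ℝ (Fin 3)) x₀).continuousAt hx)
  refine h.congr ?_
  filter_upwards [(chartAt (EuclideanSpace ℝ (Fin 3)) x₀).open_source.mem_nhds hx] with x hx'
  exact (energyDensity_eq_sum_gramMatrix hx').symm

variable (p) in
lemma exists_metric_le [CompactSpace X] :
    ∃ C, 0 ≤ C ∧ ∀ e, B.metric e (p.toFun e) (p.toFun e) ≤ C := by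
  have h : Continuous fun e => B.metric e (p.toFun e) (p.toFun e) :=
    continuous_iff_continuousAt.2 fun e => (contMDiffAt_form_apply (b := id)
      B.contMDiff_metric contMDiffAt_id (p.smooth e) (p.smooth e)).continuousAt
  obtain ⟨C, hC⟩ := (isCompact_range h).bddAbove
  exact ⟨max C 0, le_max_right _ _, fun e => (hC ⟨e, rfl⟩).trans (le_max_left _ _)⟩

/-- The two energy densities, of the given connection in an orthonormal frame and of the modified
connection in the coordinate frame, are comparable. -/
lemma density_sectionEnergy_le {z : E3} (hz : z ∈ (chartAt (EuclideanSpace ℝ (Fin 3)) x₀).target)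
    {Λ C : ℝ} (hΛ : 1 ≤ Λ) (hG : ∀ k l, |gramMatrix x₀ z k l| ≤ Λ)
    (hGinv : ∀ k l, |(gramMatrix x₀ z)⁻¹ k l| ≤ Λ) (hC : 0 ≤ C)
    (hp : ∀ e, B.metric e (p.toFun e) (p.toFun e) ≤ C) :
    density (A.sectionEnergy p u x₀) z ≤ 243 * Λ ^ 2 * (1 + C) *
      (1 + A.energyDensity u ((chartAt (EuclideanSpace ℝ (Fin 3)) x₀).symm z)) ∧
    A.energyDensity u ((chartAt (EuclideanSpace ℝ (Fin 3)) x₀).symm z) ≤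
      243 * Λ ^ 3 * (1 + C) * density (A.sectionEnergy p u x₀) z := by
  set x := (chartAt (EuclideanSpace ℝ (Fin 3)) x₀).symm z with hxdef
  have hx : x ∈ (chartAt (EuclideanSpace ℝ (Fin 3)) x₀).source :=
    (chartAt (EuclideanSpace ℝ (Fin 3)) x₀).map_target hz
  have hxz : chartAt (EuclideanSpace ℝ (Fin 3)) x₀ x = z :=
    (chartAt (EuclideanSpace ℝ (Fin 3)) x₀).right_inv hz
  have hcmp := fun k => metric_perturbedVert_le (A := A) (p := p) (u.proj_toFun x)
    (mfderiv (𝓡 3) (𝓡 n) u.toFun x) (mfderiv_proj_section u x) (baseField x₀ k x)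
  set q : Fin 3 → ℝ := fun k => A.gradForm u x (baseField x₀ k x) (baseField x₀ k x) with hq
  set s : Fin 3 → ℝ := fun k => A.sectionEnergy p u x₀ z (stdE k) (stdE k) with hs
  have hq0 : ∀ k, 0 ≤ q k := fun k => gradForm_self_nonneg _
  have hs0 : ∀ k, 0 ≤ s k := fun k => metric_self_nonneg (A.isVertical_perturbedVert p _ _)
  have hE0 : 0 ≤ A.energyDensity u x := energyDensity_nonneg
  have hb : ∀ k, ‖baseField x₀ k x‖ ^ 2 ≤ Λ := fun k => by
    have h := gramMatrix_chartAt hx k k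
    rw [hxz] at h
    rw [← real_inner_self_eq_norm_sq, ← h]
    exact (le_abs_self _).trans (hG k k)
  have hbC : ∀ k, ‖baseField x₀ k x‖ ^ 2 * B.metric (u.toFun x) (p.toFun _) (p.toFun _) ≤ Λ * C :=
    fun k => mul_le_mul (hb k) (hp _) (metric_self_nonneg (p.isVertical _)) (by linarith)
  have h1 : ∀ k, s k ≤ 3 * (q k + Λ * C) := fun k =>
    (hcmp k).1.trans (mul_le_mul_of_nonneg_left (add_le_add le_rfl (hbC k)) (by norm_num))
  have h2 : ∀ k, q k ≤ 3 * (s k + Λ * C) := fun k =>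
    (hcmp k).2.trans (mul_le_mul_of_nonneg_left (add_le_add le_rfl (hbC k)) (by norm_num))
  set w := orthonormalFrame x with hw
  have h3 : ∀ k, q k ≤ 3 * (Λ * A.energyDensity u x) := fun k => by
    have e1 : baseField x₀ k x = ∑ i, inner ℝ (w i) (baseField x₀ k x) • w i :=
      (w.sum_repr' _).symm
    have e2 := gradForm_sum_le (A := A) (u := u) (fun i => inner ℝ (w i) (baseField x₀ k x)) w
    rw [← e1] at e2
    refine e2.trans (mul_le_mul_of_nonneg_left ?_ (by norm_num))
    rw [energyDensity_eq, Finset.mul_sum]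
    refine Finset.sum_le_sum fun i _ => mul_le_mul_of_nonneg_right ?_ (gradForm_self_nonneg _)
    have e3 := abs_real_inner_le_norm (w i) (baseField x₀ k x)
    rw [w.norm_eq_one, one_mul] at e3
    exact (sq_le_sq.2 (by rwa [abs_norm])).trans (hb k)
  have h4 : A.energyDensity u x ≤ 3 * (Λ * ∑ k, q k) := by
    have e1 : ∀ i, w i = ∑ k, tangentCoord x₀ x (w i) k • baseField x₀ k x := fun i => by
      rw [← tangentCoordSymm_eq_sum, tangentCoordSymm_coord hx]
    have e2 : ∀ i, A.gradForm u x (w i) (w i) ≤ 3 * ∑ k, tangentCoord x₀ x (w i) k ^ 2 * q k :=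
      fun i => by
        have := gradForm_sum_le (A := A) (u := u) (tangentCoord x₀ x (w i))
          fun k => baseField x₀ k x
        rwa [← e1] at this
    rw [energyDensity_eq]
    refine (Finset.sum_le_sum fun i _ => e2 i).trans ?_
    rw [← Finset.mul_sum, Finset.sum_comm]
    refine mul_le_mul_of_nonneg_left ?_ (by norm_num)
    rw [Finset.mul_sum]
    refine Finset.sum_le_sum fun k _ => ?_
    rw [← Finset.sum_mul]
    refine mul_le_mul_of_nonneg_right ?_ (hq0 k)
    have e3 := gramMatrix_inv_frame hx w k k
    rw [hxz] at e3
    simp only [sq]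
    rw [← e3]
    exact (le_abs_self _).trans (hGinv k k)
  have hden : density (A.sectionEnergy p u x₀) z = 1 + (s 0 + s 1 + s 2) := by
    rw [density, Fin.sum_univ_three]
  rw [Fin.sum_univ_three] at h4
  rw [hden]
  have hΛ2 : Λ ≤ Λ ^ 2 := by nlinarith
  have hΛ3 : Λ ^ 2 ≤ Λ ^ 3 := by nlinarith [sq_nonneg Λ]
  have hΛC : 0 ≤ Λ * C := by positivity
  have hs01 := add_nonneg (add_nonneg (hs0 0) (hs0 1)) (hs0 2)
  constructor
  · have e1 : 1 + (s 0 + s 1 + s 2) ≤ 1 + 27 * (Λ * A.energyDensity u x) + 9 * (Λ * C) := by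
      linarith [h1 0, h1 1, h1 2, h3 0, h3 1, h3 2]
    refine e1.trans ?_
    have e2 : 0 ≤ (Λ ^ 2 - Λ) * C := mul_nonneg (by linarith) hC
    have e3 : 0 ≤ (Λ ^ 2 - Λ) * A.energyDensity u x := mul_nonneg (by linarith) hE0
    have e4 : 0 ≤ Λ ^ 2 * C * A.energyDensity u x := by positivity
    have e5 : 0 ≤ Λ ^ 2 * C := by positivity
    have e6 : 0 ≤ Λ ^ 2 * A.energyDensity u x := by positivity
    linarith
  · have e1 : A.energyDensity u x ≤ 9 * (Λ * (s 0 + s 1 + s 2)) + 27 * (Λ * (Λ * C)) := by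
      have : Λ * (q 0 + q 1 + q 2) ≤ Λ * (3 * (s 0 + s 1 + s 2) + 9 * (Λ * C)) :=
        mul_le_mul_of_nonneg_left (by linarith [h2 0, h2 1, h2 2]) (by linarith)
      linarith
    refine e1.trans ?_
    have e2 : 0 ≤ (Λ ^ 3 - Λ ^ 2) * C := mul_nonneg (by linarith) hC
    have e3 : 0 ≤ (Λ ^ 3 - Λ) * (s 0 + s 1 + s 2) := mul_nonneg (by linarith) hs01
    have e4 : 0 ≤ Λ ^ 3 * C * (s 0 + s 1 + s 2) := by positivity
    have e5 : 0 ≤ Λ ^ 3 * C := by positivity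
    have e6 : 0 ≤ Λ ^ 3 * (s 0 + s 1 + s 2) := by positivity
    have e7 : 0 ≤ Λ ^ 3 := by positivity
    linarith

end HyperkahlerBundle

/-! ### The `ε`-regularity estimate on the manifold -/

variable {n : ℕ} {M X : Type*} [EMetricSpace M]
  [ChartedSpace (EuclideanSpace ℝ (Fin 3)) M] [IsManifold (𝓡 3) ∞ M]
  [RiemannianBundle (fun x : M => TangentSpace (𝓡 3) x)]
  [TopologicalSpace X] [ChartedSpace (EuclideanSpace ℝ (Fin n)) X] [IsManifold (𝓡 n) ∞ X]

lemma exists_le_sqrt_det_gramMatrix [IsContMDiffRiemannianBundle (𝓡 3) ∞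
    (EuclideanSpace ℝ (Fin 3)) (fun x : M => TangentSpace (𝓡 3) x)] {x₀ : M} {y₀ : E3} {r : ℝ}
    (hr : closedBall y₀ r ⊆ (chartAt (EuclideanSpace ℝ (Fin 3)) x₀).target) :
    ∃ c > 0, ∀ z ∈ closedBall y₀ r, c ≤ Real.sqrt (gramMatrix x₀ z).det := by
  by_cases hne : (closedBall y₀ r).Nonempty
  · obtain ⟨z, hz, hmin⟩ := (isCompact_closedBall y₀ r).exists_isMinOn hne
      (Real.continuous_sqrt.comp_continuousOn
        ((contDiffOn_det_gramMatrix (x₀ := x₀)).continuousOn.mono hr))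
    exact ⟨_, Real.sqrt_pos.2 (gramMatrix_det_pos (hr hz)), fun z' hz' => hmin hz'⟩
  · exact ⟨1, one_pos, fun z hz => (hne ⟨z, hz⟩).elim⟩

namespace HyperkahlerBundle

variable {B : HyperkahlerBundle n M X} {A : B.Connection} {p : B.VerticalField}
  {u : B.SmoothSection}

lemma compactSpace_base [CompactSpace X] (B : HyperkahlerBundle n M X) : CompactSpace M :=
  B.surjective_proj.compactSpace B.contMDiff_proj.continuous

variable [MeasurableSpace M]

/-- The statement of `ε`-regularity for centres in a set `V`. -/
def EpsilonRegularOn (A : B.Connection) (p : B.VerticalField) (V : Set M) : Prop :=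
  ∃ ε > 0, ∃ C > 0, ∃ r₁ > 0, ∀ u : B.SmoothSection, A.IsPerturbedFueter p u → ∀ y ∈ V,
    ∀ s, 0 < s → s ≤ r₁ → renormalisedEnergy A u y s ≤ ε →
      A.energyDensity u y ≤ C * (s⁻¹ ^ 2 * renormalisedEnergy A u y s + 1)

lemma renormalisedEnergy_nonneg {x : M} {r : ℝ} (hr : 0 < r) : 0 ≤ renormalisedEnergy A u x r :=
  mul_nonneg (by positivity) (integral_nonneg fun _ => energyDensity_nonneg)

variable [BorelSpace M]
  [IsContMDiffRiemannianBundle (𝓡 3) ∞ (EuclideanSpace ℝ (Fin 3))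
    (fun x : M => TangentSpace (𝓡 3) x)]

lemma integrable_energyDensity [CompactSpace M] :
    Integrable (A.energyDensity u) (riemannianVolume M) := by
  have := isFiniteMeasure_riemannianVolume (M := M)
  exact continuous_energyDensity.integrable_of_hasCompactSupport (HasCompactSupport.of_compactSpace _)

/-- The renormalised integral of the density in a coordinate ball, in terms of the energy of the
section in a geodesic ball that contains it. -/
lemma integral_density_le [CompactSpace M] {x₀ : M} {η : E3} {R c C₁ : ℝ} (hR : 0 < R) (hc : 0 < c)
    (hC₁ : 0 ≤ C₁)
    (hball : closedBall η (2 * R) ⊆ (chartAt (EuclideanSpace ℝ (Fin 3)) x₀).target)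
    (hdet : ∀ z ∈ closedBall η (2 * R), c ≤ Real.sqrt (gramMatrix x₀ z).det)
    (hint : IntegrableOn (density (A.sectionEnergy p u x₀)) (ball η (2 * R)))
    (hdens : ∀ z ∈ closedBall η (2 * R), density (A.sectionEnergy p u x₀) z ≤
      C₁ * (1 + A.energyDensity u ((chartAt (EuclideanSpace ℝ (Fin 3)) x₀).symm z)))
    {T : Set M} (hT : MeasurableSet T)
    (hTball : ∀ z ∈ ball η (2 * R), (chartAt (EuclideanSpace ℝ (Fin 3)) x₀).symm z ∈ T) :
    ∫ z in ball η (2 * R), density (A.sectionEnergy p u x₀) z ≤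
      C₁ * (8 * R ^ 3 * volume.real (ball (0 : E3) 1) +
        c⁻¹ * ∫ x in T, A.energyDensity u x ∂(riemannianVolume M)) := by
  set f : E3 → ℝ := fun z => A.energyDensity u ((chartAt (EuclideanSpace ℝ (Fin 3)) x₀).symm z)
    with hf
  have hfi : IntegrableOn f (ball η (2 * R)) :=
    ((continuous_energyDensity.comp_continuousOn
      ((chartAt (EuclideanSpace ℝ (Fin 3)) x₀).symm.continuousOn.mono hball)).integrableOn_compact
      (isCompact_closedBall _ _)).mono_set ball_subset_closedBall
  have h1i : IntegrableOn (fun _ : E3 => (1 : ℝ)) (ball η (2 * R)) :=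
    integrableOn_const measure_ball_lt_top.ne
  have hvol : volume.real (ball η (2 * R)) = 8 * R ^ 3 * volume.real (ball (0 : E3) 1) := by
    rw [measureReal_def, Measure.addHaar_ball_of_pos _ _ (by positivity), ENNReal.toReal_mul,
      ENNReal.toReal_ofReal (by positivity), measureReal_def, finrank_euclideanSpace_fin]
    ring
  have h2 : ∫ z in ball η (2 * R), f z ≤
      c⁻¹ * ∫ x in T, A.energyDensity u x ∂(riemannianVolume M) := by
    rw [← div_eq_inv_mul, le_div_iff₀' hc]
    exact setIntegral_chartAt_symm_le continuous_energyDensity (fun x => energyDensity_nonneg)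
      integrable_energyDensity isOpen_ball (ball_subset_closedBall.trans hball) hT hTball hc.le
      fun z hz => hdet z (ball_subset_closedBall hz)
  calc _ ≤ ∫ z in ball η (2 * R), C₁ * (1 + f z) :=
        setIntegral_mono_on hint ((h1i.add hfi).const_mul C₁) measurableSet_ball
          fun z hz => hdens z (ball_subset_closedBall hz)
    _ = C₁ * (volume.real (ball η (2 * R)) + ∫ z in ball η (2 * R), f z) := by
        rw [integral_const_mul, integral_add h1i hfi, setIntegral_const, smul_eq_mul, mul_one]
    _ ≤ _ := by
        rw [hvol]
        gcongr

set_option maxHeartbeats 1000000 in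
/-- `ε`-regularity near a point, by means of the estimate for the Dirac-type equation in
coordinates. -/
lemma exists_epsilonRegularOn [IsRiemannianManifold (𝓡 3) M] [T2Space X] [CompactSpace X]
    (A : B.Connection) (p : B.VerticalField) (x₀ : M) :
    ∃ V ∈ nhds x₀, EpsilonRegularOn A p V := by
  have := B.compactSpace_base
  set φ := chartAt (EuclideanSpace ℝ (Fin 3)) x₀ with hφ
  obtain ⟨r, hr, hrt, Λ, hΛ, hbase⟩ :=
    exists_baseMetric (mem_chart_target (EuclideanSpace ℝ (Fin 3)) x₀)
  have hbase := hbase (ball (φ x₀) r) ball_subset_closedBall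
  obtain ⟨c, hc, hdet⟩ := exists_le_sqrt_det_gramMatrix hrt
  have hSc : IsClosed (B.proj ⁻¹' (φ.symm '' closedBall (φ x₀) r)) :=
    ((isCompact_closedBall _ _).image_of_continuousOn
      (φ.symm.continuousOn.mono hrt)).isClosed.preimage B.contMDiff_proj.continuous
  obtain ⟨K, L, t, θ, hK, hL, hcov⟩ := exists_modelCover (x₀ := x₀) A p hSc fun e he => by
    obtain ⟨z, hz, h⟩ := he
    exact h ▸ φ.map_target (hrt hz)
  have hδ : (0 : ℝ) < 1 / (8 * K * L + 1) := by positivity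
  obtain ⟨ε₁, hε₁, C₁, hC₁, R₁, hR₁, hreg⟩ := IsDiracSection.exists_epsilon_regularity
    (EuclideanSpace ℝ (Fin n)) hK hΛ hδ
  obtain ⟨Cp, hCp, hp⟩ := exists_metric_le p
  set A₁ := 243 * Λ ^ 2 * (1 + Cp) with hA₁
  have hA₁0 : 0 < A₁ := by positivity
  set A₂ := A₁ * (8 * volume.real (ball (0 : E3) 1) + c⁻¹ * (6 * Λ)) with hA₂
  have hA₂0 : 0 < A₂ := by positivity
  set A₃ := 243 * Λ ^ 3 * (1 + Cp) with hA₃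
  have hA₃0 : 0 < A₃ := by positivity
  -- the radii `R` of the coordinate balls that are admitted
  set R₂ := min (min (r / 4) R₁) (min 1 (ε₁ / (2 * A₂))) with hR₂
  have hR₂0 : 0 < R₂ := by positivity
  refine ⟨φ.source ∩ φ ⁻¹' ball (φ x₀) (r / 2),
    (φ.isOpen_inter_preimage isOpen_ball).mem_nhds
      ⟨mem_chart_source _ x₀, mem_ball_self (by positivity)⟩,
    ε₁ / (2 * A₂), by positivity, A₃ * (C₁ * A₂) * (36 * Λ ^ 2), by positivity, 6 * Λ * R₂,
    by positivity, fun u hu y hy s hs hsr hε => ?_⟩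
  have hD := hcov.isDiracSection hK hL hu isOpen_ball (ball_subset_closedBall.trans hrt)
    fun z hz => ⟨z, ball_subset_closedBall hz, (u.proj_toFun _).symm⟩
  set R := s / (6 * Λ) with hRdef
  have hR : 0 < R := by positivity
  have hsR : s = 6 * Λ * R := by rw [hRdef]; field_simp
  have hRR₂ : R ≤ R₂ := by rwa [hRdef, div_le_iff₀' (by positivity)]
  have hRr : R ≤ r / 4 := hRR₂.trans ((min_le_left _ _).trans (min_le_left _ _))
  have hRR₁ : R ≤ R₁ := hRR₂.trans ((min_le_left _ _).trans (min_le_right _ _))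
  have hR1 : R ≤ 1 := hRR₂.trans ((min_le_right _ _).trans (min_le_left _ _))
  have hRε : R ≤ ε₁ / (2 * A₂) := hRR₂.trans ((min_le_right _ _).trans (min_le_right _ _))
  have hball : closedBall (φ y) (2 * R) ⊆ ball (φ x₀) r := fun z hz => by
    have h1 := mem_ball.1 hy.2
    have h2 := mem_closedBall.1 hz
    exact mem_ball.2 ((dist_triangle z (φ y) (φ x₀)).trans_lt (by linarith))
  have hcb : closedBall (φ y) (2 * R) ⊆ closedBall (φ x₀) r := hball.trans ball_subset_closedBall
  have hηD : φ y ∈ ball (φ x₀) r := hball (mem_closedBall_self (by positivity))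
  have hcmp := fun z (hz : z ∈ ball (φ x₀) r) => density_sectionEnergy_le (A := A) (u := u)
    (hrt (ball_subset_closedBall hz)) hΛ (fun k l => hbase.abs_le k l z hz)
    (fun k l => hbase.abs_inv_le k l z hz) hCp hp
  have hTball : ∀ z ∈ ball (φ y) (2 * R), φ.symm z ∈ Metric.eball y (ENNReal.ofReal s) := by
    intro z hz
    have h1 := edist_chartAt_symm_le hΛ (ball_subset_closedBall.trans hrt)
      (fun k l z hz => hbase.abs_le k l z hz) (hball (ball_subset_closedBall hz)) hηD
    rw [← hφ, φ.left_inv hy.1] at h1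
    refine mem_eball.2 (h1.trans_lt ((ENNReal.ofReal_lt_ofReal_iff hs).2 ?_))
    have h2 := mem_ball'.1 hz
    rw [dist_eq_norm] at h2
    rw [hsR]
    calc 3 * Λ * ‖φ y - z‖ < 3 * Λ * (2 * R) := by gcongr
      _ = _ := by ring
  set J := renormalisedEnergy A u y s with hJ
  have hJ0 : 0 ≤ J := renormalisedEnergy_nonneg hs
  have hJs : ∫ x in Metric.eball y (ENNReal.ofReal s), A.energyDensity u x ∂(riemannianVolume M) =
      s * J := by
    rw [hJ, renormalisedEnergy]
    field_simp
  have hI := integral_density_le (A := A) (p := p) (u := u) hR hc hA₁0.le (hcb.trans hrt)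
    (fun z hz => hdet z (hcb hz))
    ((hD.continuousOn_density.mono hball).integrableOn_compact (isCompact_closedBall _ _) |>.mono_set
      ball_subset_closedBall)
    (fun z hz => (hcmp z (hball hz)).1) Metric.isOpen_eball.measurableSet hTball
  rw [hJs, hsR] at hI
  have hI2 : R⁻¹ * ∫ z in ball (φ y) (2 * R), density (A.sectionEnergy p u x₀) z ≤
      A₂ * (R ^ 2 + J) := by
    have hV : 0 ≤ volume.real (ball (0 : E3) 1) := measureReal_nonneg
    calc _ ≤ R⁻¹ * (A₁ * (8 * R ^ 3 * volume.real (ball (0 : E3) 1) +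
          c⁻¹ * (6 * Λ * R * J))) := by gcongr
      _ = A₁ * (8 * volume.real (ball (0 : E3) 1) * R ^ 2 + c⁻¹ * (6 * Λ) * J) := by
          field_simp
      _ ≤ A₁ * ((8 * volume.real (ball (0 : E3) 1) + c⁻¹ * (6 * Λ)) * (R ^ 2 + J)) := by
          refine mul_le_mul_of_nonneg_left ?_ hA₁0.le
          have h1 : 0 ≤ 8 * volume.real (ball (0 : E3) 1) * J := by positivity
          have h2 : 0 ≤ c⁻¹ * (6 * Λ) * R ^ 2 := by positivity
          linarith
      _ = _ := by rw [hA₂]; ring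
  have hsmall : A₂ * (R ^ 2 + J) ≤ ε₁ := by
    have h1 : R ^ 2 ≤ ε₁ / (2 * A₂) := by nlinarith
    calc _ ≤ A₂ * (ε₁ / (2 * A₂) + ε₁ / (2 * A₂)) := by gcongr
      _ = ε₁ := by field_simp; ring
  have hfin := hreg hbase hD (φ y) R hR hRR₁ hball (hI2.trans hsmall)
  have hfin2 : density (A.sectionEnergy p u x₀) (φ y) ≤ C₁ * A₂ * (1 + R⁻¹ ^ 2 * J) := by
    have h1 := hfin.trans (mul_le_mul_of_nonneg_left hI2 hC₁.le)
    rw [← le_div_iff₀' (by positivity)] at h1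
    refine h1.trans (le_of_eq ?_)
    field_simp
  have hE := (hcmp _ hηD).2
  rw [← hφ, φ.left_inv hy.1] at hE
  have hRinv : R⁻¹ = 6 * Λ * s⁻¹ := by rw [hRdef, inv_div]; ring
  rw [hRinv] at hfin2
  calc _ ≤ A₃ * (C₁ * A₂ * (1 + (6 * Λ * s⁻¹) ^ 2 * J)) :=
        hE.trans (mul_le_mul_of_nonneg_left hfin2 hA₃0.le)
    _ ≤ A₃ * (C₁ * A₂ * (36 * Λ ^ 2 * (s⁻¹ ^ 2 * J + 1))) := by
        gcongr
        nlinarith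
    _ = _ := by ring

lemma epsilonRegularOn_univ [IsRiemannianManifold (𝓡 3) M] [T2Space X] [CompactSpace X]
    (A : B.Connection) (p : B.VerticalField) : EpsilonRegularOn A p univ := by
  have := B.compactSpace_base
  refine isCompact_univ.induction_on (p := EpsilonRegularOn A p) ?_ ?_ ?_ ?_
  · exact ⟨1, one_pos, 1, one_pos, 1, one_pos, fun _ _ _ h => h.elim⟩
  · rintro V W hVW ⟨ε, hε, C, hC, r₁, hr₁, h⟩
    exact ⟨ε, hε, C, hC, r₁, hr₁, fun u hu y hy => h u hu y (hVW hy)⟩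
  · rintro V W ⟨ε, hε, C, hC, r₁, hr₁, h⟩ ⟨ε', hε', C', hC', r₁', hr₁', h'⟩
    refine ⟨min ε ε', lt_min hε hε', max C C', lt_max_of_lt_left hC, min r₁ r₁',
      lt_min hr₁ hr₁', fun u hu y hy s hs hsr hE => ?_⟩
    have h0 : 0 ≤ s⁻¹ ^ 2 * renormalisedEnergy A u y s + 1 := by
      have := renormalisedEnergy_nonneg (A := A) (u := u) (x := y) hs
      positivity
    rcases hy with hy | hy
    · exact (h u hu y hy s hs (hsr.trans (min_le_left _ _)) (hE.trans (min_le_left _ _))).trans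
        (mul_le_mul_of_nonneg_right (le_max_left _ _) h0)
    · exact (h' u hu y hy s hs (hsr.trans (min_le_right _ _)) (hE.trans (min_le_right _ _))).trans
        (mul_le_mul_of_nonneg_right (le_max_right _ _) h0)
  · intro x _
    obtain ⟨V, hV, h⟩ := exists_epsilonRegularOn A p x
    exact ⟨V, mem_nhdsWithin_of_mem_nhds hV, h⟩

/-- The renormalised energy in a smaller ball with centre in `B_{r/4}(x)`. -/
lemma renormalisedEnergy_le [CompactSpace M] {x y : M} {r κ : ℝ} (hr : 0 < r) (hκ : 0 < κ)
    (hκ2 : κ ≤ 1 / 2) (hy : y ∈ Metric.eball x (ENNReal.ofReal (r / 4))) :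
    renormalisedEnergy A u y (κ * r) ≤ κ⁻¹ * renormalisedEnergy A u x r := by
  have hsub : Metric.eball y (ENNReal.ofReal (κ * r)) ⊆ Metric.eball x (ENNReal.ofReal r) := by
    intro z hz
    refine mem_eball.2 ((edist_triangle z y x).trans_lt ?_)
    calc _ < ENNReal.ofReal (κ * r) + ENNReal.ofReal (r / 4) :=
          ENNReal.add_lt_add (mem_eball.1 hz) (mem_eball.1 hy)
      _ = ENNReal.ofReal (κ * r + r / 4) := (ENNReal.ofReal_add (by positivity) (by positivity)).symm
      _ ≤ ENNReal.ofReal r := ENNReal.ofReal_le_ofReal (by nlinarith)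
  have h := setIntegral_mono_set (μ := riemannianVolume M)
    (integrable_energyDensity (A := A) (u := u)).integrableOn
    (Filter.Eventually.of_forall fun _ => energyDensity_nonneg) hsub.eventuallyLE
  unfold renormalisedEnergy
  calc _ ≤ 1 / (κ * r) * ∫ x in Metric.eball x (ENNReal.ofReal r),
        A.energyDensity u x ∂(riemannianVolume M) := mul_le_mul_of_nonneg_left h (by positivity)
    _ = _ := by field_simp

end HyperkahlerBundle

end Fueter

end

theorem mainTheorem5 {n : ℕ} {M X : Type*}
    [EMetricSpace M] [ChartedSpace (EuclideanSpace ℝ (Fin 3)) M] [IsManifold (𝓡 3) ∞ M]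
    [RiemannianBundle (fun x : M => TangentSpace (𝓡 3) x)]
    [IsContMDiffRiemannianBundle (𝓡 3) ∞ (EuclideanSpace ℝ (Fin 3))
      (fun x : M => TangentSpace (𝓡 3) x)]
    [IsRiemannianManifold (𝓡 3) M] [MeasurableSpace M] [BorelSpace M]
    [TopologicalSpace X] [T2Space X] [CompactSpace X]
    [ChartedSpace (EuclideanSpace ℝ (Fin n)) X] [IsManifold (𝓡 n) ∞ X]
    (B : Fueter.HyperkahlerBundle n M X) (A : B.Connection) (p : B.VerticalField)
    (r₀ : ℝ) (hr₀ : 0 < r₀) :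
    ∃ ε₀ > 0, ∃ C > 0, ∀ u : B.SmoothSection, A.IsPerturbedFueter p u →
      ∀ (x : M) (r : ℝ), 0 < r → r ≤ r₀ →
        Fueter.renormalisedEnergy A u x r ≤ ε₀ →
        ∀ y ∈ Metric.eball x (ENNReal.ofReal (r / 4)),
          A.energyDensity u y ≤ C * (r⁻¹ ^ 2 * Fueter.renormalisedEnergy A u x r + 1) := by
  have := B.compactSpace_base
  obtain ⟨ε, hε, C, hC, r₁, hr₁, h⟩ := Fueter.HyperkahlerBundle.epsilonRegularOn_univ A p
  -- the estimate is applied at `y` itself, in the ball of radius `κ r`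
  set κ := min (1 / 2) (r₁ / r₀) with hκdef
  have hκ : 0 < κ := by positivity
  have hκ2 : κ ≤ 1 / 2 := min_le_left _ _
  refine ⟨κ * ε, by positivity, C * κ⁻¹ ^ 3, by positivity, fun u hu x r hr hrr hE y hy => ?_⟩
  have hle := Fueter.HyperkahlerBundle.renormalisedEnergy_le (A := A) (u := u) hr hκ hκ2 hy
  have hκr : κ * r ≤ r₁ := by
    calc κ * r ≤ r₁ / r₀ * r₀ := by
          gcongr
          exact min_le_right _ _
      _ = r₁ := by field_simp
  have hsmall : Fueter.renormalisedEnergy A u y (κ * r) ≤ ε := by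
    refine hle.trans ?_
    rw [inv_mul_le_iff₀ hκ]
    exact hE
  refine (h u hu y (Set.mem_univ y) (κ * r) (by positivity) hκr hsmall).trans ?_
  have hκ3 : 1 ≤ κ⁻¹ ^ 3 := one_le_pow₀ ((one_le_inv₀ hκ).2 (by linarith))
  calc _ ≤ C * ((κ * r)⁻¹ ^ 2 * (κ⁻¹ * Fueter.renormalisedEnergy A u x r) + 1) := by gcongr
    _ = C * (κ⁻¹ ^ 3 * (r⁻¹ ^ 2 * Fueter.renormalisedEnergy A u x r) + 1) := by
        rw [mul_inv]
        ring
    _ ≤ C * (κ⁻¹ ^ 3 * (r⁻¹ ^ 2 * Fueter.renormalisedEnergy A u x r) + κ⁻¹ ^ 3) := by gcongr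
    _ = _ := by ring
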